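/- **Setting.** For a mass ratio $\mu\in(0,1)$ let $E=(\mu,0,0)$, $M=(-1+\mu,0,0)$, with masses $m_E=1-\mu$, $m_M=\mu$, and let $$H_\mu(q,p)=\tfrac12|p|^2-\frac{\mu}{|q-M|}-\frac{1-\mu}{|q-E|}+p_1q_2-p_2q_1 ,\qquad (q,p)\in(\mathbb R^3\setminus\{E,M\})\times\mathbb R^3,$$ be the Hamiltonian of the spatial circular restricted three-body problem. Let $L_1=L_1(\mu)$ be the critical point of $H_\mu$ lying over the open segment between $M$ and $E$. Put $\Sigma_c=H_\mu^{-1}(c)$ and let $\mathcal K_c\subset\mathbb R^3$ be its projection to the position space. For $c<H_\mu(L_1)$ let $\Sigma^E_c$ (resp. $\Sigma^M_c$) be the part of $\Sigma_c$ over the connected component of $\mathcal K_c$ whose closure contains $E$ (resp. $M$). For $c$ slightly above $H_\mu(L_1)$ let $\Sigma^{E,M}_c$ be the part over the component whose closure contains both. For a primary $P\in\{E,M\}$ (other primary $P'$), Moser's map sends $(q,p)$, with $x=-p$, $y=q-P$, to the point $(\xi,\eta)\in T^*S^3\subset\mathbb R^4\times\mathbb R^4$ given by $$\xi=\Big(\frac{|x|^2-1}{|x|^2+1};\frac{2x}{|x|^2+1}\Big),\qquad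 \eta=\Big(\langle x,y\rangle;\ \tfrac{|x|^2+1}{2}\,y-\langle x,y\rangle x\Big).$$ It is symplectic and sends $\Sigma_c$ into the level set $\{Q_P=\tfrac12m_P^2\}$ of $Q_P=\tfrac12|\eta|^2f_P^2$, where $$f_P=1-\frac{m_{P'}(1-\xi_0)}{|(1-\xi_0)\vec\eta+\eta_0\vec\xi+P-P'|}+(1-\xi_0)(\xi_2\eta_1-\xi_1\eta_2)+\xi_2P_1-(c+\tfrac12)(1-\xi_0).$$ The regularized hypersurfaces $\overline\Sigma^E_c,\overline\Sigma^M_c,\overline\Sigma^{E,M}_c$ are obtained by adding, for each primary $P$ named in the superscript, the points of $\{Q_P=\tfrac12m_P^2\}$ over the north pole $\xi=(1;0)$ (collisions with $P$). Their smooth structure is given by the Moser charts at these primaries. In each chart the regularized Hamiltonian vector field is the Hamiltonian vector field $X_{Q_P}$ on $T^*S^3$ (symplectic form $d\eta\wedge d\xi$), up to a change of time, i.e. multiplication by a positive function. In what follows any such change of time that depends continuously on the point of the hypersurface and on the parameter $s\in[0,1]$ is allowed; on $\overline\Sigma^E_c$ and $\overline\Sigma^M_c$ one may take $X_{Q_P}$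 itself. **Statement.** There is a function $\epsilon:(0,1)\to(0,\infty)$ with the following property. Let $\mu:[0,1]\to(0,1)$ and $c:[0,1]\to\mathbb R$ be smooth, and let $\overline\Sigma_s$ be one of the following families of hypersurfaces: * $\overline\Sigma_s=\overline\Sigma^{E}_{c(s)}$ for all $s$, or $\overline\Sigma_s=\overline\Sigma^{M}_{c(s)}$ for all $s$ (for the mass ratio $\mu(s)$), where $c(s)<H_{\mu(s)}(L_1(\mu(s)))$ for all $s\in[0,1]$; * $\overline\Sigma_s=\overline\Sigma^{E,M}_{c(s)}$ for all $s$ (for the mass ratio $\mu(s)$), where $H_{\mu(s)}(L_1(\mu(s)))<c(s)<H_{\mu(s)}(L_1(\mu(s)))+\epsilon(\mu(s))$ for all $s\in[0,1]$. Let $(\gamma_s,\tau_s)$, $s\in[0,1)$, be a smooth family of periodic orbits $\gamma_s$ of the regularized Hamiltonian vector field on $\overline\Sigma_s$, with period $\tau_s>0$. Then the family has no blue sky catastrophe at $s=1$: it is not the case that $\tau_s\to\infty$ as $s\to1$, and in fact $\tau_s$ is bounded on $[0,1)$. -/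

import Mathlib

open Set Filter Topology
open scoped ContDiff

namespace RTBP

noncomputable section

/-- `ℝ³`, with coordinates `q 0, q 1, q 2` (written `q₁, q₂, q₃` in the usual formulas). -/
abbrev E3 := EuclideanSpace ℝ (Fin 3)

/-- `ℝ⁴`, with coordinates `ξ 0, ξ 1, ξ 2, ξ 3`. -/
abbrev E4 := EuclideanSpace ℝ (Fin 4)

/-- The two massive bodies. -/
inductive Primary
  | earth
  | moon

/-- The other primary. -/
def Primary.other : Primary → Primary
  | .earth => .moon
  | .moon => .earth

/-- Position of a primary in the rotating frame, for the mass ratio `μ`. -/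
def pos (μ : ℝ) : Primary → E3
  | .earth => !₂[μ, 0, 0]
  | .moon => !₂[-1 + μ, 0, 0]

/-- Mass of a primary, for the mass ratio `μ`. -/
def mass (μ : ℝ) : Primary → ℝ
  | .earth => 1 - μ
  | .moon => μ

/-- The Jacobi Hamiltonian on pairs `(q, p)`. -/
def jacobi (μ : ℝ) (z : E3 × E3) : ℝ :=
  (1 / 2) * ‖z.2‖ ^ 2 - μ / ‖z.1 - pos μ .moon‖ - (1 - μ) / ‖z.1 - pos μ .earth‖
    + z.2 0 * z.1 1 - z.2 1 * z.1 0

/-- The energy hypersurface `Σ_c = H⁻¹(c)` in `(ℝ³ ∖ {E, M}) × ℝ³`. -/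
def energySurface (μ c : ℝ) : Set (E3 × E3) :=
  {z | (∀ b, z.1 ≠ pos μ b) ∧ jacobi μ z = c}

/-- The Hill's region `π(Σ_c)`. -/
def hillRegion (μ c : ℝ) : Set E3 := Prod.fst '' energySurface μ c

/-- The part of the Hill's region made of the connected components whose closure contains the
positions of all the primaries in `S`. -/
def hillComponent (μ c : ℝ) (S : Set Primary) : Set E3 :=
  {q ∈ hillRegion μ c | ∀ b ∈ S, pos μ b ∈ closure (connectedComponentIn (hillRegion μ c) q)}

/-- `L` is the critical point of the Hamiltonian that lies over the open segment between the
Moon and the Earth. -/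
def IsFirstLagrangePoint (μ : ℝ) (L : E3 × E3) : Prop :=
  L.1 ∈ openSegment ℝ (pos μ .moon) (pos μ .earth) ∧ fderiv ℝ (jacobi μ) L = 0

/-- The first Lagrange point `L₁` (it exists for `0 < μ < 1`, see
`isFirstLagrangePoint_firstLagrangePoint`). -/
def firstLagrangePoint (μ : ℝ) : E3 × E3 := Classical.epsilon (IsFirstLagrangePoint μ)

/-- The first critical value `H(L₁)`. -/
def energyL1 (μ : ℝ) : ℝ := jacobi μ (firstLagrangePoint μ)

theorem hasFDerivAt_inv_norm (P q : E3) (h : q ≠ P) :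
    HasFDerivAt (fun q : E3 => ‖q - P‖⁻¹)
      (-(‖q - P‖ ^ 3)⁻¹ • (innerSL ℝ (q - P) : E3 →L[ℝ] ℝ)) q := by
  have hn : 0 < ‖q - P‖ := norm_pos_iff.mpr (sub_ne_zero.mpr h)
  have h1 : HasFDerivAt (fun q : E3 => ‖q - P‖ ^ 2) (2 • (innerSL ℝ (q - P) : E3 →L[ℝ] ℝ)) q := by
    have := ((hasFDerivAt_id q).sub_const P).norm_sq
    simpa using this
  have h0 : HasDerivAt (fun r : ℝ => (√r)⁻¹)
      (-(1 / (2 * √(‖q - P‖ ^ 2))) / √(‖q - P‖ ^ 2) ^ 2) (‖q - P‖ ^ 2) :=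
    (Real.hasDerivAt_sqrt (by positivity)).fun_inv (by positivity)
  have h2 := h0.comp_hasFDerivAt q h1
  have e : ((fun r : ℝ => (√r)⁻¹) ∘ fun q : E3 => ‖q - P‖ ^ 2) = fun q : E3 => ‖q - P‖⁻¹ := by
    funext x; simp [Real.sqrt_sq (norm_nonneg _)]
  rw [e] at h2
  refine h2.congr_fderiv ?_
  ext v
  simp only [Real.sqrt_sq (norm_nonneg _), smul_apply, smul_eq_mul,
    nsmul_eq_mul, innerSL_apply_apply]
  field_simp
  norm_num

theorem fderiv_jacobi_apply (μ : ℝ) (z V : E3 × E3) (hz : ∀ b, z.1 ≠ pos μ b) :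
    fderiv ℝ (jacobi μ) z V = inner ℝ z.2 V.2
      + μ * (‖z.1 - pos μ .moon‖ ^ 3)⁻¹ * inner ℝ (z.1 - pos μ .moon) V.1
      + (1 - μ) * (‖z.1 - pos μ .earth‖ ^ 3)⁻¹ * inner ℝ (z.1 - pos μ .earth) V.1
      + (z.2 0 * V.1 1 + z.1 1 * V.2 0) - (z.2 1 * V.1 0 + z.1 0 * V.2 1) := by
  have hM := (hasFDerivAt_inv_norm _ _ (hz .moon)).comp z (hasFDerivAt_fst (𝕜 := ℝ) (p := z))
  have hE := (hasFDerivAt_inv_norm _ _ (hz .earth)).comp z (hasFDerivAt_fst (𝕜 := ℝ) (p := z))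
  have hp := (hasFDerivAt_snd (𝕜 := ℝ) (p := z)).norm_sq
  have cq : ∀ i : Fin 3, HasFDerivAt (fun z : E3 × E3 => z.1 i)
      ((EuclideanSpace.proj i : E3 →L[ℝ] ℝ).comp (ContinuousLinearMap.fst ℝ E3 E3)) z := fun i =>
    ((EuclideanSpace.proj i : E3 →L[ℝ] ℝ).comp (ContinuousLinearMap.fst ℝ E3 E3)).hasFDerivAt
  have cp : ∀ i : Fin 3, HasFDerivAt (fun z : E3 × E3 => z.2 i)
      ((EuclideanSpace.proj i : E3 →L[ℝ] ℝ).comp (ContinuousLinearMap.snd ℝ E3 E3)) z := fun i =>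
    ((EuclideanSpace.proj i : E3 →L[ℝ] ℝ).comp (ContinuousLinearMap.snd ℝ E3 E3)).hasFDerivAt
  have H := ((((hp.const_mul (1 / 2)).sub (hM.const_mul μ)).sub (hE.const_mul (1 - μ))).add
    ((cp 0).mul (cq 1))).sub ((cp 1).mul (cq 0))
  have := HasFDerivAt.fderiv (f := jacobi μ) (x := z) H
  rw [this]
  simp [inner_sub_left]
  ring

/-- The first Lagrange point exists. -/
theorem exists_isFirstLagrangePoint (μ : ℝ) (h : μ ∈ Ioo (0 : ℝ) 1) :
    ∃ L, IsFirstLagrangePoint μ L := by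
  obtain ⟨h0, h1⟩ := h
  obtain ⟨x, hx, hx0⟩ : ∃ x ∈ Icc (-1 + μ) μ,
      μ * (μ - x) ^ 2 - (1 - μ) * (x + 1 - μ) ^ 2 - x * (x + 1 - μ) ^ 2 * (μ - x) ^ 2 = 0 := by
    have := intermediate_value_Icc' (a := -1 + μ) (b := μ) (by linarith)
      (f := fun x => μ * (μ - x) ^ 2 - (1 - μ) * (x + 1 - μ) ^ 2
        - x * (x + 1 - μ) ^ 2 * (μ - x) ^ 2) (by fun_prop)
    obtain ⟨x, hx, hx0⟩ := this (a := 0) ⟨by ring_nf; linarith, by ring_nf; linarith⟩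
    exact ⟨x, hx, hx0⟩
  have ha : 0 < x + 1 - μ := by
    refine lt_of_le_of_ne (by linarith [hx.1]) fun e => ?_
    have e' : x = -1 + μ := by linarith
    subst e'; ring_nf at hx0; linarith
  have hb : 0 < μ - x := by
    refine lt_of_le_of_ne (by linarith [hx.2]) fun e => ?_
    have e' : x = μ := by linarith
    subst e'; ring_nf at hx0; linarith
  have nM : ‖(!₂[x, 0, 0] : E3) - pos μ .moon‖ = x + 1 - μ := by
    rw [EuclideanSpace.norm_eq, Fin.sum_univ_three]
    simp [pos, Real.sqrt_sq_eq_abs]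
    rw [abs_of_pos (by linarith)]; ring
  have nE : ‖(!₂[x, 0, 0] : E3) - pos μ .earth‖ = μ - x := by
    rw [EuclideanSpace.norm_eq, Fin.sum_univ_three]
    simp [pos, Real.sqrt_sq_eq_abs]
    rw [abs_sub_comm, abs_of_pos (by linarith)]
  refine ⟨(!₂[x, 0, 0], !₂[0, x, 0]), ?_, ?_⟩
  · refine ⟨μ - x, x + 1 - μ, hb, ha, by ring, ?_⟩
    ext i; fin_cases i <;> simp [pos]
    ring
  · ext1 <;> ext v <;> simp only [ContinuousLinearMap.comp_apply, zero_apply,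
        ContinuousLinearMap.inl_apply, ContinuousLinearMap.inr_apply] <;>
      rw [fderiv_jacobi_apply μ _ _ (by
        rintro (_ | _) e
        · simp [← e] at nE; linarith
        · simp [← e] at nM; linarith)] <;>
      simp only [nM, nE, PiLp.inner_apply, Fin.sum_univ_three]
    · simp [pos]
      field_simp
      linear_combination (v 0) * (x + 1 - μ) * (μ - x) * hx0
    · simp
      ring

theorem isFirstLagrangePoint_firstLagrangePoint (μ : ℝ) (h : μ ∈ Ioo (0 : ℝ) 1) :
    IsFirstLagrangePoint μ (firstLagrangePoint μ) :=
  Classical.epsilon_spec (exists_isFirstLagrangePoint μ h)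

/-! ### Moser regularization -/

/-- The vector part `(ξ₁, ξ₂, ξ₃)` of `ξ = (ξ₀; ξ₁, ξ₂, ξ₃)`. -/
def vec (ξ : E4) : E3 := !₂[ξ 1, ξ 2, ξ 3]

/-- The vector `(a; v) ∈ ℝ⁴`. -/
def mk4 (a : ℝ) (v : E3) : E4 := !₂[a, v 0, v 1, v 2]

/-- Vectors `V = (v, w)` tangent at `z = (ξ, η)` to
`T*S³ = {(ξ, η) | |ξ| = 1, ⟨ξ, η⟩ = 0} ⊆ ℝ⁴ × ℝ⁴`. -/
def IsTangent (z V : E4 × E4) : Prop :=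
  inner ℝ z.1 V.1 = 0 ∧ inner ℝ V.1 z.2 + inner ℝ z.1 V.2 = 0

/-- The symplectic form `dη ∧ dξ`. -/
def omega (V W : E4 × E4) : ℝ := inner ℝ V.2 W.1 - inner ℝ W.2 V.1

/-- `X` is the value at `z ∈ T*S³` of the Hamiltonian vector field on `T*S³` of the restriction of
`K`, with the convention `dK = ω(·, X)`. -/
def IsHamiltonianVector (K : E4 × E4 → ℝ) (z X : E4 × E4) : Prop :=
  IsTangent z X ∧ ∀ V, IsTangent z V → fderiv ℝ K z V = omega V X

/-- The symplectic map `(q, p) ↦ (ξ, η)` given by `x = -p`, `y = q - P_b` and the cotangent lift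
of the inverse stereographic projection. -/
def moserMap (μ : ℝ) (b : Primary) (q p : E3) : E4 × E4 :=
  let x : E3 := -p
  let y : E3 := q - pos μ b
  (mk4 ((‖x‖ ^ 2 - 1) / (‖x‖ ^ 2 + 1)) ((2 / (‖x‖ ^ 2 + 1)) • x),
    mk4 (inner ℝ x y) (((‖x‖ ^ 2 + 1) / 2) • y - (inner ℝ x y) • x))

/-- The function `f` of the Moser regularization at the primary `b`. -/
def moserF (μ c : ℝ) (b : Primary) (z : E4 × E4) : ℝ :=
  1 - mass μ b.other * (1 - z.1 0) /
        ‖(1 - z.1 0) • vec z.2 + z.2 0 • vec z.1 + pos μ b - pos μ b.other‖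
    + (1 - z.1 0) * (z.1 2 * z.2 1 - z.1 1 * z.2 2) + z.1 2 * pos μ b 0
    - (c + 1 / 2) * (1 - z.1 0)

/-- The regularized Hamiltonian `Q = |η|² f² / 2` at the primary `b`; the energy level `c` becomes
the level `m_b² / 2`. -/
def moserQ (μ c : ℝ) (b : Primary) (z : E4 × E4) : ℝ :=
  (1 / 2) * ‖z.2‖ ^ 2 * moserF μ c b z ^ 2

/-- Points of the regularized phase space: pairs `(q, p)`, and collision points at a primary `b`,
which are the points `((1; 0), (0; v))` of the fibre of `T*S³` over the north pole. -/
inductive RegPoint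
  | regular (q p : E3)
  | collision (b : Primary) (v : E3)

/-- The domain of the Moser chart at `b`: everything but the collisions with the other primary. -/
def RegPoint.InChart (b : Primary) : RegPoint → Prop
  | .regular _ _ => True
  | .collision b' _ => b' = b

/-- The Moser chart at `b`, with values in `T*S³`. -/
def moserChart (μ : ℝ) (b : Primary) : RegPoint → E4 × E4
  | .regular q p => moserMap μ b q p
  | .collision _ v => (mk4 1 0, mk4 0 v)

/-- The regularized energy hypersurface: for `S = {moon}`, `{earth}`, `{earth, moon}` it is the
component of `Σ_c` that lies over the corresponding component of the Hill's region, compactified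
by the collision points at the primaries in `S`. Its smooth structure is the one given by the
Moser charts at the primaries in `S`. -/
def regSurface (μ c : ℝ) (S : Set Primary) : Set RegPoint :=
  {x | match x with
    | .regular q p => (q, p) ∈ energySurface μ c ∧ q ∈ hillComponent μ c S
    | .collision b v => b ∈ S ∧ moserQ μ c b (mk4 1 0, mk4 0 v) = (1 / 2) * mass μ b ^ 2}

/-- The part of the Moser chart at `b` that is filled by the regularized hypersurface. -/
def chartSurface (μ c : ℝ) (S : Set Primary) (b : Primary) : Set (E4 × E4) :=
  moserChart μ b '' {x ∈ regSurface μ c S | x.InChart b}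

/-- The regularized Hamiltonian vector field is defined up to a change of time. Along a family with
parameters `μ s, c s`, `s ∈ [0,1]`, such a change of time is, in each chart, a positive function
that is continuous on the union of the hypersurfaces. The vector field in the chart at `b` is
`ρ b s • X_Q`; on a hypersurface that contains one primary only, `ρ = 1` is the vector field of
`Q` itself. -/
def IsTimeScale (μ c : ℝ → ℝ) (S : Set Primary) (ρ : Primary → ℝ → E4 × E4 → ℝ) : Prop :=
  ∀ b ∈ S,
    ContinuousOn (fun x : ℝ × (E4 × E4) => ρ b x.1 x.2)
      {x | x.1 ∈ Icc (0 : ℝ) 1 ∧ x.2 ∈ chartSurface (μ x.1) (c x.1) S b} ∧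
    ∀ s ∈ Icc (0 : ℝ) 1, ∀ z ∈ chartSurface (μ s) (c s) S b, 0 < ρ b s z

/-- `(γ_s, τ_s)`, `s ∈ [0,1)`, is a smooth family of periodic orbits `γ_s`, with period `τ_s`, of
the regularized Hamiltonian vector field on the regularized hypersurfaces with the mass ratios
`μ s` and the energies `c s`. -/
structure IsPeriodicOrbitFamily (μ c : ℝ → ℝ) (S : Set Primary)
    (ρ : Primary → ℝ → E4 × E4 → ℝ) (γ : ℝ → ℝ → RegPoint) (τ : ℝ → ℝ) : Prop where
  mem : ∀ s ∈ Ico (0 : ℝ) 1, ∀ t, γ s t ∈ regSurface (μ s) (c s) S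
  period_pos : ∀ s ∈ Ico (0 : ℝ) 1, 0 < τ s
  period_smooth : ContDiffOn ℝ ∞ τ (Ico 0 1)
  periodic : ∀ s ∈ Ico (0 : ℝ) 1, Function.Periodic (γ s) (τ s)
  /-- `γ` is smooth in `(s, t)`, seen in the charts. -/
  smooth : ∀ s ∈ Ico (0 : ℝ) 1, ∀ t, ∀ b ∈ S, (γ s t).InChart b →
    (∀ᶠ x : ℝ × ℝ in 𝓝[Ico (0 : ℝ) 1 ×ˢ univ] (s, t), (γ x.1 x.2).InChart b) ∧
    ContDiffWithinAt ℝ ∞ (fun x : ℝ × ℝ => moserChart (μ x.1) b (γ x.1 x.2))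
      (Ico (0 : ℝ) 1 ×ˢ univ) (s, t)
  /-- Each `γ_s` is an integral curve, seen in the charts. -/
  integral : ∀ s ∈ Ico (0 : ℝ) 1, ∀ t, ∀ b ∈ S, (γ s t).InChart b →
    ∃ X, IsHamiltonianVector (moserQ (μ s) (c s) b) (moserChart (μ s) b (γ s t)) X ∧
      HasDerivAt (fun t' => moserChart (μ s) b (γ s t'))
        (ρ b s (moserChart (μ s) b (γ s t)) • X) t

/-- The periods go to infinity as the parameter goes to `1`. -/
def BlueSkyCatastrophe (τ : ℝ → ℝ) : Prop := Tendsto τ (𝓝[<] 1) atTop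

end

end RTBP

open Set Filter Topology
open scoped ContDiff

namespace RTBP

/-! The action controls the period. Suppose that near s = 1 the hypersurfaces carry a primitive λ of
dη ∧ dξ whose value λ(X) on the regularized vector field X is bounded below by a positive constant.
Rescale the orbits to loops u ↦ γ_s(τ_s u) and let A(s) be the integral of λ over the s-th loop.
Then A(s) ≥ δ τ_s. By periodicity A'(s) is the integral of ω(∂_s γ, ∂_u γ). Since ∂_u γ is a
multiple of X, the integrand is a multiple of the derivative of the Hamiltonian along ∂_s γ, and
since the family stays on the moving level this derivative is an explicit term, linear in μ'(s) and
c'(s) (`fderiv_moserQ_of_level`, `IsPeriodicOrbitFamily.omega_eq`). Compactness bounds the integrand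
by a constant times λ(∂_u γ), so A' ≤ C A, and Gronwall bounds A, hence τ, up to s = 1
(`bounded_of_curl_le`, `IsPeriodicOrbitFamily.exists_bound`). On the remaining compact interval τ is
continuous.

Below the first critical value take λ = η dξ, that is (q - P)·dx with x = -p, whose Liouville field
is the radial field (q - P)∂_q. Positivity of λ(X) means that H increases along this field
(`radialH_pos`). Let U be the effective potential on a ray from P and σ the squared sine of the
angle between the ray and the vertical axis. By Cauchy-Schwarz in the velocities it suffices that
U'² > 2σ(c - U). The function U'² + 2σ(U - c) has derivative 2U'(U'' + σ), which is negative because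
U' > 0 and U'' < -σ as long as the distance to P is less than that of L₁; and it is nonnegative at
that distance because U ≥ H(L₁) on the sphere around P through L₁ (`rayPot_transverse`). Both
inequalities for U come from the balance of forces at L₁. At collisions λ(X) = m_P², so nothing
degenerates there, and the regularized pieces are compact (`isCompact_chartFamily`).

Slightly above the critical value the primitives of the two primaries differ by an exact form: the
positions relative to the Moon and to the Earth differ by a constant vector, so the difference is
dx₁ = -dp₁. In a neck around L₁ they are interpolated by adding dG, with G as in `neckGen`. The
switch is the linear function ψ = κ(q₁ - x_L) + (p₂ - x_L); on the critical level near L₁ it has the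
sign of q₁ - x_L and vanishes at L₁ only (`neck_level_bounds`). For large |ψ| the function G is 0 on
the Earth side and -p₁ on the Moon side. Near ψ = 0 it is chosen so that λ(X) is positive definite
to second order at L₁, hence positive on every nearby level except at L₁ itself
(`neckRate_pos_local`). In between, positivity is proved on the critical level
(`neckRate_pos_transition`, `neckRate_pos_saturated`) and passes to slightly higher levels by
compactness, which produces ε (`exists_energy_gap`). The cut-offs change on a scale e, but ψ h'(ψ)
and ψ χ'(ψ) are bounded independently of e on their transition ranges, so e can be chosen last. -/

/-! ### One-variable inequalities -/

/-- The function `1/x + x²/2` of the distance to a primary that enters the effective potential. -/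
noncomputable def phi (x : ℝ) : ℝ := 1 / x + x ^ 2 / 2

/-- The function `1/x² - x`, the negative of the derivative of `phi`. -/
noncomputable def kfun (x : ℝ) : ℝ := 1 / x ^ 2 - x

/-- The difference factors as `(d - r) * (2 - r * d * (d + r)) / (2 * (r * d))`, and `d + r ≤ 2`
makes the second factor positive. The range passes the minimum of `phi` at 1, since the distance to
a primary may exceed 1 on the spheres where potentials are compared. -/
theorem phi_lt {r d : ℝ} (hr : 0 < r) (hr1 : r < 1) (h : r < d) (hd : d ≤ 2 - r) :
    phi d < phi r := by
  have hd0 : 0 < d := hr.trans h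
  have e : phi r - phi d = (d - r) * (2 - r * d * (d + r)) / (2 * (r * d)) := by
    unfold phi; field_simp; ring
  have h1 : r * d < 1 := by nlinarith
  have h2 : 0 < 2 - r * d * (d + r) := by nlinarith [mul_pos hr hd0]
  have : 0 < phi r - phi d := by
    rw [e]; have := sub_pos.2 h; positivity
  linarith

theorem phi_le {r d : ℝ} (hr : 0 < r) (hr1 : r < 1) (h : r ≤ d) (hd : d ≤ 2 - r) :
    phi d ≤ phi r := by
  rcases h.eq_or_lt with rfl | h
  · exact le_rfl
  · exact (phi_lt hr hr1 h hd).le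

/-- Convexity: the graph lies above its tangent line, with the explicit remainder `(d - r) ^ 2 * (1
/ (d * r ^ 2) + 1 / 2)`. -/
theorem phi_tangent {r d : ℝ} (hr : 0 < r) (hd : 0 < d) :
    phi r - kfun r * (d - r) ≤ phi d := by
  have e : phi d - (phi r - kfun r * (d - r)) = (d - r) ^ 2 * (1 / (d * r ^ 2) + 1 / 2) := by
    unfold phi kfun; field_simp; ring
  have : 0 ≤ phi d - (phi r - kfun r * (d - r)) := by rw [e]; positivity
  linarith

theorem kfun_lt {x y : ℝ} (hx : 0 < x) (h : x < y) : kfun y < kfun x := by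
  unfold kfun
  have : 1 / y ^ 2 < 1 / x ^ 2 := by
    apply one_div_lt_one_div_of_lt (by positivity); gcongr
  linarith

/-- Balance inequality on the side of the first primary. -/
theorem balance_lt {m m' r ρ : ℝ} (hm : 0 < m) (hm' : 0 < m') (hr1 : r < 1)
    (hb : m * kfun r = m' * kfun (1 - r)) (h0 : 0 < ρ) (h : ρ < r) :
    m' * kfun (1 - ρ) < m * kfun ρ := by
  have h1 := kfun_lt h0 h
  have h2 : kfun (1 - ρ) < kfun (1 - r) := kfun_lt (by linarith) (by linarith)
  nlinarith

/-- The first radial derivative of the effective potential is positive. -/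
theorem radial_deriv_pos {m m' r ρ t σ D : ℝ} (hm : 0 < m) (hm' : 0 < m') (hsum : m + m' = 1)
    (hr1 : r < 1) (hb : m * kfun r = m' * kfun (1 - r)) (h0 : 0 < ρ) (h : ρ < r)
    (ht1 : t ^ 2 ≤ 1) (hσ1 : σ ≤ 1) (hD : 0 < D) (hD2 : D ^ 2 = 1 - 2 * ρ * t + ρ ^ 2) :
    0 < m / ρ ^ 2 + m' * (ρ - t) / D ^ 3 - ρ * σ + m' * t := by
  have hbal := balance_lt hm hm' hr1 hb h0 h
  have hρ1 : ρ < 1 := h.trans hr1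
  have ht := abs_le.1 (abs_le_one_iff_mul_self_le_one.2 (by nlinarith : t * t ≤ 1))
  have hDlo : 1 - ρ ≤ D := by
    apply le_of_sq_le_sq _ hD.le
    nlinarith
  have hDhi : D ≤ 1 + ρ := by
    apply le_of_sq_le_sq _ (by linarith)
    nlinarith
  -- The difference is 1 - t². Thus `w` below is a cosine, of the angle at the moving point between
  -- the ray and the line from the other primary.
  have hc : (ρ - t) ^ 2 ≤ D ^ 2 := by nlinarith
  have hc' := abs_le_of_sq_le_sq' hc hD.le
  set w := (ρ - t) / D with hw
  have hw1 : -1 ≤ w := by rw [hw, le_div_iff₀ hD]; linarith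
  have hw2 : w ≤ 1 := by rw [hw, div_le_iff₀ hD]; linarith
  -- `kfun` decreases and D lies in [1 - ρ, 1 + ρ]. It may be negative at 1 + ρ, but never by more
  -- than its value at 1 - ρ.
  have hk : |kfun D| ≤ kfun (1 - ρ) := by
    rw [abs_le]
    constructor
    · have h1 : kfun (1 + ρ) ≤ kfun D := by
        rcases hDhi.eq_or_lt with e | e
        · rw [e]
        · exact (kfun_lt hD e).le
      have h2 : 0 ≤ kfun (1 - ρ) + kfun (1 + ρ) := by
        have h3 : 0 < 1 - ρ := by linarith
        have h4 : 0 < 1 + ρ := by linarith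
        have e : kfun (1 - ρ) + kfun (1 + ρ) =
            2 * (ρ ^ 2 * (3 - ρ ^ 2)) / ((1 - ρ) ^ 2 * (1 + ρ) ^ 2) := by
          unfold kfun; field_simp; ring
        rw [e]
        have : 0 ≤ 3 - ρ ^ 2 := by nlinarith
        positivity
      linarith
    · rcases hDlo.eq_or_lt with e | e
      · rw [e]
      · exact (kfun_lt (by linarith) e).le
  have hprod : -kfun (1 - ρ) ≤ kfun D * w := by
    have : |kfun D * w| ≤ kfun (1 - ρ) := by
      rw [abs_mul]
      calc |kfun D| * |w| ≤ |kfun D| * 1 := by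
            gcongr; exact abs_le.2 ⟨hw1, hw2⟩
        _ ≤ _ := by linarith
    linarith [(abs_le.1 this).1]
  -- With m + m' = 1 the centrifugal terms are absorbed into `kfun`; the balance inequality then
  -- beats the term of the other primary even for `w = -1`.
  have e : m / ρ ^ 2 + m' * (ρ - t) / D ^ 3 - ρ * σ + m' * t =
      m * kfun ρ + m' * (kfun D * w) + ρ * (1 - σ) := by
    rw [hw]; unfold kfun
    have : m = 1 - m' := by linarith
    subst this
    field_simp
    ring
  rw [e]
  nlinarith [mul_le_mul_of_nonneg_left hprod hm'.le]

/-- The second radial derivative of the effective potential is less than `-σ`. -/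
theorem radial_deriv2_neg {m m' r ρ t D : ℝ} (hm : 0 < m) (hm' : 0 < m')
    (hr1 : r < 1) (hb : m * kfun r = m' * kfun (1 - r)) (h0 : 0 < ρ) (h : ρ < r)
    (ht1 : t ^ 2 ≤ 1) (hD : 0 < D) (hD2 : D ^ 2 = 1 - 2 * ρ * t + ρ ^ 2) :
    -2 * m / ρ ^ 3 + m' * (D ^ 2 - 3 * (ρ - t) ^ 2) / D ^ 5 < 0 := by
  have hbal := balance_lt hm hm' hr1 hb h0 h
  have hρ1 : ρ < 1 := h.trans hr1
  have ht := abs_le.1 (abs_le_one_iff_mul_self_le_one.2 (by nlinarith : t * t ≤ 1))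
  set e := 1 - ρ with he
  have he0 : 0 < e := by linarith
  have hρe : ρ = 1 - e := by linarith
  have hDlo : e ≤ D := by
    apply le_of_sq_le_sq _ hD.le
    nlinarith
  set s := ρ - t with hs
  -- the balance inequality, cleared of denominators
  have hK : m' * (3 - 3 * ρ + ρ ^ 2) * ρ ^ 3 ≤ m * (1 + ρ + ρ ^ 2) * e ^ 3 := by
    have e1 : m * kfun ρ = m * (1 + ρ + ρ ^ 2) * e ^ 3 / (ρ ^ 2 * e ^ 2) := by
      unfold kfun; rw [he]
      have : (1 - ρ) ≠ 0 := by linarith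
      field_simp; ring
    have e2 : m' * kfun e = m' * (3 - 3 * ρ + ρ ^ 2) * ρ ^ 3 / (ρ ^ 2 * e ^ 2) := by
      unfold kfun; rw [he]
      have : (1 - ρ) ≠ 0 := by linarith
      field_simp; ring
    rw [e1, e2] at hbal
    rw [div_lt_div_iff_of_pos_right (by positivity)] at hbal
    exact hbal.le
  -- `hK` bounds m / m' from below, so the masses drop out and this inequality in ρ, D, s is all
  -- that remains.
  have key : (1 + ρ + ρ ^ 2) * e ^ 3 * (D ^ 2 - 3 * s ^ 2) <
      2 * (3 - 3 * ρ + ρ ^ 2) * D ^ 5 := by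
    have hq : 0 < 3 - 3 * ρ + ρ ^ 2 := by nlinarith
    -- For ρ ≤ 4/5 it suffices to drop s and use D ≥ e, since 5 - 7ρ + ρ² > 0 there; its smaller
    -- root is about 0.807.
    rcases le_or_gt ρ (4 / 5) with hcase | hcase
    · have h1 : 1 + ρ + ρ ^ 2 < 2 * (3 - 3 * ρ + ρ ^ 2) := by nlinarith
      have h2 : e ^ 3 * D ^ 2 ≤ D ^ 5 := by
        calc e ^ 3 * D ^ 2 ≤ D ^ 3 * D ^ 2 := by gcongr
          _ = D ^ 5 := by ring
      calc (1 + ρ + ρ ^ 2) * e ^ 3 * (D ^ 2 - 3 * s ^ 2)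
          ≤ (1 + ρ + ρ ^ 2) * e ^ 3 * D ^ 2 := by gcongr; nlinarith [sq_nonneg s]
        _ = (1 + ρ + ρ ^ 2) * (e ^ 3 * D ^ 2) := by ring
        _ ≤ (1 + ρ + ρ ^ 2) * D ^ 5 := by gcongr
        _ < _ := by gcongr
    · have he5 : e < 1 / 5 := by linarith
      -- Near ρ = 1 either D² ≥ (3/2)e², which gives room in 2D³ > 3e³, or the point lies almost
      -- between the primaries, where |s| ≥ (9/10)e makes D² - 3s² negative.
      rcases le_or_gt (3 / 2 * e ^ 2) (D ^ 2) with hc | hc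
      · have h3 : 3 * e ^ 3 < 2 * D ^ 3 := by
          have : (3 * e ^ 3) ^ 2 < (2 * D ^ 3) ^ 2 := by
            have h6 : (3 / 2 * e ^ 2) ^ 3 ≤ (D ^ 2) ^ 3 := by gcongr
            have : 0 < e ^ 6 := by positivity
            nlinarith
          exact lt_of_pow_lt_pow_left₀ 2 (by positivity) this
        have h1 : 1 + ρ + ρ ^ 2 ≤ 3 * (3 - 3 * ρ + ρ ^ 2) := by nlinarith
        calc (1 + ρ + ρ ^ 2) * e ^ 3 * (D ^ 2 - 3 * s ^ 2)
            ≤ (1 + ρ + ρ ^ 2) * e ^ 3 * D ^ 2 := by gcongr; nlinarith [sq_nonneg s]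
          _ ≤ 3 * (3 - 3 * ρ + ρ ^ 2) * e ^ 3 * D ^ 2 := by gcongr
          _ = (3 - 3 * ρ + ρ ^ 2) * D ^ 2 * (3 * e ^ 3) := by ring
          _ < (3 - 3 * ρ + ρ ^ 2) * D ^ 2 * (2 * D ^ 3) := by gcongr
          _ = _ := by ring
      · have hsd : 2 * ρ * (-s) = e * (2 - e) - D ^ 2 := by
          rw [hD2, hs, hρe]; ring
        have hs1 : 9 / 10 * e ≤ -s := by
          by_contra hlt
          push Not at hlt
          have : 2 * ρ * (-s) < 2 * ρ * (9 / 10 * e) := by gcongr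
          nlinarith
        have hneg : D ^ 2 - 3 * s ^ 2 < 0 := by nlinarith
        have h1 : (1 + ρ + ρ ^ 2) * e ^ 3 * (D ^ 2 - 3 * s ^ 2) ≤ 0 :=
          mul_nonpos_of_nonneg_of_nonpos (by positivity) hneg.le
        have h2 : 0 < 2 * (3 - 3 * ρ + ρ ^ 2) * D ^ 5 := by positivity
        linarith
  have hA : 0 < (1 + ρ + ρ ^ 2) * e ^ 3 := by positivity
  rw [show -2 * m / ρ ^ 3 + m' * (D ^ 2 - 3 * s ^ 2) / D ^ 5 =
    (m' * (D ^ 2 - 3 * s ^ 2) * ρ ^ 3 - 2 * m * D ^ 5) / (ρ ^ 3 * D ^ 5) by field_simp; ring]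
  apply div_neg_of_neg_of_pos _ (by positivity)
  have hk1 := mul_lt_mul_of_pos_left key (by positivity : 0 < m' * ρ ^ 3)
  have hk2 := mul_le_mul_of_nonneg_left hK (by positivity : 0 ≤ 2 * D ^ 5)
  have e3 : ((1 + ρ + ρ ^ 2) * e ^ 3) * (m' * (D ^ 2 - 3 * s ^ 2) * ρ ^ 3 - 2 * m * D ^ 5) =
      m' * ρ ^ 3 * ((1 + ρ + ρ ^ 2) * e ^ 3 * (D ^ 2 - 3 * s ^ 2)) -
        2 * D ^ 5 * (m * (1 + ρ + ρ ^ 2) * e ^ 3) := by ring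
  have e4 : m' * ρ ^ 3 * (2 * (3 - 3 * ρ + ρ ^ 2) * D ^ 5) =
      2 * D ^ 5 * (m' * (3 - 3 * ρ + ρ ^ 2) * ρ ^ 3) := by ring
  exact (pos_iff_neg_of_mul_neg (by rw [e3]; linarith)).1 hA

/-- The effective potential along a ray through a primary. -/
noncomputable def rayPot (m m' t σ ρ : ℝ) : ℝ :=
  -m / ρ - m' / √(1 - 2 * ρ * t + ρ ^ 2) - σ * ρ ^ 2 / 2 + m' * t * ρ - m' ^ 2 / 2

/-- The derivative of `rayPot`. -/
noncomputable def rayPot' (m m' t σ ρ : ℝ) : ℝ :=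
  m / ρ ^ 2 + m' * (ρ - t) / √(1 - 2 * ρ * t + ρ ^ 2) ^ 3 - ρ * σ + m' * t

theorem ray_dist_pos {ρ t : ℝ} (h0 : 0 < ρ) (h1 : ρ < 1) (ht1 : t ^ 2 ≤ 1) :
    0 < 1 - 2 * ρ * t + ρ ^ 2 := by
  have ht := abs_le.1 (abs_le_one_iff_mul_self_le_one.2 (by nlinarith : t * t ≤ 1))
  nlinarith

theorem hasDerivAt_rayPot {m m' t σ ρ : ℝ} (h0 : 0 < ρ) (h1 : ρ < 1) (ht1 : t ^ 2 ≤ 1) :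
    HasDerivAt (rayPot m m' t σ) (rayPot' m m' t σ ρ) ρ := by
  have hp := ray_dist_pos h0 h1 ht1
  have hD : 0 < √(1 - 2 * ρ * t + ρ ^ 2) := Real.sqrt_pos.2 hp
  have hin : HasDerivAt (fun ρ : ℝ => 1 - 2 * ρ * t + ρ ^ 2) (2 * (ρ - t)) ρ := by
    have := (((hasDerivAt_id ρ).const_mul 2).mul_const t).const_sub 1 |>.add
      ((hasDerivAt_id ρ).pow 2)
    refine this.congr_deriv ?_
    simp; ring
  have hs := hin.sqrt hp.ne'
  have H := ((((hasDerivAt_const ρ (-m)).div (hasDerivAt_id ρ) h0.ne').sub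
    ((hasDerivAt_const ρ m').div hs hD.ne')).sub
    ((((hasDerivAt_id ρ).pow 2).const_mul σ).div_const 2)).add
      ((hasDerivAt_id ρ).const_mul (m' * t)) |>.sub_const (m' ^ 2 / 2)
  refine H.congr_deriv ?_
  simp only [rayPot', id]
  field_simp
  simp
  ring

theorem hasDerivAt_rayPot' {m m' t σ ρ : ℝ} (h0 : 0 < ρ) (h1 : ρ < 1) (ht1 : t ^ 2 ≤ 1) :
    HasDerivAt (rayPot' m m' t σ) (-2 * m / ρ ^ 3 + m' * (√(1 - 2 * ρ * t + ρ ^ 2) ^ 2 -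
      3 * (ρ - t) ^ 2) / √(1 - 2 * ρ * t + ρ ^ 2) ^ 5 - σ) ρ := by
  have hp := ray_dist_pos h0 h1 ht1
  have hD : 0 < √(1 - 2 * ρ * t + ρ ^ 2) := Real.sqrt_pos.2 hp
  have hin : HasDerivAt (fun ρ : ℝ => 1 - 2 * ρ * t + ρ ^ 2) (2 * (ρ - t)) ρ := by
    have := (((hasDerivAt_id ρ).const_mul 2).mul_const t).const_sub 1 |>.add
      ((hasDerivAt_id ρ).pow 2)
    refine this.congr_deriv ?_
    simp; ring
  have hs := (hin.sqrt hp.ne').pow 3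
  have H := ((((hasDerivAt_const ρ m).div ((hasDerivAt_id ρ).pow 2) (by simp [h0.ne'])).add
    ((((hasDerivAt_id ρ).sub_const t).const_mul m').div hs (pow_ne_zero 3 hD.ne'))).sub
    ((hasDerivAt_id ρ).mul_const σ)).add_const (m' * t)
  refine H.congr_deriv ?_
  simp only [id, Pi.pow_apply, Nat.cast_ofNat, Nat.add_one_sub_one, pow_one]
  generalize √(1 - 2 * ρ * t + ρ ^ 2) = D at hD ⊢
  field_simp
  ring

theorem rayPot'_pos {m m' r ρ t σ : ℝ} (hm : 0 < m) (hm' : 0 < m') (hsum : m + m' = 1)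
    (hr1 : r < 1) (hb : m * kfun r = m' * kfun (1 - r)) (h0 : 0 < ρ) (h : ρ < r)
    (ht1 : t ^ 2 ≤ 1) (hσ1 : σ ≤ 1) : 0 < rayPot' m m' t σ ρ := by
  have hp := ray_dist_pos h0 (h.trans hr1) ht1
  exact radial_deriv_pos hm hm' hsum hr1 hb h0 h ht1 hσ1 (Real.sqrt_pos.2 hp)
    (Real.sq_sqrt hp.le)

/-- The effective potential increases along rays up to the distance of the Lagrange point. -/
theorem rayPot_mono {m m' r t σ : ℝ} (hm : 0 < m) (hm' : 0 < m') (hsum : m + m' = 1)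
    (hr1 : r < 1) (hb : m * kfun r = m' * kfun (1 - r)) (ht1 : t ^ 2 ≤ 1)
    (hσ1 : σ ≤ 1) : MonotoneOn (rayPot m m' t σ) (Ioc 0 r) := by
  apply monotoneOn_of_deriv_nonneg (convex_Ioc 0 r)
  · exact fun x hx =>
      (hasDerivAt_rayPot hx.1 (hx.2.trans_lt hr1) ht1).continuousAt.continuousWithinAt
  · intro x hx
    rw [interior_Ioc] at hx
    exact (hasDerivAt_rayPot hx.1 (hx.2.trans hr1) ht1).differentiableAt.differentiableWithinAt
  · intro x hx
    rw [interior_Ioc] at hx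
    rw [(hasDerivAt_rayPot hx.1 (hx.2.trans hr1) ht1).deriv]
    exact (rayPot'_pos hm hm' hsum hr1 hb hx.1 hx.2 ht1 hσ1).le

/-- The radial transversality inequality. -/
theorem rayPot_transverse {m m' r t σ c ρ : ℝ} (hm : 0 < m) (hm' : 0 < m') (hsum : m + m' = 1)
    (hr1 : r < 1) (hb : m * kfun r = m' * kfun (1 - r)) (ht1 : t ^ 2 ≤ 1)
    (hσ0 : 0 ≤ σ) (hσ1 : σ ≤ 1) (hc : c ≤ rayPot m m' t σ r) (h0 : 0 < ρ) (h : ρ < r) :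
    2 * σ * (c - rayPot m m' t σ ρ) < rayPot' m m' t σ ρ ^ 2 := by
  -- The derivative of g is 2U'(U'' + σ): the σ from the potential term cancels the -σ in U''. So g
  -- strictly decreases up to r, where it is nonnegative by `hc`.
  set g : ℝ → ℝ := fun x => rayPot' m m' t σ x ^ 2 + 2 * σ * (rayPot m m' t σ x - c) with hg
  have hd : ∀ x ∈ Ioc 0 r, HasDerivAt g (2 * rayPot' m m' t σ x *
      (-2 * m / x ^ 3 + m' * (√(1 - 2 * x * t + x ^ 2) ^ 2 -
      3 * (x - t) ^ 2) / √(1 - 2 * x * t + x ^ 2) ^ 5)) x := by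
    intro x hx
    have hx1 := hx.2.trans_lt hr1
    have := ((hasDerivAt_rayPot' (m := m) (m' := m') (σ := σ) hx.1 hx1 ht1).pow 2).add
      (((hasDerivAt_rayPot (m := m) (m' := m') (σ := σ) hx.1 hx1 ht1).sub_const c).const_mul
        (2 * σ))
    refine this.congr_deriv ?_
    simp only [Nat.cast_ofNat, Nat.add_one_sub_one, pow_one]
    ring
  have hanti : StrictAntiOn g (Ioc 0 r) := by
    apply strictAntiOn_of_deriv_neg (convex_Ioc 0 r)
    · exact fun x hx => (hd x hx).continuousAt.continuousWithinAt
    · intro x hx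
      rw [interior_Ioc] at hx
      rw [(hd x ⟨hx.1, hx.2.le⟩).deriv]
      have hp := ray_dist_pos hx.1 (hx.2.trans hr1) ht1
      exact mul_neg_of_pos_of_neg
        (by have := rayPot'_pos hm hm' hsum hr1 hb hx.1 hx.2 ht1 hσ1; positivity)
        (radial_deriv2_neg hm hm' hr1 hb hx.1 hx.2 ht1 (Real.sqrt_pos.2 hp)
          (Real.sq_sqrt hp.le))
  have h1 := hanti ⟨h0, h.le⟩ ⟨h0.trans h, le_rfl⟩ h
  have h2 : 0 ≤ g r := by
    have : 0 ≤ rayPot m m' t σ r - c := by linarith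
    simp only [hg]; positivity
  simp only [hg] at h1 h2
  linarith

/-! ### The effective potential -/

/-- The direction, along the first axis, in which the other primary lies. -/
def axisSign : Primary → ℝ
  | .earth => -1
  | .moon => 1

theorem axisSign_sq (b : Primary) : axisSign b ^ 2 = 1 := by cases b <;> simp [axisSign]

theorem axisSign_other (b : Primary) : axisSign b.other = -axisSign b := by
  cases b <;> simp [axisSign, Primary.other]

theorem mass_pos {μ : ℝ} (h : μ ∈ Ioo (0 : ℝ) 1) (b : Primary) : 0 < mass μ b := by
  cases b <;> simp [mass, h.1, h.2]

theorem mass_add_other (μ : ℝ) (b : Primary) : mass μ b + mass μ b.other = 1 := by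
  cases b <;> simp [mass, Primary.other]

theorem pos_zero (μ : ℝ) (b : Primary) : pos μ b 0 = -(mass μ b.other * axisSign b) := by
  cases b
  · simp [pos, mass, axisSign, Primary.other]
  · simp [pos, mass, axisSign, Primary.other]; ring

theorem pos_one (μ : ℝ) (b : Primary) : pos μ b 1 = 0 := by
  cases b <;> simp [pos]

theorem pos_two (μ : ℝ) (b : Primary) : pos μ b 2 = 0 := by
  cases b <;> simp [pos]

theorem pos_other_zero (μ : ℝ) (b : Primary) : pos μ b.other 0 = pos μ b 0 + axisSign b := by
  cases b
  · simp [pos, axisSign, Primary.other]; ring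
  · simp [pos, axisSign, Primary.other]

theorem norm_sq_E3 (v : E3) : ‖v‖ ^ 2 = v 0 ^ 2 + v 1 ^ 2 + v 2 ^ 2 := by
  rw [EuclideanSpace.norm_sq_eq, Fin.sum_univ_three]; simp

theorem norm_sq_E4 (v : E4) : ‖v‖ ^ 2 = v 0 ^ 2 + v 1 ^ 2 + v 2 ^ 2 + v 3 ^ 2 := by
  rw [EuclideanSpace.norm_sq_eq, Fin.sum_univ_four]; simp

theorem inner_E3 (v w : E3) : inner ℝ v w = v 0 * w 0 + v 1 * w 1 + v 2 * w 2 := by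
  rw [PiLp.inner_apply, Fin.sum_univ_three]; simp; ring

theorem inner_E4 (v w : E4) :
    inner ℝ v w = v 0 * w 0 + v 1 * w 1 + v 2 * w 2 + v 3 * w 3 := by
  rw [PiLp.inner_apply, Fin.sum_univ_four]; simp; ring

/-- The law of cosines, the primaries being at distance one along the first axis. -/
theorem norm_sub_pos_other_sq (μ : ℝ) (b : Primary) (q : E3) :
    ‖q - pos μ b.other‖ ^ 2 =
      1 - 2 * (axisSign b * (q - pos μ b) 0) + ‖q - pos μ b‖ ^ 2 := by
  rw [norm_sq_E3, norm_sq_E3]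
  simp only [PiLp.sub_apply, pos_one, pos_two, pos_other_zero]
  have := axisSign_sq b
  linear_combination this

/-- The effective potential of the rotating frame. -/
noncomputable def effPot (μ : ℝ) (q : E3) : ℝ :=
  -(μ / ‖q - pos μ .moon‖) - (1 - μ) / ‖q - pos μ .earth‖ - (q 0 ^ 2 + q 1 ^ 2) / 2

theorem effPot_eq (μ : ℝ) (b : Primary) (q : E3) :
    effPot μ q = -(mass μ b / ‖q - pos μ b‖) - mass μ b.other / ‖q - pos μ b.other‖
      - (q 0 ^ 2 + q 1 ^ 2) / 2 := by
  cases b <;> simp only [effPot, mass, Primary.other] <;> ring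

/-- The square is completed in the momenta shifted by the rotation, so that the kinetic part is half
the squared velocity in the rotating frame. -/
theorem jacobi_eq (μ : ℝ) (q p : E3) :
    jacobi μ (q, p) =
      ((p 0 + q 1) ^ 2 + (p 1 - q 0) ^ 2 + p 2 ^ 2) / 2 + effPot μ q := by
  simp only [jacobi, effPot, norm_sq_E3]; ring

theorem mem_hillRegion {μ c : ℝ} {q : E3} :
    q ∈ hillRegion μ c ↔ (∀ b, q ≠ pos μ b) ∧ effPot μ q ≤ c := by
  constructor
  · rintro ⟨⟨q, p⟩, ⟨h1, h2⟩, rfl⟩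
    refine ⟨h1, ?_⟩
    rw [jacobi_eq] at h2
    have : 0 ≤ ((p 0 + q 1) ^ 2 + (p 1 - q 0) ^ 2 + p 2 ^ 2) / 2 := by positivity
    simp only; linarith
  · rintro ⟨h1, h2⟩
    -- The planar velocity is zero and all the kinetic energy is put in the vertical direction.
    refine ⟨(q, !₂[-q 1, q 0, √(2 * (c - effPot μ q))]), ⟨h1, ?_⟩, rfl⟩
    have hs := Real.sq_sqrt (by linarith : 0 ≤ 2 * (c - effPot μ q))
    rw [jacobi_eq]
    generalize √(2 * (c - effPot μ q)) = w at hs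
    simp only [Matrix.cons_val, hs]
    ring

theorem effPot_le_of_mem {μ c : ℝ} {q p : E3} (h : jacobi μ (q, p) = c) : effPot μ q ≤ c := by
  rw [jacobi_eq] at h
  have : 0 ≤ ((p 0 + q 1) ^ 2 + (p 1 - q 0) ^ 2 + p 2 ^ 2) / 2 := by positivity
  linarith

theorem norm_sub_pos_pos {μ : ℝ} {q : E3} {b : Primary} (h : q ≠ pos μ b) :
    0 < ‖q - pos μ b‖ := norm_pos_iff.2 (sub_ne_zero.2 h)

/-- The effective potential in terms of the distances to the primaries. -/
theorem effPot_eq_phi (μ : ℝ) (b : Primary) (q : E3) :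
    effPot μ q = -(mass μ b * phi ‖q - pos μ b‖) - mass μ b.other * phi ‖q - pos μ b.other‖
      + mass μ b * mass μ b.other / 2 + q 2 ^ 2 / 2 := by
  have h1 := norm_sub_pos_other_sq μ b q
  have h2 := mass_add_other μ b
  have h3 := norm_sq_E3 (q - pos μ b)
  rw [effPot_eq μ b]
  simp only [PiLp.sub_apply, pos_one, pos_two, pos_zero] at h1 h3
  rw [h3] at h1
  unfold phi
  rw [h1, h3]
  have h4 : mass μ b = 1 - mass μ b.other := by linarith
  rw [h4]
  have h5 := axisSign_sq b
  linear_combination (-(mass μ b.other ^ 2) / 2) * h5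

theorem norm_sub_other_le (μ : ℝ) (b : Primary) (q : E3) :
    ‖q - pos μ b.other‖ ≤ 1 + ‖q - pos μ b‖ := by
  apply le_of_sq_le_sq _ (by positivity)
  rw [norm_sub_pos_other_sq]
  have h1 := norm_sq_E3 (q - pos μ b)
  have h2 : (axisSign b * (q - pos μ b) 0) ^ 2 ≤ ‖q - pos μ b‖ ^ 2 := by
    rw [mul_pow, axisSign_sq]
    nlinarith [sq_nonneg ((q - pos μ b) 1), sq_nonneg ((q - pos μ b) 2)]
  have := abs_le_of_sq_le_sq' h2 (norm_nonneg _)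
  nlinarith

theorem norm_sub_other_ge (μ : ℝ) (b : Primary) (q : E3) :
    1 - ‖q - pos μ b‖ ≤ ‖q - pos μ b.other‖ := by
  have h : ‖pos μ b - pos μ b.other‖ = 1 := by
    have := norm_sub_pos_other_sq μ b (pos μ b)
    simp at this
    rcases this with h | h
    · exact h
    · linarith [norm_nonneg (pos μ b - pos μ b.other)]
  have := norm_sub_le_norm_sub_add_norm_sub (pos μ b) q (pos μ b.other)
  rw [h, norm_sub_rev (pos μ b) q] at this
  linarith

theorem pos_ne_other (μ : ℝ) (b : Primary) : pos μ b ≠ pos μ b.other := by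
  intro h
  have := norm_sub_pos_other_sq μ b (pos μ b)
  rw [← h] at this
  simp at this

/-! ### The first Lagrange point -/

/-- The first coordinate of the Lagrange point. -/
noncomputable def lagX (μ : ℝ) : ℝ := (firstLagrangePoint μ).1 0

/-- The position of the Lagrange point. -/
noncomputable def lagPos (μ : ℝ) : E3 := !₂[lagX μ, 0, 0]

/-- The distance of the Lagrange point to a primary. -/
noncomputable def lagDist (μ : ℝ) : Primary → ℝ
  | .earth => μ - lagX μ
  | .moon => lagX μ + 1 - μ

theorem lagDist_other (μ : ℝ) (b : Primary) : lagDist μ b.other = 1 - lagDist μ b := by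
  cases b <;> simp only [lagDist, Primary.other] <;> ring

theorem lagX_eq (μ : ℝ) (b : Primary) : lagX μ = pos μ b 0 + axisSign b * lagDist μ b := by
  cases b <;> simp [lagDist, pos, axisSign]

theorem norm_lagPos_sub_pos_abs (μ : ℝ) (b : Primary) : ‖lagPos μ - pos μ b‖ = |lagDist μ b| := by
  rw [← abs_norm, ← sq_eq_sq_iff_abs_eq_abs, norm_sq_E3]
  simp [lagPos, pos_one, pos_two]
  rw [lagX_eq μ b]
  linear_combination (lagDist μ b ^ 2) * axisSign_sq b

/-- `firstLagrangePoint` is only known to be some critical point over the open segment. Testing the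
differential of H on coordinate vectors yields its momentum and the balance of forces, which is all
that is used later. -/
theorem firstLagrangePoint_spec {μ : ℝ} (h : μ ∈ Ioo (0 : ℝ) 1) :
    firstLagrangePoint μ = (lagPos μ, !₂[0, lagX μ, 0]) ∧ (∀ b, 0 < lagDist μ b) ∧
    (1 - μ) * kfun (lagDist μ .earth) = μ * kfun (lagDist μ .moon) := by
  obtain ⟨⟨α, β, hα, hβ, hαβ, hq⟩, hL⟩ := isFirstLagrangePoint_firstLagrangePoint μ h
  have hx : lagX μ = α * (-1 + μ) + β * μ := by
    have := congrArg (fun v : E3 => v 0) hq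
    simp [pos] at this
    simp only [lagX]; linarith
  have hq' : (firstLagrangePoint μ).1 = lagPos μ := by
    ext i
    fin_cases i
    · simp [lagPos, lagX]
    · have := congrArg (fun v : E3 => v 1) hq
      simp [pos] at this
      simp [lagPos, this]
    · have := congrArg (fun v : E3 => v 2) hq
      simp [pos] at this
      simp [lagPos, this]
  have hdist : ∀ b, 0 < lagDist μ b := by
    rintro (_ | _)
    · rw [lagDist, hx, show β = 1 - α by linarith]; ring_nf; exact hα
    · rw [lagDist, hx, show α = 1 - β by linarith]; ring_nf; exact hβ
  have hne : ∀ b, (firstLagrangePoint μ).1 ≠ pos μ b := by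
    intro b e
    have := norm_lagPos_sub_pos_abs μ b
    rw [← hq', e, sub_self, norm_zero, abs_of_pos (hdist b)] at this
    linarith [hdist b]
  have hf := fun V => (fderiv_jacobi_apply μ (firstLagrangePoint μ) V hne).symm.trans
    (by rw [hL]; rfl : _ = (0 : ℝ))
  have nn : ∀ b, ‖(firstLagrangePoint μ).1 - pos μ b‖ = lagDist μ b := fun b => by
    rw [hq', norm_lagPos_sub_pos_abs, abs_of_pos (hdist b)]
  simp only [nn, inner_E3] at hf
  have p0 := hf (0, !₂[1, 0, 0])
  have p1 := hf (0, !₂[0, 1, 0])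
  have p2 := hf (0, !₂[0, 0, 1])
  have f0 := hf (!₂[1, 0, 0], 0)
  have l1 : (firstLagrangePoint μ).1 1 = 0 := by rw [hq']; simp [lagPos]
  simp [l1] at p0 p1 p2 f0
  refine ⟨?_, hdist, ?_⟩
  · refine Prod.ext hq' ?_
    ext i
    fin_cases i
    · simpa using p0
    · simp only [lagX]; simp; linarith
    · simpa using p2
  · have hE := hdist .earth
    have hM := hdist .moon
    have e1 : (firstLagrangePoint μ).1 0 - pos μ .moon 0 = lagDist μ .moon := by
      simp [pos, lagDist, lagX]; ring
    have e2 : (firstLagrangePoint μ).1 0 - pos μ .earth 0 = -lagDist μ .earth := by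
      simp [pos, lagDist, lagX]
    have e3 : (firstLagrangePoint μ).2 1 = μ - lagDist μ .earth := by
      simp only [lagDist, lagX]; linarith
    rw [e1, e2, e3] at f0
    have e4 : lagDist μ .moon = 1 - lagDist μ .earth := lagDist_other μ .earth
    rw [e4] at f0 hM ⊢
    unfold kfun
    have hM' := hM.ne'
    field_simp at f0 ⊢
    linear_combination (-1 : ℝ) * f0

theorem lagDist_pos {μ : ℝ} (h : μ ∈ Ioo (0 : ℝ) 1) (b : Primary) : 0 < lagDist μ b :=
  (firstLagrangePoint_spec h).2.1 b

theorem lagDist_lt_one {μ : ℝ} (h : μ ∈ Ioo (0 : ℝ) 1) (b : Primary) : lagDist μ b < 1 := by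
  have := lagDist_pos h b.other
  rw [lagDist_other] at this
  linarith

theorem lag_balance {μ : ℝ} (h : μ ∈ Ioo (0 : ℝ) 1) (b : Primary) :
    mass μ b * kfun (lagDist μ b) = mass μ b.other * kfun (1 - lagDist μ b) := by
  rw [← lagDist_other]
  have := (firstLagrangePoint_spec h).2.2
  cases b
  · exact this
  · exact this.symm

theorem norm_lagPos_sub_pos {μ : ℝ} (h : μ ∈ Ioo (0 : ℝ) 1) (b : Primary) :
    ‖lagPos μ - pos μ b‖ = lagDist μ b := by
  rw [norm_lagPos_sub_pos_abs, abs_of_pos (lagDist_pos h b)]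

theorem energyL1_eq_effPot {μ : ℝ} (h : μ ∈ Ioo (0 : ℝ) 1) : energyL1 μ = effPot μ (lagPos μ) := by
  rw [energyL1, (firstLagrangePoint_spec h).1, jacobi_eq]
  simp [lagPos]

theorem energyL1_eq_phi {μ : ℝ} (h : μ ∈ Ioo (0 : ℝ) 1) (b : Primary) :
    energyL1 μ = -(mass μ b * phi (lagDist μ b)) - mass μ b.other * phi (lagDist μ b.other)
      + mass μ b * mass μ b.other / 2 := by
  rw [energyL1_eq_effPot h, effPot_eq_phi μ b, norm_lagPos_sub_pos h, norm_lagPos_sub_pos h]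
  simp [lagPos]

/-- The two distances sum to 1, so the spheres around the primaries are tangent and touch at the
Lagrange point only. -/
theorem eq_lagPos_of_dist {μ : ℝ} (b : Primary) {q : E3}
    (h1 : ‖q - pos μ b‖ = lagDist μ b) (h2 : ‖q - pos μ b.other‖ = lagDist μ b.other) :
    q = lagPos μ := by
  have e := norm_sub_pos_other_sq μ b q
  rw [h1, h2, lagDist_other] at e
  have e1 : axisSign b * (q - pos μ b) 0 = lagDist μ b := by linarith
  have e2 := norm_sq_E3 (q - pos μ b)
  rw [h1] at e2
  have e3 : (q - pos μ b) 0 = axisSign b * lagDist μ b := by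
    rw [← e1, ← mul_assoc, ← sq, axisSign_sq, one_mul]
  rw [e3, mul_pow, axisSign_sq] at e2
  have z1 : (q - pos μ b) 1 = 0 := by nlinarith [sq_nonneg ((q - pos μ b) 2), sq_nonneg ((q - pos μ b) 1)]
  have z2 : (q - pos μ b) 2 = 0 := by nlinarith [sq_nonneg ((q - pos μ b) 2), sq_nonneg ((q - pos μ b) 1)]
  simp only [PiLp.sub_apply, pos_one, pos_two, sub_zero] at z1 z2 e3
  ext i
  fin_cases i
  · simp [lagPos, lagX_eq μ b]; linarith
  · simpa [lagPos] using z1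
  · simpa [lagPos] using z2

/-- Outside the two balls through the Lagrange point, and not too far, the effective potential
exceeds the first critical value. -/
theorem energyL1_lt_effPot {μ : ℝ} (h : μ ∈ Ioo (0 : ℝ) 1) {q : E3}
    (h1 : ∀ b, lagDist μ b ≤ ‖q - pos μ b‖ ∧ ‖q - pos μ b‖ ≤ 2 - lagDist μ b)
    (hq : q ≠ lagPos μ) : energyL1 μ < effPot μ q := by
  rw [energyL1_eq_phi h .earth, effPot_eq_phi μ .earth q]
  have hph := fun b => phi_le (lagDist_pos h b) (lagDist_lt_one h b) (h1 b).1 (h1 b).2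
  have a1 := mul_le_mul_of_nonneg_left (hph .earth) (mass_pos h .earth).le
  have a2 := mul_le_mul_of_nonneg_left (hph (Primary.other .earth))
    (mass_pos h (Primary.other .earth)).le
  by_cases e1 : ‖q - pos μ .earth‖ = lagDist μ .earth
  · by_cases e2 : ‖q - pos μ (Primary.other .earth)‖ = lagDist μ (Primary.other .earth)
    · exact absurd (eq_lagPos_of_dist _ e1 e2) hq
    · have := phi_lt (lagDist_pos h _) (lagDist_lt_one h _)
        (lt_of_le_of_ne (h1 (Primary.other .earth)).1 (Ne.symm e2)) (h1 _).2
      have := mul_lt_mul_of_pos_left this (mass_pos h (Primary.other .earth))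
      nlinarith [sq_nonneg (q 2)]
  · have := phi_lt (lagDist_pos h _) (lagDist_lt_one h _)
      (lt_of_le_of_ne (h1 .earth).1 (Ne.symm e1)) (h1 _).2
    have := mul_lt_mul_of_pos_left this (mass_pos h .earth)
    nlinarith [sq_nonneg (q 2)]

/-- On the sphere of radius r around one primary the distance to the other lies in [1 - r, 1 + r],
and with r' = 1 - r this is [r', 2 - r'], the range of `phi_lt` for the other primary. -/
theorem dist_bounds_of_mem_sphere {μ : ℝ} (h : μ ∈ Ioo (0 : ℝ) 1) (b : Primary) {q : E3}
    (hq : ‖q - pos μ b‖ = lagDist μ b) (b' : Primary) :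
    lagDist μ b' ≤ ‖q - pos μ b'‖ ∧ ‖q - pos μ b'‖ ≤ 2 - lagDist μ b' := by
  have hb : b' = b ∨ b' = b.other := by cases b <;> cases b' <;> simp [Primary.other]
  rcases hb with rfl | rfl
  · rw [hq]; exact ⟨le_rfl, by linarith [lagDist_lt_one h b']⟩
  · rw [lagDist_other, ← hq]
    exact ⟨norm_sub_other_ge μ b q, by linarith [norm_sub_other_le μ b q]⟩

theorem energyL1_le_effPot_sphere {μ : ℝ} (h : μ ∈ Ioo (0 : ℝ) 1) (b : Primary) {q : E3}
    (hq : ‖q - pos μ b‖ = lagDist μ b) : energyL1 μ ≤ effPot μ q := by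
  by_cases e : q = lagPos μ
  · rw [e, energyL1_eq_effPot h]
  · exact (energyL1_lt_effPot h (dist_bounds_of_mem_sphere h b hq) e).le

/-- On the segment between the primaries the effective potential is at most the critical value. -/
theorem effPot_axis_le {μ : ℝ} (h : μ ∈ Ioo (0 : ℝ) 1) (x : ℝ) (hx : x ∈ Ioo (-1 + μ) μ) :
    effPot μ !₂[x, 0, 0] ≤ energyL1 μ := by
  have n1 : ‖(!₂[x, 0, 0] : E3) - pos μ .earth‖ = μ - x := by
    rw [← abs_of_pos (by linarith [hx.2] : 0 < μ - x), ← abs_norm, ← sq_eq_sq_iff_abs_eq_abs,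
      norm_sq_E3]
    simp [pos]; ring
  have n2 : ‖(!₂[x, 0, 0] : E3) - pos μ (Primary.other .earth)‖ = x + 1 - μ := by
    rw [← abs_of_pos (by linarith [hx.1] : 0 < x + 1 - μ), ← abs_norm, ← sq_eq_sq_iff_abs_eq_abs,
      norm_sq_E3]
    simp [pos, Primary.other]; ring
  rw [energyL1_eq_phi h .earth, effPot_eq_phi μ .earth, n1, n2]
  -- Moving along the segment changes the two distances by opposite amounts, so by the balance of
  -- forces the linear terms of the two tangent lines cancel.
  have t1 := phi_tangent (lagDist_pos h .earth) (d := μ - x) (by linarith [hx.2])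
  have t2 := phi_tangent (lagDist_pos h (Primary.other .earth)) (d := x + 1 - μ)
    (by linarith [hx.1])
  have a1 := mul_le_mul_of_nonneg_left t1 (mass_pos h .earth).le
  have a2 := mul_le_mul_of_nonneg_left t2 (mass_pos h (Primary.other .earth)).le
  have hb := lag_balance h .earth
  rw [← lagDist_other] at hb
  have e : x + 1 - μ - lagDist μ (Primary.other .earth) = -(μ - x - lagDist μ .earth) := by
    rw [lagDist_other]; ring
  rw [e] at a2
  have hb' := congrArg (· * (μ - x - lagDist μ .earth)) hb
  simp only [Matrix.cons_val] at hb' ⊢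
  linarith

/-! ### Rays through a primary -/

/-- The parameters of `rayPot` are the cosine of the angle between the ray and the direction of the
other primary, and the squared sine of its angle with the vertical axis. -/
theorem effPot_ray (μ : ℝ) (b : Primary) (y : E3) (hy : y ≠ 0) {τ : ℝ} (hτ : 0 < τ) :
    effPot μ (pos μ b + τ • y) =
      rayPot (mass μ b) (mass μ b.other) (axisSign b * y 0 / ‖y‖)
        ((y 0 ^ 2 + y 1 ^ 2) / ‖y‖ ^ 2) (τ * ‖y‖) := by
  have hn : 0 < ‖y‖ := norm_pos_iff.2 hy
  have e1 : ‖pos μ b + τ • y - pos μ b‖ = τ * ‖y‖ := by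
    rw [add_sub_cancel_left, norm_smul, Real.norm_of_nonneg hτ.le]
  have e2 : ‖pos μ b + τ • y - pos μ b.other‖ =
      √(1 - 2 * (τ * ‖y‖) * (axisSign b * y 0 / ‖y‖) + (τ * ‖y‖) ^ 2) := by
    rw [← Real.sqrt_sq (norm_nonneg (pos μ b + τ • y - pos μ b.other)), norm_sub_pos_other_sq, e1]
    congr 1
    simp only [PiLp.sub_apply, PiLp.add_apply, PiLp.smul_apply, smul_eq_mul]
    field_simp
    ring
  rw [effPot_eq μ b, e1, e2, rayPot]
  simp only [PiLp.add_apply, PiLp.smul_apply, smul_eq_mul, pos_one, pos_zero]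
  generalize √(1 - 2 * (τ * ‖y‖) * (axisSign b * y 0 / ‖y‖) + (τ * ‖y‖) ^ 2) = D
  field_simp
  have := axisSign_sq b
  linear_combination (-(τ * ‖y‖ * mass μ b.other ^ 2)) * this

theorem ray_sq_le_one (b : Primary) (y : E3) :
    (axisSign b * y 0 / ‖y‖) ^ 2 ≤ 1 := by
  rw [div_pow, mul_pow, axisSign_sq, one_mul]
  apply div_le_one_of_le₀ _ (by positivity)
  rw [norm_sq_E3]
  nlinarith [sq_nonneg (y 1), sq_nonneg (y 2)]

theorem ray_planar_le_one (y : E3) : (y 0 ^ 2 + y 1 ^ 2) / ‖y‖ ^ 2 ≤ 1 := by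
  apply div_le_one_of_le₀ _ (by positivity)
  rw [norm_sq_E3]
  nlinarith [sq_nonneg (y 2)]

/-- The effective potential does not increase when a point of the ball through the Lagrange point
moves towards the primary. -/
theorem effPot_ray_le {μ : ℝ} (h : μ ∈ Ioo (0 : ℝ) 1) (b : Primary) {y : E3} (hy : y ≠ 0)
    (hyr : ‖y‖ ≤ lagDist μ b) {τ : ℝ} (hτ : τ ∈ Ioc (0 : ℝ) 1) :
    effPot μ (pos μ b + τ • y) ≤ effPot μ (pos μ b + y) := by
  have hn : 0 < ‖y‖ := norm_pos_iff.2 hy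
  have e := effPot_ray μ b y hy one_pos
  rw [one_smul, one_mul] at e
  rw [e, effPot_ray μ b y hy hτ.1]
  apply rayPot_mono (mass_pos h b) (mass_pos h _) (mass_add_other μ b) (lagDist_lt_one h b)
    (lag_balance h b) (ray_sq_le_one b y) (ray_planar_le_one y)
  · exact ⟨by have := hτ.1; positivity, by nlinarith [hτ.2]⟩
  · exact ⟨hn, hyr⟩
  · nlinarith [hτ.2]

/-- The derivative of the Hamiltonian in the direction of the radial Liouville field
`(q - P) ∂_q` at a primary `P`. -/
noncomputable def radialH (μ : ℝ) (b : Primary) (q p : E3) : ℝ :=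
  p 0 * (q - pos μ b) 1 - p 1 * (q - pos μ b) 0 + mass μ b / ‖q - pos μ b‖
    + mass μ b.other * inner ℝ (q - pos μ b.other) (q - pos μ b) / ‖q - pos μ b.other‖ ^ 3

/-- Transversality of the radial field up to the first critical energy. -/
theorem radialH_pos {μ : ℝ} (h : μ ∈ Ioo (0 : ℝ) 1) (b : Primary) {q p : E3}
    (h0 : q ≠ pos μ b) (hr : ‖q - pos μ b‖ < lagDist μ b) (hE : jacobi μ (q, p) ≤ energyL1 μ) :
    0 < radialH μ b q p := by
  set y := q - pos μ b with hy
  have hy0 : y ≠ 0 := sub_ne_zero.2 h0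
  have hn : 0 < ‖y‖ := norm_pos_iff.2 hy0
  have hL := lagDist_pos h b
  have hq : q = pos μ b + y := by rw [hy]; abel
  have hU := effPot_ray μ b y hy0 one_pos
  rw [one_smul, one_mul, ← hq] at hU
  set t := axisSign b * y 0 / ‖y‖ with ht
  set σ := (y 0 ^ 2 + y 1 ^ 2) / ‖y‖ ^ 2 with hσ
  -- The ray is prolonged until it meets the sphere through the Lagrange point, where the potential
  -- is at least the critical value.
  have hc : energyL1 μ ≤ rayPot (mass μ b) (mass μ b.other) t σ (lagDist μ b) := by
    have e := effPot_ray μ b y hy0 (τ := lagDist μ b / ‖y‖) (by positivity)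
    rw [div_mul_cancel₀ _ hn.ne'] at e
    rw [← e]
    apply energyL1_le_effPot_sphere h b
    rw [add_sub_cancel_left, norm_smul, Real.norm_of_nonneg (by positivity),
      div_mul_cancel₀ _ hn.ne']
  have hσ0 : 0 ≤ σ := by positivity
  have key := rayPot_transverse (mass_pos h b) (mass_pos h _) (mass_add_other μ b)
    (lagDist_lt_one h b) (lag_balance h b) (ray_sq_le_one b y) hσ0 (ray_planar_le_one y)
    hc hn hr
  have hpos := rayPot'_pos (mass_pos h b) (mass_pos h _) (mass_add_other μ b)
    (lagDist_lt_one h b) (lag_balance h b) hn hr (ray_sq_le_one b y) (ray_planar_le_one y)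
  simp only [← ht, ← hσ] at hpos
  rw [← hU] at key
  have hD : √(1 - 2 * ‖y‖ * t + ‖y‖ ^ 2) = ‖q - pos μ b.other‖ := by
    rw [← Real.sqrt_sq (norm_nonneg (q - pos μ b.other)), norm_sub_pos_other_sq, ← hy, ht]
    congr 1
    field_simp
  set W := rayPot' (mass μ b) (mass μ b.other) t σ ‖y‖ with hW
  have hin : inner ℝ (q - pos μ b.other) y = ‖y‖ * (‖y‖ - t) := by
    have e1 : ‖y‖ * (‖y‖ - t) = ‖y‖ ^ 2 - axisSign b * y 0 := by rw [ht]; field_simp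
    rw [e1, norm_sq_E3, inner_E3, hq]
    simp only [PiLp.sub_apply, PiLp.add_apply, pos_one, pos_two, pos_other_zero]
    ring
  have e : radialH μ b q p = (p 0 + q 1) * y 1 - (p 1 - q 0) * y 0 + ‖y‖ * W := by
    have hq0 : q 0 = y 0 - mass μ b.other * axisSign b := by
      rw [hq, PiLp.add_apply, pos_zero]; ring
    have hq1 : q 1 = y 1 := by rw [hq, PiLp.add_apply, pos_one]; ring
    rw [radialH, ← hy, hin, hW, rayPot', hD, hq0, hq1, hσ, ht]
    generalize ‖q - pos μ b.other‖ = D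
    field_simp
    ring
  rw [e]
  rw [jacobi_eq] at hE
  have hab : (p 0 + q 1) ^ 2 + (p 1 - q 0) ^ 2 ≤ 2 * (energyL1 μ - effPot μ q) := by
    nlinarith [sq_nonneg (p 2)]
  -- Cauchy-Schwarz for the planar velocity; its square is at most twice the kinetic energy, and
  -- |planar part of y|² = σ|y|² turns the bound into the one of `rayPot_transverse`.
  have hcs : ((p 0 + q 1) * y 1 - (p 1 - q 0) * y 0) ^ 2 < (‖y‖ * W) ^ 2 := by
    have hs : y 0 ^ 2 + y 1 ^ 2 = σ * ‖y‖ ^ 2 := by rw [hσ]; field_simp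
    calc ((p 0 + q 1) * y 1 - (p 1 - q 0) * y 0) ^ 2
        ≤ ((p 0 + q 1) ^ 2 + (p 1 - q 0) ^ 2) * (y 0 ^ 2 + y 1 ^ 2) := by
          nlinarith [sq_nonneg ((p 0 + q 1) * y 0 + (p 1 - q 0) * y 1)]
      _ ≤ (2 * (energyL1 μ - effPot μ q)) * (y 0 ^ 2 + y 1 ^ 2) := by gcongr
      _ = ‖y‖ ^ 2 * (2 * σ * (energyL1 μ - effPot μ q)) := by rw [hs]; ring
      _ < ‖y‖ ^ 2 * W ^ 2 := by gcongr
      _ = _ := by ring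
  have := abs_lt_of_sq_lt_sq' hcs (by positivity)
  linarith [this.1]

/-! ### Positivity on nearby fibres of a compact family -/

/-- A function that is positive on the fibre over `t₀` of a compact family is bounded below by a
positive constant on the nearby fibres. The function may be defined on a subfamily `W` only,
provided that `W` has the same fibre over `t₀`. -/
theorem eventually_forall_le_of_isCompact {T Z : Type*} [TopologicalSpace T] [T2Space T]
    [TopologicalSpace Z] {K W : Set (T × Z)} (hK : IsCompact K) (hWK : W ⊆ K) {t₀ : T}
    (hfib : ∀ z, (t₀, z) ∈ K → (t₀, z) ∈ W) {φ : T × Z → ℝ} (hφ : ContinuousOn φ W)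
    (hpos : ∀ z, (t₀, z) ∈ W → 0 < φ (t₀, z)) :
    ∃ δ > 0, ∀ᶠ t in 𝓝 t₀, ∀ z, (t, z) ∈ W → δ ≤ φ (t, z) := by
  have hK0 : IsCompact (K ∩ Prod.fst ⁻¹' {t₀}) :=
    hK.inter_right (isClosed_singleton.preimage continuous_fst)
  have key : ∃ δ > 0, ∃ O : Set (T × Z), IsOpen O ∧ K ∩ Prod.fst ⁻¹' {t₀} ⊆ O ∧
      ∀ x ∈ O, x ∈ W → δ ≤ φ x := by
    refine hK0.induction_on (p := fun A => ∃ δ > 0, ∃ O : Set (T × Z), IsOpen O ∧ A ⊆ O ∧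
      ∀ x ∈ O, x ∈ W → δ ≤ φ x) ?_ ?_ ?_ ?_
    · exact ⟨1, one_pos, ∅, isOpen_empty, le_rfl, by simp⟩
    · rintro A B hAB ⟨δ, hδ, O, hO, hBO, h⟩
      exact ⟨δ, hδ, O, hO, hAB.trans hBO, h⟩
    · rintro A B ⟨δ, hδ, O, hO, hAO, h⟩ ⟨δ', hδ', O', hO', hAO', h'⟩
      refine ⟨min δ δ', lt_min hδ hδ', O ∪ O', hO.union hO', union_subset_union hAO hAO', ?_⟩
      rintro x (hx | hx) hxW
      · exact (min_le_left _ _).trans (h x hx hxW)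
      · exact (min_le_right _ _).trans (h' x hx hxW)
    · rintro ⟨t, z⟩ ⟨hxK, hxt⟩
      obtain rfl : t = t₀ := hxt
      have hxW := hfib z hxK
      have h1 : ∀ᶠ x in 𝓝[W] (t, z), φ (t, z) / 2 < φ x :=
        (hφ _ hxW).eventually_const_lt (half_lt_self (hpos z hxW))
      rw [eventually_nhdsWithin_iff, eventually_nhds_iff] at h1
      obtain ⟨O, hO, hOo, hxO⟩ := h1
      exact ⟨O, mem_nhdsWithin_of_mem_nhds (hOo.mem_nhds hxO), φ (t, z) / 2,
        half_pos (hpos z hxW), O, hOo, le_rfl, fun x hx hxW => (hO x hx hxW).le⟩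
  obtain ⟨δ, hδ, O, hO, hKO, h⟩ := key
  refine ⟨δ, hδ, ?_⟩
  -- Tube lemma: the part of K outside the neighbourhood O of the fibre is compact, so its
  -- projection is closed and misses t₀.
  have hC : IsClosed (Prod.fst '' (K \ O)) := ((hK.diff hO).image continuous_fst).isClosed
  have ht : t₀ ∉ Prod.fst '' (K \ O) := by
    rintro ⟨x, ⟨hxK, hxO⟩, hx⟩
    exact hxO (hKO ⟨hxK, hx⟩)
  filter_upwards [hC.isOpen_compl.mem_nhds ht] with t ht z hz
  apply h _ _ hz
  by_contra hcon
  exact ht ⟨(t, z), ⟨hWK hz, hcon⟩, rfl⟩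

/-! ### Components of the Hill's region -/

/-- A component of the Hill's region whose closure contains a point of an open set stays inside
the open set if the potential exceeds the energy on a closed collar around it. -/
theorem hillComponent_subset {μ c : ℝ} {S : Set Primary} {D O : Set E3} (hD : IsClosed D)
    (hO : IsOpen O) (hOD : O ⊆ D) {b : Primary} (hb : b ∈ S) (hbO : pos μ b ∈ O)
    (hc : ∀ q ∈ D \ O, c < effPot μ q) : hillComponent μ c S ⊆ O := by
  rintro q ⟨hq, hcl⟩
  -- The collar D \ O is disjoint from the Hill's region, so the component lies in the disjoint open
  -- sets O and Dᶜ, and it meets O because its closure contains the primary.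
  have hsub : connectedComponentIn (hillRegion μ c) q ⊆ O ∪ Dᶜ := by
    intro x hx
    by_contra hcon
    simp only [mem_union, mem_compl_iff, not_or, not_not] at hcon
    have h1 := (mem_hillRegion.1 (connectedComponentIn_subset _ _ hx)).2
    exact absurd (hc x ⟨hcon.2, hcon.1⟩) (not_lt.2 h1)
  obtain ⟨x, hxO, hx⟩ := mem_closure_iff.1 (hcl b hb) O hO hbO
  have := isPreconnected_connectedComponentIn.subset_left_of_subset_union hO hD.isOpen_compl
    (disjoint_compl_right.mono_left hOD) hsub ⟨x, hx, hxO⟩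
  exact this (mem_connectedComponentIn hq)

theorem ray_ne_pos {μ : ℝ} {b : Primary} {y : E3} (hy : y ≠ 0) (hy1 : ‖y‖ < 1) {τ : ℝ}
    (hτ : τ ∈ Ioc (0 : ℝ) 1) (b' : Primary) : pos μ b + τ • y ≠ pos μ b' := by
  have hn : 0 < ‖y‖ := norm_pos_iff.2 hy
  have hnn : ‖pos μ b + τ • y - pos μ b‖ = τ * ‖y‖ := by
    rw [add_sub_cancel_left, norm_smul, Real.norm_of_nonneg hτ.1.le]
  have hb : b' = b ∨ b' = b.other := by cases b <;> cases b' <;> simp [Primary.other]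
  rcases hb with rfl | rfl
  · intro e
    rw [e, sub_self, norm_zero] at hnn
    have := mul_pos hτ.1 hn
    linarith
  · intro e
    have := norm_sub_other_ge μ b (pos μ b + τ • y)
    rw [hnn, e, sub_self, norm_zero] at this
    nlinarith [hτ.2]

/-- The ray to the primary lies in the component of a point of the ball through the Lagrange
point. -/
theorem ray_subset_component {μ c : ℝ} (h : μ ∈ Ioo (0 : ℝ) 1) {b : Primary} {q : E3}
    (h0 : q ≠ pos μ b) (hr : ‖q - pos μ b‖ ≤ lagDist μ b) (hc : effPot μ q ≤ c) :
    (fun τ : ℝ => pos μ b + τ • (q - pos μ b)) '' Ioc 0 1 ⊆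
      connectedComponentIn (hillRegion μ c) q := by
  have hy : q - pos μ b ≠ 0 := sub_ne_zero.2 h0
  apply IsPreconnected.subset_connectedComponentIn
  · exact isPreconnected_Ioc.image _ (by fun_prop)
  · exact ⟨1, by simp, by simp⟩
  · rintro _ ⟨τ, hτ, rfl⟩
    refine mem_hillRegion.2 ⟨ray_ne_pos hy (hr.trans_lt (lagDist_lt_one h b)) hτ, ?_⟩
    refine (effPot_ray_le h b hy hr hτ).trans ?_
    simpa using hc

/-- The potential does not increase towards the primary, so the whole ray stays in the component and
converges to the primary. -/
theorem pos_mem_closure_component {μ c : ℝ} (h : μ ∈ Ioo (0 : ℝ) 1) {b : Primary} {q : E3}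
    (h0 : q ≠ pos μ b) (hr : ‖q - pos μ b‖ ≤ lagDist μ b) (hc : effPot μ q ≤ c) :
    pos μ b ∈ closure (connectedComponentIn (hillRegion μ c) q) := by
  have ht : Tendsto (fun τ : ℝ => pos μ b + τ • (q - pos μ b)) (𝓝[>] 0) (𝓝 (pos μ b)) := by
    have : Continuous (fun τ : ℝ => pos μ b + τ • (q - pos μ b)) := by fun_prop
    have := this.tendsto 0
    simp only [zero_smul, add_zero] at this
    exact this.mono_left nhdsWithin_le_nhds
  apply mem_closure_of_tendsto ht
  filter_upwards [Ioc_mem_nhdsGT (one_pos : (0 : ℝ) < 1)] with τ hτ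
  exact ray_subset_component h h0 hr hc ⟨τ, hτ, rfl⟩

theorem mem_hillRegion_of_mem_ball {μ c : ℝ} (h : μ ∈ Ioo (0 : ℝ) 1) {b : Primary} {q : E3}
    (h0 : q ≠ pos μ b) (hr : ‖q - pos μ b‖ ≤ lagDist μ b) (hc : effPot μ q ≤ c) :
    q ∈ hillRegion μ c := by
  have := ray_ne_pos (μ := μ) (b := b) (sub_ne_zero.2 h0)
    (hr.trans_lt (lagDist_lt_one h b)) (τ := 1) (by simp)
  rw [one_smul, add_sub_cancel] at this
  exact mem_hillRegion.2 ⟨this, hc⟩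

/-- Inside this ball the component condition is automatic. Hence the level equation over the ball, a
closed condition, already describes the hypersurface; this is what the compactness argument needs at
s = 1. -/
theorem mem_hillComponent_singleton {μ c : ℝ} (h : μ ∈ Ioo (0 : ℝ) 1) {b : Primary} {q : E3}
    (h0 : q ≠ pos μ b) (hr : ‖q - pos μ b‖ ≤ lagDist μ b) (hc : effPot μ q ≤ c) :
    q ∈ hillComponent μ c {b} := by
  refine ⟨mem_hillRegion_of_mem_ball h h0 hr hc, ?_⟩
  rintro b' rfl
  exact pos_mem_closure_component h h0 hr hc

/-- The open segment between the primaries. -/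
def axisSegment (μ : ℝ) : Set E3 := (fun x : ℝ => (!₂[x, 0, 0] : E3)) '' Ioo (-1 + μ) μ

theorem continuous_axis : Continuous (fun x : ℝ => (!₂[x, 0, 0] : E3)) := by
  refine (PiLp.continuous_toLp 2 _).comp (continuous_pi fun i => ?_)
  fin_cases i <;> simp <;> fun_prop

theorem axisSegment_subset {μ c : ℝ} (h : μ ∈ Ioo (0 : ℝ) 1) (hc : energyL1 μ ≤ c) :
    axisSegment μ ⊆ hillRegion μ c := by
  rintro _ ⟨x, hx, rfl⟩
  refine mem_hillRegion.2 ⟨?_, (effPot_axis_le h x hx).trans hc⟩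
  intro b e
  have := congrArg (fun v : E3 => v 0) e
  cases b <;> simp [pos] at this <;> linarith [hx.1, hx.2]

/-- From the critical value on, the open segment between the primaries lies in the Hill's region. It
is connected and adheres to both primaries, so any component that meets it qualifies for every S. -/
theorem mem_hillComponent_of_axis {μ c : ℝ} (h : μ ∈ Ioo (0 : ℝ) 1) (hc : energyL1 μ ≤ c)
    (S : Set Primary) {q x : E3} (hx : x ∈ axisSegment μ)
    (hxq : x ∈ connectedComponentIn (hillRegion μ c) q) : q ∈ hillComponent μ c S := by
  have hq : q ∈ hillRegion μ c := by
    by_contra hcon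
    rw [connectedComponentIn_eq_empty hcon] at hxq
    exact hxq
  refine ⟨hq, fun b _ => ?_⟩
  have hsub : axisSegment μ ⊆ connectedComponentIn (hillRegion μ c) q := by
    rw [connectedComponentIn_eq hxq]
    exact (isPreconnected_Ioo.image _ continuous_axis.continuousOn).subset_connectedComponentIn hx
      (axisSegment_subset h hc)
  apply closure_mono hsub
  have hcl : (fun x : ℝ => (!₂[x, 0, 0] : E3)) '' Icc (-1 + μ) μ ⊆ closure (axisSegment μ) := by
    rw [← closure_Ioo (by linarith : (-1 + μ) ≠ μ)]
    exact image_closure_subset_closure_image continuous_axis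
  apply hcl
  cases b
  · exact ⟨μ, ⟨by linarith, le_rfl⟩, rfl⟩
  · exact ⟨-1 + μ, ⟨le_rfl, by linarith⟩, rfl⟩

/-- The point is moved along its ray to a small sphere around the primary that lies in the Hill's
region. The sphere is connected and meets the segment between the primaries. -/
theorem mem_hillComponent_of_mem_ball {μ c : ℝ} (h : μ ∈ Ioo (0 : ℝ) 1) (hc0 : energyL1 μ ≤ c)
    (S : Set Primary) {b : Primary} {q : E3} (h0 : q ≠ pos μ b)
    (hr : ‖q - pos μ b‖ ≤ lagDist μ b) (hc : effPot μ q ≤ c) : q ∈ hillComponent μ c S := by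
  have hy : q - pos μ b ≠ 0 := sub_ne_zero.2 h0
  have hn : 0 < ‖q - pos μ b‖ := norm_pos_iff.2 hy
  have hm := mass_pos h b
  -- The second bound makes the attraction m/ρ at least |c| + 1, so the whole sphere of radius ρ has
  -- potential below c.
  set ρ := min ‖q - pos μ b‖ (mass μ b / (|c| + 1)) with hρ
  have hρ0 : 0 < ρ := lt_min hn (by positivity)
  have hρ1 : ρ < 1 := (min_le_left _ _).trans_lt (hr.trans_lt (lagDist_lt_one h b))
  have hlow : ∀ x ∈ Metric.sphere (pos μ b) ρ, x ∈ hillRegion μ c := by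
    intro x hx
    rw [mem_sphere_iff_norm] at hx
    have hx0 : x ≠ pos μ b := by rintro rfl; simp at hx; linarith
    refine mem_hillRegion_of_mem_ball h hx0 (by rw [hx]; exact (min_le_left _ _).trans hr) ?_
    rw [effPot_eq μ b, hx]
    have h1 : |c| + 1 ≤ mass μ b / ρ := by
      rw [le_div_iff₀ hρ0]
      have : ρ ≤ mass μ b / (|c| + 1) := min_le_right _ _
      rw [le_div_iff₀ (by positivity)] at this
      linarith
    have h2 : 0 ≤ mass μ b.other / ‖x - pos μ b.other‖ :=
      div_nonneg (mass_pos h _).le (norm_nonneg _)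
    nlinarith [neg_abs_le c, sq_nonneg (x 0), sq_nonneg (x 1)]
  have hsph : IsPreconnected (Metric.sphere (pos μ b) ρ) :=
    isPreconnected_sphere (by rw [← Module.finrank_eq_rank]; simp) _ _
  set x₁ : E3 := pos μ b + (ρ / ‖q - pos μ b‖) • (q - pos μ b) with hx₁
  have hx₁m : x₁ ∈ connectedComponentIn (hillRegion μ c) q := by
    refine ray_subset_component h h0 hr hc ⟨ρ / ‖q - pos μ b‖, ⟨by positivity, ?_⟩, rfl⟩
    exact div_le_one_of_le₀ (min_le_left _ _) hn.le
  have hx₁s : x₁ ∈ Metric.sphere (pos μ b) ρ := by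
    rw [mem_sphere_iff_norm, hx₁, add_sub_cancel_left, norm_smul,
      Real.norm_of_nonneg (by positivity), div_mul_cancel₀ _ hn.ne']
  set x₂ : E3 := !₂[pos μ b 0 + axisSign b * ρ, 0, 0] with hx₂
  have hx₂s : x₂ ∈ Metric.sphere (pos μ b) ρ := by
    rw [mem_sphere_iff_norm, ← abs_of_pos hρ0, ← abs_norm, ← sq_eq_sq_iff_abs_eq_abs, norm_sq_E3]
    simp [hx₂, pos_one, pos_two, mul_pow, axisSign_sq]
  refine mem_hillComponent_of_axis h hc0 S (x := x₂) ⟨_, ?_, rfl⟩ ?_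
  · cases b <;> simp [pos, axisSign] <;> constructor <;> linarith
  · rw [connectedComponentIn_eq hx₁m]
    exact hsph.subset_connectedComponentIn hx₁s hlow hx₂s

/-- The point is pushed perpendicularly onto the axis. Both distances to the primaries are less than
1 and shrink, so both values of `phi` grow, while the height shrinks too; hence the potential does
not increase and the path stays in the Hill's region. -/
theorem mem_hillComponent_of_mem_neck {μ c a : ℝ} (h : μ ∈ Ioo (0 : ℝ) 1)
    (hc0 : energyL1 μ ≤ c) (S : Set Primary) (ha : ∀ b, a < lagDist μ b) {q : E3}
    (hq : ‖q - lagPos μ‖ ≤ a) (hc : effPot μ q ≤ c) : q ∈ hillComponent μ c S := by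
  have hx : |q 0 - lagX μ| ≤ a := by
    refine le_trans ?_ hq
    apply abs_le_of_sq_le_sq _ (norm_nonneg _)
    rw [norm_sq_E3]
    simp only [lagPos, PiLp.sub_apply, Matrix.cons_val, sub_zero]
    nlinarith [sq_nonneg (q 1), sq_nonneg (q 2)]
  rw [abs_le] at hx
  have haE := ha .earth
  have haM := ha .moon
  simp only [lagDist] at haE haM
  have hd1 : ∀ b, ‖q - pos μ b‖ < 1 := by
    intro b
    have h1 := norm_sub_le_norm_sub_add_norm_sub q (lagPos μ) (pos μ b)
    have h2 := ha b.other
    rw [lagDist_other] at h2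
    rw [norm_lagPos_sub_pos h] at h1
    linarith
  have hne : ∀ (v w : ℝ) b, (!₂[q 0, v, w] : E3) ≠ pos μ b := by
    intro v w b e
    have := congrArg (fun v : E3 => v 0) e
    cases b <;> simp [pos] at this <;> linarith
  set path : ℝ → E3 := fun τ => !₂[q 0, τ * q 1, τ * q 2] with hpath
  have hcont : Continuous path := by
    refine (PiLp.continuous_toLp 2 _).comp (continuous_pi fun i => ?_)
    fin_cases i <;> simp <;> fun_prop
  have hmem : path '' Icc 0 1 ⊆ hillRegion μ c := by
    rintro _ ⟨τ, hτ, rfl⟩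
    refine mem_hillRegion.2 ⟨hne _ _, le_trans ?_ hc⟩
    have hdle : ∀ b, ‖path τ - pos μ b‖ ≤ ‖q - pos μ b‖ := by
      intro b
      apply le_of_sq_le_sq _ (norm_nonneg _)
      rw [norm_sq_E3, norm_sq_E3]
      simp only [hpath, PiLp.sub_apply, pos_one, pos_two, sub_zero, Matrix.cons_val]
      have : τ ^ 2 ≤ 1 := by nlinarith [hτ.1, hτ.2]
      nlinarith [mul_le_mul_of_nonneg_right this (sq_nonneg (q 1)),
        mul_le_mul_of_nonneg_right this (sq_nonneg (q 2))]
    have hph : ∀ b, phi ‖q - pos μ b‖ ≤ phi ‖path τ - pos μ b‖ := fun b =>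
      phi_le (norm_sub_pos_pos (hne _ _ b)) ((hdle b).trans_lt (hd1 b)) (hdle b)
        (by linarith [hd1 b, hdle b])
    rw [effPot_eq_phi μ .earth, effPot_eq_phi μ .earth q]
    have a1 := mul_le_mul_of_nonneg_left (hph .earth) (mass_pos h .earth).le
    have a2 := mul_le_mul_of_nonneg_left (hph (Primary.other .earth))
      (mass_pos h (Primary.other .earth)).le
    have a3 : (path τ) 2 ^ 2 ≤ q 2 ^ 2 := by
      simp only [hpath, Matrix.cons_val]
      have : τ ^ 2 ≤ 1 := by nlinarith [hτ.1, hτ.2]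
      nlinarith [mul_le_mul_of_nonneg_right this (sq_nonneg (q 2))]
    linarith
  have hq1 : path 1 = q := by
    ext i; fin_cases i <;> simp [hpath]
  refine mem_hillComponent_of_axis h hc0 S (x := path 0) ⟨q 0, ⟨by linarith, by linarith⟩, ?_⟩ ?_
  · simp [hpath]
  · exact (isPreconnected_Icc.image _ hcont.continuousOn).subset_connectedComponentIn
      ⟨1, by simp, hq1⟩ hmem ⟨0, by simp, rfl⟩

/-! ### Algebra of the Moser charts -/

@[simp] theorem vec_zero (ξ : E4) : vec ξ 0 = ξ 1 := rfl
@[simp] theorem vec_one (ξ : E4) : vec ξ 1 = ξ 2 := rfl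
@[simp] theorem vec_two (ξ : E4) : vec ξ 2 = ξ 3 := rfl
@[simp] theorem mk4_zero (a : ℝ) (v : E3) : mk4 a v 0 = a := rfl
@[simp] theorem mk4_one (a : ℝ) (v : E3) : mk4 a v 1 = v 0 := rfl
@[simp] theorem mk4_two (a : ℝ) (v : E3) : mk4 a v 2 = v 1 := rfl
@[simp] theorem mk4_three (a : ℝ) (v : E3) : mk4 a v 3 = v 2 := rfl

theorem ext_E4 {v w : E4} (h0 : v 0 = w 0) (h1 : v 1 = w 1) (h2 : v 2 = w 2) (h3 : v 3 = w 3) :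
    v = w := by
  ext i; fin_cases i <;> assumption

theorem ext_E3 {v w : E3} (h0 : v 0 = w 0) (h1 : v 1 = w 1) (h2 : v 2 = w 2) : v = w := by
  ext i; fin_cases i <;> assumption

/-- The points of `T*S³`. -/
def OnTS (z : E4 × E4) : Prop := ‖z.1‖ ^ 2 = 1 ∧ inner ℝ z.1 z.2 = 0

/-- The position `y = q - P` in a Moser chart. -/
noncomputable def chartY (z : E4 × E4) : E3 := (1 - z.1 0) • vec z.2 + z.2 0 • vec z.1

/-- The variable `x = -p` in a Moser chart. -/
noncomputable def chartX (z : E4 × E4) : E3 := (1 - z.1 0)⁻¹ • vec z.1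

theorem chartY_apply_zero (z : E4 × E4) :
    chartY z 0 = (1 - z.1 0) * z.2 1 + z.2 0 * z.1 1 := by simp [chartY]
theorem chartY_apply_one (z : E4 × E4) :
    chartY z 1 = (1 - z.1 0) * z.2 2 + z.2 0 * z.1 2 := by simp [chartY]
theorem chartY_apply_two (z : E4 × E4) :
    chartY z 2 = (1 - z.1 0) * z.2 3 + z.2 0 * z.1 3 := by simp [chartY]

/-- Uses |ξ| = 1 and ⟨ξ, η⟩ = 0. For η ≠ 0 the position reaches the primary exactly over the north
pole, and on bounded positions a large |η| forces ξ₀ close to 1. -/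
theorem norm_chartY {z : E4 × E4} (hz : OnTS z) : ‖chartY z‖ = (1 - z.1 0) * ‖z.2‖ := by
  obtain ⟨h1, h2⟩ := hz
  rw [norm_sq_E4] at h1
  rw [inner_E4] at h2
  have h3 : z.1 0 ≤ 1 := by
    nlinarith [sq_nonneg (z.1 1), sq_nonneg (z.1 2), sq_nonneg (z.1 3)]
  have h4 : 0 ≤ (1 - z.1 0) * ‖z.2‖ := mul_nonneg (by linarith) (norm_nonneg _)
  rw [← abs_of_nonneg h4, ← abs_norm, ← sq_eq_sq_iff_abs_eq_abs, norm_sq_E3, mul_pow, norm_sq_E4,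
    chartY_apply_zero, chartY_apply_one, chartY_apply_two]
  have h5 : z.1 1 * z.2 1 + z.1 2 * z.2 2 + z.1 3 * z.2 3 = -(z.1 0 * z.2 0) := by linarith
  have h6 : z.1 1 ^ 2 + z.1 2 ^ 2 + z.1 3 ^ 2 = 1 - z.1 0 ^ 2 := by linarith
  linear_combination (2 * (1 - z.1 0) * z.2 0) * h5 + (z.2 0) ^ 2 * h6

theorem moserMap_fst_zero (μ : ℝ) (b : Primary) (q p : E3) :
    1 - (moserMap μ b q p).1 0 = 2 / (‖p‖ ^ 2 + 1) := by
  have : 0 < ‖p‖ ^ 2 + 1 := by positivity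
  simp [moserMap]
  field_simp
  ring

theorem moserMap_fst_zero_lt (μ : ℝ) (b : Primary) (q p : E3) :
    0 < 1 - (moserMap μ b q p).1 0 := by
  rw [moserMap_fst_zero]; positivity

theorem onTS_moserMap (μ : ℝ) (b : Primary) (q p : E3) : OnTS (moserMap μ b q p) := by
  have h0 : 0 < ‖p‖ ^ 2 + 1 := by positivity
  constructor
  · rw [norm_sq_E4]
    simp only [moserMap, norm_neg, mk4_zero, mk4_one, mk4_two, mk4_three, PiLp.smul_apply,
      PiLp.neg_apply, smul_eq_mul]
    have h := norm_sq_E3 p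
    field_simp
    linear_combination (-4 : ℝ) * h
  · rw [inner_E4]
    simp only [moserMap, norm_neg, mk4_zero, mk4_one, mk4_two, mk4_three, PiLp.smul_apply,
      PiLp.neg_apply, smul_eq_mul, PiLp.sub_apply, inner_E3]
    have h := norm_sq_E3 p
    generalize ‖p‖ ^ 2 = n at *
    field_simp
    rw [h]
    ring

theorem chartY_moserMap (μ : ℝ) (b : Primary) (q p : E3) :
    chartY (moserMap μ b q p) = q - pos μ b := by
  have h0 : 0 < ‖p‖ ^ 2 + 1 := by positivity
  apply ext_E3
  all_goals
    simp only [chartY_apply_zero, chartY_apply_one, chartY_apply_two, moserMap_fst_zero]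
    simp only [moserMap, norm_neg, mk4_zero, mk4_one, mk4_two, mk4_three, PiLp.smul_apply,
      PiLp.neg_apply, smul_eq_mul, PiLp.sub_apply]
    field_simp
    ring

theorem chartX_moserMap (μ : ℝ) (b : Primary) (q p : E3) :
    chartX (moserMap μ b q p) = -p := by
  have h0 : 0 < ‖p‖ ^ 2 + 1 := by positivity
  rw [chartX, moserMap_fst_zero]
  apply ext_E3 <;> simp [moserMap] <;> field_simp

theorem norm_moserMap_snd (μ : ℝ) (b : Primary) (q p : E3) :
    ‖(moserMap μ b q p).2‖ = (‖p‖ ^ 2 + 1) / 2 * ‖q - pos μ b‖ := by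
  have h := norm_chartY (onTS_moserMap μ b q p)
  rw [chartY_moserMap, moserMap_fst_zero] at h
  have h0 : 0 < ‖p‖ ^ 2 + 1 := by positivity
  rw [h]; field_simp

theorem moserF_eq (μ c : ℝ) (b : Primary) (z : E4 × E4) :
    moserF μ c b z = 1 - mass μ b.other * (1 - z.1 0) / ‖chartY z + pos μ b - pos μ b.other‖
      + (z.1 2 * chartY z 0 - z.1 1 * chartY z 1) + z.1 2 * pos μ b 0
      - (c + 1 / 2) * (1 - z.1 0) := by
  rw [moserF, chartY_apply_zero, chartY_apply_one, chartY]
  ring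

/-- The regularized Hamiltonian in terms of the original one. -/
theorem norm_mul_moserF (μ c : ℝ) (b : Primary) {q p : E3} (hq : q ≠ pos μ b) :
    ‖(moserMap μ b q p).2‖ * moserF μ c b (moserMap μ b q p) =
      ‖q - pos μ b‖ * (jacobi μ (q, p) - c) + mass μ b := by
  have h0 : 0 < ‖p‖ ^ 2 + 1 := by positivity
  have h1 := norm_sub_pos_pos hq
  rw [moserF_eq, chartY_moserMap, moserMap_fst_zero, norm_moserMap_snd, jacobi_eq,
    effPot_eq μ b, sub_add_cancel]
  simp only [moserMap, norm_neg, mk4_one, mk4_two, PiLp.smul_apply,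
      PiLp.neg_apply, smul_eq_mul, PiLp.sub_apply, pos_one, sub_zero]
  have h := norm_sq_E3 p
  generalize ‖p‖ ^ 2 = n at *
  rw [show mass μ b.other / ‖q - pos μ b.other‖ = mass μ b.other * ‖q - pos μ b.other‖⁻¹ by
    rw [div_eq_mul_inv], mul_div_assoc, div_eq_mul_inv (2 / (n + 1))]
  generalize ‖q - pos μ b.other‖⁻¹ = D at *
  field_simp
  rw [h]
  ring

/-- `chartX` and `chartY` invert the Moser map, which therefore covers the part of T*S³ off the
fibre over the north pole; that fibre is treated in `eq_collision_of_fst_eq_one`. -/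
theorem moserMap_chart (μ : ℝ) (b : Primary) {z : E4 × E4} (hz : OnTS z) (h1 : z.1 0 < 1) :
    moserMap μ b (chartY z + pos μ b) (-chartX z) = z := by
  obtain ⟨hz1, hz2⟩ := hz
  rw [norm_sq_E4] at hz1
  rw [inner_E4] at hz2
  have h0 : 0 < 1 - z.1 0 := by linarith
  have hne := h0.ne'
  have hX : ‖chartX z‖ ^ 2 = (1 + z.1 0) / (1 - z.1 0) := by
    rw [norm_sq_E3]
    simp [chartX]
    field_simp
    linear_combination hz1
  have hX1 : ‖chartX z‖ ^ 2 + 1 = 2 / (1 - z.1 0) := by rw [hX]; field_simp; ring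
  have hX2 : ‖chartX z‖ ^ 2 - 1 = 2 * z.1 0 / (1 - z.1 0) := by rw [hX]; field_simp; ring
  have hin : inner ℝ (chartX z) (chartY z) = z.2 0 := by
    rw [inner_E3, chartY_apply_zero, chartY_apply_one, chartY_apply_two]
    simp [chartX]
    field_simp
    linear_combination (1 - z.1 0) * hz2 + z.2 0 * hz1
  simp only [moserMap, neg_neg, add_sub_cancel_right, hX1, hX2, hin]
  refine Prod.ext (ext_E4 ?_ ?_ ?_ ?_) (ext_E4 ?_ ?_ ?_ ?_)
  · simp; field_simp
  · simp [chartX]; field_simp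
  · simp [chartX]; field_simp
  · simp [chartX]; field_simp
  · simp
  · simp [chartX, chartY]; field_simp; ring
  · simp [chartX, chartY]; field_simp; ring
  · simp [chartX, chartY]; field_simp; ring

theorem eq_collision_of_fst_eq_one {z : E4 × E4} (hz : OnTS z) (h1 : z.1 0 = 1) :
    z = (mk4 1 0, mk4 0 (vec z.2)) := by
  obtain ⟨hz1, hz2⟩ := hz
  rw [norm_sq_E4, h1] at hz1
  rw [inner_E4, h1] at hz2
  have a1 : z.1 1 = 0 := by nlinarith [sq_nonneg (z.1 1), sq_nonneg (z.1 2), sq_nonneg (z.1 3)]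
  have a2 : z.1 2 = 0 := by nlinarith [sq_nonneg (z.1 1), sq_nonneg (z.1 2), sq_nonneg (z.1 3)]
  have a3 : z.1 3 = 0 := by nlinarith [sq_nonneg (z.1 1), sq_nonneg (z.1 2), sq_nonneg (z.1 3)]
  rw [a1, a2, a3] at hz2
  refine Prod.ext (ext_E4 ?_ ?_ ?_ ?_) (ext_E4 ?_ ?_ ?_ ?_) <;> simp [*]
  linarith

theorem onTS_moserChart (μ : ℝ) (b : Primary) (x : RegPoint) : OnTS (moserChart μ b x) := by
  cases x with
  | regular q p => exact onTS_moserMap μ b q p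
  | collision b' v =>
    constructor
    · rw [norm_sq_E4]; simp [moserChart]
    · rw [inner_E4]; simp [moserChart]

theorem OnTS.fst_zero_le {z : E4 × E4} (hz : OnTS z) : z.1 0 ≤ 1 := by
  have h1 := hz.1
  rw [norm_sq_E4] at h1
  nlinarith [sq_nonneg (z.1 1), sq_nonneg (z.1 2), sq_nonneg (z.1 3)]

theorem moserChart_regular_lt (μ : ℝ) (b : Primary) (q p : E3) :
    (moserChart μ b (.regular q p)).1 0 < 1 := by
  have := moserMap_fst_zero_lt μ b q p
  simp only [moserChart]; linarith

/-- The position of a regularized point. -/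
def RegPoint.position (μ : ℝ) : RegPoint → E3
  | .regular q _ => q
  | .collision b _ => pos μ b

theorem chartY_moserChart {μ : ℝ} {b : Primary} {x : RegPoint} (hx : x.InChart b) :
    chartY (moserChart μ b x) + pos μ b = x.position μ := by
  cases x with
  | regular q p => simp [moserChart, chartY_moserMap, RegPoint.position]
  | collision b' v =>
    obtain rfl : b' = b := hx
    have : chartY (moserChart μ b' (.collision b' v)) = 0 := by
      apply ext_E3 <;> simp [chartY, moserChart]
    rw [this, zero_add, RegPoint.position]

theorem moserF_collision (μ c : ℝ) (b : Primary) (v : E3) :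
    moserF μ c b (mk4 1 0, mk4 0 v) = 1 := by simp [moserF]

/-- On the regularized hypersurface `|η| f = m`. -/
theorem norm_mul_moserF_eq {μ c : ℝ} {S : Set Primary} {b : Primary} {x : RegPoint}
    (hm : 0 < mass μ b) (hx : x ∈ regSurface μ c S) (hxb : x.InChart b) :
    ‖(moserChart μ b x).2‖ * moserF μ c b (moserChart μ b x) = mass μ b := by
  cases x with
  | regular q p =>
    obtain ⟨⟨h1, h2⟩, -⟩ := hx
    simp only [moserChart]
    rw [norm_mul_moserF μ c b (h1 b), h2]; ring
  | collision b' v =>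
    obtain rfl : b' = b := hxb
    obtain ⟨-, h2⟩ := hx
    simp only [moserChart, moserQ, moserF_collision] at h2 ⊢
    rw [mul_one, ← sq_eq_sq₀ (norm_nonneg _) hm.le]
    linarith

/-- A point of `T*S³` on the level `|η| f = m` is a point of the regularized hypersurface if its
position belongs to the right component. -/
theorem mem_chartSurface {μ c : ℝ} {S : Set Primary} {b : Primary} (hb : b ∈ S) {z : E4 × E4}
    (hz : OnTS z) (hf : ‖z.2‖ * moserF μ c b z = mass μ b) (hm : 0 < mass μ b)
    (hother : chartY z + pos μ b ≠ pos μ b.other)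
    (hq : chartY z + pos μ b ≠ pos μ b → effPot μ (chartY z + pos μ b) ≤ c →
      chartY z + pos μ b ∈ hillComponent μ c S) : z ∈ chartSurface μ c S b := by
  rcases hz.fst_zero_le.lt_or_eq with h1 | h1
  · set q := chartY z + pos μ b with hqdef
    have hmap := moserMap_chart μ b hz h1
    rw [← hqdef] at hmap
    have hz2 : z.2 ≠ 0 := by
      intro e; rw [e, norm_zero, zero_mul] at hf; linarith
    have hqne : q ≠ pos μ b := by
      intro e
      have h2 : chartY z = 0 := by simpa [hqdef] using e
      have h3 := norm_chartY hz
      rw [h2, norm_zero] at h3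
      have : 0 < (1 - z.1 0) * ‖z.2‖ := mul_pos (by linarith) (norm_pos_iff.2 hz2)
      linarith
    have hne : ∀ b', q ≠ pos μ b' := by
      intro b'
      have hb : b' = b ∨ b' = b.other := by cases b <;> cases b' <;> simp [Primary.other]
      rcases hb with rfl | rfl
      · exact hqne
      · exact hother
    have hE : jacobi μ (q, -chartX z) = c := by
      have := norm_mul_moserF μ c b (p := -chartX z) hqne
      rw [hmap, hf] at this
      have hn := norm_sub_pos_pos hqne
      have : ‖q - pos μ b‖ * (jacobi μ (q, -chartX z) - c) = 0 := by linarith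
      rcases mul_eq_zero.1 this with h | h
      · linarith
      · linarith
    exact ⟨.regular q (-chartX z), ⟨⟨⟨hne, hE⟩, hq hqne (effPot_le_of_mem hE)⟩, trivial⟩, hmap⟩
  · have e := eq_collision_of_fst_eq_one hz h1
    refine ⟨.collision b (vec z.2), ⟨⟨hb, ?_⟩, rfl⟩, e.symm⟩
    rw [← e, moserQ, ← hf]; ring

/-! ### Compactness of families of regularized hypersurfaces -/

@[fun_prop]
theorem continuous_pos (b : Primary) : Continuous (fun μ : ℝ => pos μ b) := by
  cases b <;>
  · refine (PiLp.continuous_toLp 2 _).comp (continuous_pi fun i => ?_)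
    fin_cases i <;> simp <;> fun_prop

@[fun_prop]
theorem continuous_mass (b : Primary) : Continuous (fun μ : ℝ => mass μ b) := by
  cases b <;> simp only [mass] <;> fun_prop

@[fun_prop]
theorem continuous_vec : Continuous vec := by
  refine (PiLp.continuous_toLp 2 _).comp (continuous_pi fun i => ?_)
  fin_cases i <;> simp <;> fun_prop

@[fun_prop]
theorem continuous_chartY : Continuous chartY := by
  unfold chartY; fun_prop

/-- The points of the charts at `b`, for the parameters `(μ, c) ∈ P`, that lie on the level
`|η| f = m` over the set `D` of positions. -/
def chartFamily (b : Primary) (P : Set (ℝ × ℝ)) (D : Set E3) : Set ((ℝ × ℝ) × (E4 × E4)) :=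
  {x | x.1 ∈ P ∧ OnTS x.2 ∧ chartY x.2 + pos x.1.1 b ∈ D ∧
    ‖x.2.2‖ * moserF x.1.1 x.1.2 b x.2 = mass x.1.1 b}

theorem continuousOn_moserF (b : Primary) : ContinuousOn
    (fun x : (ℝ × ℝ) × (E4 × E4) => moserF x.1.1 x.1.2 b x.2)
    {x | chartY x.2 + pos x.1.1 b ≠ pos x.1.1 b.other} := by
  intro x hx
  simp only [moserF_eq]
  have h : ‖chartY x.2 + pos x.1.1 b - pos x.1.1 b.other‖ ≠ 0 :=
    norm_ne_zero_iff.2 (sub_ne_zero.2 hx)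
  apply ContinuousAt.continuousWithinAt
  have hp : Continuous (fun x : (ℝ × ℝ) × (E4 × E4) => pos x.1.1 b 0) := by fun_prop
  fun_prop (disch := assumption)

theorem OnTS.sq_le {z : E4 × E4} (hz : OnTS z) :
    z.1 1 ^ 2 ≤ 2 * (1 - z.1 0) ∧ z.1 2 ^ 2 ≤ 2 * (1 - z.1 0) := by
  have h1 := hz.1
  have h0 := hz.fst_zero_le
  rw [norm_sq_E4] at h1
  constructor <;>
  nlinarith [sq_nonneg (z.1 1), sq_nonneg (z.1 2), sq_nonneg (z.1 3), sq_nonneg (1 - z.1 0)]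

/-- If N = |η| is large, then 1 - ξ₀ = |y|/N and ξ₁, ξ₂ are small. The part of f without the factor
1 - ξ₀ is then at least 1/2, while N times the rest is |y| times a bounded quantity; so |η| f = m
bounds N. -/
theorem norm_snd_le_of_level {μ c δ R : ℝ} {b : Primary} {z : E4 × E4} (hz : OnTS z)
    (hf : ‖z.2‖ * moserF μ c b z = mass μ b) (hδ : 0 < δ) (hR : 1 ≤ R)
    (hd : δ ≤ ‖chartY z + pos μ b - pos μ b.other‖) (hq : ‖chartY z + pos μ b‖ ≤ R)
    (hy : ‖chartY z‖ ≤ R) (hm : |mass μ b| ≤ R) (hm' : |mass μ b.other| ≤ R) (hc : |c| ≤ R) :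
    ‖z.2‖ ≤ 32 * R ^ 3 + 2 * (R + R * (R / δ + R + 1)) := by
  by_contra hcon
  push Not at hcon
  have hR0 : 0 < R := by linarith
  have hC : 0 ≤ R * (R / δ + R + 1) := by positivity
  set N := ‖z.2‖ with hN
  have hN1 : 32 * R ^ 3 < N := by nlinarith
  have hN0 : 0 < N := lt_trans (by positivity) hN1
  have hyN := norm_chartY hz
  rw [← hN] at hyN
  have h0 := hz.fst_zero_le
  have hxi : ∀ w : ℝ, w ^ 2 ≤ 2 * (1 - z.1 0) → |w| ≤ 1 / (4 * R) := by
    intro w hw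
    apply abs_le_of_sq_le_sq _ (by positivity)
    have h1 : (1 - z.1 0) * N ≤ R := by rw [← hyN]; exact hy
    have h2 : (1 - z.1 0) ≤ R / N := by rw [le_div_iff₀ hN0]; exact h1
    have h3 : R / N ≤ R / (32 * R ^ 3) := by gcongr
    have h4 : R / (32 * R ^ 3) = (1 / (4 * R)) ^ 2 / 2 := by field_simp; norm_num
    linarith
  have hx1 := hxi _ hz.sq_le.1
  have hx2 := hxi _ hz.sq_le.2
  have hcoord : ∀ i, |(chartY z + pos μ b) i| ≤ R := fun i =>
    (PiLp.norm_apply_le (chartY z + pos μ b) i).trans hq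
  have hprod : ∀ (w : ℝ) i, |w| ≤ 1 / (4 * R) → |w * (chartY z + pos μ b) i| ≤ 1 / 4 := by
    intro w i hw
    rw [abs_mul]
    calc |w| * |(chartY z + pos μ b) i| ≤ 1 / (4 * R) * R := by gcongr; exact hcoord i
      _ = 1 / 4 := by field_simp
  have a1 := hprod _ 1 hx1
  have a2 := hprod _ 0 hx2
  simp only [PiLp.add_apply, pos_one, add_zero] at a1 a2
  rw [moserF_eq] at hf
  set d := ‖chartY z + pos μ b - pos μ b.other‖ with hdd
  have hd0 : 0 < d := hδ.trans_le hd
  -- The level equation with the terms containing 1 - ξ₀ moved to the right. The threshold 32R³ was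
  -- chosen so that |ξ₁|, |ξ₂| ≤ 1/(4R), which makes the bracket at least 1/2.
  have e1 : N * (1 + z.1 2 * (chartY z 0 + pos μ b 0) - z.1 1 * chartY z 1) =
      mass μ b + ((1 - z.1 0) * N) * (mass μ b.other / d + (c + 1 / 2)) := by
    rw [← hf]; ring
  rw [← hyN] at e1
  have e2 : N / 2 ≤ N * (1 + z.1 2 * (chartY z 0 + pos μ b 0) - z.1 1 * chartY z 1) := by
    have : 1 / 2 ≤ 1 + z.1 2 * (chartY z 0 + pos μ b 0) - z.1 1 * chartY z 1 := by
      linarith [(abs_le.1 a1).2, (abs_le.1 a2).1]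
    nlinarith
  have e3 : mass μ b.other / d + (c + 1 / 2) ≤ R / δ + R + 1 := by
    have : mass μ b.other / d ≤ R / δ := by
      calc mass μ b.other / d ≤ R / d := by gcongr; exact (le_abs_self _).trans hm'
        _ ≤ R / δ := by gcongr
    linarith [le_abs_self c]
  have e4 : ‖chartY z‖ * (mass μ b.other / d + (c + 1 / 2)) ≤ R * (R / δ + R + 1) := by
    calc _ ≤ ‖chartY z‖ * (R / δ + R + 1) := by gcongr
      _ ≤ _ := by gcongr
  have := le_abs_self (mass μ b)
  have h32 : 0 < R ^ 3 := by positivity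
  linarith

/-- Positions in D stay away from the other primary, so f is continuous there and the set is closed;
the momentum bound above makes it bounded. Collisions with b are allowed in D: this is where
regularization is used. -/
theorem isCompact_chartFamily (b : Primary) {P : Set (ℝ × ℝ)} {D : Set E3} (hP : IsCompact P)
    (hD : IsCompact D) (hPD : ∀ x ∈ P, pos x.1 b.other ∉ D) :
    IsCompact (chartFamily b P D) := by
  obtain ⟨δ, hδ, hδd⟩ := (hP.prod hD).exists_forall_le' (a := 0)
    (f := fun x : (ℝ × ℝ) × E3 => ‖x.2 - pos x.1.1 b.other‖) (by fun_prop) (by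
      rintro ⟨x, q⟩ ⟨hx, hq⟩
      refine norm_pos_iff.2 (sub_ne_zero.2 fun e : q = pos x.1 b.other => ?_)
      exact hPD x hx (e ▸ hq))
  obtain ⟨R₁, hR₁⟩ := hD.exists_bound_of_continuousOn (f := fun q : E3 => q) (by fun_prop)
  obtain ⟨R₂, hR₂⟩ := (hP.prod hD).exists_bound_of_continuousOn
    (f := fun x : (ℝ × ℝ) × E3 => x.2 - pos x.1.1 b) (by fun_prop)
  obtain ⟨R₃, hR₃⟩ := hP.exists_bound_of_continuousOn (f := fun x => mass x.1 b) (by fun_prop)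
  obtain ⟨R₄, hR₄⟩ := hP.exists_bound_of_continuousOn (f := fun x => mass x.1 b.other)
    (by fun_prop)
  obtain ⟨R₅, hR₅⟩ := hP.exists_bound_of_continuousOn (f := fun x => x.2) (by fun_prop)
  set R := 1 + |R₁| + |R₂| + |R₃| + |R₄| + |R₅| with hR
  have b1 := abs_nonneg R₁
  have b2 := abs_nonneg R₂
  have b3 := abs_nonneg R₃
  have b4 := abs_nonneg R₄
  have b5 := abs_nonneg R₅
  have c1 := le_abs_self R₁
  have c2 := le_abs_self R₂
  have c3 := le_abs_self R₃
  have c4 := le_abs_self R₄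
  have c5 := le_abs_self R₅
  have hbig : IsCompact (P ×ˢ (Metric.closedBall (0 : E4) 1 ×ˢ
      Metric.closedBall (0 : E4) (32 * R ^ 3 + 2 * (R + R * (R / δ + R + 1))))) :=
    hP.prod ((isCompact_closedBall _ _).prod (isCompact_closedBall _ _))
  refine hbig.of_isClosed_subset ?_ ?_
  · have hC : IsClosed {x : (ℝ × ℝ) × (E4 × E4) | x.1 ∈ P ∧ OnTS x.2 ∧
        chartY x.2 + pos x.1.1 b ∈ D} := by
      refine (hP.isClosed.preimage continuous_fst).inter (IsClosed.inter ?_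
        (hD.isClosed.preimage (by fun_prop)))
      exact IsClosed.inter (isClosed_eq (by fun_prop) continuous_const)
        (isClosed_eq (by fun_prop) continuous_const)
    have hcont : ContinuousOn (fun x : (ℝ × ℝ) × (E4 × E4) =>
        ‖x.2.2‖ * moserF x.1.1 x.1.2 b x.2 - mass x.1.1 b) {x | x.1 ∈ P ∧ OnTS x.2 ∧
        chartY x.2 + pos x.1.1 b ∈ D} := by
      refine ContinuousOn.sub (ContinuousOn.mul (by fun_prop) ?_) (by fun_prop)
      refine (continuousOn_moserF b).mono ?_
      rintro x ⟨hx1, -, hx3⟩ e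
      exact hPD x.1 hx1 (e ▸ hx3)
    have := hcont.preimage_isClosed_of_isClosed hC (isClosed_singleton (x := (0 : ℝ)))
    convert this using 1
    ext x
    simp only [chartFamily, mem_ofPred_eq, mem_inter_iff, mem_preimage, mem_singleton_iff,
      sub_eq_zero, and_assoc]
  · rintro ⟨x, z⟩ ⟨hx, hz, hq, hf⟩
    refine ⟨hx, ?_, ?_⟩
    · have := hz.1
      rw [mem_closedBall_zero_iff]
      nlinarith [norm_nonneg z.1]
    · rw [mem_closedBall_zero_iff]
      refine norm_snd_le_of_level hz hf hδ (by linarith) (hδd (x, _) ⟨hx, hq⟩) ?_ ?_ ?_ ?_ ?_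
      · have := hR₁ _ hq; simp only at this ⊢; linarith
      · have := hR₂ (x, _) ⟨hx, hq⟩
        simp only [add_sub_cancel_right] at this; linarith
      · have := hR₃ _ hx; simp only [Real.norm_eq_abs] at this; linarith
      · have := hR₄ _ hx; simp only [Real.norm_eq_abs] at this; linarith
      · have := hR₅ _ hx; simp only [Real.norm_eq_abs] at this; linarith

/-! ### The regularized vector field -/

theorem hasDerivAt_E3 {f : ℝ → E3} {f' : E3} {t : ℝ}
    (h : ∀ i, HasDerivAt (fun t => f t i) (f' i) t) : HasDerivAt f f' t := by
  have H := ((PiLp.continuousLinearEquiv 2 ℝ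
    (fun _ : Fin 3 => ℝ)).symm.toContinuousLinearMap.hasFDerivAt
    (x := fun i => f t i)).comp_hasDerivAt t (hasDerivAt_pi.2 h)
  exact H

theorem hasDerivAt_E4 {f : ℝ → E4} {f' : E4} {t : ℝ}
    (h : ∀ i, HasDerivAt (fun t => f t i) (f' i) t) : HasDerivAt f f' t := by
  have H := ((PiLp.continuousLinearEquiv 2 ℝ
    (fun _ : Fin 4 => ℝ)).symm.toContinuousLinearMap.hasFDerivAt
    (x := fun i => f t i)).comp_hasDerivAt t (hasDerivAt_pi.2 h)
  exact H

theorem HasDerivAt.E3_apply {f : ℝ → E3} {f' : E3} {t : ℝ} (h : HasDerivAt f f' t) (i : Fin 3) :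
    HasDerivAt (fun t => f t i) (f' i) t :=
  (EuclideanSpace.proj i : E3 →L[ℝ] ℝ).hasFDerivAt.comp_hasDerivAt t h

theorem HasDerivAt.E4_apply {f : ℝ → E4} {f' : E4} {t : ℝ} (h : HasDerivAt f f' t) (i : Fin 4) :
    HasDerivAt (fun t => f t i) (f' i) t :=
  (EuclideanSpace.proj i : E4 →L[ℝ] ℝ).hasFDerivAt.comp_hasDerivAt t h

theorem contDiff_E3 {E : Type*} [NormedAddCommGroup E] [NormedSpace ℝ E] {f : E → E3}
    (h : ∀ i, ContDiff ℝ ∞ (fun x => f x i)) : ContDiff ℝ ∞ f :=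
  contDiff_euclidean.2 h

@[fun_prop]
theorem contDiff_vec : ContDiff ℝ ∞ vec := by
  apply contDiff_E3
  intro i
  fin_cases i <;> simp [vec] <;> fun_prop

@[fun_prop]
theorem contDiff_chartY : ContDiff ℝ ∞ chartY := by
  unfold chartY; fun_prop

/-- The derivative of the chart function `y`. -/
noncomputable def chartYDeriv (z V : E4 × E4) : E3 :=
  (1 - z.1 0) • vec V.2 - V.1 0 • vec z.2 + z.2 0 • vec V.1 + V.2 0 • vec z.1

theorem hasDerivAt_chartY {z : ℝ → E4 × E4} {z' : E4 × E4} {t : ℝ} (h : HasDerivAt z z' t) :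
    HasDerivAt (fun t => chartY (z t)) (chartYDeriv (z t) z') t := by
  have h1 := fun i => HasDerivAt.E4_apply h.fst i
  have h2 := fun i => HasDerivAt.E4_apply h.snd i
  apply hasDerivAt_E3
  intro i
  fin_cases i
  · refine ((((h1 0).const_sub 1).mul (h2 1)).add ((h2 0).mul (h1 1))).congr_deriv ?_ |>.congr_of_eventuallyEq ?_
    · simp [chartYDeriv]; ring
    · exact Eventually.of_forall fun t => by simp [chartY]
  · refine ((((h1 0).const_sub 1).mul (h2 2)).add ((h2 0).mul (h1 2))).congr_deriv ?_ |>.congr_of_eventuallyEq ?_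
    · simp [chartYDeriv]; ring
    · exact Eventually.of_forall fun t => by simp [chartY]
  · refine ((((h1 0).const_sub 1).mul (h2 3)).add ((h2 0).mul (h1 3))).congr_deriv ?_ |>.congr_of_eventuallyEq ?_
    · simp [chartYDeriv]; ring
    · exact Eventually.of_forall fun t => by simp [chartY]

/-- The derivative of the chart function `x`. -/
noncomputable def chartXDeriv (z V : E4 × E4) : E3 :=
  (1 - z.1 0)⁻¹ • vec V.1 + ((1 - z.1 0)⁻¹ ^ 2 * V.1 0) • vec z.1

theorem hasDerivAt_chartX {z : ℝ → E4 × E4} {z' : E4 × E4} {t : ℝ} (h : HasDerivAt z z' t)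
    (h0 : (z t).1 0 < 1) :
    HasDerivAt (fun t => chartX (z t)) (chartXDeriv (z t) z') t := by
  have h1 := fun i => HasDerivAt.E4_apply h.fst i
  have hne : 1 - (z t).1 0 ≠ 0 := by linarith
  have hinv := ((h1 0).const_sub 1).inv hne
  apply hasDerivAt_E3
  intro i
  fin_cases i
  · refine (hinv.mul (h1 1)).congr_deriv ?_ |>.congr_of_eventuallyEq ?_
    · simp [chartXDeriv]; field_simp; ring
    · exact Eventually.of_forall fun t => by simp [chartX]
  · refine (hinv.mul (h1 2)).congr_deriv ?_ |>.congr_of_eventuallyEq ?_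
    · simp [chartXDeriv]; field_simp; ring
    · exact Eventually.of_forall fun t => by simp [chartX]
  · refine (hinv.mul (h1 3)).congr_deriv ?_ |>.congr_of_eventuallyEq ?_
    · simp [chartXDeriv]; field_simp; ring
    · exact Eventually.of_forall fun t => by simp [chartX]

theorem contDiffAt_moserF {μ c : ℝ} {b : Primary} {z : E4 × E4}
    (hz : chartY z + pos μ b ≠ pos μ b.other) : ContDiffAt ℝ ∞ (moserF μ c b) z := by
  have e : moserF μ c b = fun z => 1 - mass μ b.other * (1 - z.1 0) /
      ‖chartY z + pos μ b - pos μ b.other‖ + (z.1 2 * chartY z 0 - z.1 1 * chartY z 1)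
      + z.1 2 * pos μ b 0 - (c + 1 / 2) * (1 - z.1 0) := funext (moserF_eq μ c b)
  rw [e]
  have h : chartY z + pos μ b - pos μ b.other ≠ 0 := sub_ne_zero.2 hz
  have hn : ContDiffAt ℝ ∞ (fun z => ‖chartY z + pos μ b - pos μ b.other‖) z :=
    ContDiffAt.norm ℝ (by fun_prop) h
  have hd : ContDiffAt ℝ ∞ (fun z : E4 × E4 => mass μ b.other * (1 - z.1 0) /
      ‖chartY z + pos μ b - pos μ b.other‖) z :=
    ContDiffAt.div (by fun_prop) hn (norm_ne_zero_iff.2 h)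
  fun_prop

theorem differentiableAt_moserQ {μ c : ℝ} {b : Primary} {z : E4 × E4}
    (hz : chartY z + pos μ b ≠ pos μ b.other) : DifferentiableAt ℝ (moserQ μ c b) z := by
  have h1 : DifferentiableAt ℝ (moserF μ c b) z :=
    (contDiffAt_moserF hz).differentiableAt (by simp)
  have h2 : DifferentiableAt ℝ (fun z : E4 × E4 => ‖z.2‖ ^ 2) z :=
    (contDiff_snd.norm_sq ℝ (n := 1)).differentiable (by simp) z
  unfold moserQ
  fun_prop

theorem moserQ_eq (μ c : ℝ) (b : Primary) (z : E4 × E4) :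
    moserQ μ c b z = (‖z.2‖ * moserF μ c b z) ^ 2 / 2 := by
  rw [moserQ]; ring

/-- The rate of change of the action form `η dξ` along the regularized field. -/
noncomputable def radialQ (μ : ℝ) (b : Primary) (z : E4 × E4) : ℝ :=
  mass μ b ^ 2 + mass μ b * ‖z.2‖ * (mass μ b.other * (1 - z.1 0) *
    inner ℝ (chartY z + pos μ b - pos μ b.other) (chartY z) /
      ‖chartY z + pos μ b - pos μ b.other‖ ^ 3 + (z.1 2 * chartY z 0 - z.1 1 * chartY z 1))

/-- The vector is the fibre dilation η ∂_η, the Liouville field of η dξ. Under η ↦ (1 + t)η the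
position y scales linearly with ξ fixed, so f can be differentiated explicitly. -/
theorem fderiv_moserQ_radial {μ c : ℝ} {b : Primary} {z : E4 × E4}
    (hz : chartY z + pos μ b ≠ pos μ b.other) (hf : ‖z.2‖ * moserF μ c b z = mass μ b) :
    fderiv ℝ (moserQ μ c b) z (0, z.2) = radialQ μ b z := by
  set cur : ℝ → E4 × E4 := fun t => (z.1, z.2 + t • z.2) with hcur
  have hcur0 : cur 0 = z := by simp [hcur]
  have hcd : HasDerivAt cur (0, z.2) 0 := by
    refine (hasDerivAt_const 0 z.1).prodMk ?_
    simpa using ((hasDerivAt_id (0 : ℝ)).smul_const z.2).const_add z.2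
  have h1 : HasDerivAt (fun t => moserQ μ c b (cur t)) (fderiv ℝ (moserQ μ c b) z (0, z.2)) 0 := by
    have : HasFDerivAt (moserQ μ c b) (fderiv ℝ (moserQ μ c b) z) (cur 0) := by
      rw [hcur0]; exact (differentiableAt_moserQ (c := c) hz).hasFDerivAt
    exact this.comp_hasDerivAt (0 : ℝ) hcd
  have hY : ∀ t, chartY (cur t) = chartY z + t • chartY z := by
    intro t
    apply ext_E3 <;> simp [hcur, chartY] <;> ring
  have hYd : HasDerivAt (fun t : ℝ => chartY z + pos μ b + t • chartY z) (chartY z) 0 := by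
    simpa using ((hasDerivAt_id (0 : ℝ)).smul_const (chartY z)).const_add (chartY z + pos μ b)
  have hinv := (hasFDerivAt_inv_norm (pos μ b.other) (chartY z + pos μ b + (0 : ℝ) • chartY z)
    (by simpa using hz)).comp_hasDerivAt (0 : ℝ) hYd
  have hlin : HasDerivAt (fun t : ℝ => 1 + t) 1 0 := by
    simpa using (hasDerivAt_id (0 : ℝ)).const_add 1
  have hF : HasDerivAt (fun t => moserF μ c b (cur t)) (mass μ b.other * (1 - z.1 0) *
    inner ℝ (chartY z + pos μ b - pos μ b.other) (chartY z) /
      ‖chartY z + pos μ b - pos μ b.other‖ ^ 3 + (z.1 2 * chartY z 0 - z.1 1 * chartY z 1)) 0 := by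
    have H := (((hinv.const_mul (mass μ b.other * (1 - z.1 0))).const_sub 1).add
      (hlin.mul_const (z.1 2 * chartY z 0 - z.1 1 * chartY z 1))).add_const
        (z.1 2 * pos μ b 0 - (c + 1 / 2) * (1 - z.1 0))
    refine (H.congr_deriv ?_).congr_of_eventuallyEq (Eventually.of_forall fun t => ?_)
    · simp [inner_add_left, inner_sub_left]; ring
    · simp only [moserF_eq, hY]
      have : chartY z + t • chartY z + pos μ b - pos μ b.other =
        chartY z + pos μ b + t • chartY z - pos μ b.other := by abel
      rw [this]
      simp [hcur]
      ring
  have hN : ∀ t, ‖(cur t).2‖ ^ 2 = (1 + t) ^ 2 * ‖z.2‖ ^ 2 := by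
    intro t
    have : (cur t).2 = (1 + t) • z.2 := by simp [hcur, add_smul]
    rw [this, norm_smul, mul_pow, Real.norm_eq_abs, sq_abs]
  have h2 := ((((hlin.pow 2).mul_const (‖z.2‖ ^ 2)).const_mul (1 / 2)).mul (hF.pow 2))
  have h3 : HasDerivAt (fun t => moserQ μ c b (cur t)) _ 0 :=
    h2.congr_of_eventuallyEq (Eventually.of_forall fun t => by simp [moserQ, hN])
  rw [h1.unique h3, radialQ, hcur0]
  simp [hcur0]
  rw [← hf]
  ring

/-- Fibre dilation is the radial field (q - P)∂_q in the old coordinates, and m|q - P| is the time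
change between H and Q on the level. The left side stays positive at collisions, where the right
side degenerates. -/
theorem radialQ_eq {μ : ℝ} {b : Primary} {q p : E3} (hq : q ≠ pos μ b) :
    radialQ μ b (moserMap μ b q p) = mass μ b * ‖q - pos μ b‖ * radialH μ b q p := by
  have h0 : 0 < ‖p‖ ^ 2 + 1 := by positivity
  have hn := norm_sub_pos_pos hq
  rw [radialQ, chartY_moserMap, moserMap_fst_zero, norm_moserMap_snd, radialH, sub_add_cancel]
  simp only [moserMap, norm_neg, mk4_one, mk4_two, PiLp.smul_apply,
      PiLp.neg_apply, smul_eq_mul, div_eq_mul_inv]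
  generalize (‖q - pos μ b.other‖ ^ 3)⁻¹ = D
  field_simp
  ring

/-! ### Hamilton's equations in the original variables -/

/-- The gradient of the gravitational potential. -/
noncomputable def gradV (μ : ℝ) (q : E3) : E3 :=
  (μ * (‖q - pos μ .moon‖ ^ 3)⁻¹) • (q - pos μ .moon)
    + ((1 - μ) * (‖q - pos μ .earth‖ ^ 3)⁻¹) • (q - pos μ .earth)

/-- The velocity `∂H/∂p`. -/
noncomputable def hamQ (q p : E3) : E3 := !₂[p 0 + q 1, p 1 - q 0, p 2]

/-- The force `-∂H/∂q`. -/
noncomputable def hamP (μ : ℝ) (q p : E3) : E3 := !₂[p 1, -p 0, 0] - gradV μ q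

theorem fderiv_jacobi_eq {μ : ℝ} {q p : E3} (hq : ∀ b, q ≠ pos μ b) (w e : E3) :
    fderiv ℝ (jacobi μ) (q, p) (w, e) = inner ℝ (hamQ q p) e - inner ℝ (hamP μ q p) w := by
  rw [fderiv_jacobi_apply μ (q, p) (w, e) hq]
  simp only [hamQ, hamP, gradV, inner_E3, PiLp.sub_apply, PiLp.add_apply, PiLp.smul_apply,
    smul_eq_mul, Matrix.cons_val]
  ring

theorem differentiableAt_jacobi {μ : ℝ} {q p : E3} (hq : ∀ b, q ≠ pos μ b) :
    DifferentiableAt ℝ (jacobi μ) (q, p) := by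
  have h : ∀ b, DifferentiableAt ℝ (fun z : E3 × E3 => ‖z.1 - pos μ b‖⁻¹) (q, p) := fun b => by
    have H := (hasFDerivAt_inv_norm (pos μ b) q (hq b)).comp (q, p)
      (hasFDerivAt_fst (𝕜 := ℝ) (p := (q, p)))
    exact H.differentiableAt
  have hp : DifferentiableAt ℝ (fun z : E3 × E3 => ‖z.2‖ ^ 2) (q, p) :=
    (contDiff_snd.norm_sq ℝ (n := 1)).differentiable (by simp) _
  have hE := h .earth
  have hM := h .moon
  unfold jacobi
  simp only [div_eq_mul_inv]
  fun_prop

/-- The derivative of the regularized Hamiltonian along the image of a curve `(q, p)`. -/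
theorem fderiv_moserQ_curve {μ c : ℝ} {b : Primary} {q p w e : E3} (hq : ∀ b, q ≠ pos μ b)
    (hE : jacobi μ (q, p) = c) {V : E4 × E4}
    (hV : HasDerivAt (fun t : ℝ => moserMap μ b (q + t • w) (p + t • e)) V 0) :
    fderiv ℝ (moserQ μ c b) (moserMap μ b q p) V =
      mass μ b * ‖q - pos μ b‖ * (inner ℝ (hamQ q p) e - inner ℝ (hamP μ q p) w) := by
  have hz : chartY (moserMap μ b q p) + pos μ b ≠ pos μ b.other := by
    rw [chartY_moserMap, sub_add_cancel]; exact hq _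
  have h1 : HasDerivAt (fun t : ℝ => moserQ μ c b (moserMap μ b (q + t • w) (p + t • e)))
      (fderiv ℝ (moserQ μ c b) (moserMap μ b q p) V) 0 := by
    have := (differentiableAt_moserQ (c := c) hz).hasFDerivAt
    have e0 : moserMap μ b q p = moserMap μ b (q + (0 : ℝ) • w) (p + (0 : ℝ) • e) := by simp
    rw [e0] at this ⊢
    exact this.comp_hasDerivAt (0 : ℝ) hV
  have hqd : HasDerivAt (fun t : ℝ => q + t • w) w 0 := by
    simpa using ((hasDerivAt_id (0 : ℝ)).smul_const w).const_add q
  have hpd : HasDerivAt (fun t : ℝ => p + t • e) e 0 := by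
    simpa using ((hasDerivAt_id (0 : ℝ)).smul_const e).const_add p
  have hH : HasDerivAt (fun t : ℝ => jacobi μ (q + t • w, p + t • e))
      (inner ℝ (hamQ q p) e - inner ℝ (hamP μ q p) w) 0 := by
    rw [← fderiv_jacobi_eq hq]
    have := (differentiableAt_jacobi (p := p) hq).hasFDerivAt
    have e0 : (q, p) = (q + (0 : ℝ) • w, p + (0 : ℝ) • e) := by simp
    rw [e0] at this ⊢
    exact this.comp_hasDerivAt (0 : ℝ) (hqd.prodMk hpd)
  have hN : DifferentiableAt ℝ (fun t : ℝ => ‖q + t • w - pos μ b‖) 0 :=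
    ((hqd.sub_const (pos μ b)).differentiableAt).norm ℝ (by simpa using sub_ne_zero.2 (hq b))
  -- Q is (|y|(H - c) + m)²/2. Since H = c at the point, the derivative of |y| does not contribute
  -- and dQ = m|y| dH.
  have h2 := (((hN.hasDerivAt.mul (hH.sub_const c)).add_const (mass μ b)).pow 2).div_const 2
  have hev : ∀ᶠ t : ℝ in 𝓝 0, q + t • w ≠ pos μ b := by
    apply hqd.continuousAt.eventually_ne
    simpa using hq b
  have h3 : HasDerivAt (fun t : ℝ => moserQ μ c b (moserMap μ b (q + t • w) (p + t • e))) _ 0 :=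
    h2.congr_of_eventuallyEq (by
      filter_upwards [hev] with t ht
      rw [moserQ_eq, norm_mul_moserF μ c b ht]
      rfl)
  rw [h1.unique h3]
  simp [hE]
  ring

/-- The tangent vector at `z` that corresponds to the variation `w` of the position. -/
noncomputable def tangentQ (z : E4 × E4) (w : E3) : E4 × E4 :=
  (0, mk4 (inner ℝ (chartX z) w) ((1 - z.1 0)⁻¹ • w - (inner ℝ (chartX z) w) • chartX z))

/-- The tangent vector at `z` that corresponds to the variation `e` of the momentum. -/
noncomputable def tangentP (z : E4 × E4) (e : E3) : E4 × E4 :=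
  ((inner ℝ (vec z.1) e) • z.1 - mk4 (inner ℝ (vec z.1) e) ((1 - z.1 0) • e),
    mk4 (-inner ℝ (vec z.2) e) (z.2 0 • e) - (inner ℝ (vec z.1) e) • z.2
      + (inner ℝ (vec z.2) e) • z.1)

theorem isTangent_tangentQ {z : E4 × E4} (hz : OnTS z) (h1 : z.1 0 < 1) (w : E3) :
    IsTangent z (tangentQ z w) := by
  obtain ⟨h2, h3⟩ := hz
  rw [norm_sq_E4] at h2
  have hne : 1 - z.1 0 ≠ 0 := by linarith
  constructor
  · simp [tangentQ]
  · simp only [tangentQ, inner_E4, inner_E3, chartX]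
    simp
    field_simp
    linear_combination (-(z.1 1 * w 0 + z.1 2 * w 1 + z.1 3 * w 2)) * h2

theorem isTangent_tangentP {z : E4 × E4} (hz : OnTS z) (e : E3) :
    IsTangent z (tangentP z e) := by
  obtain ⟨h2, h3⟩ := hz
  rw [norm_sq_E4] at h2
  rw [inner_E4] at h3
  constructor
  · simp only [tangentP, inner_E4, inner_E3]
    simp
    linear_combination (z.1 1 * e 0 + z.1 2 * e 1 + z.1 3 * e 2) * h2
  · simp only [tangentP, inner_E4, inner_E3]
    simp
    linear_combination (z.2 1 * e 0 + z.2 2 * e 1 + z.2 3 * e 2) * h2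

/-- Pairing with the position variations reads off the x-component of a tangent vector;
`omega_tangentP` reads off its y-component. Together they turn Hamilton's equation on T*S³ into the
usual ones. -/
theorem omega_tangentQ {z X : E4 × E4} (hX : IsTangent z X) (h1 : z.1 0 < 1) (w : E3) :
    omega (tangentQ z w) X = inner ℝ w (chartXDeriv z X) := by
  have h2 := hX.1
  rw [inner_E4] at h2
  have hne : 1 - z.1 0 ≠ 0 := by linarith
  simp only [tangentQ, omega, inner_E4, inner_E3, chartX, chartXDeriv]
  simp
  field_simp
  linear_combination (-(z.1 1 * w 0 + z.1 2 * w 1 + z.1 3 * w 2)) * h2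

theorem omega_tangentP {z X : E4 × E4} (hX : IsTangent z X) (e : E3) :
    omega (tangentP z e) X = inner ℝ e (chartYDeriv z X) := by
  obtain ⟨h2, h3⟩ := hX
  rw [inner_E4] at h2
  rw [inner_E4, inner_E4] at h3
  simp only [tangentP, omega, inner_E4, inner_E3, chartYDeriv]
  simp
  linear_combination (z.2 1 * e 0 + z.2 2 * e 1 + z.2 3 * e 2) * h2 -
    (z.1 1 * e 0 + z.1 2 * e 1 + z.1 3 * e 2) * h3

theorem hasDerivAt_moserMap_q (μ : ℝ) (b : Primary) (q p w : E3) :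
    HasDerivAt (fun t : ℝ => moserMap μ b (q + t • w) (p + t • (0 : E3)))
      (tangentQ (moserMap μ b q p) w) 0 := by
  have e : (fun t : ℝ => moserMap μ b (q + t • w) (p + t • (0 : E3))) = fun t : ℝ =>
      moserMap μ b q p + t • tangentQ (moserMap μ b q p) w := by
    funext t
    have h0 : 0 < ‖p‖ ^ 2 + 1 := by positivity
    rw [smul_zero, add_zero, tangentQ, chartX_moserMap, moserMap_fst_zero]
    refine Prod.ext ?_ (ext_E4 ?_ ?_ ?_ ?_)
    · simp [moserMap]
    · simp [moserMap, inner_E3]; ring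
    · simp [moserMap, inner_E3]; ring
    · simp [moserMap, inner_E3]; ring
    · simp [moserMap, inner_E3]; ring
  rw [e]
  simpa using ((hasDerivAt_id (0 : ℝ)).smul_const
    (tangentQ (moserMap μ b q p) w)).const_add (moserMap μ b q p)

theorem hasDerivAt_moserMap_p (μ : ℝ) (b : Primary) (q p e : E3) :
    HasDerivAt (fun t : ℝ => moserMap μ b (q + t • (0 : E3)) (p + t • e))
      (tangentP (moserMap μ b q p) e) 0 := by
  simp only [smul_zero, add_zero]
  set y := q - pos μ b with hy
  have hc : ∀ i, HasDerivAt (fun t : ℝ => (p + t • e) i) (e i) 0 := by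
    intro i
    have : HasDerivAt (fun t : ℝ => p + t • e) e 0 := by
      simpa using ((hasDerivAt_id (0 : ℝ)).smul_const e).const_add p
    exact HasDerivAt.E3_apply this i
  have hn0 : ∀ t : ℝ, ‖p + t • e‖ ^ 2 = (p + t • e) 0 ^ 2 + (p + t • e) 1 ^ 2 + (p + t • e) 2 ^ 2 :=
    fun t => norm_sq_E3 _
  have hn : HasDerivAt (fun t : ℝ => ‖p + t • e‖ ^ 2) (2 * (p 0 * e 0 + p 1 * e 1 + p 2 * e 2)) 0 := by
    simp only [hn0]
    refine ((((hc 0).pow 2).add ((hc 1).pow 2)).add ((hc 2).pow 2)).congr_deriv ?_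
    simp; ring
  have hs : HasDerivAt (fun t : ℝ => -((p + t • e) 0 * y 0 + (p + t • e) 1 * y 1 + (p + t • e) 2 * y 2))
      (-(e 0 * y 0 + e 1 * y 1 + e 2 * y 2)) 0 :=
    ((((hc 0).mul_const _).add ((hc 1).mul_const _)).add ((hc 2).mul_const _)).neg
  have hp0 : ‖p + (0 : ℝ) • e‖ ^ 2 + 1 ≠ 0 := by positivity
  have h0 : 0 < ‖p‖ ^ 2 + 1 := by positivity
  have hN := norm_sq_E3 p
  have hneg : ∀ t : ℝ, ‖-(t • e) + -p‖ = ‖p + t • e‖ := fun t => by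
    rw [← neg_add, norm_neg, add_comm]
  have hξ0 : HasDerivAt (fun t : ℝ => (‖p + t • e‖ ^ 2 - 1) / (‖p + t • e‖ ^ 2 + 1)) _ 0 :=
    (hn.sub_const 1).div (hn.add_const 1) hp0
  have hξ : ∀ i, HasDerivAt (fun t : ℝ => 2 / (‖p + t • e‖ ^ 2 + 1) * -((p + t • e) i)) _ 0 :=
    fun i => ((hasDerivAt_const (0 : ℝ) (2 : ℝ)).div (hn.add_const 1) hp0).mul (hc i).neg
  have hη : ∀ i, HasDerivAt (fun t : ℝ => (‖p + t • e‖ ^ 2 + 1) / 2 * y i -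
      -((p + t • e) 0 * y 0 + (p + t • e) 1 * y 1 + (p + t • e) 2 * y 2) * -((p + t • e) i)) _ 0 :=
    fun i => (((hn.add_const 1).div_const 2).mul_const (y i)).sub (hs.mul (hc i).neg)
  have e1 : 1 - (moserMap μ b q p).1 0 = 2 / (‖p‖ ^ 2 + 1) := moserMap_fst_zero μ b q p
  have e0 : (moserMap μ b q p).1 0 = 1 - 2 / (‖p‖ ^ 2 + 1) := by linarith
  refine HasDerivAt.prodMk (hasDerivAt_E4 fun i => ?_) (hasDerivAt_E4 fun i => ?_)
  · fin_cases i
    · refine (hξ0.congr_deriv ?_).congr_of_eventuallyEq (Eventually.of_forall fun t => ?_)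
      · simp only [inner_E3]
        simp [moserMap]
        rw [hN] at *
        field_simp
        ring
      · simp [hneg]
    · refine ((hξ 0).congr_deriv ?_).congr_of_eventuallyEq (Eventually.of_forall fun t => ?_)
      · simp only [inner_E3]
        simp [moserMap]
        rw [hN] at *
        field_simp
        ring
      · simp [hneg]; ring
    · refine ((hξ 1).congr_deriv ?_).congr_of_eventuallyEq (Eventually.of_forall fun t => ?_)
      · simp only [inner_E3]
        simp [moserMap]
        rw [hN] at *
        field_simp
        ring
      · simp [hneg]; ring
    · refine ((hξ 2).congr_deriv ?_).congr_of_eventuallyEq (Eventually.of_forall fun t => ?_)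
      · simp only [inner_E3]
        simp [moserMap]
        rw [hN] at *
        field_simp
        ring
      · simp [hneg]; ring
  · fin_cases i
    · refine (hs.congr_deriv ?_).congr_of_eventuallyEq (Eventually.of_forall fun t => ?_)
      · simp only [inner_E3]
        simp [moserMap, ← hy, inner_E3]
        rw [hN] at *
        field_simp
        ring
      · simp [← hy, inner_E3, hneg]; ring
    · refine ((hη 0).congr_deriv ?_).congr_of_eventuallyEq (Eventually.of_forall fun t => ?_)
      · simp only [inner_E3]
        simp [moserMap, ← hy, inner_E3]
        rw [hN] at *
        field_simp
        ring
      · simp [← hy, inner_E3, hneg]; ring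
    · refine ((hη 1).congr_deriv ?_).congr_of_eventuallyEq (Eventually.of_forall fun t => ?_)
      · simp only [inner_E3]
        simp [moserMap, ← hy, inner_E3]
        rw [hN] at *
        field_simp
        ring
      · simp [← hy, inner_E3, hneg]; ring
    · refine ((hη 2).congr_deriv ?_).congr_of_eventuallyEq (Eventually.of_forall fun t => ?_)
      · simp only [inner_E3]
        simp [moserMap, ← hy, inner_E3]
        rw [hN] at *
        field_simp
        ring
      · simp [← hy, inner_E3, hneg]; ring

/-- Hamilton's equations for the regularized field at regular points. -/
theorem chartDeriv_hamiltonian {μ c : ℝ} {b : Primary} {q p : E3} (hq : ∀ b, q ≠ pos μ b)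
    (hE : jacobi μ (q, p) = c) {X : E4 × E4}
    (hX : IsHamiltonianVector (moserQ μ c b) (moserMap μ b q p) X) :
    chartYDeriv (moserMap μ b q p) X = (mass μ b * ‖q - pos μ b‖) • hamQ q p ∧
    chartXDeriv (moserMap μ b q p) X = -((mass μ b * ‖q - pos μ b‖) • hamP μ q p) := by
  have hz := onTS_moserMap μ b q p
  have h1 : (moserMap μ b q p).1 0 < 1 := moserChart_regular_lt μ b q p
  constructor
  · refine ext_inner_left ℝ fun e => ?_
    rw [← omega_tangentP hX.1, ← hX.2 _ (isTangent_tangentP hz e),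
      fderiv_moserQ_curve hq hE (hasDerivAt_moserMap_p μ b q p e), inner_zero_right, sub_zero,
      inner_smul_right, real_inner_comm]
  · refine ext_inner_left ℝ fun w => ?_
    rw [← omega_tangentQ hX.1 h1, ← hX.2 _ (isTangent_tangentQ hz h1 w),
      fderiv_moserQ_curve hq hE (hasDerivAt_moserMap_q μ b q p w), inner_zero_right, zero_sub,
      inner_neg_right, inner_smul_right, real_inner_comm]
    ring

/-- The action form evaluated on the regularized field. -/
theorem inner_snd_hamiltonian {μ c : ℝ} {b : Primary} {z X : E4 × E4} (hz : OnTS z)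
    (hne : chartY z + pos μ b ≠ pos μ b.other) (hf : ‖z.2‖ * moserF μ c b z = mass μ b)
    (hX : IsHamiltonianVector (moserQ μ c b) z X) : inner ℝ z.2 X.1 = radialQ μ b z := by
  -- Fibre dilation is tangent to T*S³, and contracting it with ω gives the form η dξ.
  have h := hX.2 (0, z.2) ⟨by simp, by simpa using hz.2⟩
  rw [fderiv_moserQ_radial hne hf] at h
  simpa [omega] using h.symm

/-! ### The action estimate -/

/-- The pullback to the parameter plane of the form `η dξ + dg`. -/
noncomputable def actionForm (z : ℝ × ℝ → E4 × E4) (g : ℝ × ℝ → ℝ) (x : ℝ × ℝ) :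
    ℝ × ℝ →L[ℝ] ℝ :=
  (innerSL ℝ (z x).2).comp (fderiv ℝ (fun x => (z x).1) x) + fderiv ℝ g x

theorem actionForm_apply (z : ℝ × ℝ → E4 × E4) (g : ℝ × ℝ → ℝ) (x v : ℝ × ℝ) :
    actionForm z g x v = inner ℝ (z x).2 (fderiv ℝ (fun x => (z x).1) x v) + fderiv ℝ g x v := by
  simp [actionForm]

theorem contDiffAt_actionForm {z : ℝ × ℝ → E4 × E4} {g : ℝ × ℝ → ℝ} {x : ℝ × ℝ}
    (hz : ContDiffAt ℝ ∞ z x) (hg : ContDiffAt ℝ ∞ g x) :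
    ContDiffAt ℝ 1 (actionForm z g) x := by
  have h1 : ContDiffAt ℝ 1 (fderiv ℝ (fun x => (z x).1)) x :=
    (hz.fst).fderiv_right (m := 1) (by norm_cast)
  have h2 : ContDiffAt ℝ 1 (fderiv ℝ g) x := hg.fderiv_right (m := 1) (by norm_cast)
  have h3 : ContDiffAt ℝ 1 (fun x => innerSL ℝ (z x).2) x :=
    (innerSL ℝ (E := E4)).contDiff.contDiffAt.comp x ((hz.snd).of_le (by norm_cast))
  exact (h3.clm_comp h1).add h2

theorem fderiv_actionForm {z : ℝ × ℝ → E4 × E4} {g : ℝ × ℝ → ℝ} {x : ℝ × ℝ}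
    (hz : ContDiffAt ℝ ∞ z x) (hg : ContDiffAt ℝ ∞ g x) (v w : ℝ × ℝ) :
    fderiv ℝ (actionForm z g) x v w = inner ℝ (fderiv ℝ z x v).2 (fderiv ℝ z x w).1 +
      inner ℝ (z x).2 (fderiv ℝ (fderiv ℝ (fun x => (z x).1)) x v w) +
      fderiv ℝ (fderiv ℝ g) x v w := by
  have hzd : DifferentiableAt ℝ z x := hz.differentiableAt (by simp)
  have h1 : DifferentiableAt ℝ (fderiv ℝ (fun x => (z x).1)) x :=
    ((hz.fst).fderiv_right (m := 1) (by norm_cast)).differentiableAt (by simp)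
  have h2 : DifferentiableAt ℝ (fderiv ℝ g) x :=
    (hg.fderiv_right (m := 1) (by norm_cast)).differentiableAt (by simp)
  have h3 : HasFDerivAt (fun x => innerSL ℝ (z x).2)
      ((innerSL ℝ (E := E4)).comp ((ContinuousLinearMap.snd ℝ E4 E4).comp (fderiv ℝ z x))) x :=
    (innerSL ℝ (E := E4)).hasFDerivAt.comp x hzd.hasFDerivAt.snd
  have h4 : fderiv ℝ (fun x => (z x).1) x = (ContinuousLinearMap.fst ℝ E4 E4).comp (fderiv ℝ z x) :=
    hzd.hasFDerivAt.fst.fderiv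
  have H := (h3.clm_comp h1.hasFDerivAt).add h2.hasFDerivAt
  have H' : fderiv ℝ (actionForm z g) x = _ := H.fderiv
  rw [H', h4]
  simp
  ring

/-- This is d(η dξ + dg) = dη ∧ dξ pulled back to the parameter plane; the second derivatives are
symmetric and cancel. -/
theorem curl_actionForm {z : ℝ × ℝ → E4 × E4} {g : ℝ × ℝ → ℝ} {x : ℝ × ℝ}
    (hz : ContDiffAt ℝ ∞ z x) (hg : ContDiffAt ℝ ∞ g x) (v w : ℝ × ℝ) :
    fderiv ℝ (actionForm z g) x v w - fderiv ℝ (actionForm z g) x w v =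
      omega (fderiv ℝ z x v) (fderiv ℝ z x w) := by
  rw [fderiv_actionForm hz hg, fderiv_actionForm hz hg]
  have s1 : fderiv ℝ (fderiv ℝ (fun x => (z x).1)) x v w =
      fderiv ℝ (fderiv ℝ (fun x => (z x).1)) x w v :=
    (hz.fst.isSymmSndFDerivAt (by simp; exact WithTop.coe_le_coe.2 le_top)).eq v w
  have s2 : fderiv ℝ (fderiv ℝ g) x v w = fderiv ℝ (fderiv ℝ g) x w v :=
    (hg.isSymmSndFDerivAt (by simp; exact WithTop.coe_le_coe.2 le_top)).eq v w
  rw [s1, s2, omega]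
  ring

/-- Gronwall's argument for the action: if the curl of a form on the strip is controlled by the
form itself, then the integral over the circles, and whatever it dominates, stays bounded. -/
theorem bounded_of_curl_le {s₁ s₂ C δ : ℝ} (h12 : s₁ < s₂) (hC : 0 ≤ C)
    (hδ : 0 < δ) {θ : ℝ × ℝ → ℝ × ℝ →L[ℝ] ℝ} {τ : ℝ → ℝ}
    (hθ : ∀ s ∈ Ioo s₁ 1, ∀ u, ContDiffAt ℝ 1 θ (s, u))
    (hper : ∀ s ∈ Ioo s₁ 1, θ (s, 1) (1, 0) = θ (s, 0) (1, 0))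
    (hcurl : ∀ s ∈ Ioo s₁ 1, ∀ u, fderiv ℝ θ (s, u) (1, 0) (0, 1) -
      fderiv ℝ θ (s, u) (0, 1) (1, 0) ≤ C * θ (s, u) (0, 1))
    (hpos : ∀ s ∈ Ioo s₁ 1, ∀ u, δ * τ s ≤ θ (s, u) (0, 1)) :
    ∃ B, ∀ s ∈ Ico s₂ 1, τ s ≤ B := by
  set A : ℝ → ℝ := fun s => ∫ u in (0 : ℝ)..1, θ (s, u) (0, 1) with hA
  have hline : ∀ s ∈ Ioo s₁ 1, ∀ v : ℝ × ℝ, Continuous (fun u => θ (s, u) v) := by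
    intro s hs v
    refine continuous_iff_continuousAt.2 fun u => ?_
    have h1 : ContinuousAt (fun u : ℝ => θ (s, u)) u :=
      (hθ s hs u).continuousAt.comp (by fun_prop : ContinuousAt (fun u : ℝ => (s, u)) u)
    exact h1.clm_apply continuousAt_const
  have hDc : ∀ s ∈ Ioo s₁ 1, ∀ u, ContinuousAt (fderiv ℝ θ) (s, u) := fun s hs u =>
    ((hθ s hs u).fderiv_right (m := 0) (by norm_num)).continuousAt
  have hlineD : ∀ s ∈ Ioo s₁ 1, ∀ v w : ℝ × ℝ, Continuous (fun u => fderiv ℝ θ (s, u) v w) := by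
    intro s hs v w
    refine continuous_iff_continuousAt.2 fun u => ?_
    have h1 : ContinuousAt (fun u : ℝ => fderiv ℝ θ (s, u)) u :=
      ContinuousAt.comp (f := fun u : ℝ => (s, u)) (hDc s hs u) (by fun_prop)
    exact (h1.clm_apply continuousAt_const).clm_apply continuousAt_const
  have hds : ∀ s ∈ Ioo s₁ 1, ∀ u, HasDerivAt (fun s => θ (s, u) (0, 1))
      (fderiv ℝ θ (s, u) (1, 0) (0, 1)) s := by
    intro s hs u
    have h1 : HasDerivAt (fun s : ℝ => (s, u)) ((1 : ℝ), (0 : ℝ)) s :=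
      (hasDerivAt_id s).prodMk (hasDerivAt_const s u)
    have h2 := ((hθ s hs u).differentiableAt (by simp)).hasFDerivAt.comp_hasDerivAt s h1
    have h3 := h2.clm_apply (hasDerivAt_const s ((0 : ℝ), (1 : ℝ)))
    simpa using h3
  have hdu : ∀ s ∈ Ioo s₁ 1, ∀ u, HasDerivAt (fun u => θ (s, u) (1, 0))
      (fderiv ℝ θ (s, u) (0, 1) (1, 0)) u := by
    intro s hs u
    have h1 : HasDerivAt (fun u : ℝ => (s, u)) ((0 : ℝ), (1 : ℝ)) u :=
      (hasDerivAt_const u s).prodMk (hasDerivAt_id u)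
    have h2 := ((hθ s hs u).differentiableAt (by simp)).hasFDerivAt.comp_hasDerivAt u h1
    have h3 := h2.clm_apply (hasDerivAt_const u ((1 : ℝ), (0 : ℝ)))
    simpa using h3
  have hAd : ∀ s ∈ Ioo s₁ 1,
      HasDerivAt A (∫ u in (0 : ℝ)..1, fderiv ℝ θ (s, u) (1, 0) (0, 1)) s := by
    intro s hs
    obtain ⟨ε, hε, hεs⟩ := Metric.isOpen_iff.1 isOpen_Ioo s hs
    have hball : Metric.closedBall s (ε / 2) ⊆ Ioo s₁ 1 :=
      (Metric.closedBall_subset_ball (by linarith)).trans hεs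
    have hK : IsCompact (Metric.closedBall s (ε / 2) ×ˢ Icc (0 : ℝ) 1) :=
      (isCompact_closedBall _ _).prod isCompact_Icc
    obtain ⟨M, hM⟩ := hK.exists_bound_of_continuousOn
      (f := fun x : ℝ × ℝ => fderiv ℝ θ x (1, 0) (0, 1)) (by
        rintro ⟨s', u⟩ ⟨hs', -⟩
        exact (((hDc s' (hball hs') u).clm_apply continuousAt_const).clm_apply
          continuousAt_const).continuousWithinAt)
    refine (intervalIntegral.hasDerivAt_integral_of_dominated_loc_of_deriv_le
      (F := fun s u => θ (s, u) (0, 1)) (F' := fun s u => fderiv ℝ θ (s, u) (1, 0) (0, 1))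
      (bound := fun _ => M) (Metric.closedBall_mem_nhds s (half_pos hε)) ?_ ?_ ?_ ?_ ?_ ?_).2
    · filter_upwards [isOpen_Ioo.mem_nhds hs] with s' hs'
      exact (hline s' hs' _).aestronglyMeasurable
    · exact (hline s hs _).intervalIntegrable _ _
    · exact (hlineD s hs _ _).aestronglyMeasurable
    · refine Eventually.of_forall fun u hu s' hs' => hM (s', u) ⟨hs', ?_⟩
      rw [uIoc_of_le zero_le_one] at hu
      exact ⟨hu.1.le, hu.2⟩
    · exact continuous_const.intervalIntegrable _ _
    · exact Eventually.of_forall fun u _ s' hs' => hds s' (hball hs') u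
  have hle : ∀ s ∈ Ioo s₁ 1, ∫ u in (0 : ℝ)..1, fderiv ℝ θ (s, u) (1, 0) (0, 1) ≤ C * A s := by
    intro s hs
    -- The integral over a circle of the u-derivative of θ(∂_s) vanishes by periodicity, so the
    -- derivative of the action is the integral of the curl.
    have h0 : ∫ u in (0 : ℝ)..1, fderiv ℝ θ (s, u) (0, 1) (1, 0) = 0 := by
      rw [intervalIntegral.integral_eq_sub_of_hasDerivAt (f := fun u => θ (s, u) (1, 0))
        (fun u _ => hdu s hs u) ((hlineD s hs _ _).intervalIntegrable _ _)]
      simp only [hper s hs, sub_self]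
    calc ∫ u in (0 : ℝ)..1, fderiv ℝ θ (s, u) (1, 0) (0, 1)
        = ∫ u in (0 : ℝ)..1, (fderiv ℝ θ (s, u) (1, 0) (0, 1) -
            fderiv ℝ θ (s, u) (0, 1) (1, 0)) := by
          rw [intervalIntegral.integral_sub ((hlineD s hs _ _).intervalIntegrable _ _)
            ((hlineD s hs _ _).intervalIntegrable _ _), h0, sub_zero]
      _ ≤ ∫ u in (0 : ℝ)..1, C * θ (s, u) (0, 1) := by
          refine intervalIntegral.integral_mono_on zero_le_one ?_ ?_ fun u _ => hcurl s hs u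
          · exact ((hlineD s hs _ _).sub (hlineD s hs _ _)).intervalIntegrable _ _
          · exact ((hline s hs _).const_mul C).intervalIntegrable _ _
      _ = C * A s := by rw [intervalIntegral.integral_const_mul]
  have hge : ∀ s ∈ Ioo s₁ 1, δ * τ s ≤ A s := by
    intro s hs
    calc δ * τ s = ∫ _u in (0 : ℝ)..1, δ * τ s := by simp
      _ ≤ A s := intervalIntegral.integral_mono_on zero_le_one
          (continuous_const.intervalIntegrable _ _) ((hline s hs _).intervalIntegrable _ _)
          fun u _ => hpos s hs u
  -- A' ≤ C A makes A e^{-Cs} nonincreasing.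
  set F : ℝ → ℝ := fun s => A s * Real.exp (-C * s) with hF
  have hFd : ∀ s ∈ Ioo s₁ 1, HasDerivAt F
      ((∫ u in (0 : ℝ)..1, fderiv ℝ θ (s, u) (1, 0) (0, 1)) * Real.exp (-C * s) +
        A s * (Real.exp (-C * s) * (-C * 1))) s := fun s hs =>
    (hAd s hs).mul (((hasDerivAt_id s).const_mul (-C)).exp)
  have hsub : Ico s₂ 1 ⊆ Ioo s₁ 1 := fun s hs => ⟨h12.trans_le hs.1, hs.2⟩
  have hanti : AntitoneOn F (Ico s₂ 1) := by
    apply antitoneOn_of_deriv_nonpos (convex_Ico _ _)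
    · exact fun s hs => (hFd s (hsub hs)).continuousAt.continuousWithinAt
    · intro s hs
      exact (hFd s (hsub (interior_subset hs))).differentiableAt.differentiableWithinAt
    · intro s hs
      have hs' := hsub (interior_subset hs)
      rw [(hFd s hs').deriv]
      have h1 := mul_le_mul_of_nonneg_right (hle s hs') (Real.exp_pos (-C * s)).le
      linarith
  refine ⟨|F s₂| * Real.exp C / δ, fun s hs => ?_⟩
  rw [le_div_iff₀ hδ, mul_comm]
  refine (hge s (hsub hs)).trans ?_
  have h1 : F s ≤ F s₂ := hanti ⟨le_rfl, hs.1.trans_lt hs.2⟩ hs hs.1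
  have h2 : A s = F s * Real.exp (C * s) := by
    rw [hF]; simp only; rw [mul_assoc, ← Real.exp_add]; simp
  rw [h2]
  calc F s * Real.exp (C * s) ≤ |F s₂| * Real.exp (C * s) := by
        gcongr; exact h1.trans (le_abs_self _)
    _ ≤ |F s₂| * Real.exp C := by
        gcongr; nlinarith [hs.2]

/-! ### Families of periodic orbits in a chart -/

theorem mass_eq_add (μ₀ μ : ℝ) (b : Primary) :
    mass μ b = mass μ₀ b + axisSign b * (μ - μ₀) := by
  cases b <;> simp [mass, axisSign]

theorem pos_zero_eq_add (μ₀ μ : ℝ) (b : Primary) : pos μ b 0 = pos μ₀ b 0 + (μ - μ₀) := by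
  cases b <;> simp [pos]

theorem pos_sub_other (μ₀ μ : ℝ) (b : Primary) :
    pos μ b - pos μ b.other = pos μ₀ b - pos μ₀ b.other := by
  apply ext_E3
  · simp only [PiLp.sub_apply, pos_other_zero]; ring
  · simp only [PiLp.sub_apply, pos_one]
  · simp only [PiLp.sub_apply, pos_two]

/-- The function `f` depends on the parameters in an affine way. -/
theorem moserF_eq_add (μ₀ c₀ μ c : ℝ) (b : Primary) (z : E4 × E4) :
    moserF μ c b z = moserF μ₀ c₀ b z
      + (μ - μ₀) * (axisSign b * ((1 - z.1 0) / ‖chartY z + pos μ₀ b - pos μ₀ b.other‖) + z.1 2)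
      - (c - c₀) * (1 - z.1 0) := by
  have e : chartY z + pos μ b - pos μ b.other = chartY z + pos μ₀ b - pos μ₀ b.other := by
    rw [add_sub_assoc, pos_sub_other μ₀ μ, ← add_sub_assoc]
  rw [moserF_eq, moserF_eq, e, mass_eq_add μ₀ μ, axisSign_other, pos_zero_eq_add μ₀ μ b]
  simp only [mul_div_assoc]
  ring

/-- The derivative of the regularized Hamiltonian in the direction of a change of the
parameters, with the sign that is needed to stay on the level. -/
noncomputable def drift (b : Primary) (μ μ' c' : ℝ) (z : E4 × E4) : ℝ :=
  mass μ b * (axisSign b * μ') - mass μ b * ‖z.2‖ *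
    (μ' * (axisSign b * ((1 - z.1 0) / ‖chartY z + pos μ b - pos μ b.other‖) + z.1 2)
      - c' * (1 - z.1 0))

theorem hasDerivAt_fst_snd {z : ℝ → E4 × E4} {s : ℝ} {z' : E4 × E4} (hz : HasDerivAt z z' s) :
    HasDerivAt (fun s => (z s).1) z'.1 s ∧ HasDerivAt (fun s => (z s).2) z'.2 s :=
  ⟨(ContinuousLinearMap.fst ℝ E4 E4).hasFDerivAt.comp_hasDerivAt s hz,
    (ContinuousLinearMap.snd ℝ E4 E4).hasFDerivAt.comp_hasDerivAt s hz⟩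

/-- Along the family Q_s(z(s)) = m_s²/2. The derivative with the parameters of Q frozen is therefore
the derivative of m_s²/2 minus the explicit parameter derivative of Q, which is affine data of f by
`moserF_eq_add`. -/
theorem fderiv_moserQ_of_level {μ c : ℝ → ℝ} {b : Primary} {z : ℝ → E4 × E4} {s μ' c' : ℝ}
    {z' : E4 × E4} (hμ : HasDerivAt μ μ' s) (hc : HasDerivAt c c' s) (hz : HasDerivAt z z' s)
    (hne : chartY (z s) + pos (μ s) b ≠ pos (μ s) b.other)
    (hlev : ∀ᶠ s' in 𝓝 s, ‖(z s').2‖ * moserF (μ s') (c s') b (z s') = mass (μ s') b) :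
    fderiv ℝ (moserQ (μ s) (c s) b) (z s) z' = drift b (μ s) μ' c' (z s) := by
  have hlev0 := hlev.self_of_nhds
  set P : ℝ → ℝ := fun s' => (μ s' - μ s) * (axisSign b * ((1 - (z s').1 0) /
      ‖chartY (z s') + pos (μ s) b - pos (μ s) b.other‖) + (z s').1 2)
      - (c s' - c s) * (1 - (z s').1 0) with hP
  have h1 := fun i => HasDerivAt.E4_apply hz.fst i
  have hNd : DifferentiableAt ℝ
      (fun s' => ‖chartY (z s') + pos (μ s) b - pos (μ s) b.other‖) s :=
    DifferentiableAt.norm ℝ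
      (((hasDerivAt_chartY hz).add_const _).sub_const _).differentiableAt (sub_ne_zero.2 hne)
  have hn0 : ‖chartY (z s) + pos (μ s) b - pos (μ s) b.other‖ ≠ 0 :=
    norm_ne_zero_iff.2 (sub_ne_zero.2 hne)
  have hPd : HasDerivAt P (μ' * (axisSign b * ((1 - (z s).1 0) /
      ‖chartY (z s) + pos (μ s) b - pos (μ s) b.other‖) + (z s).1 2)
      - c' * (1 - (z s).1 0)) s := by
    have H := ((hμ.sub_const (μ s)).mul
      (((((h1 0).const_sub 1).div hNd.hasDerivAt hn0).const_mul (axisSign b)).add (h1 2))).sub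
      ((hc.sub_const (c s)).mul ((h1 0).const_sub 1))
    refine H.congr_deriv ?_
    simp
  have hF : HasDerivAt (fun s' => moserF (μ s) (c s) b (z s'))
      (fderiv ℝ (moserF (μ s) (c s) b) (z s) z') s :=
    ((contDiffAt_moserF hne).differentiableAt (by simp)).hasFDerivAt.comp_hasDerivAt s hz
  have hsq : DifferentiableAt ℝ (fun s' => ‖(z s').2‖ ^ 2) s :=
    (hasDerivAt_fst_snd hz).2.differentiableAt.norm_sq ℝ
  have hQ1 : HasDerivAt (fun s' => moserQ (μ s) (c s) b (z s'))
      (fderiv ℝ (moserQ (μ s) (c s) b) (z s) z') s :=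
    (differentiableAt_moserQ hne).hasFDerivAt.comp_hasDerivAt s hz
  have hQ2 := (hsq.hasDerivAt.const_mul (1 / 2)).mul (hF.pow 2)
  -- `hQ2` has frozen parameters and `hQ3` moving ones. Their factors agree at s because P vanishes
  -- there, so the two derivatives differ by the P'-term only.
  have hQ3 := (hsq.hasDerivAt.const_mul (1 / 2)).mul ((hF.add hPd).pow 2)
  have hm : HasDerivAt (fun s' => mass (μ s') b) (axisSign b * μ') s := by
    have := ((hμ.sub_const (μ s)).const_mul (axisSign b)).const_add (mass (μ s) b)
    exact this.congr_of_eventuallyEq (Eventually.of_forall fun s' => mass_eq_add (μ s) (μ s') b)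
  have hQ4 := (hm.pow 2).const_mul (1 / 2)
  have e1 := hQ1.unique (hQ2.congr_of_eventuallyEq (Eventually.of_forall fun s' => by
    simp [moserQ]))
  have e2 := hQ4.unique (hQ3.congr_of_eventuallyEq (by
    filter_upwards [hlev] with s' hs'
    have := moserF_eq_add (μ s) (c s) (μ s') (c s') b (z s')
    simp only [Pi.pow_apply, Pi.mul_apply, Pi.add_apply]
    rw [← hs', this]
    simp only [hP]
    ring))
  have hP0 : P s = 0 := by simp [hP]
  rw [e1, drift]
  simp only [Pi.pow_apply, Pi.add_apply, hP0, add_zero] at e2 ⊢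
  simp only [Nat.cast_ofNat, Nat.add_one_sub_one, pow_one] at e2 ⊢
  have hf2 : ‖(z s).2‖ ^ 2 * moserF (μ s) (c s) b (z s) = mass (μ s) b * ‖(z s).2‖ := by
    rw [← hlev0]; ring
  linear_combination -e2 - (μ' * (axisSign b * ((1 - (z s).1 0) /
      ‖chartY (z s) + pos (μ s) b - pos (μ s) b.other‖) + (z s).1 2)
      - c' * (1 - (z s).1 0)) * hf2

theorem isTangent_of_hasDerivAt {z : ℝ → E4 × E4} {s : ℝ} {z' : E4 × E4}
    (hz : HasDerivAt z z' s) (h : ∀ᶠ s' in 𝓝 s, OnTS (z s')) : IsTangent (z s) z' := by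
  obtain ⟨hz1, hz2⟩ := hasDerivAt_fst_snd hz
  have h1 := (hz1.inner ℝ hz1).unique ((hasDerivAt_const s (1 : ℝ)).congr_of_eventuallyEq (by
    filter_upwards [h] with s' hs'
    rw [real_inner_self_eq_norm_sq]; exact hs'.1))
  have h2 := (hz1.inner ℝ hz2).unique ((hasDerivAt_const s (0 : ℝ)).congr_of_eventuallyEq (by
    filter_upwards [h] with s' hs'
    exact hs'.2))
  constructor
  · rw [real_inner_comm (z s).1 z'.1] at h1; linarith
  · linarith

/-- The rescaled family in the chart at `b`. -/
noncomputable def chartCurve (μ τ : ℝ → ℝ) (γ : ℝ → ℝ → RegPoint) (b : Primary) (x : ℝ × ℝ) :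
    E4 × E4 := moserChart (μ x.1) b (γ x.1 (τ x.1 * x.2))

/-! ### The rescaled family as a map from a strip into the charts. -/

section Family

variable {μ c : ℝ → ℝ} {S : Set Primary} {ρ : Primary → ℝ → E4 × E4 → ℝ} {γ : ℝ → ℝ → RegPoint}
  {τ : ℝ → ℝ}

theorem IsPeriodicOrbitFamily.tendsto_rescale (h : IsPeriodicOrbitFamily μ c S ρ γ τ) {s u : ℝ}
    (hs : s ∈ Ioo (0 : ℝ) 1) :
    ContDiffAt ℝ ∞ (fun x : ℝ × ℝ => (x.1, τ x.1 * x.2)) (s, u) := by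
  have hτ : ContDiffAt ℝ ∞ τ s :=
    h.period_smooth.contDiffAt (Ico_mem_nhds hs.1 hs.2)
  have hτ' : ContDiffAt ℝ ∞ (fun x : ℝ × ℝ => τ x.1) (s, u) :=
    ContDiffAt.comp (s, u) (f := Prod.fst) hτ contDiffAt_fst
  exact contDiffAt_fst.prodMk (hτ'.mul contDiffAt_snd)

theorem IsPeriodicOrbitFamily.eventually_inChart (h : IsPeriodicOrbitFamily μ c S ρ γ τ)
    {s u : ℝ} (hs : s ∈ Ioo (0 : ℝ) 1) {b : Primary} (hb : b ∈ S)
    (hin : (γ s (τ s * u)).InChart b) :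
    ∀ᶠ x : ℝ × ℝ in 𝓝 (s, u), (γ x.1 (τ x.1 * x.2)).InChart b := by
  have h1 := (h.smooth s ⟨hs.1.le, hs.2⟩ (τ s * u) b hb hin).1
  rw [nhdsWithin_eq_nhds.2 (prod_mem_nhds (Ico_mem_nhds hs.1 hs.2) univ_mem)] at h1
  exact (h.tendsto_rescale (u := u) hs).continuousAt.eventually h1

theorem IsPeriodicOrbitFamily.contDiffAt_chartCurve (h : IsPeriodicOrbitFamily μ c S ρ γ τ)
    {s u : ℝ} (hs : s ∈ Ioo (0 : ℝ) 1) {b : Primary} (hb : b ∈ S)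
    (hin : (γ s (τ s * u)).InChart b) : ContDiffAt ℝ ∞ (chartCurve μ τ γ b) (s, u) := by
  have h1 := (h.smooth s ⟨hs.1.le, hs.2⟩ (τ s * u) b hb hin).2.contDiffAt
    (prod_mem_nhds (Ico_mem_nhds hs.1 hs.2) univ_mem)
  exact ContDiffAt.comp (s, u) (f := fun x : ℝ × ℝ => (x.1, τ x.1 * x.2)) h1
    (h.tendsto_rescale hs)

theorem IsPeriodicOrbitFamily.hasDerivAt_chartCurve_u (h : IsPeriodicOrbitFamily μ c S ρ γ τ)
    {s u : ℝ} (hs : s ∈ Ioo (0 : ℝ) 1) {b : Primary} (hb : b ∈ S)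
    (hin : (γ s (τ s * u)).InChart b) :
    HasDerivAt (fun u => chartCurve μ τ γ b (s, u))
      (fderiv ℝ (chartCurve μ τ γ b) (s, u) (0, 1)) u := by
  have h1 := ((h.contDiffAt_chartCurve hs hb hin).differentiableAt (by simp)).hasFDerivAt
  have h2 : HasDerivAt (fun u : ℝ => (s, u)) ((0 : ℝ), (1 : ℝ)) u :=
    (hasDerivAt_const u s).prodMk (hasDerivAt_id u)
  exact h1.comp_hasDerivAt u h2

theorem IsPeriodicOrbitFamily.hasDerivAt_chartCurve_s (h : IsPeriodicOrbitFamily μ c S ρ γ τ)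
    {s u : ℝ} (hs : s ∈ Ioo (0 : ℝ) 1) {b : Primary} (hb : b ∈ S)
    (hin : (γ s (τ s * u)).InChart b) :
    HasDerivAt (fun s => chartCurve μ τ γ b (s, u))
      (fderiv ℝ (chartCurve μ τ γ b) (s, u) (1, 0)) s := by
  have h1 := ((h.contDiffAt_chartCurve hs hb hin).differentiableAt (by simp)).hasFDerivAt
  have h2 : HasDerivAt (fun s : ℝ => (s, u)) ((1 : ℝ), (0 : ℝ)) s :=
    (hasDerivAt_id s).prodMk (hasDerivAt_const s u)
  exact h1.comp_hasDerivAt s h2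

/-- The velocity of the rescaled orbits. -/
theorem IsPeriodicOrbitFamily.exists_hamiltonian (h : IsPeriodicOrbitFamily μ c S ρ γ τ)
    {s u : ℝ} (hs : s ∈ Ioo (0 : ℝ) 1) {b : Primary} (hb : b ∈ S)
    (hin : (γ s (τ s * u)).InChart b) :
    ∃ X, IsHamiltonianVector (moserQ (μ s) (c s) b) (chartCurve μ τ γ b (s, u)) X ∧
      fderiv ℝ (chartCurve μ τ γ b) (s, u) (0, 1) =
        (τ s * ρ b s (chartCurve μ τ γ b (s, u))) • X := by
  obtain ⟨X, hX, hd⟩ := h.integral s ⟨hs.1.le, hs.2⟩ (τ s * u) b hb hin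
  refine ⟨X, hX, ?_⟩
  have h1 : HasDerivAt (fun u : ℝ => τ s * u) (τ s) u := by
    simpa using (hasDerivAt_id u).const_mul (τ s)
  have h2 := hd.scomp u h1
  rw [mul_smul]
  exact (h.hasDerivAt_chartCurve_u hs hb hin).unique h2

theorem IsPeriodicOrbitFamily.position_ne_other (h : IsPeriodicOrbitFamily μ c S ρ γ τ)
    {s u : ℝ} (hs : s ∈ Ioo (0 : ℝ) 1) {b : Primary}
    (hin : (γ s (τ s * u)).InChart b) :
    chartY (chartCurve μ τ γ b (s, u)) + pos (μ s) b ≠ pos (μ s) b.other := by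
  have hm := h.mem s ⟨hs.1.le, hs.2⟩ (τ s * u)
  unfold chartCurve
  simp only
  rw [chartY_moserChart hin]
  revert hm hin
  cases γ s (τ s * u) with
  | regular q p => exact fun _ hm => hm.1.1 _
  | collision b' v =>
    rintro hin -
    obtain rfl : b' = b := hin
    exact pos_ne_other _ _

theorem IsPeriodicOrbitFamily.level (h : IsPeriodicOrbitFamily μ c S ρ γ τ)
    {s u : ℝ} (hs : s ∈ Ioo (0 : ℝ) 1) (hμ : μ s ∈ Ioo (0 : ℝ) 1) {b : Primary}
    (hin : (γ s (τ s * u)).InChart b) :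
    ‖(chartCurve μ τ γ b (s, u)).2‖ * moserF (μ s) (c s) b (chartCurve μ τ γ b (s, u)) =
      mass (μ s) b :=
  norm_mul_moserF_eq (mass_pos hμ b) (h.mem s ⟨hs.1.le, hs.2⟩ _) hin

/-- The symplectic area spanned by the two partial derivatives of the family. -/
theorem IsPeriodicOrbitFamily.omega_eq (h : IsPeriodicOrbitFamily μ c S ρ γ τ)
    (hμ1 : ∀ s ∈ Icc (0 : ℝ) 1, μ s ∈ Ioo (0 : ℝ) 1)
    {s u μ' c' : ℝ} (hs : s ∈ Ioo (0 : ℝ) 1) (hμ : HasDerivAt μ μ' s) (hc : HasDerivAt c c' s)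
    {b : Primary} (hb : b ∈ S) (hin : (γ s (τ s * u)).InChart b) :
    omega (fderiv ℝ (chartCurve μ τ γ b) (s, u) (1, 0))
      (fderiv ℝ (chartCurve μ τ γ b) (s, u) (0, 1)) =
    (τ s * ρ b s (chartCurve μ τ γ b (s, u))) *
      drift b (μ s) μ' c' (chartCurve μ τ γ b (s, u)) := by
  obtain ⟨X, hX, hXd⟩ := h.exists_hamiltonian hs hb hin
  have hd := h.hasDerivAt_chartCurve_s hs hb hin
  have htan := isTangent_of_hasDerivAt hd (Eventually.of_forall fun s' => onTS_moserChart _ _ _)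
  have hev : ∀ᶠ s' in 𝓝 s, (γ s' (τ s' * u)).InChart b :=
    ((by fun_prop : Continuous (fun s : ℝ => (s, u))).tendsto s).eventually
      (h.eventually_inChart hs hb hin)
  have hdr := fderiv_moserQ_of_level hμ hc hd (h.position_ne_other hs hin) (by
    filter_upwards [hev, isOpen_Ioo.mem_nhds hs] with s' h1 h2
    exact h.level h2 (hμ1 s' (Ioo_subset_Icc_self h2)) h1)
  rw [← hdr, hX.2 _ htan, hXd]
  simp only [omega, Prod.smul_fst, Prod.smul_snd, inner_smul_left, inner_smul_right]
  simp
  ring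

/-- The action form along the orbits. -/
theorem IsPeriodicOrbitFamily.inner_eq (h : IsPeriodicOrbitFamily μ c S ρ γ τ)
    {s u : ℝ} (hs : s ∈ Ioo (0 : ℝ) 1) (hμ : μ s ∈ Ioo (0 : ℝ) 1)
    {b : Primary} (hb : b ∈ S) (hin : (γ s (τ s * u)).InChart b) (g : ℝ × ℝ → ℝ) :
    actionForm (chartCurve μ τ γ b) g (s, u) (0, 1) =
    (τ s * ρ b s (chartCurve μ τ γ b (s, u))) * radialQ (μ s) b (chartCurve μ τ γ b (s, u)) +
      fderiv ℝ g (s, u) (0, 1) := by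
  obtain ⟨X, hX, hXd⟩ := h.exists_hamiltonian hs hb hin
  have hTS : OnTS (chartCurve μ τ γ b (s, u)) := onTS_moserChart _ _ _
  have hz : DifferentiableAt ℝ (chartCurve μ τ γ b) (s, u) :=
    (h.contDiffAt_chartCurve hs hb hin).differentiableAt (by simp)
  have h1 : fderiv ℝ (fun x => (chartCurve μ τ γ b x).1) (s, u) (0, 1) =
      (fderiv ℝ (chartCurve μ τ γ b) (s, u) (0, 1)).1 := by
    rw [hz.hasFDerivAt.fst.fderiv]; rfl
  rw [actionForm_apply, h1, hXd, Prod.smul_fst, inner_smul_right,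
    inner_snd_hamiltonian hTS (h.position_ne_other hs hin)
      (h.level hs hμ hin) hX]

end Family

/-! ### Uniform bounds near the end of the family -/

/-- The part of the family of hypersurfaces that lies over `D`, in the chart at `b`. -/
def chartPiece (μ c : ℝ → ℝ) (S : Set Primary) (b : Primary) (D : Set E3) (s₀ : ℝ) :
    Set (ℝ × (E4 × E4)) :=
  {x | x.1 ∈ Icc s₀ 1 ∧ x.2 ∈ chartSurface (μ x.1) (c x.1) S b ∧
    chartY x.2 + pos (μ x.1) b ∈ D}

theorem OnTS.of_mem_chartSurface {μ c : ℝ} {S : Set Primary} {b : Primary} {z : E4 × E4}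
    (hz : z ∈ chartSurface μ c S b) : OnTS z := by
  obtain ⟨x, -, rfl⟩ := hz
  exact onTS_moserChart _ _ _

theorem level_of_mem_chartSurface {μ c : ℝ} {S : Set Primary} {b : Primary} {z : E4 × E4}
    (hm : 0 < mass μ b) (hz : z ∈ chartSurface μ c S b) :
    ‖z.2‖ * moserF μ c b z = mass μ b := by
  obtain ⟨x, hx, rfl⟩ := hz
  exact norm_mul_moserF_eq hm hx.1 hx.2

theorem ne_other_of_mem_chartSurface {μ c : ℝ} {S : Set Primary} {b : Primary} {z : E4 × E4}
    (hz : z ∈ chartSurface μ c S b) : chartY z + pos μ b ≠ pos μ b.other := by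
  obtain ⟨x, hx, rfl⟩ := hz
  rw [chartY_moserChart hx.2]
  obtain ⟨h1, h2⟩ := hx
  cases x with
  | regular q p => exact h1.1.1 _
  | collision b' v =>
    obtain rfl : b' = b := h2
    exact pos_ne_other _ _

theorem exists_left_interval {p : ℝ → Prop} (h : ∀ᶠ s in 𝓝[≤] (1 : ℝ), p s) :
    ∃ s₀ ∈ Ico (0 : ℝ) 1, ∀ s ∈ Icc s₀ 1, p s := by
  obtain ⟨l, hl, h'⟩ := mem_nhdsLE_iff_exists_Icc_subset.1 h
  exact ⟨max l 0, ⟨le_max_right _ _, max_lt hl one_pos⟩, fun s hs =>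
    h' ⟨(le_max_left _ _).trans hs.1, hs.2⟩⟩

section

variable {μ c : ℝ → ℝ} {S : Set Primary} {b : Primary} {D : Set E3}

/-- A function that is positive over `D` for the final parameters is bounded from below for the
parameters close to the final ones. -/
theorem exists_pos_le (hμc : ContinuousOn μ (Icc 0 1)) (hcc : ContinuousOn c (Icc 0 1))
    (hμ1 : ∀ s ∈ Icc (0 : ℝ) 1, μ s ∈ Ioo (0 : ℝ) 1) (hD : IsCompact D)
    (hb : pos (μ 1) b.other ∉ D)
    (hfib : ∀ z, OnTS z → chartY z + pos (μ 1) b ∈ D →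
      ‖z.2‖ * moserF (μ 1) (c 1) b z = mass (μ 1) b → z ∈ chartSurface (μ 1) (c 1) S b)
    {φ : ℝ × (E4 × E4) → ℝ} {s₀ : ℝ} (hs₀ : s₀ ∈ Ico (0 : ℝ) 1)
    (hφ : ContinuousOn φ (chartPiece μ c S b D s₀))
    (hpos : ∀ z ∈ chartSurface (μ 1) (c 1) S b, chartY z + pos (μ 1) b ∈ D → 0 < φ (1, z)) :
    ∃ δ > 0, ∀ᶠ s in 𝓝[<] (1 : ℝ), ∀ z ∈ chartSurface (μ s) (c s) S b,
      chartY z + pos (μ s) b ∈ D → δ ≤ φ (s, z) := by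
  have h1 : ContinuousWithinAt μ (Icc 0 1) 1 := hμc 1 (right_mem_Icc.2 zero_le_one)
  have hne : ∀ᶠ s in 𝓝[≤] (1 : ℝ), pos (μ s) b.other ∉ D := by
    rw [← nhdsWithin_Icc_eq_nhdsLE (zero_lt_one' ℝ)]
    exact ((continuous_pos b.other).continuousAt.tendsto.comp h1).eventually
      (hD.isClosed.isOpen_compl.mem_nhds hb)
  obtain ⟨s₁, hs₁, hs₁'⟩ := exists_left_interval hne
  obtain ⟨s₂, h02, h12, h21⟩ : ∃ s₂, s₀ ≤ s₂ ∧ s₁ ≤ s₂ ∧ s₂ < 1 :=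
    ⟨max s₀ s₁, le_max_left _ _, le_max_right _ _, max_lt hs₀.2 hs₁.2⟩
  have hsub : Icc s₂ 1 ⊆ Icc (0 : ℝ) 1 := Icc_subset_Icc_left (hs₀.1.trans h02)
  have hpar : ContinuousOn (fun s => (μ s, c s)) (Icc s₂ 1) :=
    (hμc.mono hsub).prodMk (hcc.mono hsub)
  have hCF := isCompact_chartFamily b (isCompact_Icc.image_of_continuousOn hpar) hD (by
    rintro _ ⟨s, hs, rfl⟩
    exact hs₁' s ⟨h12.trans hs.1, hs.2⟩)
  set P := (fun s => (μ s, c s)) '' Icc s₂ 1 with hP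
  -- The hypersurface itself need not be closed, being cut out by a component condition. K keeps
  -- only the level equation over D; it is compact and has the same fibre at s = 1 by `hfib`.
  set K : Set (ℝ × (E4 × E4)) :=
    (Icc s₂ 1 ×ˢ univ) ∩ (fun x => ((μ x.1, c x.1), x.2)) ⁻¹' chartFamily b P D with hK
  have hKc : IsCompact K := by
    have hcl : IsClosed K := by
      refine ContinuousOn.preimage_isClosed_of_isClosed ?_ (isClosed_Icc.prod isClosed_univ)
        hCF.isClosed
      exact (hpar.comp continuousOn_fst fun x hx => hx.1).prodMk continuousOn_snd
    refine ((isCompact_Icc (a := s₂) (b := 1)).prod (hCF.image continuous_snd)).of_isClosed_subset hcl ?_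
    rintro ⟨s, z⟩ ⟨hs, hz⟩
    exact ⟨hs.1, _, hz, rfl⟩
  have hWK : chartPiece μ c S b D s₂ ⊆ K := by
    rintro ⟨s, z⟩ ⟨hs, hz, hzD⟩
    exact ⟨⟨hs, mem_univ _⟩, ⟨s, hs, rfl⟩, OnTS.of_mem_chartSurface hz, hzD,
      level_of_mem_chartSurface (mass_pos (hμ1 s (hsub hs)) b) hz⟩
  obtain ⟨δ, hδ, hev⟩ := eventually_forall_le_of_isCompact hKc hWK (t₀ := 1)
    (fun z hz => ⟨right_mem_Icc.2 h21.le, hfib z hz.2.2.1 hz.2.2.2.1 hz.2.2.2.2, hz.2.2.2.1⟩)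
    (hφ.mono fun x hx => ⟨⟨h02.trans hx.1.1, hx.1.2⟩, hx.2⟩)
    (fun z hz => hpos z hz.2.1 hz.2.2)
  refine ⟨δ, hδ, ?_⟩
  filter_upwards [nhdsWithin_le_nhds hev, Ioo_mem_nhdsLT h21] with s hs hs' z hz hzD
  exact hs z ⟨⟨hs'.1.le, hs'.2.le⟩, hz, hzD⟩

theorem continuousOn_chartPiece_of_params {Φ : (ℝ × ℝ) × (E4 × E4) → ℝ} {V : Set ((ℝ × ℝ) × (E4 × E4))}
    {s₀ : ℝ} (hμc : ContinuousOn μ (Icc 0 1)) (hcc : ContinuousOn c (Icc 0 1))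
    (hs₀ : 0 ≤ s₀) (hΦ : ContinuousOn Φ V)
    (hV : ∀ x ∈ chartPiece μ c S b D s₀, ((μ x.1, c x.1), x.2) ∈ V) :
    ContinuousOn (fun x : ℝ × (E4 × E4) => Φ ((μ x.1, c x.1), x.2)) (chartPiece μ c S b D s₀) := by
  have hsub : Icc s₀ 1 ⊆ Icc (0 : ℝ) 1 := Icc_subset_Icc_left hs₀
  have hpar : ContinuousOn (fun s => (μ s, c s)) (Icc s₀ 1) :=
    (hμc.mono hsub).prodMk (hcc.mono hsub)
  exact hΦ.comp ((hpar.comp continuousOn_fst fun x hx => hx.1).prodMk continuousOn_snd) hV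

/-- The size of the drift for unit speed of the parameters. -/
noncomputable def driftBound (b : Primary) (x : (ℝ × ℝ) × (E4 × E4)) : ℝ :=
  mass x.1.1 b + mass x.1.1 b * ‖x.2.2‖ *
    ((1 - x.2.1 0) / ‖chartY x.2 + pos x.1.1 b - pos x.1.1 b.other‖ + 3)

theorem continuousOn_driftBound (b : Primary) : ContinuousOn (driftBound b)
    {x | chartY x.2 + pos x.1.1 b ≠ pos x.1.1 b.other} := by
  have h1 : Continuous fun x : (ℝ × ℝ) × (E4 × E4) => mass x.1.1 b :=
    (continuous_mass b).comp (by fun_prop)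
  have h2 : ∀ b, Continuous fun x : (ℝ × ℝ) × (E4 × E4) => pos x.1.1 b := fun b =>
    (continuous_pos b).comp (by fun_prop)
  have h3 : Continuous fun x : (ℝ × ℝ) × (E4 × E4) => chartY x.2 :=
    continuous_chartY.comp (by fun_prop)
  unfold driftBound
  refine (h1.continuousOn).add (ContinuousOn.mul (by fun_prop) (ContinuousOn.add ?_ (by fun_prop)))
  refine ContinuousOn.div (by fun_prop) (by fun_prop) fun x hx => ?_
  exact norm_ne_zero_iff.2 (sub_ne_zero.2 hx)

theorem OnTS.abs_apply_le {z : E4 × E4} (hz : OnTS z) (i : Fin 4) : |z.1 i| ≤ 1 := by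
  have h1 : ‖z.1‖ = 1 := by
    have := hz.1
    nlinarith [norm_nonneg z.1]
  have := PiLp.norm_apply_le z.1 i
  rwa [h1] at this

/-- The constant 3 in `driftBound` consists of 1 for |ξ₂| and 2 for 1 - ξ₀. -/
theorem drift_le {μ μ' c' B : ℝ} {c : ℝ} {z : E4 × E4} (hz : OnTS z) (hm : 0 < mass μ b)
    (hμ' : |μ'| ≤ B) (hc' : |c'| ≤ B) : drift b μ μ' c' z ≤ B * driftBound b ((μ, c), z) := by
  have hB : 0 ≤ B := (abs_nonneg _).trans hμ'
  have h0 : 0 ≤ 1 - z.1 0 := sub_nonneg.2 hz.fst_zero_le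
  set R := (1 - z.1 0) / ‖chartY z + pos μ b - pos μ b.other‖ with hR
  have hR0 : 0 ≤ R := by positivity
  have hsig : |axisSign b| = 1 := by cases b <;> simp [axisSign]
  have hz2 := hz.abs_apply_le 2
  have hz0 := (abs_le.1 (hz.abs_apply_le 0)).1
  have e1 : axisSign b * μ' ≤ B := by
    refine (le_abs_self _).trans ?_
    rw [abs_mul, hsig, one_mul]; exact hμ'
  have e2 : |axisSign b * R + z.1 2| ≤ R + 1 := by
    refine (abs_add_le _ _).trans (add_le_add ?_ hz2)
    rw [abs_mul, hsig, one_mul, abs_of_nonneg hR0]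
  have e3 : |μ' * (axisSign b * R + z.1 2)| ≤ B * (R + 1) := by
    rw [abs_mul]; exact mul_le_mul hμ' e2 (abs_nonneg _) hB
  have e4 : |c' * (1 - z.1 0)| ≤ B * 2 := by
    rw [abs_mul, abs_of_nonneg h0]; exact mul_le_mul hc' (by linarith) h0 hB
  have e5 : -(μ' * (axisSign b * R + z.1 2) - c' * (1 - z.1 0)) ≤ B * (R + 3) := by
    have := neg_abs_le (μ' * (axisSign b * R + z.1 2))
    have := le_abs_self (c' * (1 - z.1 0))
    linarith
  have e6 := mul_le_mul_of_nonneg_left e5 (by positivity : 0 ≤ mass μ b * ‖z.2‖)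
  have e7 := mul_le_mul_of_nonneg_left e1 hm.le
  simp only [drift, driftBound, ← hR]
  linarith

end

theorem exists_deriv_bound {f : ℝ → ℝ} (hf : ContDiffOn ℝ ∞ f (Icc 0 1)) :
    ∃ B, ∀ s ∈ Ioo (0 : ℝ) 1, ∃ f', HasDerivAt f f' s ∧ |f'| ≤ B := by
  have h1 := hf.continuousOn_derivWithin (uniqueDiffOn_Icc zero_lt_one) (by simp)
  obtain ⟨B, hB⟩ := isCompact_Icc.exists_bound_of_continuousOn h1
  refine ⟨B, fun s hs => ⟨derivWithin f (Icc 0 1) s, ?_, hB s (Ioo_subset_Icc_self hs)⟩⟩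
  exact ((hf.differentiableOn (by simp) s (Ioo_subset_Icc_self hs)).hasDerivWithinAt).hasDerivAt
    (Icc_mem_nhds hs.1 hs.2)

/-! ### Bounded periods from local action forms -/

/-- A version of `bounded_of_curl_le` for a form that is given locally. -/
theorem bounded_of_local_forms {ι : Type*} {s₁ s₂ C δ : ℝ} (h12 : s₁ < s₂) (hC : 0 ≤ C)
    (hδ : 0 < δ) {θ : ι → ℝ × ℝ → ℝ × ℝ →L[ℝ] ℝ} {V : ι → Set (ℝ × ℝ)} {τ : ℝ → ℝ}
    (hcov : ∀ s ∈ Ioo s₁ 1, ∀ u : ℝ, ∃ i, (s, u) ∈ V i)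
    (hopen : ∀ i, ∀ s ∈ Ioo s₁ 1, ∀ u : ℝ, (s, u) ∈ V i → V i ∈ 𝓝 (s, u))
    (hagree : ∀ i j, ∀ s ∈ Ioo s₁ 1, ∀ u : ℝ, (s, u) ∈ V i → (s, u) ∈ V j →
      θ i (s, u) = θ j (s, u))
    (hper : ∀ i, ∀ s ∈ Ioo s₁ 1, (s, 0) ∈ V i → (s, 1) ∈ V i ∧ θ i (s, 1) = θ i (s, 0))
    (hsm : ∀ i, ∀ s ∈ Ioo s₁ 1, ∀ u : ℝ, (s, u) ∈ V i → ContDiffAt ℝ 1 (θ i) (s, u))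
    (hcurl : ∀ i, ∀ s ∈ Ioo s₁ 1, ∀ u : ℝ, (s, u) ∈ V i →
      fderiv ℝ (θ i) (s, u) (1, 0) (0, 1) - fderiv ℝ (θ i) (s, u) (0, 1) (1, 0)
        ≤ C * θ i (s, u) (0, 1))
    (hpos : ∀ i, ∀ s ∈ Ioo s₁ 1, ∀ u : ℝ, (s, u) ∈ V i → δ * τ s ≤ θ i (s, u) (0, 1)) :
    ∃ B, ∀ s ∈ Ico s₂ 1, τ s ≤ B := by
  classical
  -- An arbitrary local form is chosen at each point. Since the local forms agree on overlaps of
  -- open sets, the choice coincides with each of them nearby and inherits smoothness and curl.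
  set Θ : ℝ × ℝ → ℝ × ℝ →L[ℝ] ℝ := fun x =>
    if h : ∃ i, x ∈ V i then θ h.choose x else 0 with hΘ
  have key : ∀ i, ∀ s ∈ Ioo s₁ 1, ∀ u : ℝ, (s, u) ∈ V i → Θ (s, u) = θ i (s, u) := by
    intro i s hs u hi
    have h : ∃ i, (s, u) ∈ V i := ⟨i, hi⟩
    simp only [hΘ, dif_pos h]
    exact hagree _ _ s hs u h.choose_spec hi
  have keyev : ∀ i, ∀ s ∈ Ioo s₁ 1, ∀ u : ℝ, (s, u) ∈ V i → Θ =ᶠ[𝓝 (s, u)] θ i := by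
    intro i s hs u hi
    filter_upwards [hopen i s hs u hi,
      prod_mem_nhds (isOpen_Ioo.mem_nhds hs) (univ_mem (f := 𝓝 u))] with x hx hx'
    exact key i x.1 hx'.1 x.2 hx
  refine bounded_of_curl_le (θ := Θ) h12 hC hδ ?_ ?_ ?_ ?_
  · intro s hs u
    obtain ⟨i, hi⟩ := hcov s hs u
    exact (hsm i s hs u hi).congr_of_eventuallyEq (keyev i s hs u hi)
  · intro s hs
    obtain ⟨i, hi⟩ := hcov s hs 0
    obtain ⟨h1, h2⟩ := hper i s hs hi
    rw [key i s hs 1 h1, key i s hs 0 hi, h2]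
  · intro s hs u
    obtain ⟨i, hi⟩ := hcov s hs u
    rw [(keyev i s hs u hi).fderiv_eq, key i s hs u hi]
    exact hcurl i s hs u hi
  · intro s hs u
    obtain ⟨i, hi⟩ := hcov s hs u
    rw [key i s hs u hi]
    exact hpos i s hs u hi

/-! ### The Gronwall estimate for families of periodic orbits. -/

section Family

variable {μ c : ℝ → ℝ} {S : Set Primary} {ρ : Primary → ℝ → E4 × E4 → ℝ} {γ : ℝ → ℝ → RegPoint}
  {τ : ℝ → ℝ}

theorem IsPeriodicOrbitFamily.periodic_rescaled (h : IsPeriodicOrbitFamily μ c S ρ γ τ) {s u : ℝ}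
    (hs : s ∈ Ioo (0 : ℝ) 1) : γ s (τ s * (u + 1)) = γ s (τ s * u) := by
  rw [mul_add, mul_one]
  exact h.periodic s ⟨hs.1.le, hs.2⟩ _

theorem fderiv_eq_of_periodic {F : Type*} [NormedAddCommGroup F] [NormedSpace ℝ F]
    {f : ℝ × ℝ → F} {s : ℝ} (hs : s ∈ Ioo (0 : ℝ) 1)
    (hf : ∀ s ∈ Ioo (0 : ℝ) 1, ∀ u, f (s, u + 1) = f (s, u)) :
    fderiv ℝ f (s, 1) = fderiv ℝ f (s, 0) := by
  have e : (fun x => f (x + ((0 : ℝ), (1 : ℝ)))) =ᶠ[𝓝 (s, 0)] f := by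
    filter_upwards [prod_mem_nhds (isOpen_Ioo.mem_nhds hs) (univ_mem (f := 𝓝 (0 : ℝ)))] with x hx
    have e : x + ((0 : ℝ), (1 : ℝ)) = (x.1, x.2 + 1) := by ext <;> simp
    rw [e]
    exact hf x.1 hx.1 x.2
  rw [← e.fderiv_eq, fderiv_comp_add_right]
  simp

theorem IsPeriodicOrbitFamily.actionForm_periodic (h : IsPeriodicOrbitFamily μ c S ρ γ τ) {s : ℝ}
    (hs : s ∈ Ioo (0 : ℝ) 1) (b : Primary) (G : E4 × E4 → ℝ) :
    actionForm (chartCurve μ τ γ b) (fun x => G (chartCurve μ τ γ b x)) (s, 1) =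
      actionForm (chartCurve μ τ γ b) (fun x => G (chartCurve μ τ γ b x)) (s, 0) := by
  have hz : ∀ s ∈ Ioo (0 : ℝ) 1, ∀ u,
      chartCurve μ τ γ b (s, u + 1) = chartCurve μ τ γ b (s, u) := fun s hs u => by
    simp only [chartCurve, h.periodic_rescaled hs]
  have h0 : chartCurve μ τ γ b (s, 1) = chartCurve μ τ γ b (s, 0) := by
    simpa using hz s hs 0
  unfold actionForm
  rw [h0, fderiv_eq_of_periodic hs (f := fun x => (chartCurve μ τ γ b x).1)
    (fun s hs u => by rw [hz s hs u]),
    fderiv_eq_of_periodic hs (f := fun x => G (chartCurve μ τ γ b x))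
    (fun s hs u => by rw [hz s hs u])]

/-- The rescaled family is bounded as soon as the hypersurfaces near the end of the family are
covered by pieces on which the action form, modified by an exact form, is positive on the
vector field. -/
theorem IsPeriodicOrbitFamily.exists_bound (h : IsPeriodicOrbitFamily μ c S ρ γ τ)
    (hρ : IsTimeScale μ c S ρ)
    (hμ : ContDiffOn ℝ ∞ μ (Icc 0 1)) (hc : ContDiffOn ℝ ∞ c (Icc 0 1))
    (hμ1 : ∀ s ∈ Icc (0 : ℝ) 1, μ s ∈ Ioo (0 : ℝ) 1)
    {ι : Type*} [Finite ι] {b : ι → Primary} {D O : ι → Set E3} {G : ι → E4 × E4 → ℝ}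
    {φ : ι → ℝ × (E4 × E4) → ℝ} {s₀ : ℝ} (hs₀ : s₀ ∈ Ico (0 : ℝ) 1)
    (hbS : ∀ i, b i ∈ S) (hD : ∀ i, IsCompact (D i)) (hO : ∀ i, IsOpen (O i))
    (hOD : ∀ i, O i ⊆ D i) (hoth : ∀ i, pos (μ 1) (b i).other ∉ D i)
    (hfib : ∀ i z, OnTS z → chartY z + pos (μ 1) (b i) ∈ D i →
      ‖z.2‖ * moserF (μ 1) (c 1) (b i) z = mass (μ 1) (b i) →
      z ∈ chartSurface (μ 1) (c 1) S (b i))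
    (hcov : ∀ s ∈ Ico s₀ 1, ∀ x ∈ regSurface (μ s) (c s) S, ∃ i, x.position (μ s) ∈ O i)
    (hG : ∀ i, ∀ s ∈ Ico s₀ 1, ∀ z ∈ chartSurface (μ s) (c s) S (b i),
      chartY z + pos (μ s) (b i) ∈ O i → ContDiffAt ℝ ∞ (G i) z ∧
        ∀ X, IsHamiltonianVector (moserQ (μ s) (c s) (b i)) z X →
          radialQ (μ s) (b i) z + fderiv ℝ (G i) z X = φ i (s, z))
    (hφc : ∀ i, ContinuousOn (φ i) (chartPiece μ c S (b i) (D i) s₀))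
    (hφpos : ∀ i, ∀ z ∈ chartSurface (μ 1) (c 1) S (b i), chartY z + pos (μ 1) (b i) ∈ D i →
      0 < φ i (1, z))
    (hagree : ∀ i j, ∀ s ∈ Ioo s₀ 1, ∀ u, (γ s (τ s * u)).position (μ s) ∈ O i →
      (γ s (τ s * u)).position (μ s) ∈ O j →
      (γ s (τ s * u)).InChart (b i) → (γ s (τ s * u)).InChart (b j) →
      actionForm (chartCurve μ τ γ (b i)) (fun x => G i (chartCurve μ τ γ (b i) x)) (s, u) =
      actionForm (chartCurve μ τ γ (b j)) (fun x => G j (chartCurve μ τ γ (b j) x)) (s, u)) :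
    ∃ s₂ < 1, ∃ B, ∀ s ∈ Ico s₂ 1, τ s ≤ B := by
  have hμc := hμ.continuousOn
  have hcc := hc.continuousOn
  obtain ⟨B₁, hB₁⟩ := exists_deriv_bound hμ
  obtain ⟨B₂, hB₂⟩ := exists_deriv_bound hc
  set B := max (max B₁ B₂) 0 with hB
  -- uniform bounds for each piece
  have unif : ∀ i, ∃ δ > 0, ∀ᶠ s in 𝓝[<] (1 : ℝ), ∀ z ∈ chartSurface (μ s) (c s) S (b i),
      chartY z + pos (μ s) (b i) ∈ D i → δ ≤ φ i (s, z) ∧ δ ≤ ρ (b i) s z ∧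
        driftBound (b i) ((μ s, c s), z) ≤ δ⁻¹ := by
    intro i
    obtain ⟨δ₁, hδ₁, h₁⟩ := exists_pos_le hμc hcc hμ1 (hD i) (hoth i) (hfib i) hs₀ (hφc i)
      (hφpos i)
    have hsub : chartPiece μ c S (b i) (D i) s₀ ⊆
        {x | x.1 ∈ Icc (0 : ℝ) 1 ∧ x.2 ∈ chartSurface (μ x.1) (c x.1) S (b i)} :=
      fun x hx => ⟨⟨hs₀.1.trans hx.1.1, hx.1.2⟩, hx.2.1⟩
    obtain ⟨δ₂, hδ₂, h₂⟩ := exists_pos_le hμc hcc hμ1 (hD i) (hoth i) (hfib i) hs₀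
      (φ := fun x => ρ (b i) x.1 x.2) ((hρ (b i) (hbS i)).1.mono hsub)
      (fun z hz _ => (hρ (b i) (hbS i)).2 1 (right_mem_Icc.2 zero_le_one) z hz)
    have hdb0 : ∀ s ∈ Icc (0 : ℝ) 1, ∀ z, OnTS z → 0 ≤ driftBound (b i) ((μ s, c s), z) := by
      intro s hs z hz
      have := mass_pos (hμ1 s hs) (b i)
      have : 0 ≤ 1 - z.1 0 := sub_nonneg.2 hz.fst_zero_le
      unfold driftBound
      positivity
    -- An upper bound for the drift is obtained from the positive lower bound for the inverse of 1 +
    -- `driftBound`.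
    obtain ⟨δ₃, hδ₃, h₃⟩ := exists_pos_le hμc hcc hμ1 (hD i) (hoth i) (hfib i) hs₀
      (φ := fun x => (1 + driftBound (b i) ((μ x.1, c x.1), x.2))⁻¹) (by
        refine ContinuousOn.inv₀ (continuousOn_const.add
          (continuousOn_chartPiece_of_params hμc hcc hs₀.1 (continuousOn_driftBound (b i))
            fun x hx => ne_other_of_mem_chartSurface hx.2.1)) fun x hx => ?_
        have := hdb0 x.1 (hsub hx).1 x.2 (OnTS.of_mem_chartSurface hx.2.1)
        positivity)
      (fun z hz _ => by
        have := hdb0 1 (right_mem_Icc.2 zero_le_one) z (OnTS.of_mem_chartSurface hz)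
        positivity)
    refine ⟨min δ₁ (min δ₂ δ₃), by positivity, ?_⟩
    filter_upwards [h₁, h₂, h₃, Ioo_mem_nhdsLT (zero_lt_one' ℝ)] with s g₁ g₂ g₃ hs z hz hzD
    refine ⟨(min_le_left _ _).trans (g₁ z hz hzD),
      ((min_le_right _ _).trans (min_le_left _ _)).trans (g₂ z hz hzD), ?_⟩
    have h5 : min δ₁ (min δ₂ δ₃) ≤ (1 + driftBound (b i) ((μ s, c s), z))⁻¹ :=
      ((min_le_right _ _).trans (min_le_right _ _)).trans (g₃ z hz hzD)
    have h6 := hdb0 s (Ioo_subset_Icc_self hs) z (OnTS.of_mem_chartSurface hz)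
    have h7 := (le_inv_comm₀ (by positivity) (by positivity)).1 h5
    linarith
  choose δ' hδ' hunif using unif
  obtain ⟨δ, hδ, hδle⟩ : ∃ δ > 0, ∀ i, δ ≤ δ' i := by
    rcases isEmpty_or_nonempty ι with he | he
    · exact ⟨1, one_pos, fun i => (he.false i).elim⟩
    · obtain ⟨i, hi⟩ := Finite.exists_min δ'
      exact ⟨δ' i, hδ' i, hi⟩
  -- With the other primary outside D i, an orbit point over O i cannot be a collision with it, so
  -- it lies in the chart of the piece.
  have hne : ∀ i, ∀ᶠ s in 𝓝[<] (1 : ℝ), pos (μ s) (b i).other ∉ D i := fun i => by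
    have h1 : ContinuousWithinAt μ (Ioo 0 1) 1 :=
      (hμc 1 (right_mem_Icc.2 zero_le_one)).mono Ioo_subset_Icc_self
    rw [← nhdsWithin_Ioo_eq_nhdsLT (zero_lt_one' ℝ)]
    exact ((continuous_pos _).continuousAt.tendsto.comp h1).eventually
      ((hD i).isClosed.isOpen_compl.mem_nhds (hoth i))
  have hall := (eventually_all.2 hunif).and (eventually_all.2 hne)
  obtain ⟨l, hl, hl'⟩ := mem_nhdsLT_iff_exists_Ioo_subset.1 hall
  set s₁ := max l s₀ with hs₁
  have hs11 : s₁ < 1 := max_lt hl hs₀.2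
  have hmem : ∀ s ∈ Ioo s₁ 1, s ∈ Ioo l 1 ∧ s ∈ Ioo s₀ 1 ∧ s ∈ Ioo (0 : ℝ) 1 := fun s hs =>
    ⟨⟨(le_max_left _ _).trans_lt hs.1, hs.2⟩, ⟨(le_max_right _ _).trans_lt hs.1, hs.2⟩,
      ⟨(hs₀.1.trans (le_max_right _ _)).trans_lt hs.1, hs.2⟩⟩
  obtain ⟨s₂, h12, h21⟩ := exists_between hs11
  refine ⟨s₂, h21, ?_⟩
  set V : ι → Set (ℝ × ℝ) := fun i => {x | (γ x.1 (τ x.1 * x.2)).InChart (b i) ∧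
    (γ x.1 (τ x.1 * x.2)).position (μ x.1) ∈ O i} with hV
  set θ : ι → ℝ × ℝ → ℝ × ℝ →L[ℝ] ℝ := fun i =>
    actionForm (chartCurve μ τ γ (b i)) (fun x => G i (chartCurve μ τ γ (b i) x)) with hθ
  -- data at a point of a piece
  have hz : ∀ i, ∀ s ∈ Ioo s₁ 1, ∀ u, (s, u) ∈ V i →
      chartCurve μ τ γ (b i) (s, u) ∈ chartSurface (μ s) (c s) S (b i) ∧
      chartY (chartCurve μ τ γ (b i) (s, u)) + pos (μ s) (b i) ∈ O i := by
    intro i s hs u hi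
    refine ⟨⟨_, ⟨h.mem s ⟨(hmem s hs).2.2.1.le, hs.2⟩ _, hi.1⟩, rfl⟩, ?_⟩
    have := hi.2
    rwa [← chartY_moserChart hi.1] at this
  have hcc' : ∀ i, ∀ s ∈ Ioo s₁ 1, ∀ u, (s, u) ∈ V i →
      ContDiffAt ℝ ∞ (chartCurve μ τ γ (b i)) (s, u) ∧
      ContDiffAt ℝ ∞ (fun x => G i (chartCurve μ τ γ (b i) x)) (s, u) := by
    intro i s hs u hi
    have h1 := h.contDiffAt_chartCurve (hmem s hs).2.2 (hbS i) hi.1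
    obtain ⟨h2, h3⟩ := hz i s hs u hi
    exact ⟨h1, ContDiffAt.comp (s, u) (hG i s ⟨(hmem s hs).2.1.1.le, hs.2⟩ _ h2 h3).1 h1⟩
  have hval : ∀ i, ∀ s ∈ Ioo s₁ 1, ∀ u, (s, u) ∈ V i → θ i (s, u) (0, 1) =
      (τ s * ρ (b i) s (chartCurve μ τ γ (b i) (s, u))) *
        φ i (s, chartCurve μ τ γ (b i) (s, u)) := by
    intro i s hs u hi
    obtain ⟨h2, h3⟩ := hz i s hs u hi
    obtain ⟨h4, h5⟩ := hG i s ⟨(hmem s hs).2.1.1.le, hs.2⟩ _ h2 h3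
    obtain ⟨X, hX, hXd⟩ := h.exists_hamiltonian (hmem s hs).2.2 (hbS i) hi.1
    have h6 : fderiv ℝ (fun x => G i (chartCurve μ τ γ (b i) x)) (s, u) (0, 1) =
        (τ s * ρ (b i) s (chartCurve μ τ γ (b i) (s, u))) *
          fderiv ℝ (G i) (chartCurve μ τ γ (b i) (s, u)) X := by
      have h7 := (h4.differentiableAt (by simp)).hasFDerivAt.comp (s, u)
        ((hcc' i s hs u hi).1.differentiableAt (by simp)).hasFDerivAt
      have h8 := h7.fderiv
      simp only [Function.comp_def] at h8
      rw [h8, ContinuousLinearMap.comp_apply, hXd, map_smul, smul_eq_mul]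
    rw [hθ, h.inner_eq (hmem s hs).2.2 (hμ1 s (Ioo_subset_Icc_self (hmem s hs).2.2)) (hbS i) hi.1,
      h6, ← h5 X hX]
    ring
  have hbd : ∀ i, ∀ s ∈ Ioo s₁ 1, ∀ u, (s, u) ∈ V i →
      δ ≤ φ i (s, chartCurve μ τ γ (b i) (s, u)) ∧
      δ ≤ ρ (b i) s (chartCurve μ τ γ (b i) (s, u)) ∧
      driftBound (b i) ((μ s, c s), chartCurve μ τ γ (b i) (s, u)) ≤ δ⁻¹ := by
    intro i s hs u hi
    obtain ⟨h2, h3⟩ := hz i s hs u hi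
    obtain ⟨g1, g2, g3⟩ := (hl' (hmem s hs).1).1 i _ h2 (hOD i h3)
    exact ⟨(hδle i).trans g1, (hδle i).trans g2, g3.trans (inv_anti₀ hδ (hδle i))⟩
  have hτ : ∀ s ∈ Ioo s₁ 1, 0 < τ s := fun s hs =>
    h.period_pos s ⟨(hmem s hs).2.2.1.le, hs.2⟩
  -- With φ ≥ δ, ρ ≥ δ and drift ≤ B/δ one has drift ≤ (B/δ²)φ, which gives the Gronwall constant,
  -- and the form on the velocity is τρφ ≥ δ²τ.
  refine bounded_of_local_forms (θ := θ) (V := V) (C := B * (δ⁻¹ * δ⁻¹)) (δ := δ * δ) h12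
    (by positivity) (by positivity) ?_ ?_ ?_ ?_ ?_ ?_ ?_
  · intro s hs u
    have hm := h.mem s ⟨(hmem s hs).2.2.1.le, hs.2⟩ (τ s * u)
    obtain ⟨i, hi⟩ := hcov s ⟨(hmem s hs).2.1.1.le, hs.2⟩ _ hm
    refine ⟨i, ?_, hi⟩
    have hno := (hl' (hmem s hs).1).2 i
    simp only
    revert hi
    cases γ s (τ s * u) with
    | regular q p => exact fun _ => trivial
    | collision b' v =>
      intro hi
      have hi' : pos (μ s) b' ∈ O i := hi
      by_contra hne
      have hne' : b' ≠ b i := hne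
      have e : b' = (b i).other := by
        revert hne'; generalize b i = b''
        cases b' <;> cases b'' <;> simp [Primary.other]
      exact hno (hOD i (e ▸ hi'))
  · intro i s hs u hi
    have h1 := h.eventually_inChart (hmem s hs).2.2 (hbS i) hi.1
    have h2 : ContinuousAt (fun x => chartY (chartCurve μ τ γ (b i) x) + pos (μ x.1) (b i))
        (s, u) := by
      have hμs : ContinuousAt μ s :=
        (hμc s (Ioo_subset_Icc_self (hmem s hs).2.2)).continuousAt
          (Icc_mem_nhds (hmem s hs).2.2.1 hs.2)
      have hμs' : ContinuousAt (fun x : ℝ × ℝ => μ x.1) (s, u) :=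
        ContinuousAt.comp (f := Prod.fst) hμs continuousAt_fst
      exact (continuous_chartY.continuousAt.comp (hcc' i s hs u hi).1.continuousAt).add
        ((continuous_pos (b i)).continuousAt.comp hμs')
    filter_upwards [h1, h2.eventually ((hO i).mem_nhds (hz i s hs u hi).2)] with x hx1 hx2
    refine ⟨hx1, ?_⟩
    rw [← chartY_moserChart hx1]
    exact hx2
  · intro i j s hs u hi hj
    exact hagree i j s (hmem s hs).2.1 u hi.2 hj.2 hi.1 hj.1
  · intro i s hs hi
    have e := h.periodic_rescaled (u := 0) (hmem s hs).2.2
    rw [zero_add] at e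
    refine ⟨?_, h.actionForm_periodic (hmem s hs).2.2 _ _⟩
    simp only [hV, mem_ofPred_eq] at hi ⊢
    rwa [e]
  · intro i s hs u hi
    exact contDiffAt_actionForm (hcc' i s hs u hi).1 (hcc' i s hs u hi).2
  · intro i s hs u hi
    obtain ⟨μ', hμ', hμb⟩ := hB₁ s (hmem s hs).2.2
    obtain ⟨c', hc', hcb⟩ := hB₂ s (hmem s hs).2.2
    have hm := hμ1 s (Ioo_subset_Icc_self (hmem s hs).2.2)
    obtain ⟨g1, g2, g3⟩ := hbd i s hs u hi
    have hts := hτ s hs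
    rw [hθ, curl_actionForm (hcc' i s hs u hi).1 (hcc' i s hs u hi).2,
      h.omega_eq hμ1 (hmem s hs).2.2 hμ' hc' (hbS i) hi.1]
    have hval' := hval i s hs u hi
    rw [hθ] at hval'
    rw [hval']
    have hρp : 0 < τ s * ρ (b i) s (chartCurve μ τ γ (b i) (s, u)) :=
      mul_pos hts (hδ.trans_le g2)
    have d1 := drift_le (c := c s) (b := b i) (OnTS.of_mem_chartSurface (hz i s hs u hi).1)
      (mass_pos hm (b i)) (B := B) (hμb.trans ((le_max_left _ _).trans (le_max_left _ _)))
      (hcb.trans ((le_max_right _ _).trans (le_max_left _ _)))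
    have hB0 : 0 ≤ B := le_max_right _ _
    have d2 : drift (b i) (μ s) μ' c' (chartCurve μ τ γ (b i) (s, u)) ≤
        B * (δ⁻¹ * δ⁻¹) * φ i (s, chartCurve μ τ γ (b i) (s, u)) := by
      calc _ ≤ B * δ⁻¹ := d1.trans (mul_le_mul_of_nonneg_left g3 hB0)
        _ = B * (δ⁻¹ * δ⁻¹) * δ := by field_simp
        _ ≤ _ := mul_le_mul_of_nonneg_left g1 (by positivity)
    calc _ ≤ _ := mul_le_mul_of_nonneg_left d2 hρp.le
      _ = _ := by ring
  · intro i s hs u hi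
    obtain ⟨g1, g2, g3⟩ := hbd i s hs u hi
    have hts := hτ s hs
    rw [hval i s hs u hi]
    calc δ * δ * τ s = τ s * δ * δ := by ring
      _ ≤ _ := mul_le_mul (mul_le_mul_of_nonneg_left g2 hts.le) g1 hδ.le
        (mul_nonneg hts.le (hδ.le.trans g2))

/-- The conclusion on the period from a bound near the end of the family. -/
theorem IsPeriodicOrbitFamily.not_blueSky (h : IsPeriodicOrbitFamily μ c S ρ γ τ)
    (hB : ∃ s₂ < (1 : ℝ), ∃ B, ∀ s ∈ Ico s₂ 1, τ s ≤ B) :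
    ¬ BlueSkyCatastrophe τ ∧ BddAbove (τ '' Ico 0 1) := by
  obtain ⟨s₂, hs₂, B, hB⟩ := hB
  constructor
  · intro ht
    have h1 := ht.eventually_gt_atTop B
    obtain ⟨s, h2, h3⟩ := (h1.and (Ico_mem_nhdsLT hs₂)).exists
    exact absurd (hB s h3) (not_le.2 h2)
  · have h1 : ContinuousOn τ (Icc 0 s₂) :=
      h.period_smooth.continuousOn.mono fun s hs => ⟨hs.1, hs.2.trans_lt hs₂⟩
    obtain ⟨B', hB'⟩ := (isCompact_Icc.image_of_continuousOn h1).bddAbove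
    refine ⟨max B B', ?_⟩
    rintro _ ⟨s, hs, rfl⟩
    rcases le_total s₂ s with hle | hle
    · exact (hB s ⟨hle, hs.2⟩).trans (le_max_left _ _)
    · exact (hB' ⟨s, ⟨hs.1, hle⟩, rfl⟩).trans (le_max_right _ _)

end Family

/-! ### Below the first critical value -/

theorem continuousOn_effPot : ContinuousOn (fun x : ℝ × E3 => effPot x.1 x.2)
    {x | ∀ b, x.2 ≠ pos x.1 b} := by
  have h2 : ∀ b, Continuous fun x : ℝ × E3 => pos x.1 b := fun b =>
    (continuous_pos b).comp continuous_fst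
  unfold effPot
  refine ContinuousOn.sub (ContinuousOn.sub (ContinuousOn.neg ?_) ?_) (by fun_prop)
  · exact ContinuousOn.div (by fun_prop) (by fun_prop) fun x hx =>
      norm_ne_zero_iff.2 (sub_ne_zero.2 (hx .moon))
  · exact ContinuousOn.div (by fun_prop) (by fun_prop) fun x hx =>
      norm_ne_zero_iff.2 (sub_ne_zero.2 (hx .earth))

/-- A compact set that lies outside of the Hill's region stays outside of it. -/
theorem eventually_lt_effPot {A : Set E3} (hA : IsCompact A) {μ₁ c₁ : ℝ}
    (hne : ∀ q ∈ A, ∀ b, q ≠ pos μ₁ b) (hlt : ∀ q ∈ A, c₁ < effPot μ₁ q) :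
    ∀ᶠ x : ℝ × ℝ in 𝓝 (μ₁, c₁), ∀ q ∈ A, x.2 < effPot x.1 q := by
  have key : ∀ q ∈ A, ∀ᶠ y : (ℝ × ℝ) × E3 in 𝓝 ((μ₁, c₁), q), y.1.2 < effPot y.1.1 y.2 := by
    intro q hq
    have hopen : {x : ℝ × E3 | ∀ b, x.2 ≠ pos x.1 b} ∈ 𝓝 (μ₁, q) := by
      have h2 : ∀ b, Continuous fun x : ℝ × E3 => pos x.1 b := fun b =>
        (continuous_pos b).comp continuous_fst
      have h3 : ∀ b, ∀ᶠ x : ℝ × E3 in 𝓝 (μ₁, q), x.2 ≠ pos x.1 b := fun b =>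
        (isOpen_ne_fun continuous_snd (h2 b)).mem_nhds (hne q hq b)
      filter_upwards [h3 .earth, h3 .moon] with x h4 h5 b
      cases b
      · exact h4
      · exact h5
    have h1 : ContinuousAt (fun x : ℝ × E3 => effPot x.1 x.2) (μ₁, q) :=
      continuousOn_effPot.continuousAt hopen
    have h2 : ContinuousAt (fun y : (ℝ × ℝ) × E3 => effPot y.1.1 y.2) ((μ₁, c₁), q) :=
      ContinuousAt.comp (g := fun x : ℝ × E3 => effPot x.1 x.2)
        (f := fun y : (ℝ × ℝ) × E3 => (y.1.1, y.2)) (x := ((μ₁, c₁), q)) h1 (by fun_prop)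
    have h4 : ContinuousAt (fun y : (ℝ × ℝ) × E3 => y.1.2) ((μ₁, c₁), q) := by fun_prop
    exact h4.eventually_lt h2 (hlt q hq)
  exact hA.eventually_forall_of_forall_eventually key

theorem radialQ_pos_of_collision {μ : ℝ} {b : Primary} {z : E4 × E4} (hm : 0 < mass μ b)
    (hz : OnTS z) (h : z.1 0 = 1) : 0 < radialQ μ b z := by
  rw [eq_collision_of_fst_eq_one hz h]
  simp [radialQ, chartY]
  positivity

theorem chart_regular_of_level {μ c : ℝ} {b : Primary} {z : E4 × E4}
    (hz : OnTS z) (hlev : ‖z.2‖ * moserF μ c b z = mass μ b)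
    (hne : chartY z + pos μ b ≠ pos μ b) :
    z.1 0 < 1 ∧ jacobi μ (chartY z + pos μ b, -chartX z) = c := by
  have hlt : z.1 0 < 1 := by
    refine hz.fst_zero_le.lt_of_ne fun e => hne ?_
    have : ‖chartY z‖ = 0 := by rw [norm_chartY hz, e]; simp
    rw [norm_eq_zero.1 this, zero_add]
  refine ⟨hlt, ?_⟩
  have e := norm_mul_moserF μ c b (p := -chartX z) hne
  rw [moserMap_chart μ b hz hlt, hlev] at e
  have h2 : ‖chartY z + pos μ b - pos μ b‖ *
    (jacobi μ (chartY z + pos μ b, -chartX z) - c) = 0 := by linarith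
  rcases mul_eq_zero.1 h2 with h3 | h3
  · exact absurd (sub_eq_zero.1 (norm_eq_zero.1 h3)) hne
  · linarith

/-- The action form is positive near a primary, below the first critical value. -/
theorem radialQ_pos {μ c : ℝ} (h : μ ∈ Ioo (0 : ℝ) 1) {b : Primary} {z : E4 × E4} (hz : OnTS z)
    (hlev : ‖z.2‖ * moserF μ c b z = mass μ b) (hd : ‖chartY z‖ < lagDist μ b)
    (hc : c ≤ energyL1 μ) : 0 < radialQ μ b z := by
  rcases hz.fst_zero_le.lt_or_eq with hlt | heq
  · have hy : chartY z ≠ 0 := by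
      rw [← norm_ne_zero_iff, norm_chartY hz]
      have h1 : 0 < ‖z.2‖ := by
        rcases (norm_nonneg z.2).eq_or_lt with h0 | h0
        · rw [← h0, zero_mul] at hlev
          exact absurd hlev (mass_pos h b).ne
        · exact h0
      have : 0 < 1 - z.1 0 := by linarith
      positivity
    have e := moserMap_chart μ b hz hlt
    have hq : chartY z + pos μ b ≠ pos μ b := by simpa using hy
    have hj := (chart_regular_of_level hz hlev hq).2
    rw [← e, radialQ_eq hq]
    have := radialH_pos h b (p := -chartX z) hq (by simpa using hd) (hj.trans_le hc)
    have := mass_pos h b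
    have := norm_pos_iff.2 (sub_ne_zero.2 hq)
    positivity
  · exact radialQ_pos_of_collision (mass_pos h b) hz heq

theorem continuousOn_radialQ (b : Primary) : ContinuousOn
    (fun x : (ℝ × ℝ) × (E4 × E4) => radialQ x.1.1 b x.2)
    {x | chartY x.2 + pos x.1.1 b ≠ pos x.1.1 b.other} := by
  have h1 : ∀ b, Continuous fun x : (ℝ × ℝ) × (E4 × E4) => mass x.1.1 b := fun b =>
    (continuous_mass b).comp (by fun_prop)
  have h2 : ∀ b, Continuous fun x : (ℝ × ℝ) × (E4 × E4) => pos x.1.1 b := fun b =>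
    (continuous_pos b).comp (by fun_prop)
  have h3 : Continuous fun x : (ℝ × ℝ) × (E4 × E4) => chartY x.2 :=
    continuous_chartY.comp (by fun_prop)
  unfold radialQ
  refine ContinuousOn.add (by fun_prop) (ContinuousOn.mul (by fun_prop)
    (ContinuousOn.add ?_ (by fun_prop)))
  refine ContinuousOn.div (by fun_prop) (by fun_prop) fun x hx => ?_
  exact pow_ne_zero _ (norm_ne_zero_iff.2 (sub_ne_zero.2 hx))

/-- The covering of the hypersurfaces near the end of a family. -/
theorem exists_left_cover {μ c : ℝ → ℝ} {S : Set Primary} {D O : Set E3}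
    (hμc : ContinuousOn μ (Icc 0 1)) (hcc : ContinuousOn c (Icc 0 1)) (hS : S.Nonempty)
    (hD : IsCompact D) (hO : IsOpen O) (hOD : O ⊆ D) (hpos : ∀ b ∈ S, pos (μ 1) b ∈ O)
    (hne : ∀ q ∈ D \ O, ∀ b, q ≠ pos (μ 1) b) (hlt : ∀ q ∈ D \ O, c 1 < effPot (μ 1) q) :
    ∃ s₀ ∈ Ico (0 : ℝ) 1, ∀ s ∈ Icc s₀ 1, ∀ x ∈ regSurface (μ s) (c s) S,
      x.position (μ s) ∈ O := by
  have h1 : Tendsto (fun s => (μ s, c s)) (𝓝[≤] (1 : ℝ)) (𝓝 (μ 1, c 1)) := by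
    rw [← nhdsWithin_Icc_eq_nhdsLE (zero_lt_one' ℝ)]
    exact (hμc.prodMk hcc) 1 (right_mem_Icc.2 zero_le_one)
  have h2 := h1.eventually (eventually_lt_effPot (hD.diff hO) hne hlt)
  have h3 : ∀ b, ∀ᶠ s in 𝓝[≤] (1 : ℝ), b ∈ S → pos (μ s) b ∈ O := by
    intro b
    by_cases hb : b ∈ S
    · have h4 : Tendsto (fun s => pos (μ s) b) (𝓝[≤] (1 : ℝ)) (𝓝 (pos (μ 1) b)) :=
        ((continuous_pos b).tendsto _).comp ((continuous_fst.tendsto _).comp h1)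
      exact (h4.eventually (hO.mem_nhds (hpos b hb))).mono fun _ h _ => h
    · exact Eventually.of_forall fun _ h => absurd h hb
  obtain ⟨s₀, hs₀, h5⟩ := exists_left_interval (h2.and ((h3 .earth).and (h3 .moon)))
  refine ⟨s₀, hs₀, fun s hs x hx => ?_⟩
  obtain ⟨h6, h7, h8⟩ := h5 s hs
  have h9 : ∀ b ∈ S, pos (μ s) b ∈ O := fun b => by cases b <;> assumption
  cases x with
  | regular q p =>
    obtain ⟨b, hb⟩ := hS
    exact hillComponent_subset hD.isClosed hO hOD hb (h9 b hb) h6 hx.2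
  | collision b v => exact h9 b hx.1

/-- One piece suffices, the ball around the primary through the Lagrange point, with the unmodified
form η dξ. Only the final energy matters: the estimate is needed near s = 1 and all conditions
persist there. -/
theorem IsPeriodicOrbitFamily.exists_bound_of_lt {μ c : ℝ → ℝ} {b : Primary}
    {ρ : Primary → ℝ → E4 × E4 → ℝ} {γ : ℝ → ℝ → RegPoint} {τ : ℝ → ℝ}
    (h : IsPeriodicOrbitFamily μ c {b} ρ γ τ) (hρ : IsTimeScale μ c {b} ρ)
    (hμ : ContDiffOn ℝ ∞ μ (Icc 0 1)) (hc : ContDiffOn ℝ ∞ c (Icc 0 1))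
    (hμ1 : ∀ s ∈ Icc (0 : ℝ) 1, μ s ∈ Ioo (0 : ℝ) 1) (hlt : c 1 < energyL1 (μ 1)) :
    ∃ s₂ < 1, ∃ B, ∀ s ∈ Ico s₂ 1, τ s ≤ B := by
  have hm := hμ1 1 (right_mem_Icc.2 zero_le_one)
  have hr0 := lagDist_pos hm b
  have hr1 := lagDist_lt_one hm b
  set D := Metric.closedBall (pos (μ 1) b) (lagDist (μ 1) b) with hD
  set O := Metric.ball (pos (μ 1) b) (lagDist (μ 1) b) with hO
  have hDO : ∀ q ∈ D \ O, ‖q - pos (μ 1) b‖ = lagDist (μ 1) b := by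
    intro q hq
    rw [← dist_eq_norm]
    exact le_antisymm hq.1 (not_lt.1 hq.2)
  have hdist : ‖pos (μ 1) b.other - pos (μ 1) b‖ = 1 := by
    have h2 : ‖pos (μ 1) b.other - pos (μ 1) b‖ ^ 2 = 1 := by
      rw [norm_sq_E3]
      simp only [PiLp.sub_apply, pos_other_zero, pos_one, pos_two]
      nlinarith [axisSign_sq b]
    nlinarith [norm_nonneg (pos (μ 1) b.other - pos (μ 1) b)]
  have hoth : pos (μ 1) b.other ∉ D := by
    rw [hD, Metric.mem_closedBall, dist_eq_norm, hdist]
    linarith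
  obtain ⟨s₀, hs₀, hcov⟩ := exists_left_cover (S := {b}) (D := D) (O := O) hμ.continuousOn
    hc.continuousOn
    ⟨b, rfl⟩ (isCompact_closedBall _ _) Metric.isOpen_ball Metric.ball_subset_closedBall
    (by rintro _ rfl; exact Metric.mem_ball_self hr0)
    (fun q hq b' e => by
      have h1 := hDO q hq
      rw [e] at h1
      by_cases hbb : b' = b
      · rw [hbb] at h1; simp at h1; linarith
      · have e2 : b' = b.other := by
          revert hbb; cases b' <;> cases b <;> simp [Primary.other]
        rw [e2, hdist] at h1
        linarith)
    (fun q hq => hlt.trans_le (energyL1_le_effPot_sphere hm b (hDO q hq)))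
  refine h.exists_bound hρ hμ hc hμ1 (ι := Unit) (b := fun _ => b) (D := fun _ => D)
    (O := fun _ => O) (G := fun _ _ => 0) (φ := fun _ x => radialQ (μ x.1) b x.2) hs₀
    (fun _ => rfl) (fun _ => isCompact_closedBall _ _) (fun _ => Metric.isOpen_ball)
    (fun _ => Metric.ball_subset_closedBall) (fun _ => hoth) ?_
    (fun s hs x hx => ⟨(), hcov s ⟨hs.1, hs.2.le⟩ x hx⟩) ?_ ?_ ?_ (fun _ _ _ _ _ _ _ _ _ => rfl)
  · intro _ z hz hzD hlev
    refine mem_chartSurface (b := b) (mem_singleton b) hz hlev (mass_pos hm b) ?_ ?_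
    · intro e
      rw [e] at hzD
      exact hoth hzD
    · intro h1 h2
      exact mem_hillComponent_singleton hm h1 (by rw [← dist_eq_norm]; exact hzD) h2
  · intro _ s _ z _ _
    exact ⟨contDiffAt_const, fun X _ => by simp⟩
  · intro _
    exact continuousOn_chartPiece_of_params hμ.continuousOn hc.continuousOn hs₀.1
      (continuousOn_radialQ b) fun x hx => ne_other_of_mem_chartSurface hx.2.1
  · intro _ z hz hzD
    have hlev := level_of_mem_chartSurface (mass_pos hm b) hz
    have hTS := OnTS.of_mem_chartSurface hz
    refine radialQ_pos hm hTS hlev ?_ hlt.le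
    -- At s = 1 no point of the hypersurface lies over the boundary of the ball, which provides the
    -- strict inequality required by `radialQ_pos`.
    have h1 := hcov 1 (right_mem_Icc.2 hs₀.2.le)
    obtain ⟨x, hx, rfl⟩ := hz
    have h2 := h1 x hx.1
    rw [← chartY_moserChart hx.2, hO, Metric.mem_ball, dist_eq_norm] at h2
    simpa using h2

/-! ### Scalar estimates near the first Lagrange point -/

/-- Second order expansion of the Newton potential. -/
theorem newton_expansion {x y z ρ U : ℝ} (hρ0 : 0 ≤ ρ) (hρ : ρ ≤ 1 / 4)
    (hs : x ^ 2 + y ^ 2 + z ^ 2 = ρ ^ 2) (hU : 0 < U)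
    (h : U ^ 2 * ((1 - x) ^ 2 + y ^ 2 + z ^ 2) = 1) :
    |U - 1 - x - (2 * x ^ 2 - y ^ 2 - z ^ 2) / 2| ≤ 40 * ρ ^ 3 ∧
      |U ^ 3 - 1 - 3 * x| ≤ 100 * ρ ^ 2 ∧ |U ^ 3 - 1| ≤ 28 * ρ := by
  have hx : |x| ≤ ρ := abs_le_of_sq_le_sq (by nlinarith [sq_nonneg y, sq_nonneg z]) hρ0
  obtain ⟨β, hβ⟩ : ∃ β, β = (2 * x ^ 2 - y ^ 2 - z ^ 2) / 2 := ⟨_, rfl⟩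
  have hβe : β = (3 * x ^ 2 - ρ ^ 2) / 2 := by rw [hβ, ← hs]; ring
  have hβ1 : |β| ≤ ρ ^ 2 := by
    rw [abs_le]; constructor <;> nlinarith [sq_nonneg x, sq_nonneg y, sq_nonneg z]
  rw [← hβ]
  obtain ⟨hx1, hx2⟩ := abs_le.1 hx
  obtain ⟨hb1, hb2⟩ := abs_le.1 hβ1
  set D := (1 - x) ^ 2 + y ^ 2 + z ^ 2 with hD
  have hDe : D = 1 - 2 * x + ρ ^ 2 := by rw [hD, ← hs]; ring
  have hD1 : 1 / 2 ≤ D := by nlinarith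
  -- The second order Taylor polynomial of D^{-1/2}; 1 - P²D is of third order because the lower
  -- orders cancel.
  set P := 1 + x + β with hP
  have hP1 : 1 / 2 ≤ P := by nlinarith
  have hrem : |1 - P ^ 2 * D| ≤ 10 * ρ ^ 3 := by
    have e : 1 - P ^ 2 * D = 2 * (x * β) + 2 * x ^ 3 - 2 * (x * ρ ^ 2)
        + (-(β ^ 2) + 4 * (x ^ 2 * β) - ρ ^ 2 * x ^ 2 - 2 * (ρ ^ 2 * β))
        + (2 * (x * β ^ 2) - 2 * (x * β * ρ ^ 2)) - β ^ 2 * ρ ^ 2 := by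
      rw [hDe, hP]
      linear_combination (-2) * hβe
    have ax2 : |x ^ 2| ≤ ρ ^ 2 := by rw [abs_pow]; gcongr
    have ab2 : |β ^ 2| ≤ (ρ ^ 2) ^ 2 := by rw [abs_pow]; gcongr
    have m1 : |x * β| ≤ ρ * ρ ^ 2 := by rw [abs_mul]; gcongr
    have m2 : |x ^ 3| ≤ ρ ^ 3 := by rw [abs_pow]; gcongr
    have m3 : |x * ρ ^ 2| ≤ ρ * ρ ^ 2 := by
      rw [abs_mul, abs_of_nonneg (sq_nonneg ρ)]; gcongr
    have m4 : |x ^ 2 * β| ≤ ρ ^ 2 * ρ ^ 2 := by rw [abs_mul]; gcongr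
    have m5 : |ρ ^ 2 * x ^ 2| ≤ ρ ^ 2 * ρ ^ 2 := by
      rw [abs_mul, abs_of_nonneg (sq_nonneg ρ)]; gcongr
    have m6 : |ρ ^ 2 * β| ≤ ρ ^ 2 * ρ ^ 2 := by
      rw [abs_mul, abs_of_nonneg (sq_nonneg ρ)]; gcongr
    have m7 : |x * β ^ 2| ≤ ρ * (ρ ^ 2) ^ 2 := by rw [abs_mul]; gcongr
    have m8 : |x * β * ρ ^ 2| ≤ ρ * ρ ^ 2 * ρ ^ 2 := by
      rw [abs_mul, abs_of_nonneg (sq_nonneg ρ)]; gcongr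
    have m9 : |β ^ 2 * ρ ^ 2| ≤ (ρ ^ 2) ^ 2 * ρ ^ 2 := by
      rw [abs_mul, abs_of_nonneg (sq_nonneg ρ)]; gcongr
    have r4 : ρ ^ 4 ≤ ρ ^ 3 * (1 / 4) := by
      have := mul_le_mul_of_nonneg_left hρ (pow_nonneg hρ0 3); linarith
    have r5 : ρ ^ 5 ≤ ρ ^ 3 * (1 / 16) := by
      have := mul_le_mul_of_nonneg_left hρ (pow_nonneg hρ0 4); linarith
    have r6 : ρ ^ 6 ≤ ρ ^ 3 * (1 / 64) := by
      have := mul_le_mul_of_nonneg_left hρ (pow_nonneg hρ0 5); linarith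
    have r3 : 0 ≤ ρ ^ 3 := pow_nonneg hρ0 3
    rw [e, abs_le]
    rw [abs_le] at m1 m2 m3 m4 m5 m6 m7 m8 m9 ab2
    constructor <;> linarith [m1.1, m1.2, m2.1, m2.2, m3.1, m3.2, m4.1, m4.2, m5.1, m5.2, m6.1,
      m6.2, m7.1, m7.2, m8.1, m8.2, m9.1, m9.2, ab2.1, ab2.2]
  have hUP : |U - P| ≤ 40 * ρ ^ 3 := by
    -- Since U²D = 1, the error U - P is this remainder divided by (U + P)D ≥ 1/4.
    have e : (U - P) * ((U + P) * D) = 1 - P ^ 2 * D := by rw [← h]; ring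
    have h1 : 1 / 4 ≤ (U + P) * D := by nlinarith
    have h2 : |U - P| * ((U + P) * D) ≤ 10 * ρ ^ 3 := by
      rw [← abs_of_pos (by linarith : 0 < (U + P) * D), ← abs_mul, e]; exact hrem
    have h3 := mul_le_mul_of_nonneg_left h1 (abs_nonneg (U - P))
    linarith
  have hU1 : |U - 1 - x| ≤ 11 * ρ ^ 2 := by
    have e : U - 1 - x = (U - P) + β := by rw [hP]; ring
    have r3 : ρ ^ 3 ≤ ρ ^ 2 * (1 / 4) := by
      have := mul_le_mul_of_nonneg_left hρ (pow_nonneg hρ0 2); linarith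
    rw [e]
    exact (abs_add_le _ _).trans (by linarith)
  have hU2 : |U - 1| ≤ 4 * ρ := by
    have e : U - 1 = (U - 1 - x) + x := by ring
    rw [e]
    exact (abs_add_le _ _).trans (by nlinarith)
  have d2 : |(U - 1) ^ 2| ≤ (4 * ρ) ^ 2 := by rw [abs_pow]; gcongr
  have d3 : |(U - 1) ^ 3| ≤ (4 * ρ) ^ 3 := by rw [abs_pow]; gcongr
  have r3 : ρ ^ 3 ≤ ρ ^ 2 * (1 / 4) := by
    have := mul_le_mul_of_nonneg_left hρ (pow_nonneg hρ0 2); linarith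
  have r2 : ρ ^ 2 ≤ ρ * (1 / 4) := by nlinarith
  have e3 : |U ^ 3 - 1 - 3 * x| ≤ 100 * ρ ^ 2 := by
    have e : U ^ 3 - 1 - 3 * x = 3 * (U - 1 - x) + 3 * (U - 1) ^ 2 + (U - 1) ^ 3 := by ring
    rw [e, abs_le]
    rw [abs_le] at hU1 d2 d3
    constructor <;> linarith [hU1.1, hU1.2, d2.1, d2.2, d3.1, d3.2]
  refine ⟨by convert hUP using 2; rw [hP]; ring, e3, ?_⟩
  rw [abs_le] at e3 ⊢
  constructor <;> linarith [e3.1, e3.2]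

/-- The value on the Hamiltonian vector field of the modified action form near the first
Lagrange point. The variables are the coordinates `x, q₁, q₂` and `p₀, π, p₂` relative to the
Lagrange point, the coefficient `K` of the attraction, the derivative `w` of `p₀`, and the values
and derivatives of the two cut-off functions. -/
noncomputable def neckRate (κ x q₁ q₂ p₀ π p₂ K w h h' χ χ' : ℝ) : ℝ :=
  (h - x) * w + q₁ * p₀ + K * (q₁ ^ 2 + q₂ ^ 2)
    + h' * ((κ - 1) * p₀ + (κ - K) * q₁) * p₀
    + 1 / 2 * χ' * ((κ - 1) * p₀ + (κ - K) * q₁) * (q₁ * (π - x) + q₂ * p₂)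
    + 1 / 2 * χ * ((π - x) ^ 2 - 2 * q₁ * p₀ - (K + 1) * q₁ ^ 2 + p₂ ^ 2 - K * q₂ ^ 2)

/-- After multiplication by 5/4, completing the square in π leaves (κ²/4 + κ/2 - 11/16)x², which is
positive for κ > 1. -/
theorem neck_form_pos {κ : ℝ} (hκ : 1 < κ) (x π : ℝ) :
    (x ^ 2 + π ^ 2) / 4 ≤ -x * (π + 2 * κ * x) + (κ * x + π) * (2 * κ * x + π)
      + (π - x) ^ 2 / 2 := by
  have h : 0 ≤ (5 / 4 * π + (3 * κ - 2) / 2 * x) ^ 2 := sq_nonneg _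
  have h2 : 0 ≤ ((κ - 1) * (κ + 1) + (κ - 1) ^ 2 / 4) * x ^ 2 :=
    mul_nonneg (by nlinarith) (sq_nonneg x)
  nlinarith [sq_nonneg ((κ - 1) * x), mul_nonneg (by nlinarith : 0 ≤ κ ^ 2 - 1) (sq_nonneg x)]

/-- Positivity close to the Lagrange point, on all levels. -/
theorem neckRate_pos_local {κ C : ℝ} (hκ : 1 < κ) (hC : 0 ≤ C) :
    ∃ a₀ > 0, ∀ x q₁ q₂ p₀ π p₂ K w ρ : ℝ, 0 ≤ ρ → ρ ≤ a₀ →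
      x ^ 2 + q₁ ^ 2 + q₂ ^ 2 = ρ ^ 2 → |K - κ| ≤ C * ρ → |w - (π + 2 * κ * x)| ≤ C * ρ ^ 2 →
      0 < ρ ^ 2 + p₀ ^ 2 + π ^ 2 + p₂ ^ 2 →
      0 < neckRate κ x q₁ q₂ p₀ π p₂ K w (κ * x + π) 1 1 0 := by
  set k := min (1 / 4) ((κ - 1) / 2) with hk
  have hk0 : 0 < k := lt_min (by norm_num) (by linarith)
  have hk1 : k ≤ 1 / 4 := min_le_left _ _
  have hk2 : k ≤ (κ - 1) / 2 := min_le_right _ _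
  refine ⟨k / (C * (κ + 3) + 1), by positivity, ?_⟩
  intro x q₁ q₂ p₀ π p₂ K w ρ hρ0 hρ hs hK hw hN
  set a := k / (C * (κ + 3) + 1) with ha
  have ha0 : 0 < a := by positivity
  have hCa : C * a * (κ + 3) < k := by
    have : a * (C * (κ + 3) + 1) = k := by rw [ha]; field_simp
    linarith
  set N := ρ ^ 2 + p₀ ^ 2 + π ^ 2 + p₂ ^ 2 with hNdef
  obtain ⟨dw, hdw⟩ : ∃ dw, dw = w - (π + 2 * κ * x) := ⟨_, rfl⟩
  rw [← hdw] at hw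
  have hx : |x| ≤ ρ := abs_le_of_sq_le_sq (by nlinarith [sq_nonneg q₁, sq_nonneg q₂]) hρ0
  have hq : |q₁| ≤ ρ := abs_le_of_sq_le_sq (by nlinarith [sq_nonneg x, sq_nonneg q₂]) hρ0
  have hCρ : C * ρ ≤ C * a := mul_le_mul_of_nonneg_left hρ hC
  have hCa0 : 0 ≤ C * a := by positivity
  have e1 : |((κ - 1) * x + π) * dw| ≤ C * a * (κ + 1) * N := by
    have h1 : |(κ - 1) * x + π| ≤ κ * ρ + |π| := by
      refine (abs_add_le _ _).trans ?_
      rw [abs_mul, abs_of_pos (by linarith : 0 < κ - 1)]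
      nlinarith
    rw [abs_mul]
    calc _ ≤ (κ * ρ + |π|) * (C * ρ ^ 2) := by gcongr
      _ = (C * ρ) * (κ * ρ ^ 2 + |π| * ρ) := by ring
      _ ≤ (C * a) * ((κ + 1) * N) := by
          refine mul_le_mul hCρ ?_ (by positivity) hCa0
          have : |π| * ρ ≤ N := by
            have t1 := sq_nonneg (|π| - ρ)
            have t2 := sq_abs π
            nlinarith [sq_nonneg p₀, sq_nonneg p₂]
          have : ρ ^ 2 ≤ N := by nlinarith [sq_nonneg p₀, sq_nonneg p₂, sq_nonneg π]
          nlinarith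
      _ = _ := by ring
  have e2 : |(K - κ) * (q₁ ^ 2 + q₂ ^ 2)| ≤ C * a * N := by
    rw [abs_mul, abs_of_nonneg (by positivity : 0 ≤ q₁ ^ 2 + q₂ ^ 2)]
    refine mul_le_mul (hK.trans hCρ) ?_ (by positivity) hCa0
    nlinarith [sq_nonneg p₀, sq_nonneg p₂, sq_nonneg π, sq_nonneg x]
  have e3 : |(K - κ) * (q₁ * p₀)| ≤ C * a * N := by
    rw [abs_mul]
    refine mul_le_mul (hK.trans hCρ) ?_ (by positivity) hCa0
    rw [abs_le]
    have t1 := sq_nonneg (q₁ - p₀)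
    have t2 := sq_nonneg (q₁ + p₀)
    have t3 : q₁ ^ 2 + p₀ ^ 2 ≤ N := by
      rw [hNdef, ← hs]
      linarith [sq_nonneg p₂, sq_nonneg π, sq_nonneg x, sq_nonneg q₂]
    constructor <;> linarith [sq_nonneg q₁, sq_nonneg p₀]
  have hform := neck_form_pos hκ x π
  -- With K = κ and w linear, the form splits into a block in (x, π) and a diagonal part: the χ-term
  -- cancels q₁p₀ and supplies p₂². The other three terms are errors of size Ca times the squared
  -- norm N.
  have e4 : neckRate κ x q₁ q₂ p₀ π p₂ K w (κ * x + π) 1 1 0 =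
      (-x * (π + 2 * κ * x) + (κ * x + π) * (2 * κ * x + π) + (π - x) ^ 2 / 2)
      + ((κ - 1) * p₀ ^ 2 + (κ - 1) / 2 * q₁ ^ 2 + κ / 2 * q₂ ^ 2 + p₂ ^ 2 / 2)
      + ((κ - 1) * x + π) * dw + 1 / 2 * ((K - κ) * (q₁ ^ 2 + q₂ ^ 2)) - (K - κ) * (q₁ * p₀) := by
    rw [neckRate, hdw]; ring
  have e5 : k * N ≤ (x ^ 2 + π ^ 2) / 4 +
      ((κ - 1) * p₀ ^ 2 + (κ - 1) / 2 * q₁ ^ 2 + κ / 2 * q₂ ^ 2 + p₂ ^ 2 / 2) := by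
    have t1 := mul_le_mul_of_nonneg_right hk1 (sq_nonneg x)
    have t2 := mul_le_mul_of_nonneg_right hk1 (sq_nonneg π)
    have t3 := mul_le_mul_of_nonneg_right (hk2.trans (by linarith : _ ≤ κ - 1)) (sq_nonneg p₀)
    have t4 := mul_le_mul_of_nonneg_right hk2 (sq_nonneg q₁)
    have t5 := mul_le_mul_of_nonneg_right (hk2.trans (by linarith : _ ≤ κ / 2)) (sq_nonneg q₂)
    have t6 := mul_le_mul_of_nonneg_right (hk1.trans (by norm_num : _ ≤ (1 / 2 : ℝ))) (sq_nonneg p₂)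
    rw [hNdef, ← hs]
    linarith
  have e6 : C * a * (κ + 3) * N < k * N := mul_lt_mul_of_pos_right hCa hN
  rw [e4]
  have f1 := (abs_le.1 e1).1
  have f2 := (abs_le.1 e2).1
  have f3 := (abs_le.1 e3).2
  have f4 : 0 ≤ C * a * N := by positivity
  linarith

/-- On the critical level, all coordinates are controlled by the first one, and `κ x + π` and `w`
have the sign of `x`. -/
theorem neck_level_bounds {κ C : ℝ} (hκ : 1 < κ) (hC : 0 ≤ C) :
    ∃ a₀ > 0, ∃ A ≥ 1, ∃ σ > 0, ∀ x q₁ q₂ p₀ π p₂ w ρ : ℝ, 0 ≤ ρ → ρ ≤ a₀ →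
      x ^ 2 + q₁ ^ 2 + q₂ ^ 2 = ρ ^ 2 → |w - (π + 2 * κ * x)| ≤ C * ρ ^ 2 →
      (π - x) ^ 2 + p₂ ^ 2 + (p₀ + q₁) ^ 2 + (κ - 1) * q₁ ^ 2 + κ * q₂ ^ 2 ≤
        (2 * κ + 1) * x ^ 2 + C * ρ ^ 3 →
      ρ ≤ A * |x| ∧ |p₀| ≤ A * |x| ∧ |π - x| ≤ A * |x| ∧ |p₂| ≤ A * |x| ∧
        σ * x ^ 2 ≤ x * (κ * x + π) ∧ σ * x ^ 2 ≤ x * w := by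
  set k := κ - 1 with hk
  have hk0 : 0 < k := by linarith
  have hκ0 : 0 < κ := by linarith
  set R := 6 * κ / k with hR
  have hR0 : 0 < R := by positivity
  set a := min (k / 2) (min 1 (κ / 2) / R) / (C + 1) with ha
  have ha0 : 0 < a := by positivity
  have hCa1 : C * a ≤ k / 2 := by
    have h1 : (C + 1) * a = min (k / 2) (min 1 (κ / 2) / R) := by rw [ha]; field_simp
    have h2 := min_le_left (k / 2) (min 1 (κ / 2) / R)
    linarith
  have hCa2 : C * a * R ≤ min 1 (κ / 2) := by
    have h1 : (C + 1) * a = min (k / 2) (min 1 (κ / 2) / R) := by rw [ha]; field_simp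
    have h2 := min_le_right (k / 2) (min 1 (κ / 2) / R)
    have h3 : C * a ≤ min 1 (κ / 2) / R := by linarith
    rwa [le_div_iff₀ hR0] at h3
  have hCa3 : C * a * R ≤ 1 := hCa2.trans (min_le_left _ _)
  have hCa4 : C * a * R ≤ κ / 2 := hCa2.trans (min_le_right _ _)
  set A := 1 + 2 * (κ + 1) ^ 2 + 2 * R with hA
  have hA1 : 1 ≤ A := by have : 0 ≤ (κ + 1) ^ 2 := sq_nonneg _; linarith
  set σ := κ ^ 2 / (4 * (κ + 1)) with hσ
  refine ⟨a, ha0, A, hA1, σ, by positivity, ?_⟩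
  intro x q₁ q₂ p₀ π p₂ w ρ hρ0 hρ hs hw hlev
  have hx2 := sq_nonneg x
  have hCρ3 : C * ρ ^ 3 ≤ C * a * ρ ^ 2 := by
    have : C * ρ ^ 2 * ρ ≤ C * ρ ^ 2 * a := mul_le_mul_of_nonneg_left hρ (by positivity)
    linarith
  -- The level inequality bounds q₁ and q₂ by x up to C ρ³ ≤ (k/2)ρ², which is absorbed on the left.
  have hρR : ρ ^ 2 ≤ R * x ^ 2 := by
    have h1 : k * ρ ^ 2 ≤ 3 * κ * x ^ 2 + k / 2 * ρ ^ 2 := by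
      have h2 := mul_le_mul_of_nonneg_right hCa1 (sq_nonneg ρ)
      have h3 : k * ρ ^ 2 = k * x ^ 2 + k * q₁ ^ 2 + k * q₂ ^ 2 := by rw [← hs]; ring
      have h4 : k * q₂ ^ 2 ≤ κ * q₂ ^ 2 := mul_le_mul_of_nonneg_right (by linarith) (sq_nonneg _)
      have h5 : k * x ^ 2 = κ * x ^ 2 - x ^ 2 := by rw [hk]; ring
      linarith [sq_nonneg (π - x), sq_nonneg p₂, sq_nonneg (p₀ + q₁)]
    have h6 : R * x ^ 2 = 6 * κ * x ^ 2 / k := by rw [hR]; ring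
    rw [h6, le_div_iff₀ hk0]
    linarith
  have hCρx : C * ρ ^ 2 * a ≤ C * a * R * x ^ 2 := by
    have := mul_le_mul_of_nonneg_left hρR (by positivity : 0 ≤ C * a)
    linarith
  have hκ2 : κ / 2 ≤ κ ^ 2 / 2 := by nlinarith
  have hlev2 : (π - x) ^ 2 + p₂ ^ 2 + (p₀ + q₁) ^ 2 ≤ (2 * κ + 1 + κ ^ 2 / 2) * x ^ 2 := by
    have h1 := mul_le_mul_of_nonneg_right (hCa4.trans hκ2) hx2
    linarith [mul_nonneg hk0.le (sq_nonneg q₁), mul_nonneg hκ0.le (sq_nonneg q₂)]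
  have hc1 : (2 * κ + 1 + κ ^ 2 / 2) * x ^ 2 ≤ (κ + 1) ^ 2 * x ^ 2 :=
    mul_le_mul_of_nonneg_right (by linarith [sq_nonneg κ]) hx2
  have hsq : ∀ y, y ^ 2 ≤ A * x ^ 2 → |y| ≤ A * |x| := by
    intro y hy
    refine abs_le_of_sq_le_sq ?_ (by positivity)
    rw [mul_pow, sq_abs]
    have : A ≤ A ^ 2 := by nlinarith
    exact hy.trans (mul_le_mul_of_nonneg_right this hx2)
  have hAx : A * x ^ 2 = x ^ 2 + 2 * ((κ + 1) ^ 2 * x ^ 2) + 2 * (R * x ^ 2) := by rw [hA]; ring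
  have hRx : 0 ≤ R * x ^ 2 := by positivity
  have hkx : 0 ≤ (κ + 1) ^ 2 * x ^ 2 := by positivity
  have hb2 : (π - x) ^ 2 ≤ (2 * κ + 1 + κ ^ 2 / 2) * x ^ 2 := by
    linarith [sq_nonneg p₂, sq_nonneg (p₀ + q₁)]
  -- The level gives (π - x)² ≤ ((κ + 1)² - κ²/2)x², so (κ + 1)x dominates π - x in their sum κx +
  -- π; the gap κ²/2 yields σ.
  have hψ : σ * x ^ 2 ≤ x * (κ * x + π) := by
    have h1 : 0 ≤ ((π - x) + (κ + 1) * x) ^ 2 := sq_nonneg _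
    have h2 : 4 * (κ + 1) * (σ * x ^ 2) = κ ^ 2 * x ^ 2 := by rw [hσ]; field_simp
    have h3 : 4 * (κ + 1) * (x * (κ * x + π)) =
      2 * ((π - x) + (κ + 1) * x) ^ 2 - 2 * (π - x) ^ 2 + 2 * ((κ + 1) ^ 2 * x ^ 2) := by ring
    have h4 : 0 < 4 * (κ + 1) := by linarith
    refine le_of_mul_le_mul_left ?_ h4
    rw [h2, h3]
    linarith
  refine ⟨?_, ?_, ?_, ?_, hψ, ?_⟩
  · exact (le_abs_self ρ).trans (hsq ρ (by linarith))
  · refine hsq p₀ ?_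
    have h1 : p₀ ^ 2 ≤ 2 * (p₀ + q₁) ^ 2 + 2 * q₁ ^ 2 := by linarith [sq_nonneg (p₀ + 2 * q₁)]
    linarith [sq_nonneg p₂, sq_nonneg (π - x), sq_nonneg q₂]
  · exact hsq _ (by linarith)
  · exact hsq _ (by linarith [sq_nonneg (π - x), sq_nonneg (p₀ + q₁)])
  · have hx : |x| ≤ ρ := abs_le_of_sq_le_sq (by linarith [sq_nonneg q₁, sq_nonneg q₂]) hρ0
    have h1 : |x * (w - (π + 2 * κ * x))| ≤ κ * x ^ 2 := by
      rw [abs_mul]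
      calc _ ≤ a * (C * ρ ^ 2) := by gcongr; exact hx.trans hρ
        _ ≤ C * a * R * x ^ 2 := by linarith
        _ ≤ κ * x ^ 2 := mul_le_mul_of_nonneg_right (by linarith) hx2
    have h2 := (abs_le.1 h1).1
    linarith

/-- Positivity on the critical level where the first cut-off is not yet constant. -/
theorem neckRate_pos_transition {κ C A σ B : ℝ} (hκ : 1 < κ) (hC : 0 ≤ C) (hA : 1 ≤ A)
    (hσ : 0 < σ) (hB : 0 ≤ B) :
    ∃ a₀ > 0, ∀ x q₁ q₂ p₀ π p₂ K w ρ h h' : ℝ, 0 ≤ ρ → ρ ≤ a₀ →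
      x ^ 2 + q₁ ^ 2 + q₂ ^ 2 = ρ ^ 2 → |K - κ| ≤ C * ρ → |w - (π + 2 * κ * x)| ≤ C * ρ ^ 2 →
      ρ ≤ A * |x| → |π - x| ≤ A * |x| →
      σ * x ^ 2 ≤ x * (κ * x + π) → σ * x ^ 2 ≤ x * w → x ≠ 0 →
      0 ≤ h' → h' * |κ * x + π| ≤ B → 0 ≤ (h - (κ * x + π)) * (κ * x + π) →
      0 < neckRate κ x q₁ q₂ p₀ π p₂ K w h h' 1 0 := by
  set k := κ - 1 with hk
  have hk0 : 0 < k := by linarith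
  set M := (κ + A) * C * A + C * A ^ 2 + B / σ * C ^ 2 * A ^ 3 / (4 * k) with hM
  have hM0 : 0 ≤ M := by positivity
  refine ⟨1 / 4 / (M + 1), by positivity, ?_⟩
  intro x q₁ q₂ p₀ π p₂ K w ρ h h' hρ0 hρ hs hK hw hρA hbA hψx hwx hx0 hh' hhB hhs
  set a := 1 / 4 / (M + 1) with ha
  have ha0 : 0 < a := by positivity
  have haM : a * M < 1 / 4 := by
    have : a * (M + 1) = 1 / 4 := by rw [ha]; field_simp
    linarith
  have hxp : 0 < x ^ 2 := by positivity
  have hxa : 0 < |x| := abs_pos.2 hx0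
  obtain ⟨ψ, hψ⟩ : ∃ ψ, ψ = κ * x + π := ⟨_, rfl⟩
  rw [← hψ] at hψx hhB hhs
  obtain ⟨dw, hdw⟩ : ∃ dw, dw = w - (π + 2 * κ * x) := ⟨_, rfl⟩
  rw [← hdw] at hw
  have hρ2 : ρ ^ 2 ≤ a * (A * |x|) := by
    rw [sq]; exact mul_le_mul hρ hρA hρ0 ha0.le
  have e1 : |((κ - 1) * x + π) * dw| ≤ (κ + A) * C * A * a * x ^ 2 := by
    have h1 : |(κ - 1) * x + π| ≤ (κ + A) * |x| := by
      have : (κ - 1) * x + π = κ * x + (π - x) := by ring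
      rw [this]
      refine (abs_add_le _ _).trans ?_
      rw [abs_mul, abs_of_pos (by linarith : 0 < κ)]
      linarith
    rw [abs_mul]
    calc _ ≤ (κ + A) * |x| * (C * (a * (A * |x|))) := by
          refine mul_le_mul h1 (hw.trans ?_) (abs_nonneg _) (by positivity)
          exact mul_le_mul_of_nonneg_left hρ2 hC
      _ = (κ + A) * C * A * a * |x| ^ 2 := by ring
      _ = _ := by rw [sq_abs]
  have e2 : |(K - κ) * (q₁ ^ 2 + q₂ ^ 2)| ≤ C * A ^ 2 * a * x ^ 2 := by
    rw [abs_mul, abs_of_nonneg (by positivity : 0 ≤ q₁ ^ 2 + q₂ ^ 2)]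
    calc _ ≤ C * a * ((A * |x|) ^ 2) := by
          refine mul_le_mul (hK.trans (mul_le_mul_of_nonneg_left hρ hC)) ?_ (by positivity)
            (by positivity)
          have : ρ ^ 2 ≤ (A * |x|) ^ 2 := pow_le_pow_left₀ hρ0 hρA 2
          linarith [sq_nonneg x]
      _ = _ := by rw [mul_pow, sq_abs]; ring
  -- h - ψ has the sign of ψ, and ψ and w both have the sign of x, so replacing ψ by the cut-off
  -- only helps.
  have e3 : 0 ≤ (h - ψ) * w := by
    have h1 : 0 < ψ * w := by
      have : 0 < (x * ψ) * (x * w) := mul_pos ((by positivity : 0 < σ * x ^ 2).trans_le hψx)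
        ((by positivity : 0 < σ * x ^ 2).trans_le hwx)
      have e : (x * ψ) * (x * w) = x ^ 2 * (ψ * w) := by ring
      rw [e] at this
      exact pos_of_mul_pos_right this hxp.le
    have h2 : 0 ≤ ((h - ψ) * w) * ψ ^ 2 := by
      have e : ((h - ψ) * w) * ψ ^ 2 = ((h - ψ) * ψ) * (ψ * w) := by ring
      rw [e]; exact mul_nonneg hhs h1.le
    have h3 : 0 < ψ ^ 2 := by
      have : ψ ≠ 0 := by rintro rfl; simp at h1
      positivity
    exact nonneg_of_mul_nonneg_left h2 h3
  -- Completing the square in p₀. The loss carries h', which may be of size 1/e, but h'|x| ≤ B/σ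
  -- because |ψ| ≥ σ|x|; one further factor |x| remains small through ρ ≤ a.
  have e4 : -(B / σ * C ^ 2 * A ^ 3 / (4 * k) * a * x ^ 2) ≤
      h' * (k * p₀ + (κ - K) * q₁) * p₀ := by
    have h1 : -(((κ - K) * q₁) ^ 2 / (4 * k)) ≤ (k * p₀ + (κ - K) * q₁) * p₀ := by
      rw [neg_le_iff_add_nonneg]
      have : (k * p₀ + (κ - K) * q₁) * p₀ + ((κ - K) * q₁) ^ 2 / (4 * k) =
          (2 * k * p₀ + (κ - K) * q₁) ^ 2 / (4 * k) := by field_simp; ring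
      rw [this]; positivity
    have h2 : ((κ - K) * q₁) ^ 2 ≤ C ^ 2 * (A ^ 3 * |x| ^ 3 * a) := by
      have hq : q₁ ^ 2 ≤ ρ ^ 2 := by linarith [sq_nonneg x, sq_nonneg q₂]
      have hK2 : (κ - K) ^ 2 ≤ (C * ρ) ^ 2 := by
        rw [← sq_abs, abs_sub_comm]; exact pow_le_pow_left₀ (abs_nonneg _) hK 2
      calc ((κ - K) * q₁) ^ 2 = (κ - K) ^ 2 * q₁ ^ 2 := by ring
        _ ≤ (C * ρ) ^ 2 * ρ ^ 2 := mul_le_mul hK2 hq (sq_nonneg _) (sq_nonneg _)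
        _ = C ^ 2 * (ρ ^ 3 * ρ) := by ring
        _ ≤ C ^ 2 * ((A * |x|) ^ 3 * a) := by gcongr
        _ = _ := by ring
    have h3 : h' * |x| ≤ B / σ := by
      rw [le_div_iff₀ hσ]
      refine le_trans ?_ hhB
      have : σ * |x| ≤ |ψ| := by
        have h4 : σ * |x| * |x| ≤ |ψ| * |x| := by
          calc σ * |x| * |x| = σ * x ^ 2 := by rw [mul_assoc, ← sq, sq_abs]
            _ ≤ x * ψ := hψx
            _ ≤ |x * ψ| := le_abs_self _
            _ = _ := by rw [abs_mul, mul_comm]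
        exact le_of_mul_le_mul_right h4 hxa
      calc h' * |x| * σ = h' * (σ * |x|) := by ring
        _ ≤ _ := mul_le_mul_of_nonneg_left this hh'
    have h5 : h' * (((κ - K) * q₁) ^ 2 / (4 * k)) ≤ B / σ * C ^ 2 * A ^ 3 / (4 * k) * a * x ^ 2 := by
      calc h' * (((κ - K) * q₁) ^ 2 / (4 * k)) ≤ h' * (C ^ 2 * (A ^ 3 * |x| ^ 3 * a) / (4 * k)) := by
            gcongr
        _ = h' * |x| * (C ^ 2 * A ^ 3 / (4 * k) * a * |x| ^ 2) := by ring
        _ ≤ B / σ * (C ^ 2 * A ^ 3 / (4 * k) * a * |x| ^ 2) :=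
            mul_le_mul_of_nonneg_right h3 (by positivity)
        _ = _ := by rw [sq_abs]; ring
    have h6 := mul_le_mul_of_nonneg_left h1 hh'
    have e : h' * (k * p₀ + (κ - K) * q₁) * p₀ = h' * ((k * p₀ + (κ - K) * q₁) * p₀) := by ring
    rw [e]
    linarith
  have hform := neck_form_pos hκ x π
  have e5 : neckRate κ x q₁ q₂ p₀ π p₂ K w h h' 1 0 =
      (-x * (π + 2 * κ * x) + (κ * x + π) * (2 * κ * x + π) + (π - x) ^ 2 / 2)
      + (k / 2 * q₁ ^ 2 + κ / 2 * q₂ ^ 2 + p₂ ^ 2 / 2)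
      + ((κ - 1) * x + π) * dw + 1 / 2 * ((K - κ) * (q₁ ^ 2 + q₂ ^ 2)) + (h - ψ) * w
      + h' * (k * p₀ + (κ - K) * q₁) * p₀ := by
    rw [neckRate, hdw, hψ, hk]; ring
  rw [e5]
  have f1 := (abs_le.1 e1).1
  have f2 := (abs_le.1 e2).1
  have f3 : 0 ≤ C * A ^ 2 * a * x ^ 2 := by positivity
  have f4 : a * M * x ^ 2 = (κ + A) * C * A * a * x ^ 2 + C * A ^ 2 * a * x ^ 2
      + B / σ * C ^ 2 * A ^ 3 / (4 * k) * a * x ^ 2 := by rw [hM]; ring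
  have f5 := mul_lt_mul_of_pos_right haM hxp
  have f6 : 0 ≤ k / 2 * q₁ ^ 2 + κ / 2 * q₂ ^ 2 + p₂ ^ 2 / 2 := by positivity
  linarith [sq_nonneg π]

set_option maxHeartbeats 400000 in
/-- Positivity on the critical level where the first cut-off is constant. -/
theorem neckRate_pos_saturated {κ C A σ B r : ℝ} (hκ : 1 < κ) (hC : 0 ≤ C) (hA : 1 ≤ A)
    (hσ : 0 < σ) (hB : 0 ≤ B) (hr : 0 < r) :
    ∃ a₀ > 0, ∀ x q₁ q₂ p₀ π p₂ K w ρ h χ χ' : ℝ, 0 ≤ ρ → ρ ≤ a₀ →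
      x ^ 2 + q₁ ^ 2 + q₂ ^ 2 = ρ ^ 2 → |K - κ| ≤ C * ρ → |w - (π + 2 * κ * x)| ≤ C * ρ ^ 2 →
      ρ ≤ A * |x| → |p₀| ≤ A * |x| → |π - x| ≤ A * |x| → |p₂| ≤ A * |x| →
      σ * x ^ 2 ≤ x * (κ * x + π) → σ * x ^ 2 ≤ x * w → x ≠ 0 →
      r * |κ * x + π| ≤ h * (κ * x + π) → 0 ≤ χ → χ ≤ 1 → |χ'| * |κ * x + π| ≤ B →
      0 < neckRate κ x q₁ q₂ p₀ π p₂ K w h 0 χ χ' := by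
  set k := κ - 1 with hk
  have hk0 : 0 < k := by linarith
  set W := A + 1 + 2 * κ + C * A with hW
  set M := W + A ^ 2 + (κ + C) * A ^ 2 + (B / σ) * ((k + C) * A) * A ^ 2
    + (A ^ 2 + (κ + C + 1) * A ^ 2) with hM
  have hW0 : 0 ≤ W := by positivity
  have hM0 : 0 ≤ M := by positivity
  refine ⟨min 1 (r * σ / (M + 1)), by positivity, ?_⟩
  intro x q₁ q₂ p₀ π p₂ K w ρ h χ χ' hρ0 hρ hs hK hw hρA hpA hbA hp2A hψx hwx hx0 hhr hχ0 hχ1 hχB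
  have hρ1 : ρ ≤ 1 := hρ.trans (min_le_left _ _)
  have hρa : ρ ≤ r * σ / (M + 1) := hρ.trans (min_le_right _ _)
  have hxρ : |x| ≤ ρ := abs_le_of_sq_le_sq (by linarith [sq_nonneg q₁, sq_nonneg q₂]) hρ0
  have hq1 : |q₁| ≤ A * |x| :=
    (abs_le_of_sq_le_sq (by linarith [sq_nonneg x, sq_nonneg q₂]) hρ0).trans hρA
  have hq2 : |q₂| ≤ A * |x| :=
    (abs_le_of_sq_le_sq (by linarith [sq_nonneg x, sq_nonneg q₁]) hρ0).trans hρA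
  have hxa : 0 < |x| := abs_pos.2 hx0
  have hxp : 0 < x ^ 2 := by positivity
  have hKb : |K| ≤ κ + C := by
    have : K = (K - κ) + κ := by ring
    rw [this]
    refine (abs_add_le _ _).trans ?_
    rw [abs_of_pos (by linarith : 0 < κ)]
    have := mul_le_mul_of_nonneg_left hρ1 hC
    linarith
  obtain ⟨ψ, hψ⟩ : ∃ ψ, ψ = κ * x + π := ⟨_, rfl⟩
  rw [← hψ] at hψx hhr hχB
  have hσψ : σ * |x| ≤ |ψ| := by
    have h4 : σ * |x| * |x| ≤ |ψ| * |x| := by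
      calc σ * |x| * |x| = σ * x ^ 2 := by rw [mul_assoc, ← sq, sq_abs]
        _ ≤ x * ψ := hψx
        _ ≤ |x * ψ| := le_abs_self _
        _ = _ := by rw [abs_mul, mul_comm]
    exact le_of_mul_le_mul_right h4 hxa
  have hσw : σ * |x| ≤ |w| := by
    have h4 : σ * |x| * |x| ≤ |w| * |x| := by
      calc σ * |x| * |x| = σ * x ^ 2 := by rw [mul_assoc, ← sq, sq_abs]
        _ ≤ x * w := hwx
        _ ≤ |x * w| := le_abs_self _
        _ = _ := by rw [abs_mul, mul_comm]
    exact le_of_mul_le_mul_right h4 hxa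
  have hx2 : |x| ^ 2 = x ^ 2 := sq_abs x
  have hψw : 0 < ψ * w := by
    have : 0 < (x * ψ) * (x * w) := mul_pos ((by positivity : 0 < σ * x ^ 2).trans_le hψx)
        ((by positivity : 0 < σ * x ^ 2).trans_le hwx)
    have e : (x * ψ) * (x * w) = x ^ 2 * (ψ * w) := by ring
    rw [e] at this
    exact pos_of_mul_pos_right this hxp.le
  have hψ0 : ψ ≠ 0 := by rintro rfl; simp at hψw
  -- the leading term
  have lead : r * σ * |x| ≤ h * w := by
    have h1 : r * |w| ≤ h * w := by
      have h2 : r * |ψ| * |w| * |ψ| ≤ h * w * ψ ^ 2 := by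
        calc r * |ψ| * |w| * |ψ| = (r * |ψ|) * |ψ * w| := by rw [abs_mul]; ring
          _ = (r * |ψ|) * (ψ * w) := by rw [abs_of_pos hψw]
          _ ≤ (h * ψ) * (ψ * w) := mul_le_mul_of_nonneg_right hhr hψw.le
          _ = _ := by ring
      have h3 : r * |ψ| * |w| * |ψ| = r * |w| * ψ ^ 2 := by rw [← sq_abs ψ]; ring
      rw [h3] at h2
      exact le_of_mul_le_mul_right h2 (by positivity)
    have := mul_le_mul_of_nonneg_left hσw hr.le
    linarith
  have hwW : |w| ≤ W * |x| := by
    have e : w = (w - (π + 2 * κ * x)) + ((π - x) + (1 + 2 * κ) * x) := by ring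
    rw [e]
    refine (abs_add_le _ _).trans ?_
    have h1 : |(π - x) + (1 + 2 * κ) * x| ≤ A * |x| + (1 + 2 * κ) * |x| := by
      refine (abs_add_le _ _).trans ?_
      rw [abs_mul, abs_of_pos (by linarith : 0 < 1 + 2 * κ)]
      linarith
    have h2 : C * ρ ^ 2 ≤ C * (A * |x|) := by
      refine mul_le_mul_of_nonneg_left ?_ hC
      have := mul_le_mul hρ1 hρA hρ0 zero_le_one
      linarith
    rw [hW]
    linarith
  have e1 : |x * w| ≤ W * x ^ 2 := by
    rw [abs_mul, ← hx2]
    have := mul_le_mul_of_nonneg_left hwW hxa.le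
    linarith
  have e2 : |q₁ * p₀| ≤ A ^ 2 * x ^ 2 := by
    rw [abs_mul, ← hx2, ← mul_pow, sq]
    exact mul_le_mul hq1 hpA (abs_nonneg _) (by positivity)
  have hq1s : q₁ ^ 2 ≤ A ^ 2 * x ^ 2 := by
    rw [← sq_abs q₁, ← hx2, ← mul_pow]; exact pow_le_pow_left₀ (abs_nonneg _) hq1 2
  have hq2s : q₂ ^ 2 ≤ A ^ 2 * x ^ 2 := by
    rw [← sq_abs q₂, ← hx2, ← mul_pow]; exact pow_le_pow_left₀ (abs_nonneg _) hq2 2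
  have hqs : q₁ ^ 2 + q₂ ^ 2 ≤ A ^ 2 * x ^ 2 := by
    have : ρ ^ 2 ≤ (A * |x|) ^ 2 := pow_le_pow_left₀ hρ0 hρA 2
    rw [mul_pow, hx2] at this
    linarith
  have e3 : |K * (q₁ ^ 2 + q₂ ^ 2)| ≤ (κ + C) * A ^ 2 * x ^ 2 := by
    rw [abs_mul, abs_of_nonneg (by positivity : 0 ≤ q₁ ^ 2 + q₂ ^ 2), mul_assoc]
    exact mul_le_mul hKb hqs (by positivity) (by positivity)
  have e4 : |1 / 2 * χ' * (k * p₀ + (κ - K) * q₁) * (q₁ * (π - x) + q₂ * p₂)| ≤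
      (B / σ) * ((k + C) * A) * A ^ 2 * x ^ 2 := by
    have h1 : |k * p₀ + (κ - K) * q₁| ≤ (k + C) * A * |x| := by
      refine (abs_add_le _ _).trans ?_
      rw [abs_mul, abs_mul, abs_of_pos hk0, abs_sub_comm]
      have h2 : |K - κ| * |q₁| ≤ C * (A * |x|) :=
        mul_le_mul (hK.trans (mul_le_of_le_one_right hC hρ1)) hq1 (abs_nonneg _) hC
      have h3 := mul_le_mul_of_nonneg_left hpA hk0.le
      linarith
    have h2 : |q₁ * (π - x) + q₂ * p₂| ≤ 2 * (A ^ 2 * |x| ^ 2) := by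
      refine (abs_add_le _ _).trans ?_
      rw [abs_mul, abs_mul]
      have h3 := mul_le_mul hq1 hbA (abs_nonneg _) (by positivity)
      have h4 := mul_le_mul hq2 hp2A (abs_nonneg _) (by positivity)
      linarith
    have h3 : |χ'| * |x| ≤ B / σ := by
      rw [le_div_iff₀ hσ]
      refine le_trans ?_ hχB
      calc |χ'| * |x| * σ = |χ'| * (σ * |x|) := by ring
        _ ≤ _ := mul_le_mul_of_nonneg_left hσψ (abs_nonneg _)
    rw [abs_mul, abs_mul, abs_mul, abs_of_pos (by norm_num : (0 : ℝ) < 1 / 2)]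
    calc 1 / 2 * |χ'| * |k * p₀ + (κ - K) * q₁| * |q₁ * (π - x) + q₂ * p₂|
        ≤ 1 / 2 * |χ'| * ((k + C) * A * |x|) * (2 * (A ^ 2 * |x| ^ 2)) := by gcongr
      _ = (|χ'| * |x|) * ((k + C) * A * A ^ 2 * |x| ^ 2) := by ring
      _ ≤ (B / σ) * ((k + C) * A * A ^ 2 * |x| ^ 2) :=
          mul_le_mul_of_nonneg_right h3 (by positivity)
      _ = _ := by rw [hx2]; ring
  have e5 : -((A ^ 2 + (κ + C + 1) * A ^ 2) * x ^ 2) ≤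
      1 / 2 * χ * ((π - x) ^ 2 - 2 * q₁ * p₀ - (K + 1) * q₁ ^ 2 + p₂ ^ 2 - K * q₂ ^ 2) := by
    have h1 : -((2 * A ^ 2 + (κ + C + 1) * A ^ 2) * x ^ 2) ≤
        (π - x) ^ 2 - 2 * q₁ * p₀ - (K + 1) * q₁ ^ 2 + p₂ ^ 2 - K * q₂ ^ 2 := by
      have h2 := (abs_le.1 e2).2
      have h3 := (abs_le.1 e3).2
      linarith [sq_nonneg (π - x), sq_nonneg p₂]
    have hP : 0 ≤ (2 * A ^ 2 + (κ + C + 1) * A ^ 2) * x ^ 2 := by positivity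
    have h4 := mul_le_mul_of_nonneg_left h1 (by linarith : 0 ≤ 1 / 2 * χ)
    have h5 := mul_le_mul_of_nonneg_right hχ1 hP
    have h6 : 0 ≤ (κ + C + 1) * A ^ 2 * x ^ 2 := by positivity
    linarith
  have e6 : neckRate κ x q₁ q₂ p₀ π p₂ K w h 0 χ χ' = h * w - x * w + q₁ * p₀
      + K * (q₁ ^ 2 + q₂ ^ 2)
      + 1 / 2 * χ' * (k * p₀ + (κ - K) * q₁) * (q₁ * (π - x) + q₂ * p₂)
      + 1 / 2 * χ * ((π - x) ^ 2 - 2 * q₁ * p₀ - (K + 1) * q₁ ^ 2 + p₂ ^ 2 - K * q₂ ^ 2) := by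
    rw [neckRate]; ring
  -- The leading term h w is linear in |x| while everything else is quadratic, so it wins for small
  -- |x|.
  have e7 : M * x ^ 2 < r * σ * |x| := by
    have h1 : |x| * (M + 1) ≤ r * σ := by
      rw [← le_div_iff₀ (by positivity)]; exact hxρ.trans hρa
    have h2 := mul_le_mul_of_nonneg_right h1 hxa.le
    rw [← hx2]
    have h3 : 0 < |x| ^ 2 := by positivity
    linarith
  have f : M * x ^ 2 = W * x ^ 2 + A ^ 2 * x ^ 2 + (κ + C) * A ^ 2 * x ^ 2
      + (B / σ) * ((k + C) * A) * A ^ 2 * x ^ 2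
      + (A ^ 2 + (κ + C + 1) * A ^ 2) * x ^ 2 := by rw [hM]; ring
  rw [e6]
  linarith [(abs_le.1 e1).2, (abs_le.1 e2).1, (abs_le.1 e3).1, (abs_le.1 e4).1]

/-! ### Cut-off functions -/

/-- The properties of the two cut-off functions that are used in the neck. -/
structure IsNeckCutoff (e r r' B : ℝ) (h χ : ℝ → ℝ) : Prop where
  contDiff_h : ContDiff ℝ ∞ h
  contDiff_χ : ContDiff ℝ ∞ χ
  inner : ∀ ψ, |ψ| ≤ e → h ψ = ψ ∧ deriv h ψ = 1 ∧ χ ψ = 1 ∧ deriv χ ψ = 0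
  middle : ∀ ψ, e ≤ |ψ| → |ψ| ≤ 2 * e → 0 ≤ deriv h ψ ∧ deriv h ψ * |ψ| ≤ B ∧
    0 ≤ (h ψ - ψ) * ψ ∧ χ ψ = 1 ∧ deriv χ ψ = 0
  outer : ∀ ψ, 2 * e ≤ |ψ| → deriv h ψ = 0 ∧ min r r' * |ψ| ≤ h ψ * ψ ∧ 0 ≤ χ ψ ∧ χ ψ ≤ 1 ∧
    |deriv χ ψ| * |ψ| ≤ B
  right : ∀ ψ, 4 * e ≤ ψ → h ψ = r ∧ χ ψ = 0
  left : ∀ ψ, ψ ≤ -(4 * e) → h ψ = -r' ∧ χ ψ = 0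

theorem deriv_smoothTransition_nonneg (x : ℝ) : 0 ≤ deriv Real.smoothTransition x :=
  Real.smoothTransition.monotone.deriv_nonneg

theorem deriv_smoothTransition_of_nonpos {x : ℝ} (hx : x ≤ 0) :
    deriv Real.smoothTransition x = 0 := by
  refine IsLocalMin.deriv_eq_zero (Eventually.of_forall fun y => ?_)
  rw [Real.smoothTransition.zero_of_nonpos hx]
  exact Real.smoothTransition.nonneg y

theorem deriv_smoothTransition_of_one_le {x : ℝ} (hx : 1 ≤ x) :
    deriv Real.smoothTransition x = 0 := by
  refine IsLocalMax.deriv_eq_zero (Eventually.of_forall fun y => ?_)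
  rw [Real.smoothTransition.one_of_one_le hx]
  exact Real.smoothTransition.le_one y

theorem exists_deriv_smoothTransition_le :
    ∃ B, 0 ≤ B ∧ ∀ x, deriv Real.smoothTransition x ≤ B := by
  have hc : Continuous (deriv Real.smoothTransition) :=
    (Real.smoothTransition.contDiff (n := 1)).continuous_deriv le_rfl
  obtain ⟨B, hB⟩ := (isCompact_Icc (a := (0 : ℝ)) (b := 1)).exists_bound_of_continuousOn
    hc.continuousOn
  refine ⟨max B 0, le_max_right _ _, fun x => ?_⟩
  by_cases h0 : x ≤ 0
  · rw [deriv_smoothTransition_of_nonpos h0]; exact le_max_right _ _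
  by_cases h1 : 1 ≤ x
  · rw [deriv_smoothTransition_of_one_le h1]; exact le_max_right _ _
  · exact ((le_abs_self _).trans (hB x ⟨(not_le.1 h0).le, (not_le.1 h1).le⟩)).trans
      (le_max_left _ _)

/-- h passes from ψ to the constants r and -r' for e ≤ |ψ| ≤ 2e, and only then χ passes from 1 to 0
for 2e ≤ |ψ| ≤ 4e. Derivatives of size 1/e occur at |ψ| of size e, so B is independent of e; this
order of quantifiers lets e be chosen after the radius of the neck. -/
theorem exists_isNeckCutoff {r r' : ℝ} (hr : 0 < r) (hr' : 0 < r') :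
    ∃ B, 0 ≤ B ∧ ∀ e, 0 < e → 2 * e ≤ r → 2 * e ≤ r' →
      ∃ h χ : ℝ → ℝ, IsNeckCutoff e r r' B h χ := by
  obtain ⟨B₁, hB₁, hB⟩ := exists_deriv_smoothTransition_le
  have hTs : ContDiff ℝ ∞ Real.smoothTransition := Real.smoothTransition.contDiff (n := ⊤)
  have hTd : Differentiable ℝ Real.smoothTransition := hTs.differentiable (by simp)
  refine ⟨(1 + 2 * B₁) * (r + r') + 3 * B₁, by positivity, fun e he her her' => ?_⟩
  set T := Real.smoothTransition with hT
  set h : ℝ → ℝ := fun ψ => ψ + T ((ψ - e) / e) * (r - ψ) + T ((-ψ - e) / e) * (-r' - ψ) with hh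
  set χ : ℝ → ℝ := fun ψ => 1 - T ((ψ ^ 2 - 4 * e ^ 2) / (12 * e ^ 2)) with hχ
  have dh : ∀ ψ, deriv h ψ = 1 + (deriv T ((ψ - e) / e) / e * (r - ψ) - T ((ψ - e) / e))
      + (-(deriv T ((-ψ - e) / e) / e) * (-r' - ψ) - T ((-ψ - e) / e)) := by
    intro ψ
    have i := hasDerivAt_id' ψ
    have h1 := ((hTd ((ψ - e) / e)).hasDerivAt.comp ψ ((i.sub_const e).div_const e)).mul
      (i.const_sub r)
    have h2 := ((hTd ((-ψ - e) / e)).hasDerivAt.comp ψ ((i.neg.sub_const e).div_const e)).mul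
      (i.const_sub (-r'))
    refine HasDerivAt.deriv (((i.add h1).add h2).congr_deriv ?_)
    simp only [Function.comp, Pi.neg_apply]
    ring
  have dχ : ∀ ψ, deriv χ ψ =
      -(deriv T ((ψ ^ 2 - 4 * e ^ 2) / (12 * e ^ 2)) * (ψ / (6 * e ^ 2))) := by
    intro ψ
    have i := hasDerivAt_pow 2 ψ
    have h1 := ((hTd ((ψ ^ 2 - 4 * e ^ 2) / (12 * e ^ 2))).hasDerivAt.comp ψ
      ((i.sub_const (4 * e ^ 2)).div_const (12 * e ^ 2))).const_sub 1
    refine HasDerivAt.deriv (h1.congr_deriv ?_)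
    field_simp
    norm_num
    ring
  have T0 : ∀ {x}, x ≤ 0 → T x = 0 := fun hx => Real.smoothTransition.zero_of_nonpos hx
  have T1 : ∀ {x}, 1 ≤ x → T x = 1 := fun hx => Real.smoothTransition.one_of_one_le hx
  have T0' : ∀ {x}, x ≤ 0 → deriv T x = 0 := fun hx => deriv_smoothTransition_of_nonpos hx
  have T1' : ∀ {x}, 1 ≤ x → deriv T x = 0 := fun hx => deriv_smoothTransition_of_one_le hx
  have u0 : ∀ {ψ}, ψ ≤ e → (ψ - e) / e ≤ 0 := fun hψ =>
    div_nonpos_of_nonpos_of_nonneg (by linarith) he.le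
  have u1 : ∀ {ψ}, 2 * e ≤ ψ → 1 ≤ (ψ - e) / e := fun hψ => by
    rw [le_div_iff₀ he]; linarith
  have χ0 : ∀ {ψ}, |ψ| ≤ 2 * e → χ ψ = 1 ∧ deriv χ ψ = 0 := fun {ψ} hψ => by
    have h1 : (ψ ^ 2 - 4 * e ^ 2) / (12 * e ^ 2) ≤ 0 := by
      refine div_nonpos_of_nonpos_of_nonneg ?_ (by positivity)
      have := pow_le_pow_left₀ (abs_nonneg ψ) hψ 2
      rw [sq_abs] at this
      linarith
    rw [dχ, T0' h1]
    simp only [hχ]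
    rw [T0 h1]
    simp
  have χ1 : ∀ {ψ}, 4 * e ≤ |ψ| → χ ψ = 0 ∧ deriv χ ψ = 0 := fun {ψ} hψ => by
    have h1 : 1 ≤ (ψ ^ 2 - 4 * e ^ 2) / (12 * e ^ 2) := by
      rw [le_div_iff₀ (by positivity)]
      have := pow_le_pow_left₀ (by positivity) hψ 2
      rw [sq_abs] at this
      linarith
    rw [dχ, T1' h1]
    simp only [hχ]
    rw [T1 h1]
    simp
  have hplus : ∀ {ψ}, 2 * e ≤ ψ → h ψ = r ∧ deriv h ψ = 0 := fun {ψ} hψ => by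
    have h1 := u1 hψ
    have h2 : (-ψ - e) / e ≤ 0 := u0 (by linarith)
    rw [dh, T1' h1, T1 h1, T0' h2, T0 h2]
    simp only [hh]
    rw [T1 h1, T0 h2]
    constructor <;> ring
  have hminus : ∀ {ψ}, ψ ≤ -(2 * e) → h ψ = -r' ∧ deriv h ψ = 0 := fun {ψ} hψ => by
    have h1 : 1 ≤ (-ψ - e) / e := u1 (by linarith)
    have h2 : (ψ - e) / e ≤ 0 := u0 (by linarith)
    rw [dh, T1' h1, T1 h1, T0' h2, T0 h2]
    simp only [hh]
    rw [T1 h1, T0 h2]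
    constructor <;> ring
  refine ⟨h, χ, ⟨?_, ?_, ?_, ?_, ?_, ?_, ?_⟩⟩
  · have c1 : ContDiff ℝ ∞ fun ψ : ℝ => T ((ψ - e) / e) := hTs.comp (by fun_prop)
    have c2 : ContDiff ℝ ∞ fun ψ : ℝ => T ((-ψ - e) / e) := hTs.comp (by fun_prop)
    exact (contDiff_id.add (c1.mul (by fun_prop))).add (c2.mul (by fun_prop))
  · have c1 : ContDiff ℝ ∞ fun ψ : ℝ => T ((ψ ^ 2 - 4 * e ^ 2) / (12 * e ^ 2)) :=
      hTs.comp (by fun_prop)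
    exact contDiff_const.sub c1
  · intro ψ hψ
    obtain ⟨h1, h2⟩ := abs_le.1 hψ
    have h3 := u0 h2
    have h4 : (-ψ - e) / e ≤ 0 := u0 (by linarith)
    obtain ⟨h5, h6⟩ := χ0 (hψ.trans (by linarith))
    refine ⟨?_, ?_, h5, h6⟩
    · simp only [hh]; rw [T0 h3, T0 h4]; ring
    · rw [dh, T0 h3, T0 h4, T0' h3, T0' h4]; ring
  · intro ψ h1 h2
    obtain ⟨h5, h6⟩ := χ0 h2
    rcases le_total 0 ψ with h0 | h0
    · rw [abs_of_nonneg h0] at h1 h2 ⊢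
      have h4 : (-ψ - e) / e ≤ 0 := u0 (by linarith)
      have t1 := Real.smoothTransition.le_one ((ψ - e) / e)
      have t0 := Real.smoothTransition.nonneg ((ψ - e) / e)
      have t2 := deriv_smoothTransition_nonneg ((ψ - e) / e)
      have t3 := hB ((ψ - e) / e)
      rw [← hT] at t0 t1 t2
      refine ⟨?_, ?_, ?_, h5, h6⟩
      · rw [dh, T0 h4, T0' h4]
        have : 0 ≤ deriv T ((ψ - e) / e) / e * (r - ψ) :=
          mul_nonneg (by positivity) (by linarith)
        simp only [zero_div, neg_zero, zero_mul, sub_zero, add_zero]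
        linarith
      · rw [dh, T0 h4, T0' h4]
        have d1 : deriv T ((ψ - e) / e) / e * (r - ψ) ≤ B₁ / e * r :=
          mul_le_mul (by gcongr) (by linarith) (by linarith) (by positivity)
        have d2 : (1 + B₁ / e * r) * ψ ≤ (1 + B₁ / e * r) * (2 * e) :=
          mul_le_mul_of_nonneg_left h2 (by positivity)
        have d3 : (1 + B₁ / e * r) * (2 * e) = 2 * e + 2 * B₁ * r := by field_simp
        have d4 : (1 + (deriv T ((ψ - e) / e) / e * (r - ψ) - T ((ψ - e) / e))
            + (-(0 / e) * (-r' - ψ) - 0)) * ψ ≤ (1 + B₁ / e * r) * ψ := by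
          refine mul_le_mul_of_nonneg_right ?_ h0
          simp only [zero_div, neg_zero, zero_mul, sub_zero, add_zero]
          linarith
        have d5 : 0 ≤ B₁ * r' := by positivity
        linarith
      · simp only [hh]
        rw [T0 h4]
        have : 0 ≤ T ((ψ - e) / e) * (r - ψ) := mul_nonneg t0 (by linarith)
        refine mul_nonneg ?_ h0
        linarith
    · rw [abs_of_nonpos h0] at h1 h2 ⊢
      have h4 : (ψ - e) / e ≤ 0 := u0 (by linarith)
      have t1 := Real.smoothTransition.le_one ((-ψ - e) / e)
      have t0 := Real.smoothTransition.nonneg ((-ψ - e) / e)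
      have t2 := deriv_smoothTransition_nonneg ((-ψ - e) / e)
      have t3 := hB ((-ψ - e) / e)
      rw [← hT] at t0 t1 t2
      refine ⟨?_, ?_, ?_, h5, h6⟩
      · rw [dh, T0 h4, T0' h4]
        have : 0 ≤ deriv T ((-ψ - e) / e) / e * (r' + ψ) :=
          mul_nonneg (by positivity) (by linarith)
        simp only [zero_div, zero_mul, sub_zero, add_zero]
        linarith
      · rw [dh, T0 h4, T0' h4]
        have d1 : deriv T ((-ψ - e) / e) / e * (r' + ψ) ≤ B₁ / e * r' :=
          mul_le_mul (by gcongr) (by linarith) (by linarith) (by positivity)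
        have d2 : (1 + B₁ / e * r') * (-ψ) ≤ (1 + B₁ / e * r') * (2 * e) :=
          mul_le_mul_of_nonneg_left h2 (by positivity)
        have d3 : (1 + B₁ / e * r') * (2 * e) = 2 * e + 2 * B₁ * r' := by field_simp
        have d4 : (1 + (0 / e * (r - ψ) - 0)
            + (-(deriv T ((-ψ - e) / e) / e) * (-r' - ψ) - T ((-ψ - e) / e))) * (-ψ) ≤
            (1 + B₁ / e * r') * (-ψ) := by
          refine mul_le_mul_of_nonneg_right ?_ (by linarith)
          simp only [zero_div, zero_mul, sub_zero, add_zero]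
          linarith
        have d5 : 0 ≤ B₁ * r := by positivity
        linarith
      · simp only [hh]
        rw [T0 h4]
        have : 0 ≤ T ((-ψ - e) / e) * (r' + ψ) := mul_nonneg t0 (by linarith)
        refine mul_nonneg_of_nonpos_of_nonpos ?_ h0
        linarith
  · intro ψ h1
    have hsign : deriv h ψ = 0 ∧ min r r' * |ψ| ≤ h ψ * ψ := by
      rcases le_total 0 ψ with h0 | h0
      · rw [abs_of_nonneg h0] at h1 ⊢
        obtain ⟨h2, h3⟩ := hplus h1
        rw [h2]
        exact ⟨h3, mul_le_mul_of_nonneg_right (min_le_left _ _) h0⟩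
      · rw [abs_of_nonpos h0] at h1 ⊢
        obtain ⟨h2, h3⟩ := hminus (by linarith : ψ ≤ -(2 * e))
        rw [h2]
        refine ⟨h3, ?_⟩
        have := mul_le_mul_of_nonneg_right (min_le_right r r') (by linarith : 0 ≤ -ψ)
        linarith
    refine ⟨hsign.1, hsign.2, ?_, ?_, ?_⟩
    · simp only [hχ]; linarith [Real.smoothTransition.le_one ((ψ ^ 2 - 4 * e ^ 2) / (12 * e ^ 2))]
    · simp only [hχ]; linarith [Real.smoothTransition.nonneg ((ψ ^ 2 - 4 * e ^ 2) / (12 * e ^ 2))]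
    · rcases le_total (4 * e) |ψ| with h4 | h4
      · rw [(χ1 h4).2]; simp; positivity
      · rw [dχ, abs_neg, abs_mul, abs_of_nonneg (deriv_smoothTransition_nonneg _), abs_div,
          abs_of_pos (by positivity : 0 < 6 * e ^ 2)]
        have h5 : |ψ| / (6 * e ^ 2) * |ψ| ≤ 3 := by
          have h6 := pow_le_pow_left₀ (abs_nonneg ψ) h4 2
          rw [div_mul_eq_mul_div, div_le_iff₀ (by positivity)]
          nlinarith [sq_nonneg e]
        have h6 := mul_le_mul (hB ((ψ ^ 2 - 4 * e ^ 2) / (12 * e ^ 2))) h5 (by positivity) hB₁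
        have h7 : 0 ≤ (1 + 2 * B₁) * (r + r') := by positivity
        linarith
  · intro ψ hψ
    exact ⟨(hplus (by linarith)).1, (χ1 (by rwa [abs_of_nonneg (by linarith)])).1⟩
  · intro ψ hψ
    exact ⟨(hminus (by linarith)).1, (χ1 (by rw [abs_of_nonpos (by linarith)]; linarith)).1⟩

/-! ### The Hamiltonian near the first Lagrange point -/

/-- The coefficient of the attraction at the point `q`. -/
noncomputable def attraction (μ : ℝ) (q : E3) : ℝ :=
  μ * (‖q - pos μ .moon‖ ^ 3)⁻¹ + (1 - μ) * (‖q - pos μ .earth‖ ^ 3)⁻¹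

/-- The coefficient of the attraction at the first Lagrange point. -/
noncomputable def lagKappa (μ : ℝ) : ℝ :=
  μ * (lagDist μ .moon ^ 3)⁻¹ + (1 - μ) * (lagDist μ .earth ^ 3)⁻¹

/-- κ is the average, with weights the masses, of the inverse cubes of two distances less than 1. -/
theorem one_lt_lagKappa {μ : ℝ} (h : μ ∈ Ioo (0 : ℝ) 1) : 1 < lagKappa μ := by
  have key : ∀ b, 1 < (lagDist μ b ^ 3)⁻¹ := fun b => by
    have h0 := lagDist_pos h b
    exact (one_lt_inv₀ (by positivity)).2 (pow_lt_one₀ h0.le (lagDist_lt_one h b) (by norm_num))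
  have h1 := mul_lt_mul_of_pos_left (key .moon) h.1
  have h2 := mul_lt_mul_of_pos_left (key .earth) (sub_pos.2 h.2)
  unfold lagKappa
  linarith

/-- `newton_expansion` with lengths scaled by the distance from the Lagrange point to the primary;
the sign records on which side the primary lies. -/
theorem newton_expansion_lagPos {μ : ℝ} (h : μ ∈ Ioo (0 : ℝ) 1) (b : Primary) {q : E3}
    (hq : ‖q - lagPos μ‖ ≤ lagDist μ b / 4) :
    |lagDist μ b / ‖q - pos μ b‖ - 1 + axisSign b * (q 0 - lagX μ) / lagDist μ b
        - (2 * (q 0 - lagX μ) ^ 2 - q 1 ^ 2 - q 2 ^ 2) / (2 * lagDist μ b ^ 2)| ≤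
        40 * ‖q - lagPos μ‖ ^ 3 / lagDist μ b ^ 3 ∧
      |(lagDist μ b / ‖q - pos μ b‖) ^ 3 - 1 + 3 * axisSign b * (q 0 - lagX μ) / lagDist μ b| ≤
        100 * ‖q - lagPos μ‖ ^ 2 / lagDist μ b ^ 2 ∧
      |(lagDist μ b / ‖q - pos μ b‖) ^ 3 - 1| ≤ 28 * ‖q - lagPos μ‖ / lagDist μ b := by
  have hr := lagDist_pos h b
  set r := lagDist μ b with hrdef
  set ρ := ‖q - lagPos μ‖ with hρ
  set ξ := q 0 - lagX μ with hξ
  have hρ2 : ρ ^ 2 = ξ ^ 2 + q 1 ^ 2 + q 2 ^ 2 := by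
    rw [hρ, norm_sq_E3]; simp [lagPos, hξ]
  have hd2 : ‖q - pos μ b‖ ^ 2 = (r + axisSign b * ξ) ^ 2 + q 1 ^ 2 + q 2 ^ 2 := by
    have e := lagX_eq μ b
    rw [norm_sq_E3]
    simp only [PiLp.sub_apply, pos_one, pos_two, sub_zero]
    have e2 : q 0 - pos μ b 0 = ξ + axisSign b * r := by rw [hξ, e]; ring
    rw [e2]
    have := axisSign_sq b
    linear_combination (r ^ 2 - ξ ^ 2) * this
  have hd : 0 < ‖q - pos μ b‖ := by
    rw [norm_pos_iff, sub_ne_zero]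
    rintro rfl
    have e := norm_lagPos_sub_pos h b
    rw [norm_sub_rev] at e
    rw [← hρ, ← hrdef] at e
    linarith
  have key := newton_expansion (x := -(axisSign b * ξ / r)) (y := q 1 / r) (z := q 2 / r)
    (ρ := ρ / r) (U := r / ‖q - pos μ b‖) (by positivity)
    (by rw [div_le_iff₀ hr]; linarith)
    (by
      have := axisSign_sq b
      simp only [neg_sq, div_pow, mul_pow, this, hρ2]; ring)
    (by positivity)
    (by
      have : (1 - -(axisSign b * ξ / r)) ^ 2 + (q 1 / r) ^ 2 + (q 2 / r) ^ 2 =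
          ‖q - pos μ b‖ ^ 2 / r ^ 2 := by rw [hd2]; field_simp; ring
      rw [this]; field_simp)
  have hs := axisSign_sq b
  refine ⟨?_, ?_, ?_⟩
  · convert key.1 using 1
    · congr 1
      have e : (-(axisSign b * ξ / r)) ^ 2 = ξ ^ 2 / r ^ 2 := by
        rw [neg_sq, div_pow, mul_pow, hs, one_mul]
      rw [e]; field_simp; ring
    · rw [div_pow]; ring
  · convert key.2.1 using 1
    · congr 1; ring
    · rw [div_pow]; ring
  · convert key.2.2 using 1
    ring

/-- The balance in terms of `kfun` rewritten as gravity against centrifugal force; it removes the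
lowest order terms in the expansions below. -/
theorem lag_force_balance {μ : ℝ} (h : μ ∈ Ioo (0 : ℝ) 1) :
    lagX μ + (1 - μ) / lagDist μ .earth ^ 2 - μ / lagDist μ .moon ^ 2 = 0 := by
  have e := lag_balance h .earth
  have e1 := lagDist_other μ .earth
  have e2 := lagX_eq μ .earth
  simp only [Primary.other, mass, axisSign, pos] at e e1 e2
  rw [← e1] at e
  unfold kfun at e
  simp at e2
  simp only [div_eq_mul_inv, one_mul, ← inv_pow] at e ⊢
  linear_combination e + e2 - μ * e1

set_option maxHeartbeats 800000 in
/-- Expansion of the attraction, of the force and of the effective potential. -/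
theorem neck_expansion {μ : ℝ} (h : μ ∈ Ioo (0 : ℝ) 1) : ∃ C, 0 ≤ C ∧ ∃ a₀ > 0, ∀ q : E3,
    ‖q - lagPos μ‖ ≤ a₀ →
      |attraction μ q - lagKappa μ| ≤ C * ‖q - lagPos μ‖ ∧
      |lagX μ - gradV μ q 0 - 2 * lagKappa μ * (q 0 - lagX μ)| ≤ C * ‖q - lagPos μ‖ ^ 2 ∧
      |effPot μ q - energyL1 μ - (-(2 * lagKappa μ + 1) * (q 0 - lagX μ) ^ 2
        + (lagKappa μ - 1) * q 1 ^ 2 + lagKappa μ * q 2 ^ 2) / 2| ≤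
        C * ‖q - lagPos μ‖ ^ 3 := by
  have hr := lagDist_pos h .earth
  have hr' := lagDist_pos h .moon
  have hbal := lag_force_balance h
  have hE := energyL1_eq_effPot h
  have nE := norm_lagPos_sub_pos h .earth
  have nM := norm_lagPos_sub_pos h .moon
  have hm := h.1
  have hm' : 0 < 1 - μ := sub_pos.2 h.2
  have xE := lagX_eq μ .earth
  have xM := lagX_eq μ .moon
  have nb := fun b q => newton_expansion_lagPos h b (q := q)
  set r := lagDist μ .earth with hrd
  set r' := lagDist μ .moon with hrd'
  -- 128 = 28 + 100: the error 28 of the attraction times the displacement, and the error 100 in the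
  -- expansion of the cubes. It also covers the 40 of the potential.
  refine ⟨128 * (μ / r' ^ 4 + (1 - μ) / r ^ 4), by positivity, min r r' / 4, by positivity, ?_⟩
  intro q hq
  obtain ⟨a1, a2, a3⟩ := nb .earth q (hq.trans (by have := min_le_left r r'; linarith))
  obtain ⟨b1, b2, b3⟩ := nb .moon q (hq.trans (by have := min_le_right r r'; linarith))
  rw [← hrd] at a1 a2 a3
  rw [← hrd'] at b1 b2 b3
  have hρ0 : 0 ≤ ‖q - lagPos μ‖ := norm_nonneg _
  set ρ := ‖q - lagPos μ‖ with hρ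
  set ξ := q 0 - lagX μ with hξ
  set d := ‖q - pos μ .earth‖ with hd
  set d' := ‖q - pos μ .moon‖ with hd'
  obtain ⟨u, hu⟩ : ∃ u, u = r / d := ⟨_, rfl⟩
  obtain ⟨u', hu'⟩ : ∃ u', u' = r' / d' := ⟨_, rfl⟩
  rw [← hu] at a1 a2 a3
  rw [← hu'] at b1 b2 b3
  have hdi : d⁻¹ = u / r := by rw [hu]; field_simp
  have hdi' : d'⁻¹ = u' / r' := by rw [hu']; field_simp
  simp only [axisSign] at a1 a2 b1 b2 xE xM
  have hxρ : |ξ| ≤ ρ := by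
    have := PiLp.norm_apply_le (q - lagPos μ) 0
    simpa [lagPos, hξ, hρ] using this
  have hK : attraction μ q - lagKappa μ =
      μ / r' ^ 3 * (u' ^ 3 - 1) + (1 - μ) / r ^ 3 * (u ^ 3 - 1) := by
    simp only [attraction, lagKappa, ← hd, ← hd', ← hrd, ← hrd', ← inv_pow, hdi, hdi']
    ring
  have hKb : |attraction μ q - lagKappa μ| ≤ 28 * (μ / r' ^ 4 + (1 - μ) / r ^ 4) * ρ := by
    rw [hK]
    refine (abs_add_le _ _).trans ?_
    rw [abs_mul, abs_mul, abs_of_pos (by positivity : 0 < μ / r' ^ 3),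
      abs_of_pos (by positivity : 0 < (1 - μ) / r ^ 3)]
    calc _ ≤ μ / r' ^ 3 * (28 * ρ / r') + (1 - μ) / r ^ 3 * (28 * ρ / r) := by gcongr
      _ = _ := by field_simp
  have hC0 : 0 ≤ μ / r' ^ 4 + (1 - μ) / r ^ 4 := by positivity
  refine ⟨?_, ?_, ?_⟩
  · refine hKb.trans ?_
    nlinarith
  · have e : lagX μ - gradV μ q 0 - 2 * lagKappa μ * ξ = -((attraction μ q - lagKappa μ) * ξ)
        + (1 - μ) / r ^ 2 * (u ^ 3 - 1 + 3 * -1 * ξ / r)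
        - μ / r' ^ 2 * (u' ^ 3 - 1 + 3 * 1 * ξ / r') := by
      have g : gradV μ q 0 = attraction μ q * ξ + μ * (u' / r') ^ 3 * r'
          - (1 - μ) * (u / r) ^ 3 * r := by
        have e1 : q 0 - pos μ .moon 0 = ξ + r' := by rw [hξ]; linarith
        have e2 : q 0 - pos μ .earth 0 = ξ - r := by rw [hξ]; linarith
        simp only [gradV, attraction, PiLp.add_apply, PiLp.smul_apply, PiLp.sub_apply,
          smul_eq_mul, e1, e2, ← hd, ← hd', ← inv_pow, hdi, hdi']
        ring
      have k : lagKappa μ = μ / r' ^ 3 + (1 - μ) / r ^ 3 := by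
        simp only [lagKappa, ← hrd, ← hrd', div_eq_mul_inv]
      rw [g]
      have e3 : μ * (u' / r') ^ 3 * r' = μ / r' ^ 2 * u' ^ 3 := by field_simp
      have e4 : (1 - μ) * (u / r) ^ 3 * r = (1 - μ) / r ^ 2 * u ^ 3 := by field_simp
      rw [e3, e4, k]
      have e5 : (1 - μ) / r ^ 2 * (3 * -1 * ξ / r) = -(3 * ((1 - μ) / r ^ 3) * ξ) := by field_simp
      have e6 : μ / r' ^ 2 * (3 * 1 * ξ / r') = 3 * (μ / r' ^ 3) * ξ := by field_simp
      linear_combination hbal - e5 + e6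
    rw [e]
    have t1 : |(attraction μ q - lagKappa μ) * ξ| ≤
        28 * (μ / r' ^ 4 + (1 - μ) / r ^ 4) * ρ * ρ := by
      rw [abs_mul]; exact mul_le_mul hKb hxρ (abs_nonneg _) (by positivity)
    have t2 : |(1 - μ) / r ^ 2 * (u ^ 3 - 1 + 3 * -1 * ξ / r)| ≤
        100 * ((1 - μ) / r ^ 4) * ρ ^ 2 := by
      rw [abs_mul, abs_of_pos (by positivity : 0 < (1 - μ) / r ^ 2)]
      calc _ ≤ (1 - μ) / r ^ 2 * (100 * ρ ^ 2 / r ^ 2) := by gcongr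
        _ = _ := by field_simp
    have t3 : |μ / r' ^ 2 * (u' ^ 3 - 1 + 3 * 1 * ξ / r')| ≤
        100 * (μ / r' ^ 4) * ρ ^ 2 := by
      rw [abs_mul, abs_of_pos (by positivity : 0 < μ / r' ^ 2)]
      calc _ ≤ μ / r' ^ 2 * (100 * ρ ^ 2 / r' ^ 2) := by gcongr
        _ = _ := by field_simp
    rw [abs_le] at t1 t2 t3 ⊢
    constructor <;> linarith [t1.1, t1.2, t2.1, t2.2, t3.1, t3.2]
  · have e : effPot μ q - energyL1 μ - (-(2 * lagKappa μ + 1) * ξ ^ 2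
        + (lagKappa μ - 1) * q 1 ^ 2 + lagKappa μ * q 2 ^ 2) / 2 =
        -((1 - μ) / r * (u - 1 + -1 * ξ / r - (2 * ξ ^ 2 - q 1 ^ 2 - q 2 ^ 2) / (2 * r ^ 2)))
        - μ / r' * (u' - 1 + 1 * ξ / r' - (2 * ξ ^ 2 - q 1 ^ 2 - q 2 ^ 2) / (2 * r' ^ 2)) := by
      have k : lagKappa μ = μ / r' ^ 3 + (1 - μ) / r ^ 3 := by
        simp only [lagKappa, ← hrd, ← hrd', div_eq_mul_inv]
      have eU : effPot μ q = -(μ / r' * u') - (1 - μ) / r * u - (q 0 ^ 2 + q 1 ^ 2) / 2 := by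
        simp only [effPot, ← hd, ← hd', div_eq_mul_inv μ d', div_eq_mul_inv (1 - μ) d, hdi, hdi']
        ring
      have eL : energyL1 μ = -(μ / r') - (1 - μ) / r - lagX μ ^ 2 / 2 := by
        rw [hE, effPot, nE, nM]; simp [lagPos]
      have eq0 : q 0 = ξ + lagX μ := by rw [hξ]; ring
      rw [eU, eL, k, eq0]
      have e5 : (1 - μ) / r * ((2 * ξ ^ 2 - q 1 ^ 2 - q 2 ^ 2) / (2 * r ^ 2)) =
        (1 - μ) / r ^ 3 * (2 * ξ ^ 2 - q 1 ^ 2 - q 2 ^ 2) / 2 := by field_simp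
      have e6 : μ / r' * ((2 * ξ ^ 2 - q 1 ^ 2 - q 2 ^ 2) / (2 * r' ^ 2)) =
        μ / r' ^ 3 * (2 * ξ ^ 2 - q 1 ^ 2 - q 2 ^ 2) / 2 := by field_simp
      have e7 : (1 - μ) / r * (-1 * ξ / r) = -((1 - μ) / r ^ 2 * ξ) := by field_simp
      have e8 : μ / r' * (1 * ξ / r') = μ / r' ^ 2 * ξ := by field_simp
      -- The terms linear in ξ cancel by the balance of forces: the Lagrange point is critical.
      linear_combination (-ξ) * hbal - e5 - e6 + e7 + e8
    rw [e]
    have t2 : |(1 - μ) / r * (u - 1 + -1 * ξ / r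
        - (2 * ξ ^ 2 - q 1 ^ 2 - q 2 ^ 2) / (2 * r ^ 2))| ≤ 40 * ((1 - μ) / r ^ 4) * ρ ^ 3 := by
      rw [abs_mul, abs_of_pos (by positivity : 0 < (1 - μ) / r)]
      calc _ ≤ (1 - μ) / r * (40 * ρ ^ 3 / r ^ 3) := by gcongr
        _ = _ := by field_simp
    have t3 : |μ / r' * (u' - 1 + 1 * ξ / r'
        - (2 * ξ ^ 2 - q 1 ^ 2 - q 2 ^ 2) / (2 * r' ^ 2))| ≤ 40 * (μ / r' ^ 4) * ρ ^ 3 := by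
      rw [abs_mul, abs_of_pos (by positivity : 0 < μ / r')]
      calc _ ≤ μ / r' * (40 * ρ ^ 3 / r' ^ 3) := by gcongr
        _ = _ := by field_simp
    have t4 : 0 ≤ (μ / r' ^ 4 + (1 - μ) / r ^ 4) * ρ ^ 3 := by positivity
    rw [abs_le] at t2 t3 ⊢
    constructor <;> linarith [t2.1, t2.2, t3.1, t3.2]

/-! ### The modification of the action form in the neck -/

/-- The function that separates the two sides of the neck. -/
def neckPsi (κ r x₀ : ℝ) (y p : E3) : ℝ := κ * (y 0 + r) + (p 1 - x₀)

/-- The generating function of the modification, in terms of the position `y` relative to the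
Earth and of the momentum. -/
noncomputable def neckGen (κ r x₀ : ℝ) (h χ : ℝ → ℝ) (y p : E3) : ℝ :=
  h (neckPsi κ r x₀ y p) * p 0
    + 1 / 2 * χ (neckPsi κ r x₀ y p) * (y 1 * (p 1 - x₀ - (y 0 + r)) + y 2 * p 2) - r * p 0

/-- The derivative of the generating function. -/
noncomputable def neckGenDeriv (κ r x₀ : ℝ) (h χ : ℝ → ℝ) (y p y' p' : E3) : ℝ :=
  deriv h (neckPsi κ r x₀ y p) * (κ * y' 0 + p' 1) * p 0 + (h (neckPsi κ r x₀ y p) - r) * p' 0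
    + 1 / 2 * deriv χ (neckPsi κ r x₀ y p) * (κ * y' 0 + p' 1)
      * (y 1 * (p 1 - x₀ - (y 0 + r)) + y 2 * p 2)
    + 1 / 2 * χ (neckPsi κ r x₀ y p) * (y' 1 * (p 1 - x₀ - (y 0 + r)) + y 1 * (p' 1 - y' 0)
      + y' 2 * p 2 + y 2 * p' 2)

theorem hasDerivAt_neckGen {κ r x₀ : ℝ} {h χ : ℝ → ℝ} (hh : Differentiable ℝ h)
    (hχ : Differentiable ℝ χ) {y p : ℝ → E3} {y' p' : E3} {t : ℝ} (hy : HasDerivAt y y' t)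
    (hp : HasDerivAt p p' t) :
    HasDerivAt (fun t => neckGen κ r x₀ h χ (y t) (p t))
      (neckGenDeriv κ r x₀ h χ (y t) (p t) y' p') t := by
  have yi := fun i => HasDerivAt.E3_apply hy i
  have pi := fun i => HasDerivAt.E3_apply hp i
  have hψ : HasDerivAt (fun t => neckPsi κ r x₀ (y t) (p t)) (κ * y' 0 + p' 1) t :=
    (((yi 0).add_const r).const_mul κ).add ((pi 1).sub_const x₀)
  have h1 := (hh (neckPsi κ r x₀ (y t) (p t))).hasDerivAt.comp t hψ
  have h2 := (hχ (neckPsi κ r x₀ (y t) (p t))).hasDerivAt.comp t hψ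
  have h3 := ((yi 1).mul (((pi 1).sub_const x₀).sub ((yi 0).add_const r))).add ((yi 2).mul (pi 2))
  have H := ((h1.mul (pi 0)).add ((h2.const_mul (1 / 2)).mul h3)).sub ((pi 0).const_mul r)
  refine (H.congr_deriv ?_).congr_of_eventuallyEq (Eventually.of_forall fun t => ?_)
  · simp only [neckGenDeriv, Function.comp, Pi.mul_apply, Pi.add_apply, Pi.sub_apply]
    ring
  · simp [neckGen]

theorem neckGenDeriv_smul (κ r x₀ : ℝ) (h χ : ℝ → ℝ) (y p y' p' : E3) (k : ℝ) :
    neckGenDeriv κ r x₀ h χ y p (k • y') (k • p') = k * neckGenDeriv κ r x₀ h χ y p y' p' := by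
  simp only [neckGenDeriv, PiLp.smul_apply, smul_eq_mul]
  ring

/-- The generating function in the chart at the Earth. -/
noncomputable def neckG (κ r x₀ : ℝ) (h χ : ℝ → ℝ) (z : E4 × E4) : ℝ :=
  neckGen κ r x₀ h χ (chartY z) (-chartX z)

theorem contDiffAt_chartX {z : E4 × E4} (hz : z.1 0 < 1) : ContDiffAt ℝ ∞ chartX z := by
  unfold chartX
  have h1 : ContDiffAt ℝ ∞ (fun z : E4 × E4 => 1 - z.1 0) z := by fun_prop
  exact (h1.inv (by linarith)).smul (by fun_prop)

theorem contDiff_apply_E3 (i : Fin 3) : ContDiff ℝ ∞ (fun v : E3 => v i) := by fun_prop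

theorem contDiffAt_neckG {κ r x₀ : ℝ} {h χ : ℝ → ℝ} (hh : ContDiff ℝ ∞ h) (hχ : ContDiff ℝ ∞ χ)
    {z : E4 × E4} (hz : z.1 0 < 1) : ContDiffAt ℝ ∞ (neckG κ r x₀ h χ) z := by
  have hy : ∀ i, ContDiffAt ℝ ∞ (fun z => chartY z i) z := fun i =>
    ((contDiff_apply_E3 i).comp contDiff_chartY).contDiffAt
  have hp : ∀ i, ContDiffAt ℝ ∞ (fun z => (-chartX z) i) z := fun i =>
    (contDiff_apply_E3 i).contDiffAt.comp z (contDiffAt_chartX hz).neg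
  have hψ : ContDiffAt ℝ ∞ (fun z => neckPsi κ r x₀ (chartY z) (-chartX z)) z :=
    (contDiffAt_const.mul ((hy 0).add contDiffAt_const)).add ((hp 1).sub contDiffAt_const)
  have h1 := hh.contDiffAt.comp z hψ
  have h2 := hχ.contDiffAt.comp z hψ
  unfold neckG neckGen
  exact ((h1.mul (hp 0)).add ((contDiffAt_const.mul h2).mul
    (((hy 1).mul (((hp 1).sub contDiffAt_const).sub ((hy 0).add contDiffAt_const))).add
      ((hy 2).mul (hp 2))))).sub (contDiffAt_const.mul (hp 0))

theorem fderiv_neckG {κ r x₀ : ℝ} {h χ : ℝ → ℝ} (hh : ContDiff ℝ ∞ h) (hχ : ContDiff ℝ ∞ χ)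
    {z : E4 × E4} (hz : z.1 0 < 1) (X : E4 × E4) :
    fderiv ℝ (neckG κ r x₀ h χ) z X =
      neckGenDeriv κ r x₀ h χ (chartY z) (-chartX z) (chartYDeriv z X) (-chartXDeriv z X) := by
  have hc : HasDerivAt (fun t : ℝ => z + t • X) X 0 := by
    simpa using ((hasDerivAt_id (0 : ℝ)).smul_const X).const_add z
  have e0 : z + (0 : ℝ) • X = z := by simp
  have h1 : HasDerivAt (fun t : ℝ => neckG κ r x₀ h χ (z + t • X))
      (fderiv ℝ (neckG κ r x₀ h χ) z X) 0 := by
    have := ((contDiffAt_neckG (κ := κ) (r := r) (x₀ := x₀) hh hχ hz).differentiableAt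
      (by simp)).hasFDerivAt
    rw [← e0] at this
    have h2 := this.comp_hasDerivAt (0 : ℝ) hc
    simp only [zero_smul, add_zero] at h2
    exact h2
  have hY := hasDerivAt_chartY hc
  have hX := hasDerivAt_chartX hc (by simpa using hz)
  have h2 := hasDerivAt_neckGen (κ := κ) (r := r) (x₀ := x₀) (hh.differentiable (by simp))
    (hχ.differentiable (by simp)) hY hX.neg
  have h3 := h1.unique h2
  simpa using h3

/-- The value of the modified action form on the Hamiltonian vector field. -/
noncomputable def neckValue (κ r x₀ : ℝ) (h χ : ℝ → ℝ) (μ : ℝ) (q p : E3) : ℝ :=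
  radialH μ .earth q p
    + neckGenDeriv κ r x₀ h χ (q - pos μ .earth) p (hamQ q p) (hamP μ q p)

/-- Both summands carry the time change m|q - P|: the first by `radialQ_eq`, the second because the
chart velocity is that multiple of Hamilton's equations. The neck avoids the primary, so only the
sign of `neckValue` matters. -/
theorem radialQ_add_fderiv_neckG {κ r x₀ : ℝ} {h χ : ℝ → ℝ} (hh : ContDiff ℝ ∞ h)
    (hχ : ContDiff ℝ ∞ χ) {μ c : ℝ} {q p : E3} (hq : ∀ b, q ≠ pos μ b)
    (hj : jacobi μ (q, p) = c) {X : E4 × E4}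
    (hX : IsHamiltonianVector (moserQ μ c .earth) (moserMap μ .earth q p) X) :
    radialQ μ .earth (moserMap μ .earth q p)
      + fderiv ℝ (neckG κ r x₀ h χ) (moserMap μ .earth q p) X =
    mass μ .earth * ‖q - pos μ .earth‖ * neckValue κ r x₀ h χ μ q p := by
  obtain ⟨h1, h2⟩ := chartDeriv_hamiltonian hq hj hX
  have h3 := moserMap_fst_zero_lt μ .earth q p
  rw [radialQ_eq (hq _), fderiv_neckG hh hχ (by linarith), h1, h2, neg_neg, neckGenDeriv_smul,
    chartY_moserMap, chartX_moserMap, neg_neg, neckValue]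
  ring

/-- In coordinates centred at the Lagrange point, which has momentum (0, x_L, 0), the value depends
on the potential only through the attraction coefficient K and the force ṗ₀ = w; these are the two
quantities expanded in `neck_expansion`. -/
theorem neckValue_eq_neckRate {μ κ : ℝ} {h χ : ℝ → ℝ} {q p : E3} (hq : ∀ b, q ≠ pos μ b) {ψ : ℝ}
    (hψ : ψ = κ * (q 0 - lagX μ) + (p 1 - lagX μ)) :
    neckValue κ (lagDist μ .earth) (lagX μ) h χ μ q p =
      neckRate κ (q 0 - lagX μ) (q 1) (q 2) (p 0) (p 1 - lagX μ) (p 2) (attraction μ q)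
        (p 1 - gradV μ q 0) (h ψ) (deriv h ψ) (χ ψ) (deriv χ ψ) := by
  have xE := lagX_eq μ .earth
  simp only [axisSign] at xE
  have y0 : q 0 - pos μ .earth 0 + lagDist μ .earth = q 0 - lagX μ := by linarith
  have eψ : neckPsi κ (lagDist μ .earth) (lagX μ) (q - pos μ .earth) p = ψ := by
    rw [hψ, neckPsi, PiLp.sub_apply, y0]
  have g1 : gradV μ q 1 = attraction μ q * q 1 := by
    simp only [gradV, attraction, PiLp.add_apply, PiLp.smul_apply, PiLp.sub_apply, pos_one,
      smul_eq_mul]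
    ring
  have g2 : gradV μ q 2 = attraction μ q * q 2 := by
    simp only [gradV, attraction, PiLp.add_apply, PiLp.smul_apply, PiLp.sub_apply, pos_two,
      smul_eq_mul]
    ring
  have hH : radialH μ .earth q p = -((q 0 - pos μ .earth 0) * (p 1 - gradV μ q 0)
      + q 1 * (-p 0 - attraction μ q * q 1) - q 2 * (attraction μ q * q 2)) := by
    have hd := norm_sub_pos_pos (hq .earth)
    have hd2 := norm_sq_E3 (q - pos μ .earth)
    have hdi : mass μ .earth / ‖q - pos μ .earth‖ = (1 - μ) * (‖q - pos μ .earth‖ ^ 3)⁻¹ *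
        ‖q - pos μ .earth‖ ^ 2 := by simp only [mass]; field_simp
    rw [radialH, hdi, hd2, inner_E3]
    simp only [gradV, attraction, mass, Primary.other, PiLp.add_apply, PiLp.smul_apply,
      PiLp.sub_apply, pos_one, pos_two, smul_eq_mul, sub_zero, div_eq_mul_inv]
    ring
  rw [neckValue, hH, neckGenDeriv, eψ, neckRate]
  simp only [hamQ, hamP, PiLp.sub_apply, pos_one, pos_two, sub_zero, g1, g2, y0]
  simp
  linear_combination (p 1 - gradV μ q 0) * (-y0)

/-- The separating function at the first Lagrange point. -/
noncomputable def lagPsi (μ : ℝ) (y p : E3) : ℝ :=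
  neckPsi (lagKappa μ) (lagDist μ .earth) (lagX μ) y p

theorem lagPsi_eq (μ : ℝ) (q p : E3) : lagPsi μ (q - pos μ .earth) p =
    lagKappa μ * (q 0 - lagX μ) + (p 1 - lagX μ) := by
  have xE := lagX_eq μ .earth
  simp only [axisSign] at xE
  rw [lagPsi, neckPsi, PiLp.sub_apply]
  rw [xE]; ring

theorem ne_pos_of_mem_neck {μ : ℝ} (h : μ ∈ Ioo (0 : ℝ) 1) {a : ℝ} (ha : ∀ b, a < lagDist μ b)
    {q : E3} (hq : ‖q - lagPos μ‖ ≤ a) (b : Primary) : q ≠ pos μ b := by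
  rintro rfl
  have e := norm_lagPos_sub_pos h b
  rw [norm_sub_rev] at e
  linarith [ha b]

/-- There is a neck around the first Lagrange point in which the action form can be modified to
be positive, and so that the modification is trivial at both ends of the neck. -/
theorem exists_neck {μ : ℝ} (h : μ ∈ Ioo (0 : ℝ) 1) :
    ∃ a > 0, (∀ b, a < lagDist μ b) ∧ ∃ e > 0, ∃ (B : ℝ) (f χ : ℝ → ℝ),
      IsNeckCutoff e (lagDist μ .earth) (lagDist μ .moon) B f χ ∧
      (∀ q p : E3, ‖q - lagPos μ‖ ≤ a → |lagPsi μ (q - pos μ .earth) p| ≤ e →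
        jacobi μ (q, p) ≠ energyL1 μ →
        0 < neckValue (lagKappa μ) (lagDist μ .earth) (lagX μ) f χ μ q p) ∧
      (∀ q p : E3, ‖q - lagPos μ‖ ≤ a → e ≤ |lagPsi μ (q - pos μ .earth) p| →
        jacobi μ (q, p) = energyL1 μ →
        0 < neckValue (lagKappa μ) (lagDist μ .earth) (lagX μ) f χ μ q p) ∧
      (∀ q p : E3, ‖q - lagPos μ‖ ≤ a → a / 2 ≤ ‖q - lagPos μ‖ →
        jacobi μ (q, p) = energyL1 μ →
        (0 < q 0 - lagX μ → 4 * e < lagPsi μ (q - pos μ .earth) p) ∧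
        (q 0 - lagX μ < 0 → 4 * e < -lagPsi μ (q - pos μ .earth) p)) := by
  have hκ := one_lt_lagKappa h
  have hr := lagDist_pos h .earth
  have hr' := lagDist_pos h .moon
  obtain ⟨C₀, hC₀, a₁, ha₁, hexp₀⟩ := neck_expansion h
  set κ := lagKappa μ with hκd
  set r := lagDist μ .earth with hrd
  set r' := lagDist μ .moon with hrd'
  set C := 2 * C₀ with hCd
  have hC : 0 ≤ C := by positivity
  obtain ⟨a₂, ha₂, hloc⟩ := neckRate_pos_local hκ hC
  obtain ⟨a₃, ha₃, A, hA, σ, hσ, hlev⟩ := neck_level_bounds hκ hC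
  obtain ⟨B, hB, hcut⟩ := exists_isNeckCutoff hr hr'
  obtain ⟨a₄, ha₄, htra⟩ := neckRate_pos_transition hκ hC hA hσ hB
  obtain ⟨a₅, ha₅, hsat⟩ := neckRate_pos_saturated hκ hC hA hσ hB (lt_min hr hr')
  obtain ⟨a, ha, ha1, ha2, ha3, ha4, ha5, har⟩ : ∃ a > 0, a ≤ a₁ ∧ a ≤ a₂ ∧ a ≤ a₃ ∧ a ≤ a₄ ∧
      a ≤ a₅ ∧ a ≤ min r r' / 2 :=
    ⟨min a₁ (min a₂ (min a₃ (min a₄ (min a₅ (min r r' / 2))))), by positivity, by simp, by simp,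
      by simp, by simp, by simp, by simp⟩
  have hab : ∀ b, a < lagDist μ b := by
    have h1 := min_le_left r r'
    have h2 := min_le_right r r'
    have h3 : 0 < min r r' := lt_min hr hr'
    rintro (_ | _)
    · exact (by linarith : a < r)
    · exact (by linarith : a < r')
  -- Chosen after a, so that on the outer half of the neck |ψ| ≥ σ|x| ≥ σa/(2A) exceeds 4e, and both
  -- cut-offs have become constant there.
  set e := min (min r r' / 2) (σ * a / (16 * A)) with he
  have hA0 : 0 < A := by linarith
  have he0 : 0 < e := by positivity
  have her : 2 * e ≤ r := by
    have := min_le_left (min r r' / 2) (σ * a / (16 * A)); have := min_le_left r r'; linarith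
  have her' : 2 * e ≤ r' := by
    have := min_le_left (min r r' / 2) (σ * a / (16 * A)); have := min_le_right r r'; linarith
  have hea : 16 * A * e ≤ σ * a := by
    have := min_le_right (min r r' / 2) (σ * a / (16 * A))
    rw [← he, le_div_iff₀ (by positivity)] at this
    linarith
  obtain ⟨f, χ, hf⟩ := hcut e he0 her her'
  have hexp : ∀ q p : E3, ‖q - lagPos μ‖ ≤ a →
      (q 0 - lagX μ) ^ 2 + q 1 ^ 2 + q 2 ^ 2 = ‖q - lagPos μ‖ ^ 2 ∧
      |attraction μ q - κ| ≤ C * ‖q - lagPos μ‖ ∧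
      |(p 1 - gradV μ q 0) - ((p 1 - lagX μ) + 2 * κ * (q 0 - lagX μ))| ≤
        C * ‖q - lagPos μ‖ ^ 2 := by
    intro q p hq
    obtain ⟨h1, h2, -⟩ := hexp₀ q (hq.trans ha1)
    refine ⟨?_, h1.trans ?_, ?_⟩
    · rw [norm_sq_E3]; simp [lagPos]
    · have : 0 ≤ C₀ * ‖q - lagPos μ‖ := by positivity
      linarith
    · have : 0 ≤ C₀ * ‖q - lagPos μ‖ ^ 2 := by positivity
      have e2 : (p 1 - gradV μ q 0) - ((p 1 - lagX μ) + 2 * κ * (q 0 - lagX μ)) =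
          lagX μ - gradV μ q 0 - 2 * κ * (q 0 - lagX μ) := by ring
      rw [e2]
      exact h2.trans (by linarith)
  have hlevel : ∀ q p : E3, ‖q - lagPos μ‖ ≤ a → jacobi μ (q, p) = energyL1 μ →
      (p 1 - lagX μ - (q 0 - lagX μ)) ^ 2 + p 2 ^ 2 + (p 0 + q 1) ^ 2 + (κ - 1) * q 1 ^ 2
        + κ * q 2 ^ 2 ≤ (2 * κ + 1) * (q 0 - lagX μ) ^ 2 + C * ‖q - lagPos μ‖ ^ 3 := by
    intro q p hq hj
    obtain ⟨-, -, h3⟩ := hexp₀ q (hq.trans ha1)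
    rw [jacobi_eq] at hj
    have h4 := (abs_le.1 h3).1
    have e : p 1 - lagX μ - (q 0 - lagX μ) = p 1 - q 0 := by ring
    rw [e]
    linarith
  refine ⟨a, ha, hab, e, he0, B, f, χ, hf, ?_, ?_, ?_⟩
  · intro q p hq hψ hj
    obtain ⟨h1, h2, h3⟩ := hexp q p hq
    rw [lagPsi_eq] at hψ
    rw [neckValue_eq_neckRate (ne_pos_of_mem_neck h hab hq) rfl]
    obtain ⟨g1, g2, g3, g4⟩ := hf.inner _ hψ
    rw [g1, g2, g3, g4]
    refine hloc _ _ _ _ _ _ _ _ _ (norm_nonneg _) (hq.trans ha2) h1 h2 h3 ?_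
    -- If all coordinates vanish, the point is the Lagrange point, which lies on the excluded
    -- critical level.
    by_contra hN
    apply hj
    have n1 := sq_nonneg ‖q - lagPos μ‖
    have n2 := sq_nonneg (p 0)
    have n3 := sq_nonneg (p 1 - lagX μ)
    have n4 := sq_nonneg (p 2)
    have z1 : ‖q - lagPos μ‖ = 0 := pow_eq_zero_iff two_ne_zero |>.1 (by linarith)
    have z2 : p 0 = 0 := pow_eq_zero_iff two_ne_zero |>.1 (by linarith)
    have z3 : p 1 - lagX μ = 0 := pow_eq_zero_iff two_ne_zero |>.1 (by linarith)
    have z4 : p 2 = 0 := pow_eq_zero_iff two_ne_zero |>.1 (by linarith)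
    have zq : q = lagPos μ := sub_eq_zero.1 (norm_eq_zero.1 z1)
    rw [jacobi_eq, energyL1_eq_effPot h, zq, z2, z4]
    have z5 : (lagPos μ) 0 = lagX μ := by simp [lagPos]
    have z6 : (lagPos μ) 1 = 0 := by simp [lagPos]
    rw [z5, z6, z3]
    ring
  · intro q p hq hψ hj
    obtain ⟨h1, h2, h3⟩ := hexp q p hq
    obtain ⟨l1, l2, l3, l4, l5, l6⟩ := hlev _ _ _ _ _ _ _ _ (norm_nonneg _) (hq.trans ha3) h1 h3
      (hlevel q p hq hj)
    rw [lagPsi_eq] at hψ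
    rw [neckValue_eq_neckRate (ne_pos_of_mem_neck h hab hq) rfl]
    have hx0 : q 0 - lagX μ ≠ 0 := by
      intro hx
      rw [hx] at l3 hψ
      simp only [abs_zero, mul_zero, sub_zero] at l3
      have := abs_nonpos_iff.1 l3
      rw [this] at hψ
      simp at hψ
      linarith
    rcases le_total |κ * (q 0 - lagX μ) + (p 1 - lagX μ)| (2 * e) with h2e | h2e
    · obtain ⟨g1, g2, g3, g4, g5⟩ := hf.middle _ hψ h2e
      rw [g4, g5]
      exact htra _ _ _ _ _ _ _ _ _ _ _ (norm_nonneg _) (hq.trans ha4) h1 h2 h3 l1 l3 l5 l6 hx0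
        g1 g2 g3
    · obtain ⟨g1, g2, g3, g4, g5⟩ := hf.outer _ h2e
      rw [g1]
      exact hsat _ _ _ _ _ _ _ _ _ _ _ _ (norm_nonneg _) (hq.trans ha5) h1 h2 h3 l1 l2 l3 l4 l5
        l6 hx0 g2 g3 g4 g5
  · intro q p hq hq2 hj
    obtain ⟨h1, h2, h3⟩ := hexp q p hq
    obtain ⟨l1, l2, l3, l4, l5, l6⟩ := hlev _ _ _ _ _ _ _ _ (norm_nonneg _) (hq.trans ha3) h1 h3
      (hlevel q p hq hj)
    rw [lagPsi_eq]
    set x := q 0 - lagX μ with hx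
    -- From ρ ≥ a/2 and ρ ≤ A t one gets a ≤ 2At, and 16Ae ≤ σa then gives 8e ≤ σt.
    have hbig : ∀ t : ℝ, 0 < t → |x| = t → 4 * e < σ * t := by
      intro t ht hxt
      rw [hxt] at l1
      have h4 : a ≤ 2 * (A * t) := by linarith
      have h5 := mul_le_mul_of_nonneg_left h4 hσ.le
      have h6 : A * (8 * e) ≤ A * (σ * t) := by linarith
      have h7 := le_of_mul_le_mul_left h6 hA0
      linarith
    constructor
    · intro hx0
      have h4 := hbig x hx0 (abs_of_pos hx0)
      have h5 : x * (σ * x) ≤ x * (κ * x + (p 1 - lagX μ)) := by linarith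
      have := le_of_mul_le_mul_left h5 hx0
      linarith
    · intro hx0
      have h4 := hbig (-x) (by linarith) (abs_of_neg hx0)
      have h5 : (-x) * (σ * (-x)) ≤ (-x) * (-(κ * x + (p 1 - lagX μ))) := by linarith
      have := le_of_mul_le_mul_left h5 (by linarith)
      linarith

/-! ### Change of chart for the action form -/

/-- The Moser map is a cotangent lift, so η dξ becomes y·dx. In this form the charts of the two
primaries can be compared, since x = -p does not depend on the primary. -/
theorem inner_snd_eq_inner_chartY {z V : E4 × E4} (hz : OnTS z) (h0 : z.1 0 < 1)
    (hV : inner ℝ z.1 V.1 = 0) :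
    inner ℝ z.2 V.1 = inner ℝ (chartY z) (chartXDeriv z V) := by
  obtain ⟨h1, h2⟩ := hz
  rw [norm_sq_E4] at h1
  rw [inner_E4] at h2 hV
  rw [inner_E4, inner_E3]
  have hne : 1 - z.1 0 ≠ 0 := by linarith
  simp only [chartY, chartXDeriv, PiLp.add_apply, PiLp.smul_apply, smul_eq_mul, vec_zero, vec_one,
    vec_two]
  field_simp
  linear_combination (-(V.1 0 * z.2 0)) * h1 - V.1 0 * (1 - z.1 0) * h2
    - z.2 0 * (1 - z.1 0) * hV

theorem exists_regular_of_mem_chartSurface {μ c : ℝ} {S : Set Primary} {b : Primary}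
    {z : E4 × E4} (hz : z ∈ chartSurface μ c S b) (hne : chartY z + pos μ b ≠ pos μ b) :
    ∃ q p, z = moserMap μ b q p ∧ (q, p) ∈ energySurface μ c ∧ z.1 0 < 1 := by
  obtain ⟨x, ⟨hx, hxb⟩, rfl⟩ := hz
  cases x with
  | regular q p => exact ⟨q, p, rfl, hx.1, moserChart_regular_lt μ b q p⟩
  | collision b' v =>
    obtain rfl : b' = b := hxb
    rw [chartY_moserChart (by rfl)] at hne
    exact absurd rfl hne

section Family

variable {μ c : ℝ → ℝ} {S : Set Primary} {ρ : Primary → ℝ → E4 × E4 → ℝ} {γ : ℝ → ℝ → RegPoint}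
  {τ : ℝ → ℝ}

theorem actionForm_congr {z : ℝ × ℝ → E4 × E4} {g g' : ℝ × ℝ → ℝ} {x : ℝ × ℝ}
    (h : g =ᶠ[𝓝 x] g') : actionForm z g x = actionForm z g' x := by
  unfold actionForm
  rw [h.fderiv_eq]

theorem IsPeriodicOrbitFamily.inner_fderiv_eq (h : IsPeriodicOrbitFamily μ c S ρ γ τ)
    {s u : ℝ} (hs : s ∈ Ioo (0 : ℝ) 1) {b : Primary} (hb : b ∈ S)
    (hin : (γ s (τ s * u)).InChart b) (h0 : (chartCurve μ τ γ b (s, u)).1 0 < 1) (v : ℝ × ℝ) :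
    DifferentiableAt ℝ (fun x => chartX (chartCurve μ τ γ b x)) (s, u) ∧
    inner ℝ (chartCurve μ τ γ b (s, u)).2
      (fderiv ℝ (fun x => (chartCurve μ τ γ b x).1) (s, u) v) =
    inner ℝ (chartY (chartCurve μ τ γ b (s, u)))
      (fderiv ℝ (fun x => chartX (chartCurve μ τ γ b x)) (s, u) v) := by
  have hz : DifferentiableAt ℝ (chartCurve μ τ γ b) (s, u) :=
    (h.contDiffAt_chartCurve hs hb hin).differentiableAt (by simp)
  have hX : DifferentiableAt ℝ (fun x => chartX (chartCurve μ τ γ b x)) (s, u) :=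
    DifferentiableAt.comp (g := chartX) (s, u) ((contDiffAt_chartX h0).differentiableAt (by simp)) hz
  refine ⟨hX, ?_⟩
  have h1 : fderiv ℝ (fun x => (chartCurve μ τ γ b x).1) (s, u) v =
      (fderiv ℝ (chartCurve μ τ γ b) (s, u) v).1 := by
    rw [hz.hasFDerivAt.fst.fderiv]; rfl
  have hc : HasDerivAt (fun t : ℝ => (s, u) + t • v) v 0 := by
    simpa using ((hasDerivAt_id (0 : ℝ)).smul_const v).const_add (s, u)
  have e0 : (s, u) + (0 : ℝ) • v = (s, u) := by simp
  have hzc : HasDerivAt (fun t : ℝ => chartCurve μ τ γ b ((s, u) + t • v))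
      (fderiv ℝ (chartCurve μ τ γ b) (s, u) v) 0 := by
    have h2 := hz.hasFDerivAt
    rw [← e0] at h2
    have h3 := h2.comp_hasDerivAt (0 : ℝ) hc
    rw [e0] at h3
    exact h3
  have hXc : HasDerivAt (fun t : ℝ => chartX (chartCurve μ τ γ b ((s, u) + t • v)))
      (fderiv ℝ (fun x => chartX (chartCurve μ τ γ b x)) (s, u) v) 0 := by
    have h2 := hX.hasFDerivAt
    rw [← e0] at h2
    have h3 := h2.comp_hasDerivAt (0 : ℝ) hc
    rw [e0] at h3
    exact h3
  have hXc' := hasDerivAt_chartX hzc (by rw [e0]; exact h0)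
  have htan := isTangent_of_hasDerivAt hzc (Eventually.of_forall fun _ => onTS_moserChart _ _ _)
  rw [hXc.unique hXc', h1]
  rw [e0] at htan ⊢
  exact inner_snd_eq_inner_chartY (onTS_moserChart _ _ _) h0 htan.1

/-- The action forms of the two charts differ by the differential of a momentum. -/
theorem IsPeriodicOrbitFamily.actionForm_moon_eq (h : IsPeriodicOrbitFamily μ c S ρ γ τ)
    {s u : ℝ} (hs : s ∈ Ioo (0 : ℝ) 1) (hE : Primary.earth ∈ S) (hM : Primary.moon ∈ S)
    (hin : (γ s (τ s * u)).InChart .earth) (hin' : (γ s (τ s * u)).InChart .moon) :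
    actionForm (chartCurve μ τ γ .moon) (fun _ => 0) (s, u) =
      actionForm (chartCurve μ τ γ .earth) (fun x => chartX (chartCurve μ τ γ .earth x) 0)
        (s, u) := by
  have hev := (h.eventually_inChart hs hE hin).and (h.eventually_inChart hs hM hin')
  have hreg : ∀ x : ℝ × ℝ, (γ x.1 (τ x.1 * x.2)).InChart .earth ∧
      (γ x.1 (τ x.1 * x.2)).InChart .moon → ∃ q p, ∀ b,
        chartCurve μ τ γ b x = moserMap (μ x.1) b q p := by
    rintro x ⟨h1, h2⟩
    unfold chartCurve
    revert h1 h2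
    cases γ x.1 (τ x.1 * x.2) with
    | regular q p => exact fun _ _ => ⟨q, p, fun _ => rfl⟩
    | collision b' v =>
      intro h1 h2
      have e1 : b' = .earth := h1
      have e2 : b' = .moon := h2
      rw [e1] at e2
      cases e2
  obtain ⟨q, p, hqp⟩ := hreg (s, u) ⟨hin, hin'⟩
  have hlt : ∀ b, (chartCurve μ τ γ b (s, u)).1 0 < 1 := fun b => by
    rw [hqp b]; linarith [moserMap_fst_zero_lt (μ s) b q p]
  have hXeq : (fun x => chartX (chartCurve μ τ γ .moon x)) =ᶠ[𝓝 (s, u)]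
      fun x => chartX (chartCurve μ τ γ .earth x) := by
    filter_upwards [hev] with x hx
    obtain ⟨q, p, hqp⟩ := hreg x hx
    rw [hqp, hqp, chartX_moserMap, chartX_moserMap]
  refine ContinuousLinearMap.ext fun v => ?_
  obtain ⟨d1, i1⟩ := h.inner_fderiv_eq hs hE hin (hlt _) v
  obtain ⟨-, i2⟩ := h.inner_fderiv_eq hs hM hin' (hlt _) v
  rw [actionForm_apply, actionForm_apply, i1, i2, hXeq.fderiv_eq, hqp, hqp, chartY_moserMap,
    chartY_moserMap]
  set x' := fderiv ℝ (fun x => chartX (chartCurve μ τ γ .earth x)) (s, u) v with hx'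
  have h0 : fderiv ℝ (fun x => chartX (chartCurve μ τ γ .earth x) 0) (s, u) v = x' 0 := by
    have h2 := (EuclideanSpace.proj (𝕜 := ℝ) (0 : Fin 3) :
      E3 →L[ℝ] ℝ).hasFDerivAt.comp (s, u) d1.hasFDerivAt
    have h3 : HasFDerivAt (fun x => chartX (chartCurve μ τ γ .earth x) 0) _ (s, u) := h2
    rw [h3.fderiv]
    simp [hx']
  -- The relative positions in the two charts differ by the vector (1, 0, 0), whatever the mass
  -- ratio, so the forms differ by dx₀ even when μ varies with s.
  rw [h0, inner_E3, inner_E3]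
  simp [pos]
  ring

end Family

/-! ### The neck on the levels slightly above the critical one -/

theorem ContinuousOn.neckValue {α : Type*} [TopologicalSpace α] {V : Set α} {κ r x₀ : ℝ}
    {f χ : ℝ → ℝ} (hf : ContDiff ℝ ∞ f) (hχ : ContDiff ℝ ∞ χ) {m : α → ℝ} {q p : α → E3}
    (hm : ContinuousOn m V) (hq : ContinuousOn q V) (hp : ContinuousOn p V)
    (hne : ∀ x ∈ V, ∀ b, q x ≠ pos (m x) b) :
    ContinuousOn (fun x => neckValue κ r x₀ f χ (m x) (q x) (p x)) V := by
  have hpos : ∀ b, ContinuousOn (fun x => pos (m x) b) V := fun b =>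
    (continuous_pos b).comp_continuousOn hm
  have hd : ∀ b, ContinuousOn (fun x => ‖q x - pos (m x) b‖) V := fun b => (hq.sub (hpos b)).norm
  have hd0 : ∀ b, ∀ x ∈ V, ‖q x - pos (m x) b‖ ≠ 0 := fun b x hx =>
    norm_ne_zero_iff.2 (sub_ne_zero.2 (hne x hx b))
  have hg : ContinuousOn (fun x => gradV (m x) (q x)) V := by
    unfold gradV
    refine ContinuousOn.add ?_ ?_
    · exact (hm.mul (((hd _).pow 3).inv₀ fun x hx => pow_ne_zero _ (hd0 _ x hx))).smul
        (hq.sub (hpos _))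
    · exact ((continuousOn_const.sub hm).mul
        (((hd _).pow 3).inv₀ fun x hx => pow_ne_zero _ (hd0 _ x hx))).smul (hq.sub (hpos _))
  have hH : ContinuousOn (fun x => radialH (m x) .earth (q x) (p x)) V := by
    unfold radialH
    have hme : ∀ b, ContinuousOn (fun x => mass (m x) b) V := fun b =>
      (continuous_mass b).comp_continuousOn hm
    have hpe := hpos .earth
    have hpo := hpos Primary.earth.other
    refine ContinuousOn.add (ContinuousOn.add ?_ ((hme _).div (hd _) (hd0 _))) ?_
    · have hy : ContinuousOn (fun x => q x - pos (m x) .earth) V := hq.sub (hpos _)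
      set y := fun x => q x - pos (m x) .earth with hyd
      have : (fun x => p x 0 * (q x - pos (m x) .earth) 1 - p x 1 * (q x - pos (m x) .earth) 0) =
          fun x => p x 0 * y x 1 - p x 1 * y x 0 := rfl
      rw [this]
      clear_value y
      fun_prop
    · exact ((hme _).mul ((hq.sub hpo).inner (hq.sub hpe))).div ((hd _).pow 3)
        fun x hx => pow_ne_zero _ (hd0 _ x hx)
  have hy : ContinuousOn (fun x => q x - pos (m x) .earth) V := hq.sub (hpos _)
  have hfc := hf.continuous
  have hχc := hχ.continuous
  have hfd : Continuous (deriv f) := hf.continuous_deriv (by simp)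
  have hχd : Continuous (deriv χ) := hχ.continuous_deriv (by simp)
  unfold RTBP.neckValue
  refine hH.add ?_
  unfold neckGenDeriv neckPsi
  set y := fun x => q x - pos (m x) .earth with hyd
  set g := fun x => gradV (m x) (q x) with hgd
  have hyx : ∀ x, q x - pos (m x) .earth = y x := fun _ => rfl
  have hgx : ∀ x, gradV (m x) (q x) = g x := fun _ => rfl
  simp only [hamQ, hamP, hyx, hgx, PiLp.sub_apply]
  clear_value y g
  generalize deriv f = f' at hfd ⊢
  generalize deriv χ = χ' at hχd ⊢
  simp
  fun_prop

/-- The value of the modified action form, as a function of the parameters and of the point in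
the chart. -/
noncomputable def neckPhi (μ₁ : ℝ) (f χ : ℝ → ℝ) (x : (ℝ × ℝ) × (E4 × E4)) : ℝ :=
  neckValue (lagKappa μ₁) (lagDist μ₁ .earth) (lagX μ₁) f χ x.1.1
    (chartY x.2 + pos x.1.1 .earth) (-chartX x.2)

/-- Regular points of the chart at the Earth. -/
def regularChart : Set ((ℝ × ℝ) × (E4 × E4)) :=
  {x | x.2.1 0 < 1 ∧ ∀ b, chartY x.2 + pos x.1.1 .earth ≠ pos x.1.1 b}

theorem continuousOn_chartX : ContinuousOn (fun x : (ℝ × ℝ) × (E4 × E4) => chartX x.2)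
    regularChart := fun x hx =>
  (ContinuousAt.comp (g := chartX) (f := Prod.snd) (x := x) (contDiffAt_chartX hx.1).continuousAt
    continuousAt_snd).continuousWithinAt

theorem continuousOn_neckPhi (μ₁ : ℝ) {f χ : ℝ → ℝ} (hf : ContDiff ℝ ∞ f) (hχ : ContDiff ℝ ∞ χ) :
    ContinuousOn (neckPhi μ₁ f χ) regularChart := by
  have h2 : Continuous fun x : (ℝ × ℝ) × (E4 × E4) => pos x.1.1 .earth :=
    (continuous_pos .earth).comp (continuous_fst.comp continuous_fst)
  have h3 : Continuous fun x : (ℝ × ℝ) × (E4 × E4) => chartY x.2 :=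
    continuous_chartY.comp (by fun_prop)
  unfold neckPhi
  exact ContinuousOn.neckValue (V := regularChart) hf hχ (m := fun x => x.1.1)
    (q := fun x => chartY x.2 + pos x.1.1 .earth) (p := fun x => -chartX x.2)
    (continuous_fst.comp continuous_fst).continuousOn (h3.add h2).continuousOn
    continuousOn_chartX.neg (fun x hx => hx.2)

/-- The separating function in the chart at the Earth. -/
noncomputable def chartPsi (μ₁ : ℝ) (z : E4 × E4) : ℝ := lagPsi μ₁ (chartY z) (-chartX z)

theorem continuousAt_chartPsi (μ₁ : ℝ) {z : E4 × E4} (hz : z.1 0 < 1) :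
    ContinuousAt (chartPsi μ₁) z := by
  have h1 : ContinuousAt chartX z := (contDiffAt_chartX hz).continuousAt
  have h2 : ContinuousAt chartY z := continuous_chartY.continuousAt
  have h3 : ContinuousAt (fun z => chartY z 0) z :=
    (contDiff_apply_E3 0).continuous.continuousAt.comp h2
  have h4 : ContinuousAt (fun z => (-chartX z) 1) z :=
    (contDiff_apply_E3 1).continuous.continuousAt.comp h1.neg
  exact (continuousAt_const.mul (h3.add continuousAt_const)).add (h4.sub continuousAt_const)

theorem continuousOn_chartPsi (μ₁ : ℝ) :
    ContinuousOn (fun x : (ℝ × ℝ) × (E4 × E4) => chartPsi μ₁ x.2) regularChart := fun x hx =>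
  (ContinuousAt.comp (g := chartPsi μ₁) (f := Prod.snd) (x := x) (continuousAt_chartPsi μ₁ hx.1)
    continuousAt_snd).continuousWithinAt

/-! ### The two sides and the neck in configuration space. -/

/-- The piece of the configuration space around the primary `b`. -/
def sideClosed (μ a : ℝ) (b : Primary) : Set E3 :=
  Metric.closedBall (pos μ b) (lagDist μ b) \ Metric.ball (lagPos μ) (a / 2)

/-- The interior of the piece around the primary `b`. -/
def sideOpen (μ a : ℝ) (b : Primary) : Set E3 :=
  Metric.ball (pos μ b) (lagDist μ b) \ Metric.closedBall (lagPos μ) (a / 2)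

theorem isCompact_sideClosed (μ a : ℝ) (b : Primary) : IsCompact (sideClosed μ a b) :=
  (isCompact_closedBall _ _).diff Metric.isOpen_ball

theorem isOpen_sideOpen (μ a : ℝ) (b : Primary) : IsOpen (sideOpen μ a b) :=
  Metric.isOpen_ball.sdiff Metric.isClosed_closedBall

theorem sideOpen_subset (μ a : ℝ) (b : Primary) : sideOpen μ a b ⊆ sideClosed μ a b :=
  sdiff_subset_sdiff Metric.ball_subset_closedBall Metric.ball_subset_closedBall

theorem norm_pos_other_sub_pos (μ : ℝ) (b : Primary) : ‖pos μ b.other - pos μ b‖ = 1 := by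
  have h2 : ‖pos μ b.other - pos μ b‖ ^ 2 = 1 := by
    rw [norm_sq_E3]
    simp only [PiLp.sub_apply, pos_other_zero, pos_one, pos_two]
    nlinarith [axisSign_sq b]
  nlinarith [norm_nonneg (pos μ b.other - pos μ b)]

theorem pos_other_notMem_sideClosed {μ : ℝ} (h : μ ∈ Ioo (0 : ℝ) 1) (a : ℝ) (b : Primary) :
    pos μ b.other ∉ sideClosed μ a b := by
  rintro ⟨h1, -⟩
  rw [Metric.mem_closedBall, dist_eq_norm, norm_pos_other_sub_pos] at h1
  linarith [lagDist_lt_one h b]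

theorem pos_notMem_neck {μ a : ℝ} (h : μ ∈ Ioo (0 : ℝ) 1) (ha : ∀ b, a < lagDist μ b)
    (b : Primary) : pos μ b ∉ Metric.closedBall (lagPos μ) a := fun h1 => by
  rw [Metric.mem_closedBall, dist_eq_norm] at h1
  exact ne_pos_of_mem_neck h ha h1 b rfl

theorem lt_effPot_of_mem_sideClosed {μ a : ℝ} (h : μ ∈ Ioo (0 : ℝ) 1) (ha : 0 < a)
    {b : Primary} {q : E3} (hq : q ∈ sideClosed μ a b) (hd : ‖q - pos μ b‖ = lagDist μ b) :
    energyL1 μ < effPot μ q := by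
  refine energyL1_lt_effPot h (dist_bounds_of_mem_sphere h b hd) ?_
  rintro rfl
  exact hq.2 (Metric.mem_ball_self (by linarith))

/-- The ball around a primary through the Lagrange point is tangent there to the plane q₀ = x_L.
Away from that point it lies strictly on the side of the primary. -/
theorem axisSign_mul_neg {μ a : ℝ} (h : μ ∈ Ioo (0 : ℝ) 1) (ha : 0 < a)
    {b : Primary} {q : E3} (hq : q ∈ sideClosed μ a b) : axisSign b * (q 0 - lagX μ) < 0 := by
  obtain ⟨h1, h2⟩ := hq
  rw [Metric.mem_closedBall, dist_eq_norm] at h1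
  rw [Metric.mem_ball, dist_eq_norm, not_lt] at h2
  have hr := lagDist_pos h b
  have h3 := pow_le_pow_left₀ (norm_nonneg _) h1 2
  have h4 := pow_le_pow_left₀ (by positivity) h2 2
  rw [norm_sq_E3] at h3 h4
  have e := lagX_eq μ b
  have e2 : q 0 - pos μ b 0 = (q 0 - lagX μ) + axisSign b * lagDist μ b := by rw [e]; ring
  simp only [PiLp.sub_apply, pos_one, pos_two, sub_zero, e2] at h3
  have e3 : (q - lagPos μ) 0 = q 0 - lagX μ ∧ (q - lagPos μ) 1 = q 1 ∧
    (q - lagPos μ) 2 = q 2 := by simp [lagPos]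
  rw [e3.1, e3.2.1, e3.2.2] at h4
  have hs := axisSign_sq b
  have h5 : 0 < (a / 2) ^ 2 := by positivity
  have h6 : 2 * lagDist μ b * (axisSign b * (q 0 - lagX μ)) < 0 := by nlinarith
  by_contra h7
  have := mul_nonneg (by positivity : 0 ≤ 2 * lagDist μ b) (not_lt.1 h7)
  linarith

/-- The whole of the configuration space that is used above the critical level. -/
def neckClosed (μ a : ℝ) : Set E3 :=
  (Metric.closedBall (pos μ .earth) (lagDist μ .earth) ∪
    Metric.closedBall (pos μ .moon) (lagDist μ .moon)) ∪ Metric.closedBall (lagPos μ) a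

/-- The interior of `neckClosed`. -/
def neckOpen (μ a : ℝ) : Set E3 :=
  (Metric.ball (pos μ .earth) (lagDist μ .earth) ∪
    Metric.ball (pos μ .moon) (lagDist μ .moon)) ∪ Metric.ball (lagPos μ) a

theorem isCompact_neckClosed (μ a : ℝ) : IsCompact (neckClosed μ a) :=
  ((isCompact_closedBall _ _).union (isCompact_closedBall _ _)).union (isCompact_closedBall _ _)

theorem isOpen_neckOpen (μ a : ℝ) : IsOpen (neckOpen μ a) :=
  (Metric.isOpen_ball.union Metric.isOpen_ball).union Metric.isOpen_ball

theorem neckOpen_subset (μ a : ℝ) : neckOpen μ a ⊆ neckClosed μ a :=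
  union_subset_union (union_subset_union Metric.ball_subset_closedBall
    Metric.ball_subset_closedBall) Metric.ball_subset_closedBall

theorem dist_of_mem_neck_diff {μ a : ℝ} {q : E3} (hq : q ∉ neckOpen μ a) (b : Primary) :
    lagDist μ b ≤ ‖q - pos μ b‖ := by
  simp only [neckOpen, mem_union, Metric.mem_ball, dist_eq_norm, not_or, not_lt] at hq
  cases b
  · exact hq.1.1
  · exact hq.1.2

theorem lt_effPot_of_mem_neck_diff {μ a : ℝ} (h : μ ∈ Ioo (0 : ℝ) 1) (ha : 0 < a)
    (hab : ∀ b, a < lagDist μ b) {q : E3} (hq : q ∈ neckClosed μ a \ neckOpen μ a) :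
    energyL1 μ < effPot μ q := by
  have hd := dist_of_mem_neck_diff hq.2
  have hL : q ≠ lagPos μ := by
    rintro rfl
    exact hq.2 (Or.inr (Metric.mem_ball_self ha))
  rcases hq.1 with (h1 | h1) | h1
  · rw [Metric.mem_closedBall, dist_eq_norm] at h1
    exact energyL1_lt_effPot h (dist_bounds_of_mem_sphere h .earth (le_antisymm h1 (hd _))) hL
  · rw [Metric.mem_closedBall, dist_eq_norm] at h1
    exact energyL1_lt_effPot h (dist_bounds_of_mem_sphere h .moon (le_antisymm h1 (hd _))) hL
  · rw [Metric.mem_closedBall, dist_eq_norm] at h1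
    refine energyL1_lt_effPot h (fun b => ⟨hd b, ?_⟩) hL
    have h2 := norm_sub_le_norm_sub_add_norm_sub q (lagPos μ) (pos μ b)
    rw [norm_lagPos_sub_pos h] at h2
    have h3 := hab b.other
    rw [lagDist_other] at h3
    linarith [lagDist_lt_one h b]

/-- A continuous function that is positive over a compact piece of the critical level is positive
over this piece for the slightly higher levels. -/
theorem eventually_pos_of_critical {μ : ℝ} {b : Primary} {D : Set E3}
    (hD : IsCompact D) (hoth : pos μ b.other ∉ D) {φ : (ℝ × ℝ) × (E4 × E4) → ℝ}
    (hφ : ContinuousOn φ (chartFamily b ({μ} ×ˢ Icc (energyL1 μ) (energyL1 μ + 1)) D))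
    (hpos : ∀ z, OnTS z → chartY z + pos μ b ∈ D →
      ‖z.2‖ * moserF μ (energyL1 μ) b z = mass μ b → 0 < φ ((μ, energyL1 μ), z)) :
    ∀ᶠ c in 𝓝[>] (energyL1 μ), ∀ z, OnTS z → chartY z + pos μ b ∈ D →
      ‖z.2‖ * moserF μ c b z = mass μ b → 0 < φ ((μ, c), z) := by
  have hK := isCompact_chartFamily b (P := {μ} ×ˢ Icc (energyL1 μ) (energyL1 μ + 1))
    (isCompact_singleton.prod isCompact_Icc) hD (by
      rintro x ⟨hx, -⟩
      rw [mem_singleton_iff.1 hx]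
      exact hoth)
  obtain ⟨δ, hδ, hev⟩ := eventually_forall_le_of_isCompact hK Subset.rfl (t₀ := (μ, energyL1 μ))
    (fun z hz => hz) hφ (fun z hz => hpos z hz.2.1 hz.2.2.1 hz.2.2.2)
  have h1 : Tendsto (fun c => (μ, c)) (𝓝[>] (energyL1 μ)) (𝓝 (μ, energyL1 μ)) :=
    ((by fun_prop : Continuous fun c : ℝ => (μ, c)).tendsto _).mono_left nhdsWithin_le_nhds
  filter_upwards [h1.eventually hev, Ioo_mem_nhdsGT (lt_add_one (energyL1 μ))]
    with c hc hc' z h2 h3 h4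
  exact hδ.trans_le (hc z ⟨⟨rfl, ⟨hc'.1.le, hc'.2.le⟩⟩, h2, h3, h4⟩)

/-- The levels on which the modified action form is positive. -/
structure IsNeckLevel (μ a e : ℝ) (f χ : ℝ → ℝ) (c : ℝ) : Prop where
  side : ∀ b z, OnTS z → chartY z + pos μ b ∈ sideClosed μ a b →
    ‖z.2‖ * moserF μ c b z = mass μ b → 0 < radialQ μ b z
  neck : ∀ z, OnTS z → chartY z + pos μ .earth ∈ Metric.closedBall (lagPos μ) a →
    ‖z.2‖ * moserF μ c .earth z = mass μ .earth → 0 < neckPhi μ f χ ((μ, c), z)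
  separate : ∀ b z, OnTS z →
    chartY z + pos μ .earth ∈ sideClosed μ a b ∩ Metric.closedBall (lagPos μ) a →
    ‖z.2‖ * moserF μ c .earth z = mass μ .earth → 4 * e < -(axisSign b * chartPsi μ z)
  outside : ∀ q ∈ neckClosed μ a \ neckOpen μ a, c < effPot μ q

/-- Away from the Lagrange point all conditions are strict on the critical level over compact sets,
so they persist slightly above it. Near it compactness would fail, since the form vanishes at the
equilibrium; there the estimate valid on all other levels takes over. -/
theorem exists_energy_gap {μ : ℝ} (h : μ ∈ Ioo (0 : ℝ) 1) :
    ∃ a > 0, (∀ b, a < lagDist μ b) ∧ ∃ e > 0, ∃ (B : ℝ) (f χ : ℝ → ℝ),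
      IsNeckCutoff e (lagDist μ .earth) (lagDist μ .moon) B f χ ∧
      ∃ ε > 0, ∀ c, energyL1 μ < c → c < energyL1 μ + ε → IsNeckLevel μ a e f χ c := by
  obtain ⟨a, ha, hab, e, he, B, f, χ, hcut, hloc, hcrit, hsep⟩ := exists_neck h
  refine ⟨a, ha, hab, e, he, B, f, χ, hcut, ?_⟩
  have hreg : ∀ c z, OnTS z → chartY z + pos μ .earth ∈ Metric.closedBall (lagPos μ) a →
      ‖z.2‖ * moserF μ c .earth z = mass μ .earth → ((μ, c), z) ∈ regularChart ∧
        jacobi μ (chartY z + pos μ .earth, -chartX z) = c ∧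
        ‖chartY z + pos μ .earth - lagPos μ‖ ≤ a := by
    intro c z hz hzD hlev
    rw [Metric.mem_closedBall, dist_eq_norm] at hzD
    have hne := ne_pos_of_mem_neck h hab hzD
    obtain ⟨h1, h2⟩ := chart_regular_of_level hz hlev (hne _)
    exact ⟨⟨h1, hne⟩, h2, hzD⟩
  have hyq : ∀ z, chartPsi μ z =
      lagPsi μ (chartY z + pos μ .earth - pos μ .earth) (-chartX z) := fun z => by
    rw [add_sub_cancel_right]; rfl
  -- the two sides
  have h1 : ∀ b, ∀ᶠ c in 𝓝[>] (energyL1 μ), ∀ z, OnTS z →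
      chartY z + pos μ b ∈ sideClosed μ a b → ‖z.2‖ * moserF μ c b z = mass μ b →
      0 < radialQ μ b z := by
    intro b
    refine eventually_pos_of_critical (φ := fun x => radialQ x.1.1 b x.2)
      (isCompact_sideClosed μ a b) (pos_other_notMem_sideClosed h a b)
      ((continuousOn_radialQ b).mono ?_) ?_
    · rintro x ⟨⟨hx, -⟩, -, hx2, -⟩ e
      rw [mem_singleton_iff.1 hx] at e hx2
      exact pos_other_notMem_sideClosed h a b (e ▸ hx2)
    · intro z hz hzD hlev
      have hle : ‖chartY z‖ ≤ lagDist μ b := by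
        have := hzD.1
        rw [Metric.mem_closedBall, dist_eq_norm, add_sub_cancel_right] at this
        exact this
      refine radialQ_pos h hz hlev (hle.lt_of_ne fun heq => ?_) le_rfl
      have hne : chartY z + pos μ b ≠ pos μ b := by
        intro e
        rw [add_eq_right] at e
        rw [e, norm_zero] at heq
        exact (lagDist_pos h b).ne heq
      have h2 := effPot_le_of_mem (chart_regular_of_level hz hlev hne).2
      have h3 := lt_effPot_of_mem_sideClosed h ha hzD (by rwa [add_sub_cancel_right])
      linarith
  -- the neck, away from the Lagrange point
  have h2 : ∀ᶠ c in 𝓝[>] (energyL1 μ), ∀ z, OnTS z →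
      chartY z + pos μ .earth ∈ Metric.closedBall (lagPos μ) a →
      ‖z.2‖ * moserF μ c .earth z = mass μ .earth → e ≤ |chartPsi μ z| →
      0 < neckPhi μ f χ ((μ, c), z) := by
    have hK := isCompact_chartFamily .earth (P := {μ} ×ˢ Icc (energyL1 μ) (energyL1 μ + 1))
      (D := Metric.closedBall (lagPos μ) a)
      (isCompact_singleton.prod isCompact_Icc) (isCompact_closedBall _ _) (by
        rintro x ⟨hx, -⟩
        rw [mem_singleton_iff.1 hx]
        exact pos_notMem_neck h hab _)
    have hsub : chartFamily .earth ({μ} ×ˢ Icc (energyL1 μ) (energyL1 μ + 1))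
        (Metric.closedBall (lagPos μ) a) ⊆ regularChart := by
      rintro ⟨⟨m, c⟩, z⟩ ⟨⟨hx, -⟩, hz, hzD, hlev⟩
      obtain rfl : m = μ := hx
      exact (hreg c z hz hzD hlev).1
    have hK2 : IsCompact (chartFamily .earth ({μ} ×ˢ Icc (energyL1 μ) (energyL1 μ + 1))
        (Metric.closedBall (lagPos μ) a) ∩ (fun x => |chartPsi μ x.2|) ⁻¹' Ici e) := by
      refine hK.of_isClosed_subset ?_ inter_subset_left
      exact ((continuousOn_chartPsi μ).mono hsub).abs.preimage_isClosed_of_isClosed hK.isClosed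
        isClosed_Ici
    obtain ⟨δ, hδ, hev⟩ := eventually_forall_le_of_isCompact hK2 Subset.rfl
      (t₀ := (μ, energyL1 μ)) (fun z hz => hz)
      ((continuousOn_neckPhi μ hcut.contDiff_h hcut.contDiff_χ).mono
        (inter_subset_left.trans hsub)) (by
        rintro z ⟨⟨-, hz, hzD, hlev⟩, hψ⟩
        obtain ⟨-, h3, h4⟩ := hreg _ z hz hzD hlev
        refine hcrit _ _ h4 ?_ h3
        rw [← hyq]
        exact hψ)
    have h1 : Tendsto (fun c => (μ, c)) (𝓝[>] (energyL1 μ)) (𝓝 (μ, energyL1 μ)) :=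
      ((by fun_prop : Continuous fun c : ℝ => (μ, c)).tendsto _).mono_left nhdsWithin_le_nhds
    filter_upwards [h1.eventually hev, Ioo_mem_nhdsGT (lt_add_one (energyL1 μ))]
      with c hc hc' z h2 h3 h4 h5
    exact hδ.trans_le (hc z ⟨⟨⟨rfl, ⟨hc'.1.le, hc'.2.le⟩⟩, h2, h3, h4⟩, h5⟩)
  have h3 : ∀ b, ∀ᶠ c in 𝓝[>] (energyL1 μ), ∀ z, OnTS z →
      chartY z + pos μ .earth ∈ sideClosed μ a b ∩ Metric.closedBall (lagPos μ) a →
      ‖z.2‖ * moserF μ c .earth z = mass μ .earth →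
      0 < -(axisSign b * chartPsi μ z) - 4 * e := by
    intro b
    refine eventually_pos_of_critical
      (φ := fun x => -(axisSign b * chartPsi μ x.2) - 4 * e)
      ((isCompact_sideClosed μ a b).inter_right Metric.isClosed_closedBall)
      (fun hx => pos_notMem_neck h hab _ hx.2) ?_ ?_
    · refine ((continuousOn_const.mul ((continuousOn_chartPsi μ).mono ?_)).neg).sub
        continuousOn_const
      rintro ⟨⟨m, c⟩, z⟩ ⟨⟨hx, -⟩, hz, hzD, hlev⟩
      obtain rfl : m = μ := hx
      exact (hreg c z hz hzD.2 hlev).1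
    · intro z hz hzD hlev
      obtain ⟨-, h3, h4⟩ := hreg _ z hz hzD.2 hlev
      have h5 : a / 2 ≤ ‖chartY z + pos μ .earth - lagPos μ‖ := by
        have := hzD.1.2
        rwa [Metric.mem_ball, dist_eq_norm, not_lt] at this
      obtain ⟨h6, h7⟩ := hsep _ _ h4 h5 h3
      rw [← hyq] at h6 h7
      have h8 := axisSign_mul_neg h ha hzD.1
      cases b with
      | earth =>
        simp only [axisSign] at h8 ⊢
        have := h6 (by linarith)
        linarith
      | moon =>
        simp only [axisSign] at h8 ⊢
        have := h7 (by linarith)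
        linarith
  have h4 : ∀ᶠ c in 𝓝[>] (energyL1 μ), ∀ q ∈ neckClosed μ a \ neckOpen μ a, c < effPot μ q := by
    have h5 := eventually_lt_effPot ((isCompact_neckClosed μ a).diff (isOpen_neckOpen μ a))
      (μ₁ := μ) (c₁ := energyL1 μ) (fun q hq b e => by
        have h6 := dist_of_mem_neck_diff hq.2 b
        rw [e, sub_self, norm_zero] at h6
        linarith [lagDist_pos h b])
      (fun q hq => lt_effPot_of_mem_neck_diff h ha hab hq)
    have h1 : Tendsto (fun c => (μ, c)) (𝓝[>] (energyL1 μ)) (𝓝 (μ, energyL1 μ)) :=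
      ((by fun_prop : Continuous fun c : ℝ => (μ, c)).tendsto _).mono_left nhdsWithin_le_nhds
    exact h1.eventually h5
  have hall := ((h1 .earth).and (h1 .moon)).and (h2.and (((h3 .earth).and (h3 .moon)).and h4))
  obtain ⟨c₁, hc₁, hsub⟩ := mem_nhdsGT_iff_exists_Ioo_subset.1 hall
  refine ⟨c₁ - energyL1 μ, sub_pos.2 hc₁, fun c hc hc' => ?_⟩
  obtain ⟨⟨g1, g2⟩, g3, ⟨g4, g5⟩, g6⟩ := hsub ⟨hc, by linarith⟩
  refine ⟨?_, ?_, ?_, g6⟩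
  · rintro (_ | _)
    · exact g1
    · exact g2
  · intro z hz hzD hlev
    -- For small |ψ| the local estimate applies and only needs c to differ from the critical value;
    -- for the rest the compactness estimate `g3` applies.
    rcases le_total e |chartPsi μ z| with hψ | hψ
    · exact g3 z hz hzD hlev hψ
    · obtain ⟨-, h5, h6⟩ := hreg c z hz hzD hlev
      refine hloc _ _ h6 ?_ (by rw [h5]; exact hc.ne')
      rwa [← hyq]
  · intro b z hz hzD hlev
    cases b with
    | earth => have := g4 z hz hzD hlev; linarith
    | moon => have := g5 z hz hzD hlev; linarith

/-! ### Slightly above the first critical value -/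

/-- On the Earth side h = r and χ = 0, so the summand -r p₀ of `neckGen` cancels the cut-off term
and the form is the unmodified one of the Earth. -/
theorem neckG_eventuallyEq_right {μ e B : ℝ} {f χ : ℝ → ℝ}
    (hcut : IsNeckCutoff e (lagDist μ .earth) (lagDist μ .moon) B f χ) {z : E4 × E4}
    (hz : z.1 0 < 1) (hψ : 4 * e < chartPsi μ z) :
    neckG (lagKappa μ) (lagDist μ .earth) (lagX μ) f χ =ᶠ[𝓝 z] fun _ => 0 := by
  filter_upwards [(continuousAt_chartPsi μ hz).eventually (lt_mem_nhds hψ)] with w hw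
  have hw' : 4 * e ≤ neckPsi (lagKappa μ) (lagDist μ .earth) (lagX μ) (chartY w) (-chartX w) :=
    le_of_lt hw
  obtain ⟨h1, h2⟩ := hcut.right _ hw'
  rw [neckG, neckGen, h1, h2]
  ring

/-- On the Moon side h = -r' and χ = 0. Since r + r' = 1 the generating function is -p₀ = x₀,
exactly the difference between the forms of the two charts. -/
theorem neckG_eventuallyEq_left {μ e B : ℝ} {f χ : ℝ → ℝ}
    (hcut : IsNeckCutoff e (lagDist μ .earth) (lagDist μ .moon) B f χ) {z : E4 × E4}
    (hz : z.1 0 < 1) (hψ : 4 * e < -chartPsi μ z) :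
    neckG (lagKappa μ) (lagDist μ .earth) (lagX μ) f χ =ᶠ[𝓝 z] fun z => chartX z 0 := by
  filter_upwards [(continuousAt_chartPsi μ hz).neg.eventually (lt_mem_nhds hψ)] with w hw
  have hw' : neckPsi (lagKappa μ) (lagDist μ .earth) (lagX μ) (chartY w) (-chartX w) ≤
      -(4 * e) := by
    have : 4 * e < -neckPsi (lagKappa μ) (lagDist μ .earth) (lagX μ) (chartY w) (-chartX w) := hw
    linarith
  obtain ⟨h1, h2⟩ := hcut.left _ hw'
  have h3 : lagDist μ .moon = 1 - lagDist μ .earth := lagDist_other μ .earth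
  rw [neckG, neckGen, h1, h2, PiLp.neg_apply, h3]
  ring

/-- The two radii sum to the distance of the primaries. -/
theorem disjoint_sideOpen {μ a : ℝ} {q : E3} (hE : q ∈ sideOpen μ a .earth)
    (hM : q ∈ sideOpen μ a .moon) : False := by
  have h1 := hE.1
  have h2 := hM.1
  rw [Metric.mem_ball, dist_eq_norm] at h1 h2
  have h3 := norm_sub_le_norm_sub_add_norm_sub (pos μ .moon) q (pos μ .earth)
  have h4 : ‖pos μ .moon - pos μ .earth‖ = 1 := norm_pos_other_sub_pos μ .earth
  rw [h4, norm_sub_rev (pos μ .moon)] at h3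
  have h5 : lagDist μ .moon = 1 - lagDist μ .earth := lagDist_other μ .earth
  linarith

instance : Finite Primary :=
  Finite.of_surjective (fun x : Bool => if x then Primary.earth else Primary.moon) fun b => by
    cases b
    · exact ⟨true, rfl⟩
    · exact ⟨false, rfl⟩

/-- The chart, the closed and the open set, and the generating function for the two sides and for
the neck. -/
def pieceChart : Option Primary → Primary
  | none => .earth
  | some b => b

/-- The closed set of a piece. -/
def pieceClosed (μ a : ℝ) : Option Primary → Set E3
  | none => Metric.closedBall (lagPos μ) a
  | some b => sideClosed μ a b

/-- The open set of a piece. -/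
def pieceOpen (μ a : ℝ) : Option Primary → Set E3
  | none => Metric.ball (lagPos μ) a
  | some b => sideOpen μ a b

/-- The generating function of a piece. -/
noncomputable def pieceGen (μ : ℝ) (f χ : ℝ → ℝ) : Option Primary → E4 × E4 → ℝ
  | none => neckG (lagKappa μ) (lagDist μ .earth) (lagX μ) f χ
  | some _ => fun _ => 0

/-- The value of the modified action form in a piece. -/
noncomputable def pieceValue (μ₁ : ℝ) (f χ : ℝ → ℝ) :
    Option Primary → (ℝ × ℝ) × (E4 × E4) → ℝ
  | none => fun x => mass x.1.1 .earth * ‖chartY x.2‖ * neckPhi μ₁ f χ x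
  | some b => fun x => radialQ x.1.1 b x.2

theorem exists_mem_pieceOpen {μ a : ℝ} (ha : 0 < a) {q : E3} (hq : q ∈ neckOpen μ a) :
    ∃ i, q ∈ pieceOpen μ a i := by
  by_cases h1 : q ∈ Metric.closedBall (lagPos μ) (a / 2)
  · refine ⟨none, ?_⟩
    rw [Metric.mem_closedBall] at h1
    exact Metric.mem_ball.2 (h1.trans_lt (by linarith))
  · rcases hq with (h2 | h2) | h2
    · exact ⟨some .earth, h2, h1⟩
    · exact ⟨some .moon, h2, h1⟩
    · exact ⟨none, h2⟩

/-- Three pieces are used: the sides with the forms of their own charts, and the neck with the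
interpolated form in the Earth chart. All the geometric data are frozen at the final mass ratio and
remain valid near s = 1. -/
theorem IsPeriodicOrbitFamily.exists_bound_of_neck {μ c : ℝ → ℝ}
    {ρ : Primary → ℝ → E4 × E4 → ℝ} {γ : ℝ → ℝ → RegPoint} {τ : ℝ → ℝ}
    (h : IsPeriodicOrbitFamily μ c {.earth, .moon} ρ γ τ)
    (hρ : IsTimeScale μ c {.earth, .moon} ρ)
    (hμ : ContDiffOn ℝ ∞ μ (Icc 0 1)) (hc : ContDiffOn ℝ ∞ c (Icc 0 1))
    (hμ1 : ∀ s ∈ Icc (0 : ℝ) 1, μ s ∈ Ioo (0 : ℝ) 1) (hlt : energyL1 (μ 1) < c 1)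
    {a e B : ℝ} {f χ : ℝ → ℝ} (ha : 0 < a) (hab : ∀ b, a < lagDist (μ 1) b)
    (hcut : IsNeckCutoff e (lagDist (μ 1) .earth) (lagDist (μ 1) .moon) B f χ)
    (hlevel : IsNeckLevel (μ 1) a e f χ (c 1)) :
    ∃ s₂ < 1, ∃ B, ∀ s ∈ Ico s₂ 1, τ s ≤ B := by
  have hm := hμ1 1 (right_mem_Icc.2 zero_le_one)
  have hS : ∀ b, b ∈ ({.earth, .moon} : Set Primary) := fun b => by cases b <;> simp
  have hμc := hμ.continuousOn
  have hcc := hc.continuousOn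
  -- the hypersurfaces near the end of the family
  obtain ⟨s₁, hs₁, hcov⟩ := exists_left_cover (S := {.earth, .moon}) hμc hcc ⟨_, hS .earth⟩
    (isCompact_neckClosed (μ 1) a) (isOpen_neckOpen (μ 1) a) (neckOpen_subset (μ 1) a)
    (fun b _ => by
      cases b
      · exact Or.inl (Or.inl (Metric.mem_ball_self (lagDist_pos hm _)))
      · exact Or.inl (Or.inr (Metric.mem_ball_self (lagDist_pos hm _))))
    (fun q hq b e => by
      have h6 := dist_of_mem_neck_diff hq.2 b
      rw [e, sub_self, norm_zero] at h6
      linarith [lagDist_pos hm b])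
    hlevel.outside
  have hne : ∀ᶠ s in 𝓝[≤] (1 : ℝ), ∀ b, pos (μ s) b ∉ Metric.closedBall (lagPos (μ 1)) a := by
    rw [eventually_all]
    intro b
    rw [← nhdsWithin_Icc_eq_nhdsLE (zero_lt_one' ℝ)]
    have h1 : ContinuousWithinAt μ (Icc 0 1) 1 := hμc 1 (right_mem_Icc.2 zero_le_one)
    exact ((continuous_pos b).continuousAt.tendsto.comp h1).eventually
      (Metric.isClosed_closedBall.isOpen_compl.mem_nhds (pos_notMem_neck hm hab b))
  obtain ⟨s₂, hs₂, hne⟩ := exists_left_interval hne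
  obtain ⟨s₃, hs₃, h13, h23⟩ : ∃ s₃ ∈ Ico (0 : ℝ) 1, s₁ ≤ s₃ ∧ s₂ ≤ s₃ :=
    ⟨max s₁ s₂, ⟨hs₁.1.trans (le_max_left _ _), max_lt hs₁.2 hs₂.2⟩, le_max_left _ _,
      le_max_right _ _⟩
  have hregs : ∀ s ∈ Icc s₃ 1, ∀ z ∈ chartSurface (μ s) (c s) {.earth, .moon} .earth,
      chartY z + pos (μ s) .earth ∈ Metric.closedBall (lagPos (μ 1)) a →
      ∃ q p, z = moserMap (μ s) .earth q p ∧ (q, p) ∈ energySurface (μ s) (c s) ∧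
        ((μ s, c s), z) ∈ regularChart := by
    intro s hs z hz hzD
    have hneb : ∀ b, chartY z + pos (μ s) .earth ≠ pos (μ s) b := fun b e =>
      hne s ⟨h23.trans hs.1, hs.2⟩ b (e ▸ hzD)
    obtain ⟨q, p, h1, h2, h3⟩ := exists_regular_of_mem_chartSurface hz (hneb _)
    exact ⟨q, p, h1, h2, h3, hneb⟩
  have hfibN : ∀ z, OnTS z → chartY z + pos (μ 1) .earth ∈ Metric.closedBall (lagPos (μ 1)) a →
      ‖z.2‖ * moserF (μ 1) (c 1) .earth z = mass (μ 1) .earth →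
      z ∈ chartSurface (μ 1) (c 1) {.earth, .moon} .earth := by
    intro z hz hzD hlev
    rw [Metric.mem_closedBall, dist_eq_norm] at hzD
    exact mem_chartSurface (hS _) hz hlev (mass_pos hm _) (ne_pos_of_mem_neck hm hab hzD _)
      fun _ hU => mem_hillComponent_of_mem_neck hm hlt.le _ hab hzD hU
  -- the separating function at the ends of the neck
  have hsep : ∀ b, ∃ δ > 0, ∀ᶠ s in 𝓝[<] (1 : ℝ),
      ∀ z ∈ chartSurface (μ s) (c s) {.earth, .moon} .earth,
      chartY z + pos (μ s) .earth ∈ sideClosed (μ 1) a b ∩ Metric.closedBall (lagPos (μ 1)) a →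
      δ ≤ -(axisSign b * chartPsi (μ 1) z) - 4 * e := by
    intro b
    refine exists_pos_le hμc hcc hμ1
      (φ := fun x => -(axisSign b * chartPsi (μ 1) x.2) - 4 * e)
      ((isCompact_sideClosed (μ 1) a b).inter_right Metric.isClosed_closedBall)
      (fun hx => pos_notMem_neck hm hab _ hx.2)
      (fun z hz hzD hlev => hfibN z hz hzD.2 hlev) hs₃ ?_ ?_
    · have h1 := continuousOn_chartPiece_of_params (S := {.earth, .moon}) (b := .earth)
        (D := sideClosed (μ 1) a b ∩ Metric.closedBall (lagPos (μ 1)) a) (s₀ := s₃) hμc hcc hs₃.1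
        (continuousOn_chartPsi (μ 1)) fun x hx => by
          obtain ⟨q, p, -, -, h3⟩ := hregs x.1 hx.1 x.2 hx.2.1 hx.2.2.2
          exact h3
      exact ((continuousOn_const.mul h1).neg).sub continuousOn_const
    · intro z hz hzD
      have := hlevel.separate b z (OnTS.of_mem_chartSurface hz) hzD
        (level_of_mem_chartSurface (mass_pos hm _) hz)
      simp only
      linarith
  have hsep' : ∀ᶠ s in 𝓝[<] (1 : ℝ), ∀ b,
      ∀ z ∈ chartSurface (μ s) (c s) {.earth, .moon} .earth,
      chartY z + pos (μ s) .earth ∈ sideClosed (μ 1) a b ∩ Metric.closedBall (lagPos (μ 1)) a →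
      4 * e < -(axisSign b * chartPsi (μ 1) z) := by
    rw [eventually_all]
    intro b
    obtain ⟨δ, hδ, hev⟩ := hsep b
    filter_upwards [hev] with s hs z hz hzD
    linarith [hs z hz hzD]
  obtain ⟨l, hl, hl'⟩ := mem_nhdsLT_iff_exists_Ioo_subset.1 hsep'
  obtain ⟨s₀, hs₀, h30, hl0⟩ : ∃ s₀ ∈ Ico (0 : ℝ) 1, s₃ ≤ s₀ ∧ l ≤ s₀ :=
    ⟨max s₃ l, ⟨hs₃.1.trans (le_max_left _ _), max_lt hs₃.2 hl⟩, le_max_left _ _,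
      le_max_right _ _⟩
  have hneV : ∀ b, ∀ x ∈ chartPiece μ c {.earth, .moon} (pieceChart (some b))
      (pieceClosed (μ 1) a (some b)) s₀, chartY x.2 + pos (μ x.1) b ≠ pos (μ x.1) b.other :=
    fun b x hx => ne_other_of_mem_chartSurface hx.2.1
  -- agreement of the neck with the sides
  have hagr : ∀ b, ∀ s ∈ Ioo s₀ 1, ∀ u,
      (γ s (τ s * u)).position (μ s) ∈ pieceOpen (μ 1) a none →
      (γ s (τ s * u)).position (μ s) ∈ pieceOpen (μ 1) a (some b) →
      (γ s (τ s * u)).InChart .earth → (γ s (τ s * u)).InChart b →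
      actionForm (chartCurve μ τ γ .earth)
        (fun x => pieceGen (μ 1) f χ none (chartCurve μ τ γ .earth x)) (s, u) =
      actionForm (chartCurve μ τ γ b) (fun _ => 0) (s, u) := by
    intro b s hs u hN hb hin hinb
    have hs01 : s ∈ Ioo (0 : ℝ) 1 := ⟨hs₀.1.trans_lt hs.1, hs.2⟩
    have hz : chartCurve μ τ γ .earth (s, u) ∈
        chartSurface (μ s) (c s) {.earth, .moon} .earth :=
      ⟨_, ⟨h.mem s ⟨hs01.1.le, hs.2⟩ _, hin⟩, rfl⟩
    rw [← chartY_moserChart hin] at hN hb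
    have hN' : chartY (chartCurve μ τ γ .earth (s, u)) + pos (μ s) .earth ∈
        Metric.closedBall (lagPos (μ 1)) a := Metric.ball_subset_closedBall hN
    -- Where the neck overlaps a side the separating function exceeds 4e in absolute value, so near
    -- the orbit point the generating function equals its constant-cut-off expression.
    have hψ := hl' ⟨hl0.trans_lt hs.1, hs.2⟩ b _ hz ⟨sideOpen_subset _ _ _ hb, hN'⟩
    obtain ⟨q, p, -, -, hr⟩ := hregs s ⟨(h30.trans_lt hs.1).le, hs.2.le⟩ _ hz hN'
    have hcont := (h.contDiffAt_chartCurve hs01 (hS .earth) hin).continuousAt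
    cases b with
    | earth =>
      simp only [axisSign] at hψ
      exact actionForm_congr (hcont.eventually
        (neckG_eventuallyEq_right hcut hr.1 (by linarith)))
    | moon =>
      simp only [axisSign] at hψ
      rw [h.actionForm_moon_eq hs01 (hS .earth) (hS .moon) hin hinb]
      exact actionForm_congr (hcont.eventually
        (neckG_eventuallyEq_left hcut hr.1 (by linarith)))
  refine h.exists_bound hρ hμ hc hμ1 (ι := Option Primary) (b := pieceChart)
    (D := pieceClosed (μ 1) a) (O := pieceOpen (μ 1) a) (G := pieceGen (μ 1) f χ)
    (φ := fun i x => pieceValue (μ 1) f χ i ((μ x.1, c x.1), x.2)) hs₀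
    (fun i => hS _) ?_ ?_ ?_ ?_ ?_ ?_ ?_ ?_ ?_ ?_
  · rintro (_ | b)
    · exact isCompact_closedBall _ _
    · exact isCompact_sideClosed _ _ _
  · rintro (_ | b)
    · exact Metric.isOpen_ball
    · exact isOpen_sideOpen _ _ _
  · rintro (_ | b)
    · exact Metric.ball_subset_closedBall
    · exact sideOpen_subset _ _ _
  · rintro (_ | b)
    · exact pos_notMem_neck hm hab _
    · exact pos_other_notMem_sideClosed hm a b
  · rintro (_ | b) z hz hzD hlev
    · exact hfibN z hz hzD hlev
    · refine mem_chartSurface (hS _) hz hlev (mass_pos hm _) (fun e => ?_) fun h1 hU => ?_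
      · exact pos_other_notMem_sideClosed hm a b (e ▸ hzD)
      · refine mem_hillComponent_of_mem_ball hm hlt.le _ h1 ?_ hU
        have := hzD.1
        rwa [Metric.mem_closedBall, dist_eq_norm] at this
  · intro s hs x hx
    exact exists_mem_pieceOpen ha (hcov s ⟨(h13.trans h30).trans hs.1, hs.2.le⟩ x hx)
  · rintro (_ | b) s hs z hz hzO
    · obtain ⟨q, p, rfl, hqp, hr⟩ := hregs s ⟨h30.trans hs.1, hs.2.le⟩ z hz
        (Metric.ball_subset_closedBall hzO)
      refine ⟨contDiffAt_neckG hcut.contDiff_h hcut.contDiff_χ hr.1, fun X hX => ?_⟩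
      have h1 := radialQ_add_fderiv_neckG (κ := lagKappa (μ 1)) (r := lagDist (μ 1) .earth)
        (x₀ := lagX (μ 1)) hcut.contDiff_h hcut.contDiff_χ hqp.1 hqp.2 hX
      simp only [pieceValue, neckPhi, chartY_moserMap, chartX_moserMap, sub_add_cancel, neg_neg]
      exact h1
    · exact ⟨contDiffAt_const, fun X _ => by simp [pieceGen, pieceValue, pieceChart]⟩
  · rintro (_ | b)
    · refine continuousOn_chartPiece_of_params (V := regularChart) hμc hcc hs₀.1 ?_
        fun x hx => ?_
      · have h1 : Continuous fun x : (ℝ × ℝ) × (E4 × E4) => mass x.1.1 .earth :=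
          (continuous_mass .earth).comp (continuous_fst.comp continuous_fst)
        have h3 : Continuous fun x : (ℝ × ℝ) × (E4 × E4) => chartY x.2 :=
          continuous_chartY.comp continuous_snd
        exact (h1.mul h3.norm).continuousOn.mul
          (continuousOn_neckPhi (μ 1) hcut.contDiff_h hcut.contDiff_χ)
      · obtain ⟨q, p, -, -, h3⟩ := hregs x.1 ⟨h30.trans hx.1.1, hx.1.2⟩ x.2 hx.2.1 hx.2.2
        exact h3
    · exact continuousOn_chartPiece_of_params hμc hcc hs₀.1 (continuousOn_radialQ b) (hneV b)
  · rintro (_ | b) z hz hzD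
    · have h1 := hlevel.neck z (OnTS.of_mem_chartSurface hz) hzD
        (level_of_mem_chartSurface (mass_pos hm _) hz)
      have h2 := mass_pos hm .earth
      have h3 : 0 < ‖chartY z‖ := by
        rw [norm_pos_iff]
        intro e
        have hzD' : chartY z + pos (μ 1) .earth ∈ Metric.closedBall (lagPos (μ 1)) a := hzD
        rw [e, zero_add] at hzD'
        exact pos_notMem_neck hm hab _ hzD'
      exact mul_pos (mul_pos h2 h3) h1
    · exact hlevel.side b z (OnTS.of_mem_chartSurface hz) hzD
        (level_of_mem_chartSurface (mass_pos hm _) hz)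
  · rintro (_ | b) (_ | b') s hs u hi hj hci hcj
    · rfl
    · exact hagr b' s hs u hi hj hci hcj
    · exact (hagr b s hs u hj hi hcj hci).symm
    · cases b <;> cases b'
      · rfl
      · exact (disjoint_sideOpen hi hj).elim
      · exact (disjoint_sideOpen hj hi).elim
      · rfl

end RTBP

/-! ### The energy gap as a function of the mass ratio, and the conclusion. -/

theorem mainTheorem2 :
    ∃ ε : ℝ → ℝ, (∀ m ∈ Set.Ioo (0 : ℝ) 1, 0 < ε m) ∧
      ∀ (μ c : ℝ → ℝ) (S : Set RTBP.Primary),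
        ContDiffOn ℝ ∞ μ (Set.Icc 0 1) → ContDiffOn ℝ ∞ c (Set.Icc 0 1) →
        (∀ s ∈ Set.Icc (0 : ℝ) 1, μ s ∈ Set.Ioo (0 : ℝ) 1) →
        (((S = {RTBP.Primary.earth} ∨ S = {RTBP.Primary.moon}) ∧
            ∀ s ∈ Set.Icc (0 : ℝ) 1, c s < RTBP.energyL1 (μ s)) ∨
          (S = {RTBP.Primary.earth, RTBP.Primary.moon} ∧
            ∀ s ∈ Set.Icc (0 : ℝ) 1, RTBP.energyL1 (μ s) < c s ∧
              c s < RTBP.energyL1 (μ s) + ε (μ s))) →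
        ∀ (ρ : RTBP.Primary → ℝ → RTBP.E4 × RTBP.E4 → ℝ) (γ : ℝ → ℝ → RTBP.RegPoint)
          (τ : ℝ → ℝ),
          RTBP.IsTimeScale μ c S ρ → RTBP.IsPeriodicOrbitFamily μ c S ρ γ τ →
          ¬ RTBP.BlueSkyCatastrophe τ ∧ BddAbove (τ '' Set.Ico 0 1) := by
  classical
  choose a ha hab e he B f χ hcut ε hε hlevel using
    fun (m : ℝ) (hm : m ∈ Set.Ioo (0 : ℝ) 1) => RTBP.exists_energy_gap hm
  -- Outside (0, 1) the value 1 is an irrelevant default.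
  refine ⟨fun m => if hm : m ∈ Set.Ioo (0 : ℝ) 1 then ε m hm else 1, fun m hm => ?_, ?_⟩
  · simp only [dif_pos hm]
    exact hε m hm
  intro μ c S hμ hc hμ1 hS ρ γ τ hρ hγ
  have h1 : (1 : ℝ) ∈ Set.Icc (0 : ℝ) 1 := Set.right_mem_Icc.2 zero_le_one
  refine hγ.not_blueSky ?_
  rcases hS with ⟨rfl | rfl, hlt⟩ | ⟨rfl, hlt⟩
  · exact hγ.exists_bound_of_lt hρ hμ hc hμ1 (hlt 1 h1)
  · exact hγ.exists_bound_of_lt hρ hμ hc hμ1 (hlt 1 h1)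
  -- Only the gap at the final mass ratio is used, so no continuity of ε is needed.
  · obtain ⟨h2, h3⟩ := hlt 1 h1
    have hm := hμ1 1 h1
    simp only [dif_pos hm] at h3
    exact hγ.exists_bound_of_neck hρ hμ hc hμ1 h2 (ha _ hm) (hab _ hm) (hcut _ hm)
      (hlevel _ hm _ h2 h3)
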